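/- Let $k$ be a field and let $d,s\ge 0$ be integers. Let $\mathcal P_d$ be the category of homogeneous strict polynomial functors of degree $d$ over $k$ (with values in finite-dimensional $k$-vector spaces), and let $\mathcal{DP}_d$ be its bounded derived category, i.e. the category of bounded complexes in $\mathcal P_d$ localized at the quasi-isomorphisms. Let $A\in\mathcal P_s$. Precomposition with $A$, $\mathbf C_A(F)(V)=F(A(V))$, is an exact functor $\mathcal P_d\to\mathcal P_{ds}$; let $\mathbf C_A:\mathcal{DP}_d\to\mathcal{DP}_{ds}$ also denote the functor which it induces degreewise. Let $F\mapsto F^{\#}$, $F^{\#}(V)=(F(V^*))^*$, be the Kuhn duality, on strict polynomial functors and on the derived categories. Let $D^d$ be the $d$-th divided power functor, and for a finite-dimensional space $V$ let $D^d_V\in\mathcal P_d$ be the functor $W\mapsto D^d(V^*\otimes W)$; it is also polynomial, contravariantly, in $V$, so that for every $G\in\mathcal P_{ds}$ the assignment $V\mapsto \mathrm{Hom}_{\mathcal P_{ds}}(\mathbf C_A(D^d_V),G)$ is an object of $\mathcal P_d$. Then, for every $A\in\mathcal P_s$, the functor $G\mapsto\big(V\mapsto \mathrm{Hom}_{\mathcal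 P_{ds}}(\mathbf C_A(D^d_V),G)\big)$ has a (pointwise) right derived functor between the bounded derived categories, $$\mathbf K^r_A:\mathcal{DP}_{ds}\to\mathcal{DP}_d,\qquad \mathbf K^r_A(F)(V)=\mathrm{RHom}_{\mathcal P_{ds}}(\mathbf C_A(D^d_V),F),$$ and, if $\mathbf K^l_A:\mathcal{DP}_{ds}\to\mathcal{DP}_d$ is the functor $$\mathbf K^l_A(F)=\big(\mathbf K^r_{A^{\#}}(F^{\#})\big)^{\#},$$ then $\mathbf K^r_A$ is right adjoint to $\mathbf C_A:\mathcal{DP}_d\to\mathcal{DP}_{ds}$ and $\mathbf K^l_A$ is left adjoint to $\mathbf C_A:\mathcal{DP}_d\to\mathcal{DP}_{ds}$. -/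

import Mathlib

universe u

open CategoryTheory TensorProduct

noncomputable section

namespace SPF

section BaseChange

variable {k : Type u} [Field k]

/-- The map `S ⊗ M → T ⊗ M` induced by a homomorphism of `k`-algebras `φ : S → T`. -/
def coeffMap {S T : Type u} [CommRing S] [Algebra k S] [CommRing T] [Algebra k T]
    (φ : S →ₐ[k] T) (M : Type u) [AddCommGroup M] [Module k M] : S ⊗[k] M →ₗ[k] T ⊗[k] M :=
  TensorProduct.map φ.toLinearMap LinearMap.id

/-- The base change along `φ : S → T` of an `S`-linear map `S ⊗ M → S ⊗ N`: the unique `T`-linear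
map `T ⊗ M → T ⊗ N` which is compatible with it (see `extend_coeffMap`, `eq_extend`). -/
def extend {S T : Type u} [CommRing S] [Algebra k S] [CommRing T] [Algebra k T]
    (φ : S →ₐ[k] T) {M N : Type u} [AddCommGroup M] [Module k M] [AddCommGroup N] [Module k N]
    (f : S ⊗[k] M →ₗ[S] S ⊗[k] N) : T ⊗[k] M →ₗ[T] T ⊗[k] N :=
  LinearMap.liftBaseChange T
    ((coeffMap φ N) ∘ₗ (f.restrictScalars k) ∘ₗ (TensorProduct.mk k S M 1))

variable {S T T' : Type u} [CommRing S] [Algebra k S] [CommRing T] [Algebra k T]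
  [CommRing T'] [Algebra k T']
  {M N P : Type u} [AddCommGroup M] [Module k M] [AddCommGroup N] [Module k N]
  [AddCommGroup P] [Module k P]

@[simp] lemma coeffMap_tmul (φ : S →ₐ[k] T) (s : S) (m : M) :
    coeffMap φ M (s ⊗ₜ m) = φ s ⊗ₜ m := by simp [coeffMap]

lemma coeffMap_smul (φ : S →ₐ[k] T) (s : S) (x : S ⊗[k] M) :
    coeffMap φ M (s • x) = φ s • coeffMap φ M x := by
  induction x using TensorProduct.induction_on with
  | zero => simp
  | tmul a m => simp [TensorProduct.smul_tmul']
  | add x y hx hy => simp [smul_add, hx, hy]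

lemma extend_coeffMap (φ : S →ₐ[k] T) (f : S ⊗[k] M →ₗ[S] S ⊗[k] N) (x : S ⊗[k] M) :
    extend φ f (coeffMap φ M x) = coeffMap φ N (f x) := by
  induction x using TensorProduct.induction_on with
  | zero => simp
  | tmul a m =>
    have : (a ⊗ₜ[k] m : S ⊗[k] M) = a • (1 ⊗ₜ[k] m) := by simp [TensorProduct.smul_tmul']
    rw [this, f.map_smul, coeffMap_smul, coeffMap_smul]
    simp [extend]
  | add x y hx hy => simp [hx, hy]

lemma ext_one {f g : T ⊗[k] M →ₗ[T] T ⊗[k] N} (h : ∀ m : M, f (1 ⊗ₜ m) = g (1 ⊗ₜ m)) :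
    f = g := by
  ext m
  simpa using h m

lemma eq_extend (φ : S →ₐ[k] T) (f : S ⊗[k] M →ₗ[S] S ⊗[k] N) (g : T ⊗[k] M →ₗ[T] T ⊗[k] N)
    (h : ∀ m : M, g (1 ⊗ₜ m) = coeffMap φ N (f (1 ⊗ₜ m))) : g = extend φ f := by
  refine ext_one fun m => ?_
  rw [h, ← extend_coeffMap]
  simp

@[simp] lemma extend_id (φ : S →ₐ[k] T) :
    extend φ (LinearMap.id : S ⊗[k] M →ₗ[S] S ⊗[k] M) = LinearMap.id :=
  (eq_extend _ _ _ fun m => by simp).symm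

lemma extend_comp (φ : S →ₐ[k] T) (g : S ⊗[k] N →ₗ[S] S ⊗[k] P) (f : S ⊗[k] M →ₗ[S] S ⊗[k] N) :
    extend φ (g ∘ₗ f) = extend φ g ∘ₗ extend φ f :=
  (eq_extend _ _ _ fun m => by
    have : (1 ⊗ₜ m : T ⊗[k] M) = coeffMap φ M (1 ⊗ₜ m) := by simp
    rw [this, LinearMap.comp_apply, extend_coeffMap, extend_coeffMap, LinearMap.comp_apply]).symm

lemma extend_smul (φ : S →ₐ[k] T) (s : S) (f : S ⊗[k] M →ₗ[S] S ⊗[k] N) :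
    extend φ (s • f) = φ s • extend φ f :=
  (eq_extend _ _ _ fun m => by
    have : (1 ⊗ₜ m : T ⊗[k] M) = coeffMap φ M (1 ⊗ₜ m) := by simp
    rw [this, LinearMap.smul_apply, extend_coeffMap, LinearMap.smul_apply, coeffMap_smul]).symm

lemma extend_add (φ : S →ₐ[k] T) (f g : S ⊗[k] M →ₗ[S] S ⊗[k] N) :
    extend φ (f + g) = extend φ f + extend φ g :=
  (eq_extend _ _ _ fun m => by
    have : (1 ⊗ₜ m : T ⊗[k] M) = coeffMap φ M (1 ⊗ₜ m) := by simp
    rw [this, LinearMap.add_apply, extend_coeffMap, extend_coeffMap, LinearMap.add_apply,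
      map_add]).symm

lemma extend_zero (φ : S →ₐ[k] T) :
    extend φ (0 : S ⊗[k] M →ₗ[S] S ⊗[k] N) = 0 :=
  (eq_extend _ _ _ fun m => by simp).symm

lemma coeffMap_comp (ψ : T →ₐ[k] T') (φ : S →ₐ[k] T) (x : S ⊗[k] M) :
    coeffMap ψ M (coeffMap φ M x) = coeffMap (ψ.comp φ) M x := by
  induction x using TensorProduct.induction_on with
  | zero => simp
  | tmul a m => simp
  | add x y hx hy => simp [hx, hy]

lemma extend_extend (ψ : T →ₐ[k] T') (φ : S →ₐ[k] T) (f : S ⊗[k] M →ₗ[S] S ⊗[k] N) :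
    extend ψ (extend φ f) = extend (ψ.comp φ) f :=
  eq_extend _ _ _ fun m => by
    have h1 : (1 ⊗ₜ m : T' ⊗[k] M) = coeffMap ψ M (coeffMap φ M (1 ⊗ₜ m)) := by simp
    rw [h1, extend_coeffMap, extend_coeffMap, coeffMap_comp]

lemma extend_baseChange (φ : S →ₐ[k] T) (f : M →ₗ[k] N) :
    extend φ (f.baseChange S) = f.baseChange T :=
  (eq_extend _ _ _ fun m => by simp).symm

/-- The canonical isomorphism `S ⊗ V^* ≃ (S ⊗ V)^*` for a finite-dimensional space `V`. -/
def dualEquiv (S : Type u) [CommRing S] [Algebra k S] (V : Type u) [AddCommGroup V] [Module k V]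
    [Module.Finite k V] : S ⊗[k] Module.Dual k V ≃ₗ[S] Module.Dual S (S ⊗[k] V) :=
  (TensorProduct.isBaseChange k V S).toDualBaseChange

section transpose

variable {V W X : Type u} [AddCommGroup V] [Module k V] [Module.Finite k V]
  [AddCommGroup W] [Module k W] [Module.Finite k W]
  [AddCommGroup X] [Module k X] [Module.Finite k X]

@[simp] lemma dualEquiv_tmul (a b : S) (l : Module.Dual k V) (v : V) :
    dualEquiv S V (a ⊗ₜ l) (b ⊗ₜ v) = a * b * algebraMap k S (l v) := by
  have h : (b ⊗ₜ[k] v : S ⊗[k] V) = b • (1 ⊗ₜ[k] v) := by simp [TensorProduct.smul_tmul']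
  have := (TensorProduct.isBaseChange k V S).toDualBaseChange_tmul a l v
  simp only [TensorProduct.mk_apply] at this
  rw [h, map_smul, dualEquiv, this, smul_eq_mul]
  ring

/-- The transpose `S ⊗ W^* → S ⊗ V^*` of an `S`-linear map `S ⊗ V → S ⊗ W`. -/
def transpose (f : S ⊗[k] V →ₗ[S] S ⊗[k] W) :
    S ⊗[k] Module.Dual k W →ₗ[S] S ⊗[k] Module.Dual k V :=
  (dualEquiv S V).symm.toLinearMap ∘ₗ f.dualMap ∘ₗ (dualEquiv S W).toLinearMap

lemma dualEquiv_transpose (f : S ⊗[k] V →ₗ[S] S ⊗[k] W) (x : S ⊗[k] Module.Dual k W)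
    (y : S ⊗[k] V) : dualEquiv S V (transpose f x) y = dualEquiv S W x (f y) := by
  simp [transpose]

lemma eq_transpose (f : S ⊗[k] V →ₗ[S] S ⊗[k] W)
    (g : S ⊗[k] Module.Dual k W →ₗ[S] S ⊗[k] Module.Dual k V)
    (h : ∀ (l : Module.Dual k W) (v : V), dualEquiv S V (g (1 ⊗ₜ l)) (1 ⊗ₜ v) =
      dualEquiv S W (1 ⊗ₜ l) (f (1 ⊗ₜ v))) : g = transpose f := by
  refine ext_one fun l => (dualEquiv S V).injective ?_
  ext v
  simpa [dualEquiv_transpose] using h l v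

lemma dualEquiv_coeffMap (φ : S →ₐ[k] T) (x : S ⊗[k] Module.Dual k V) (y : S ⊗[k] V) :
    dualEquiv T V (coeffMap φ _ x) (coeffMap φ _ y) = φ (dualEquiv S V x y) := by
  induction x using TensorProduct.induction_on with
  | zero => simp
  | add x y hx hy => simp [hx, hy]
  | tmul a l =>
    induction y using TensorProduct.induction_on with
    | zero => simp
    | add x y hx hy => simp only [map_add, hx, hy]
    | tmul b v => simp

@[simp] lemma transpose_id :
    transpose (LinearMap.id : S ⊗[k] V →ₗ[S] S ⊗[k] V) = LinearMap.id :=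
  (eq_transpose _ _ fun l v => by simp).symm

lemma transpose_comp (g : S ⊗[k] W →ₗ[S] S ⊗[k] X) (f : S ⊗[k] V →ₗ[S] S ⊗[k] W) :
    transpose (g ∘ₗ f) = transpose f ∘ₗ transpose g :=
  (eq_transpose _ _ fun l v => by simp [dualEquiv_transpose]).symm

lemma transpose_smul (s : S) (f : S ⊗[k] V →ₗ[S] S ⊗[k] W) :
    transpose (s • f) = s • transpose f :=
  (eq_transpose _ _ fun l v => by simp [dualEquiv_transpose]).symm

lemma transpose_extend (φ : S →ₐ[k] T) (f : S ⊗[k] V →ₗ[S] S ⊗[k] W) :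
    transpose (extend φ f) = extend φ (transpose f) :=
  (eq_transpose _ _ fun l v => by
    have h1 : (1 ⊗ₜ l : T ⊗[k] Module.Dual k W) = coeffMap φ _ (1 ⊗ₜ l) := by simp
    have h2 : (1 ⊗ₜ v : T ⊗[k] V) = coeffMap φ _ (1 ⊗ₜ v) := by simp
    rw [h1, h2, extend_coeffMap, extend_coeffMap, dualEquiv_coeffMap, dualEquiv_coeffMap,
      dualEquiv_transpose]).symm

lemma transpose_baseChange (f : V →ₗ[k] W) :
    transpose (f.baseChange S) = f.dualMap.baseChange S :=
  (eq_transpose _ _ fun l v => by simp).symm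

end transpose

section tensor

variable {M' N' M'' N'' : Type u} [AddCommGroup M'] [Module k M'] [AddCommGroup N'] [Module k N']
  [AddCommGroup M''] [Module k M''] [AddCommGroup N''] [Module k N'']

/-- The tensor product over `S` of two `S`-linear maps `S ⊗ M → S ⊗ M'` and `S ⊗ N → S ⊗ N'`,
through the identification of `S ⊗ (M ⊗ N)` with `(S ⊗ M) ⊗_S (S ⊗ N)`. -/
def tensorMap (f : S ⊗[k] M →ₗ[S] S ⊗[k] M') (g : S ⊗[k] N →ₗ[S] S ⊗[k] N') :
    S ⊗[k] (M ⊗[k] N) →ₗ[S] S ⊗[k] (M' ⊗[k] N') :=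
  (AlgebraTensorModule.distribBaseChange k S M' N').symm.toLinearMap ∘ₗ
    TensorProduct.map f g ∘ₗ (AlgebraTensorModule.distribBaseChange k S M N).toLinearMap

@[simp] lemma tensorMap_id :
    tensorMap (LinearMap.id : S ⊗[k] M →ₗ[S] S ⊗[k] M)
      (LinearMap.id : S ⊗[k] N →ₗ[S] S ⊗[k] N) = LinearMap.id := by
  ext; simp [tensorMap]

lemma tensorMap_comp (f' : S ⊗[k] M' →ₗ[S] S ⊗[k] M'') (g' : S ⊗[k] N' →ₗ[S] S ⊗[k] N'')
    (f : S ⊗[k] M →ₗ[S] S ⊗[k] M') (g : S ⊗[k] N →ₗ[S] S ⊗[k] N') :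
    tensorMap (f' ∘ₗ f) (g' ∘ₗ g) = tensorMap f' g' ∘ₗ tensorMap f g := by
  refine LinearMap.ext fun x => ?_
  simp [tensorMap, TensorProduct.map_comp]

lemma tensorMap_smul_left (s : S) (f : S ⊗[k] M →ₗ[S] S ⊗[k] M')
    (g : S ⊗[k] N →ₗ[S] S ⊗[k] N') : tensorMap (s • f) g = s • tensorMap f g := by
  refine LinearMap.ext fun x => ?_
  simp [tensorMap, TensorProduct.map_smul_left]

lemma tensorMap_smul_right (s : S) (f : S ⊗[k] M →ₗ[S] S ⊗[k] M')
    (g : S ⊗[k] N →ₗ[S] S ⊗[k] N') : tensorMap f (s • g) = s • tensorMap f g := by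
  refine LinearMap.ext fun x => ?_
  simp [tensorMap, TensorProduct.map_smul_right]

lemma distrib_symm_coeffMap (φ : S →ₐ[k] T) (x : S ⊗[k] M) (y : S ⊗[k] N) :
    (AlgebraTensorModule.distribBaseChange k T M N).symm
      (coeffMap φ M x ⊗ₜ[T] coeffMap φ N y) =
    coeffMap φ _ ((AlgebraTensorModule.distribBaseChange k S M N).symm (x ⊗ₜ[S] y)) := by
  induction x using TensorProduct.induction_on with
  | zero => simp
  | add x y hx hy => simp only [map_add, TensorProduct.add_tmul, hx, hy]
  | tmul a m =>
    induction y using TensorProduct.induction_on with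
    | zero => simp
    | add x y hx hy => simp only [map_add, TensorProduct.tmul_add, hx, hy]
    | tmul b n => simp

lemma tensorMap_extend (φ : S →ₐ[k] T) (f : S ⊗[k] M →ₗ[S] S ⊗[k] M')
    (g : S ⊗[k] N →ₗ[S] S ⊗[k] N') :
    tensorMap (extend φ f) (extend φ g) = extend φ (tensorMap f g) := by
  refine eq_extend _ _ _ fun x => ?_
  induction x using TensorProduct.induction_on with
  | zero => simp
  | add x y hx hy => simp only [map_add, TensorProduct.tmul_add, hx, hy]
  | tmul m n =>
    have h1 : (1 ⊗ₜ m : T ⊗[k] M) = coeffMap φ _ (1 ⊗ₜ m) := by simp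
    have h2 : (1 ⊗ₜ n : T ⊗[k] N) = coeffMap φ _ (1 ⊗ₜ n) := by simp
    simp only [tensorMap, LinearMap.comp_apply, LinearEquiv.coe_coe,
      AlgebraTensorModule.distribBaseChange_tmul, TensorProduct.map_tmul]
    rw [h1, h2, extend_coeffMap, extend_coeffMap, distrib_symm_coeffMap]

end tensor

end BaseChange

section Functors

variable (k : Type u) [Field k]

section dualObj

variable {k}

/-- The dual of a finite-dimensional space, as an object of the category of finite-dimensional
spaces. -/
def dualObj (V : FGModuleCat.{u} k) : FGModuleCat.{u} k := FGModuleCat.of k (Module.Dual k V)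

variable {S T : Type u} [CommRing S] [Algebra k S] [CommRing T] [Algebra k T]
  {U V W : FGModuleCat.{u} k}

/-- The transpose of a linear map. -/
def dualLin (f : V →ₗ[k] W) : dualObj W →ₗ[k] dualObj V := f.dualMap

/-- The transpose `S ⊗ W^* → S ⊗ V^*` of an `S`-linear map `S ⊗ V → S ⊗ W`. -/
def dualMap (f : S ⊗[k] V →ₗ[S] S ⊗[k] W) : S ⊗[k] dualObj W →ₗ[S] S ⊗[k] dualObj V :=
  transpose f

lemma dualLin_id (V : FGModuleCat.{u} k) : dualLin (LinearMap.id : V →ₗ[k] V) = LinearMap.id := rfl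

lemma dualLin_comp (g : V →ₗ[k] W) (f : U →ₗ[k] V) :
    dualLin (g ∘ₗ f) = dualLin f ∘ₗ dualLin g := rfl

lemma dualLin_add (f g : V →ₗ[k] W) : dualLin (f + g) = dualLin f + dualLin g :=
  LinearMap.ext fun l => LinearMap.ext fun v => map_add (show Module.Dual k W from l) (f v) (g v)

lemma dualMap_id (V : FGModuleCat.{u} k) :
    dualMap (LinearMap.id : S ⊗[k] V →ₗ[S] S ⊗[k] V) = LinearMap.id :=
  transpose_id

lemma dualMap_comp (g : S ⊗[k] V →ₗ[S] S ⊗[k] W) (f : S ⊗[k] U →ₗ[S] S ⊗[k] V) :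
    dualMap (g ∘ₗ f) = dualMap f ∘ₗ dualMap g :=
  transpose_comp g f

lemma dualMap_smul (s : S) (f : S ⊗[k] V →ₗ[S] S ⊗[k] W) : dualMap (s • f) = s • dualMap f :=
  transpose_smul s f

lemma dualMap_extend (φ : S →ₐ[k] T) (f : S ⊗[k] V →ₗ[S] S ⊗[k] W) :
    dualMap (extend φ f) = extend φ (dualMap f) :=
  transpose_extend φ f

lemma dualMap_baseChange (f : V →ₗ[k] W) :
    dualMap (f.baseChange S) = (dualLin f).baseChange S :=
  transpose_baseChange f

end dualObj

/-- A homogeneous strict polynomial functor of degree `d` over the field `k`: a finite-dimensional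
space `F(V)` for every finite-dimensional space `V`, and for all `V, W` a homogeneous polynomial
map of degree `d` from the space `Hom(V, W)` to the space `Hom(F(V), F(W))`, compatible with
identities and composition.  A polynomial map between finite-dimensional spaces is a morphism
between the corresponding affine spaces over `k`; it is given here by its action on `S`-valued
points, functorially in the commutative `k`-algebra `S`, the `S`-points of `Hom(V, W)` being the
`S`-linear maps `S ⊗ V → S ⊗ W`. -/
structure StrictPoly (d : ℕ) where
  /-- the action on objects -/
  obj : FGModuleCat.{u} k → FGModuleCat.{u} k
  /-- the action on the `S`-points of `Hom(V, W)` -/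
  map : ∀ (S : Type u) [CommRing S] [Algebra k S] {V W : FGModuleCat.{u} k},
    (S ⊗[k] V →ₗ[S] S ⊗[k] W) → (S ⊗[k] obj V →ₗ[S] S ⊗[k] obj W)
  map_id : ∀ (S : Type u) [CommRing S] [Algebra k S] (V : FGModuleCat.{u} k),
    map S (LinearMap.id : S ⊗[k] V →ₗ[S] S ⊗[k] V) = LinearMap.id
  map_comp : ∀ (S : Type u) [CommRing S] [Algebra k S] {U V W : FGModuleCat.{u} k}
    (g : S ⊗[k] V →ₗ[S] S ⊗[k] W) (f : S ⊗[k] U →ₗ[S] S ⊗[k] V),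
    map S (g ∘ₗ f) = map S g ∘ₗ map S f
  map_smul : ∀ (S : Type u) [CommRing S] [Algebra k S] {V W : FGModuleCat.{u} k}
    (r : S) (f : S ⊗[k] V →ₗ[S] S ⊗[k] W), map S (r • f) = r ^ d • map S f
  map_extend : ∀ {S T : Type u} [CommRing S] [Algebra k S] [CommRing T] [Algebra k T]
    (φ : S →ₐ[k] T) {V W : FGModuleCat.{u} k} (f : S ⊗[k] V →ₗ[S] S ⊗[k] W),
    map T (extend φ f) = extend φ (map S f)

variable {k}

namespace StrictPoly

variable {d e : ℕ}

/-- A morphism of strict polynomial functors: linear maps `F(V) → G(V)` compatible with the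
polynomial maps `Hom(V, W) → Hom(F(V), F(W))` and `Hom(V, W) → Hom(G(V), G(W))`. -/
@[ext]
structure Hom (F G : StrictPoly k d) where
  app : ∀ V : FGModuleCat.{u} k, F.obj V →ₗ[k] G.obj V
  naturality : ∀ (S : Type u) [CommRing S] [Algebra k S] {V W : FGModuleCat.{u} k}
    (f : S ⊗[k] V →ₗ[S] S ⊗[k] W),
    (app W).baseChange S ∘ₗ F.map S f = G.map S f ∘ₗ (app V).baseChange S

instance : Category (StrictPoly k d) where
  Hom F G := Hom F G
  id F := ⟨fun _ => LinearMap.id, fun S _ _ _ _ f => by simp⟩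
  comp φ ψ := ⟨fun V => ψ.app V ∘ₗ φ.app V, fun S _ _ _ _ f => by
    rw [LinearMap.baseChange_comp, LinearMap.baseChange_comp, LinearMap.comp_assoc,
      φ.naturality, ← LinearMap.comp_assoc, ψ.naturality, LinearMap.comp_assoc]⟩

/-- The component at `V` of a morphism. -/
def app {F G : StrictPoly k d} (φ : F ⟶ G) (V : FGModuleCat.{u} k) : F.obj V →ₗ[k] G.obj V :=
  Hom.app φ V

variable {F G H : StrictPoly k d}

lemma naturality (φ : F ⟶ G) (S : Type u) [CommRing S] [Algebra k S] {V W : FGModuleCat.{u} k}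
    (f : S ⊗[k] V →ₗ[S] S ⊗[k] W) :
    (app φ W).baseChange S ∘ₗ F.map S f = G.map S f ∘ₗ (app φ V).baseChange S :=
  Hom.naturality φ S f

/-- Construct a morphism from its components. -/
def mkHom (a : ∀ V : FGModuleCat.{u} k, F.obj V →ₗ[k] G.obj V)
    (h : ∀ (S : Type u) [CommRing S] [Algebra k S] {V W : FGModuleCat.{u} k}
    (f : S ⊗[k] V →ₗ[S] S ⊗[k] W),
    (a W).baseChange S ∘ₗ F.map S f = G.map S f ∘ₗ (a V).baseChange S) : F ⟶ G :=
  Hom.mk a h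

@[simp] lemma app_mkHom (a : ∀ V : FGModuleCat.{u} k, F.obj V →ₗ[k] G.obj V) (h)
    (V : FGModuleCat.{u} k) : app (mkHom (F := F) (G := G) a h) V = a V := rfl

@[ext] lemma hom_ext {φ ψ : F ⟶ G} (h : ∀ V, app φ V = app ψ V) : φ = ψ :=
  Hom.ext (funext h)

@[simp] lemma app_id (V : FGModuleCat.{u} k) : app (𝟙 F) V = LinearMap.id := rfl

@[simp] lemma app_comp (φ : F ⟶ G) (ψ : G ⟶ H) (V : FGModuleCat.{u} k) :
    app (φ ≫ ψ) V = app ψ V ∘ₗ app φ V := rfl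

instance : AddCommGroup (F ⟶ G) :=
  let z : Zero (F ⟶ G) := ⟨mkHom (fun _ => 0) fun S _ _ _ _ f => by simp⟩
  let a : Add (F ⟶ G) := ⟨fun φ ψ => mkHom (fun V => app φ V + app ψ V) fun S _ _ _ _ f => by
    simp only [LinearMap.baseChange_add, LinearMap.add_comp, LinearMap.comp_add, naturality]⟩
  let n : Neg (F ⟶ G) := ⟨fun φ => mkHom (fun V => - app φ V) fun S _ _ _ _ f => by
    simp only [LinearMap.baseChange_neg, LinearMap.neg_comp, LinearMap.comp_neg, naturality]⟩
  { z, a, n with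
    add_assoc := fun _ _ _ => hom_ext fun _ => add_assoc _ _ _
    zero_add := fun _ => hom_ext fun _ => zero_add _
    add_zero := fun _ => hom_ext fun _ => add_zero _
    add_comm := fun _ _ => hom_ext fun _ => add_comm _ _
    neg_add_cancel := fun _ => hom_ext fun _ => neg_add_cancel _
    nsmul := nsmulRec
    zsmul := zsmulRec }

@[simp] lemma app_add (φ ψ : F ⟶ G) (V : FGModuleCat.{u} k) :
    app (φ + ψ) V = app φ V + app ψ V := rfl

@[simp] lemma app_zero (V : FGModuleCat.{u} k) : app (0 : F ⟶ G) V = 0 := rfl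

instance : Module k (F ⟶ G) where
  smul r φ := mkHom (fun V => r • app φ V) fun S _ _ _ _ f => by
    simp only [LinearMap.baseChange_smul, LinearMap.smul_comp, LinearMap.comp_smul, naturality]
  one_smul _ := hom_ext fun _ => one_smul _ _
  mul_smul _ _ _ := hom_ext fun _ => mul_smul _ _ _
  smul_zero _ := hom_ext fun _ => smul_zero _
  smul_add _ _ _ := hom_ext fun _ => smul_add _ _ _
  add_smul _ _ _ := hom_ext fun _ => add_smul _ _ _
  zero_smul _ := hom_ext fun _ => zero_smul _ _

@[simp] lemma app_smul (r : k) (φ : F ⟶ G) (V : FGModuleCat.{u} k) :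
    app (r • φ) V = r • app φ V := rfl

instance : Preadditive (StrictPoly k d) where
  add_comp _ _ _ _ _ _ := hom_ext fun _ => LinearMap.comp_add _ _ _
  comp_add _ _ _ _ _ _ := hom_ext fun _ => LinearMap.add_comp _ _ _

instance : Linear k (StrictPoly k d) where
  smul_comp _ _ _ _ _ _ := hom_ext fun _ => LinearMap.comp_smul _ _ _
  comp_smul _ _ _ _ _ _ := hom_ext fun _ => LinearMap.smul_comp _ _ _

/-- Evaluation at a finite-dimensional space. -/
def ev (d : ℕ) (V : FGModuleCat.{u} k) : StrictPoly k d ⥤ FGModuleCat.{u} k where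
  obj F := F.obj V
  map φ := ConcreteCategory.ofHom (app φ V)

instance (V : FGModuleCat.{u} k) : (ev d V).Additive where

/-- The precomposition `F ∘ A` of strict polynomial functors. -/
def comp {s : ℕ} (F : StrictPoly k d) (A : StrictPoly k s) : StrictPoly k (d * s) where
  obj V := F.obj (A.obj V)
  map S _ _ _ _ f := F.map S (A.map S f)
  map_id S _ _ V := by rw [A.map_id, F.map_id]
  map_comp S _ _ _ _ _ g f := by rw [A.map_comp, F.map_comp]
  map_smul S _ _ _ _ r f := by rw [A.map_smul, F.map_smul, ← pow_mul, mul_comm]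
  map_extend φ _ _ f := by rw [A.map_extend, F.map_extend]

/-- The functor `F ↦ F ∘ A` of precomposition with `A`. -/
def precomp (d : ℕ) {s : ℕ} (A : StrictPoly k s) : StrictPoly k d ⥤ StrictPoly k (d * s) where
  obj F := F.comp A
  map φ := mkHom (fun V => app φ (A.obj V)) fun S _ _ _ _ f => naturality φ S (A.map S f)

instance {s : ℕ} (A : StrictPoly k s) : (precomp d A).Additive where

/-- The Kuhn dual `F^#(V) = F(V^*)^*`. -/
def dual (F : StrictPoly k d) : StrictPoly k d where
  obj V := dualObj (F.obj (dualObj V))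
  map S _ _ _ _ f := dualMap (F.map S (dualMap f))
  map_id S _ _ V := by rw [dualMap_id, F.map_id, dualMap_id]
  map_comp S _ _ _ _ _ g f := by rw [dualMap_comp, F.map_comp, dualMap_comp]
  map_smul S _ _ _ _ r f := by rw [dualMap_smul, F.map_smul, dualMap_smul]
  map_extend φ _ _ f := by rw [dualMap_extend, F.map_extend, dualMap_extend]

lemma dual_naturality (φ : F ⟶ G) (S : Type u) [CommRing S] [Algebra k S]
    {V W : FGModuleCat.{u} k} (f : S ⊗[k] V →ₗ[S] S ⊗[k] W) :
    (dualLin (app φ (dualObj W))).baseChange S ∘ₗ dualMap (G.map S (dualMap f)) =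
      dualMap (F.map S (dualMap f)) ∘ₗ (dualLin (app φ (dualObj V))).baseChange S := by
  rw [← dualMap_baseChange, ← dualMap_baseChange, ← dualMap_comp, ← dualMap_comp, naturality]

/-- The contravariant functor `F ↦ F^#`. -/
def kuhn (d : ℕ) : (StrictPoly k d)ᵒᵖ ⥤ StrictPoly k d where
  obj F := F.unop.dual
  map φ := mkHom
    (fun V => dualLin (app φ.unop (dualObj V)))
    fun S _ _ _ _ f => dual_naturality φ.unop S f
  map_id _ := hom_ext fun _ => dualLin_id _
  map_comp _ _ := hom_ext fun _ => dualLin_comp _ _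

instance : (kuhn (k := k) d).Additive where
  map_add := hom_ext fun _ => dualLin_add _ _

end StrictPoly

section SymmetricPower

variable {d : ℕ} {V W X : Type u} [AddCommGroup V] [Module k V] [AddCommGroup W] [Module k W]
  [AddCommGroup X] [Module k X]
  {S T : Type u} [CommRing S] [Algebra k S] [CommRing T] [Algebra k T]

/-- The homomorphism of `S`-algebras `S ⊗ Sym(V) → S ⊗ Sym(W)` induced by an `S`-linear map
`S ⊗ V → S ⊗ W`. -/
def symAlg (f : S ⊗[k] V →ₗ[S] S ⊗[k] W) :
    S ⊗[k] SymmetricAlgebra k V →ₐ[S] S ⊗[k] SymmetricAlgebra k W :=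
  Algebra.TensorProduct.lift (Algebra.ofId S _)
    (SymmetricAlgebra.lift ((((SymmetricAlgebra.ι k W).baseChange S ∘ₗ f).restrictScalars k) ∘ₗ
      TensorProduct.mk k S V 1)) (fun _ _ => Commute.all _ _)

lemma symAlg_tmul_ι (f : S ⊗[k] V →ₗ[S] S ⊗[k] W) (v : V) :
    symAlg f (1 ⊗ₜ SymmetricAlgebra.ι k V v) = (SymmetricAlgebra.ι k W).baseChange S (f (1 ⊗ₜ v)) := by
  simp [symAlg, ← Algebra.TensorProduct.one_def]

lemma symAlg_tmul_algebraMap (f : S ⊗[k] V →ₗ[S] S ⊗[k] W) (c : k) :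
    symAlg f (1 ⊗ₜ algebraMap k _ c) = 1 ⊗ₜ algebraMap k _ c := by
  have h (X : Type u) [AddCommGroup X] [Module k X] :
      (1 ⊗ₜ algebraMap k _ c : S ⊗[k] SymmetricAlgebra k X) = algebraMap k _ c :=
    ((Algebra.TensorProduct.includeRight (R := k) (A := S)
      (B := SymmetricAlgebra k X)).commutes c)
  rw [h, h]
  exact ((symAlg f).restrictScalars k).commutes c

lemma symAlg_ι (f : S ⊗[k] V →ₗ[S] S ⊗[k] W) (x : S ⊗[k] V) :
    symAlg f ((SymmetricAlgebra.ι k V).baseChange S x) =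
      (SymmetricAlgebra.ι k W).baseChange S (f x) := by
  have : (symAlg f).toLinearMap ∘ₗ (SymmetricAlgebra.ι k V).baseChange S =
      (SymmetricAlgebra.ι k W).baseChange S ∘ₗ f :=
    ext_one fun v => by simpa using symAlg_tmul_ι f v
  exact LinearMap.congr_fun this x

lemma symAlg_ext {A : Type u} [CommRing A] [Algebra k A] [Algebra S A] [IsScalarTower k S A]
    {f g : S ⊗[k] SymmetricAlgebra k V →ₐ[S] A}
    (h : ∀ v : V, f (1 ⊗ₜ SymmetricAlgebra.ι k V v) = g (1 ⊗ₜ SymmetricAlgebra.ι k V v)) :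
    f = g := by
  refine Algebra.TensorProduct.ext (by ext) ?_
  refine SymmetricAlgebra.algHom_ext (LinearMap.ext fun v => ?_)
  simpa using h v

lemma symAlg_id : symAlg (LinearMap.id : S ⊗[k] V →ₗ[S] S ⊗[k] V) = AlgHom.id S _ :=
  symAlg_ext fun v => by simp [symAlg_tmul_ι]

lemma symAlg_comp (g : S ⊗[k] W →ₗ[S] S ⊗[k] X) (f : S ⊗[k] V →ₗ[S] S ⊗[k] W) :
    symAlg (g ∘ₗ f) = (symAlg g).comp (symAlg f) :=
  symAlg_ext fun v => by simp [symAlg_tmul_ι, symAlg_ι]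

lemma symAlg_extend (φ : S →ₐ[k] T) (f : S ⊗[k] V →ₗ[S] S ⊗[k] W) (x : SymmetricAlgebra k V) :
    symAlg (extend φ f) (1 ⊗ₜ x) = coeffMap φ _ (symAlg f (1 ⊗ₜ x)) := by
  have h : ((symAlg (extend φ f)).restrictScalars k).comp
        (Algebra.TensorProduct.includeRight (A := T) (B := SymmetricAlgebra k V)) =
      (Algebra.TensorProduct.map φ (AlgHom.id k _)).comp
        (((symAlg f).restrictScalars k).comp Algebra.TensorProduct.includeRight) := by
    refine SymmetricAlgebra.algHom_ext (LinearMap.ext fun v => ?_)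
    have h1 : (1 ⊗ₜ v : T ⊗[k] V) = coeffMap φ _ (1 ⊗ₜ v) := by simp
    change symAlg (extend φ f) (1 ⊗ₜ SymmetricAlgebra.ι k V v) =
      Algebra.TensorProduct.map φ (AlgHom.id k _) (symAlg f (1 ⊗ₜ SymmetricAlgebra.ι k V v))
    rw [symAlg_tmul_ι, symAlg_tmul_ι, h1, extend_coeffMap]
    generalize f (1 ⊗ₜ v) = y
    induction y using TensorProduct.induction_on with
    | zero => simp
    | add x y hx hy => simp only [map_add, hx, hy]
    | tmul a w => simp
  exact DFunLike.congr_fun h x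

/-- The degree `d` component of the symmetric algebra of `V`. -/
abbrev symSub (k : Type u) [Field k] (d : ℕ) (V : Type u) [AddCommGroup V] [Module k V] :
    Submodule k (SymmetricAlgebra k V) :=
  LinearMap.range (SymmetricAlgebra.ι k V) ^ d

instance [Module.Finite k V] : Module.Finite k (symSub k d V) :=
  Module.Finite.iff_fg.2 (Submodule.FG.pow (Module.Finite.iff_fg.1 inferInstance) d)

/-- The inclusion `S ⊗ Sym^d(V) → S ⊗ Sym(V)`. -/
def symIncl (S : Type u) [CommRing S] [Algebra k S] (d : ℕ) (V : Type u) [AddCommGroup V]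
    [Module k V] : S ⊗[k] symSub k d V →ₗ[S] S ⊗[k] SymmetricAlgebra k V :=
  (symSub k d V).subtype.baseChange S

lemma symIncl_injective : Function.Injective (symIncl (k := k) S d V) :=
  Module.Flat.lTensor_preserves_injective_linearMap (M := S) (symSub k d V).subtype
    Subtype.val_injective

lemma mul_mem_range_symIncl {a b : S ⊗[k] SymmetricAlgebra k V}
    (ha : a ∈ LinearMap.range ((SymmetricAlgebra.ι k V).baseChange S))
    (hb : b ∈ LinearMap.range (symIncl (k := k) S d V)) :
    a * b ∈ LinearMap.range (symIncl (k := k) S (d + 1) V) := by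
  obtain ⟨x, rfl⟩ := ha
  obtain ⟨y, rfl⟩ := hb
  induction x using TensorProduct.induction_on with
  | zero => simp
  | add x x' hx hx' => simpa only [map_add, add_mul] using add_mem hx hx'
  | tmul s v =>
    induction y using TensorProduct.induction_on with
    | zero => simp
    | add y y' hy hy' => simpa only [map_add, mul_add] using add_mem hy hy'
    | tmul t p =>
      refine ⟨(s * t) ⊗ₜ ⟨SymmetricAlgebra.ι k V v * p.1, ?_⟩, by simp [symIncl]⟩
      rw [symSub, pow_succ']
      exact Submodule.mul_mem_mul ⟨v, rfl⟩ p.2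

lemma symAlg_mem (f : S ⊗[k] V →ₗ[S] S ⊗[k] W) {p : SymmetricAlgebra k V}
    (hp : p ∈ symSub k d V) : symAlg f (1 ⊗ₜ p) ∈ LinearMap.range (symIncl (k := k) S d W) := by
  induction hp using Submodule.pow_induction_on_left' with
  | algebraMap r =>
    rw [symAlg_tmul_algebraMap]
    exact ⟨1 ⊗ₜ ⟨algebraMap k _ r, by simp [symSub]⟩, by simp [symIncl]⟩
  | add x y i _ _ hx hy => simpa only [TensorProduct.tmul_add, map_add] using add_mem hx hy
  | mem_mul m hm i x _ hx =>
    obtain ⟨v, rfl⟩ := hm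
    have : (1 ⊗ₜ (SymmetricAlgebra.ι k V v * x) : S ⊗[k] SymmetricAlgebra k V) =
      (1 ⊗ₜ SymmetricAlgebra.ι k V v) * (1 ⊗ₜ x) := by simp
    rw [this, map_mul, symAlg_tmul_ι]
    exact mul_mem_range_symIncl ⟨_, rfl⟩ hx

lemma symAlg_smul (r : S) (f : S ⊗[k] V →ₗ[S] S ⊗[k] W) {p : SymmetricAlgebra k V}
    (hp : p ∈ symSub k d V) : symAlg (r • f) (1 ⊗ₜ p) = r ^ d • symAlg f (1 ⊗ₜ p) := by
  induction hp using Submodule.pow_induction_on_left' with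
  | algebraMap c =>
    rw [symAlg_tmul_algebraMap, symAlg_tmul_algebraMap, pow_zero, one_smul]
  | add x y i _ _ hx hy => simp only [TensorProduct.tmul_add, map_add, hx, hy, smul_add]
  | mem_mul m hm i x _ hx =>
    obtain ⟨v, rfl⟩ := hm
    have : (1 ⊗ₜ (SymmetricAlgebra.ι k V v * x) : S ⊗[k] SymmetricAlgebra k V) =
      (1 ⊗ₜ SymmetricAlgebra.ι k V v) * (1 ⊗ₜ x) := by simp
    rw [this, map_mul, map_mul, symAlg_tmul_ι, symAlg_tmul_ι, hx, LinearMap.smul_apply, map_smul,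
      smul_mul_smul_comm, pow_succ']

lemma symAlg_symIncl_mem (f : S ⊗[k] V →ₗ[S] S ⊗[k] W) (x : S ⊗[k] symSub k d V) :
    ((symAlg f).toLinearMap ∘ₗ symIncl S d V) x ∈ LinearMap.range (symIncl (k := k) S d W) := by
  induction x using TensorProduct.induction_on with
  | zero => simp
  | add x y hx hy => simpa only [map_add] using add_mem hx hy
  | tmul s p =>
    have : (s ⊗ₜ p : S ⊗[k] symSub k d V) = s • (1 ⊗ₜ p) := by
      simp [TensorProduct.smul_tmul']
    rw [this, map_smul]
    exact Submodule.smul_mem _ _ (by simpa [symIncl] using symAlg_mem f p.2)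

/-- The map `S ⊗ Sym^d(V) → S ⊗ Sym^d(W)` induced by an `S`-linear map `S ⊗ V → S ⊗ W`: the
restriction of `symAlg` (see `symIncl_symMap`). -/
def symMap (d : ℕ) (f : S ⊗[k] V →ₗ[S] S ⊗[k] W) :
    S ⊗[k] symSub k d V →ₗ[S] S ⊗[k] symSub k d W :=
  (LinearEquiv.ofInjective (symIncl (k := k) S d W) symIncl_injective).symm.toLinearMap ∘ₗ
    ((symAlg f).toLinearMap ∘ₗ symIncl S d V).codRestrict _ (symAlg_symIncl_mem f)

lemma symIncl_symMap (f : S ⊗[k] V →ₗ[S] S ⊗[k] W) (x : S ⊗[k] symSub k d V) :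
    symIncl S d W (symMap d f x) = symAlg f (symIncl S d V x) := by
  have := LinearEquiv.apply_symm_apply
    (LinearEquiv.ofInjective (symIncl (k := k) S d W) symIncl_injective)
    (((symAlg f).toLinearMap ∘ₗ symIncl S d V).codRestrict _ (symAlg_symIncl_mem f) x)
  exact congrArg Subtype.val this

lemma symIncl_coeffMap (φ : S →ₐ[k] T) (x : S ⊗[k] symSub k d V) :
    symIncl T d V (coeffMap φ _ x) = coeffMap φ _ (symIncl S d V x) := by
  induction x using TensorProduct.induction_on with
  | zero => simp
  | add x y hx hy => simp only [map_add, hx, hy]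
  | tmul s p => simp [symIncl]

end SymmetricPower

/-- The `d`-th symmetric power functor. -/
def symPow (k : Type u) [Field k] (d : ℕ) : StrictPoly k d where
  obj V := FGModuleCat.of k (symSub k d V)
  map S _ _ _ _ f := symMap d f
  map_id S _ _ V := LinearMap.ext fun x => symIncl_injective <| by
    rw [symIncl_symMap, symAlg_id]; rfl
  map_comp S _ _ _ _ _ g f := LinearMap.ext fun x => symIncl_injective <| by
    rw [symIncl_symMap, symAlg_comp, LinearMap.comp_apply, symIncl_symMap, symIncl_symMap]; rfl
  map_smul S _ _ _ _ r f := ext_one fun p => symIncl_injective <| by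
    rw [symIncl_symMap, LinearMap.smul_apply, map_smul, symIncl_symMap]
    simpa [symIncl] using symAlg_smul r f p.2
  map_extend φ _ _ f := eq_extend _ _ _ fun p => symIncl_injective <| by
    rw [symIncl_symMap, symIncl_coeffMap, symIncl_symMap]
    simpa [symIncl] using symAlg_extend φ f p.1

end Functors

section FiniteHom

namespace StrictPoly

variable {k : Type u} [Field k] {d : ℕ} {F G : StrictPoly k d} (φ : F ⟶ G) (V : FGModuleCat.{u} k)
  {n : ℕ} (b : Module.Basis (Fin n) k V)
  {S T : Type u} [CommRing S] [Algebra k S] [CommRing T] [Algebra k T]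

/-- The endomorphism of `S ⊗ V` which is diagonal in a given basis of `V`. -/
def diag (c : Fin n → S) : S ⊗[k] V →ₗ[S] S ⊗[k] V :=
  ∑ i, c i • ((b.coord i).smulRight (b i)).baseChange S

lemma extend_diag (θ : S →ₐ[k] T) (c : Fin n → S) :
    extend θ (diag V b c) = diag V b (fun i => θ (c i)) := by
  have h (s : Finset (Fin n)) (f : Fin n → (S ⊗[k] V →ₗ[S] S ⊗[k] V)) :
      extend θ (∑ i ∈ s, f i) = ∑ i ∈ s, extend θ (f i) := by
    classical
    induction s using Finset.induction_on with
    | empty => simp [extend_zero]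
    | insert a s ha ih => rw [Finset.sum_insert ha, Finset.sum_insert ha, extend_add, ih]
  simp only [diag, h, extend_smul, extend_baseChange]

lemma diag_one : diag V b (fun _ => (1 : S)) = LinearMap.id := by
  refine ext_one fun v => ?_
  simp only [diag, one_smul, LinearMap.sum_apply, LinearMap.baseChange_tmul,
    LinearMap.smulRight_apply, LinearMap.id_apply, ← TensorProduct.tmul_sum,
    Module.Basis.coord_apply, b.sum_repr]

lemma diag_smul (r : S) (c : Fin n → S) : diag V b (fun i => r * c i) = r • diag V b c := by
  simp only [diag, Finset.smul_sum, mul_smul]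

lemma diag_factor (I : Finset (Fin n)) (hI : I.card ≤ d) (c : Fin n → S)
    (hc : ∀ i ∉ I, c i = 0) :
    ∃ (β : FGModuleCat.of k (Fin d → k) →ₗ[k] V)
      (g : S ⊗[k] V →ₗ[S] S ⊗[k] FGModuleCat.of k (Fin d → k)),
      diag V b c = β.baseChange S ∘ₗ g := by
  classical
  obtain ⟨e⟩ : Nonempty (I ↪ Fin d) :=
    Function.Embedding.nonempty_of_card_le (by simpa using hI)
  let α : V →ₗ[k] (Fin d → k) :=
    ∑ i : I, (b.coord i.1).smulRight (Pi.single (e i) 1)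
  let β : (Fin d → k) →ₗ[k] V :=
    ∑ i : I, (LinearMap.proj (e i)).smulRight (b i.1)
  have hβα (i : I) : β (α (b i.1)) = b i.1 := by
    have h1 : α (b i.1) = Pi.single (e i) 1 := by
      simp only [α, LinearMap.sum_apply, LinearMap.smulRight_apply, Module.Basis.coord_apply,
        Module.Basis.repr_self]
      rw [Finset.sum_eq_single i]
      · simp
      · intro j _ hj
        rw [Finsupp.single_eq_of_ne (fun h => hj (Subtype.ext h)), zero_smul]
      · simp
    rw [h1]
    simp only [β, LinearMap.sum_apply, LinearMap.smulRight_apply, LinearMap.proj_apply]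
    rw [Finset.sum_eq_single i]
    · simp
    · intro j _ hj
      rw [Pi.single_eq_of_ne (fun h => hj (e.injective h)), zero_smul]
    · simp
  refine ⟨β, α.baseChange S ∘ₗ diag V b c, ?_⟩
  change _ = β.baseChange S ∘ₗ (α.baseChange S ∘ₗ diag V b c)
  rw [← LinearMap.comp_assoc, ← LinearMap.baseChange_comp, diag]
  refine Eq.trans ?_ (map_sum (LinearMap.llcomp S _ _ _ ((β ∘ₗ α).baseChange S)) _ _).symm
  change _ = ∑ i, (β ∘ₗ α).baseChange S ∘ₗ
    (c i • LinearMap.baseChange S ((b.coord i).smulRight (b i)))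
  refine Finset.sum_congr rfl fun i _ => ?_
  by_cases hi : i ∈ I
  · rw [LinearMap.comp_smul, ← LinearMap.baseChange_comp]
    congr 2
    refine LinearMap.ext fun v => ?_
    have := hβα ⟨i, hi⟩
    simp only [LinearMap.comp_apply, LinearMap.smulRight_apply, _root_.map_smul, this]
  · rw [hc i hi, zero_smul, LinearMap.comp_zero]

variable (v : F.obj V) (l : Module.Dual k (G.obj V))

/-- A matrix coefficient of `φ` composed with the action of a diagonal endomorphism. -/
def coefficient (c : Fin n → S) : S :=
  Module.Dual.baseChange S l ((app φ V).baseChange S (F.map S (diag V b c) (1 ⊗ₜ v)))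

lemma coefficient_map (θ : S →ₐ[k] T) (c : Fin n → S) :
    θ (coefficient φ V b v l c) = coefficient φ V b v l (fun i => θ (c i)) := by
  have h1 : (1 ⊗ₜ v : T ⊗[k] F.obj V) = coeffMap θ _ (1 ⊗ₜ v) := by simp
  rw [coefficient, coefficient, ← extend_diag, F.map_extend, h1, extend_coeffMap,
    ← extend_baseChange θ, extend_coeffMap]
  generalize ((app φ V).baseChange S (F.map S (diag V b c) (1 ⊗ₜ v))) = x
  induction x using TensorProduct.induction_on with
  | zero => simp
  | add x y hx hy => simp only [map_add, hx, hy]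
  | tmul s w => simp

lemma coefficient_smul (r : S) (c : Fin n → S) :
    coefficient φ V b v l (fun i => r * c i) = r ^ d * coefficient φ V b v l c := by
  rw [coefficient, coefficient, diag_smul, F.map_smul, LinearMap.smul_apply, _root_.map_smul,
    _root_.map_smul,
    smul_eq_mul]

lemma coefficient_one : coefficient φ V b v l (fun _ => (1 : S)) = algebraMap k S (l (app φ V v)) := by
  rw [coefficient, diag_one, F.map_id]
  simp [Algebra.algebraMap_eq_smul_one]

variable {φ}

lemma coefficient_eq_zero (hφ : app φ (FGModuleCat.of k (Fin d → k)) = 0)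
    (I : Finset (Fin n)) (hI : I.card ≤ d) (c : Fin n → S) (hc : ∀ i ∉ I, c i = 0) :
    coefficient φ V b v l c = 0 := by
  obtain ⟨β, g, h⟩ := diag_factor (d := d) V b I hI c hc
  have h2 : (app φ V).baseChange S ∘ₗ F.map S (diag V b c) = 0 := by
    rw [h, F.map_comp, ← LinearMap.comp_assoc, naturality, hφ, LinearMap.baseChange_zero,
      LinearMap.comp_zero, LinearMap.zero_comp]
  have h3 := LinearMap.congr_fun h2 (1 ⊗ₜ v)
  rw [LinearMap.comp_apply, LinearMap.zero_apply] at h3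
  rw [coefficient, h3, map_zero]

lemma homogeneous_coeff {P : MvPolynomial (Fin n) k}
    (h : MvPolynomial.aeval (fun i => (Polynomial.X * Polynomial.C (MvPolynomial.X i) :
      Polynomial (MvPolynomial (Fin n) k))) P = Polynomial.X ^ d * Polynomial.C P)
    (a : Fin n →₀ ℕ) (ha : a.degree ≠ d) : P.coeff a = 0 := by
  have key : ∀ Q : MvPolynomial (Fin n) k, ((MvPolynomial.aeval
      (fun i => (Polynomial.X * Polynomial.C (MvPolynomial.X i) :
      Polynomial (MvPolynomial (Fin n) k))) Q).coeff a.degree).coeff a = Q.coeff a := by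
    intro Q
    induction Q using MvPolynomial.induction_on' with
    | add p q hp hq => simp only [map_add, Polynomial.coeff_add, MvPolynomial.coeff_add, hp, hq]
    | monomial m c =>
      have : MvPolynomial.aeval (fun i => (Polynomial.X * Polynomial.C (MvPolynomial.X i) :
          Polynomial (MvPolynomial (Fin n) k))) (MvPolynomial.monomial m c) =
          Polynomial.C (MvPolynomial.monomial m c) * Polynomial.X ^ m.degree := by
        rw [MvPolynomial.aeval_monomial, MvPolynomial.monomial_eq, Finsupp.prod, Finsupp.prod]
        simp only [mul_pow, Finset.prod_mul_distrib, Finset.prod_pow_eq_pow_sum, Finsupp.degree,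
          map_mul, map_prod, map_pow]
        rw [mul_comm (Polynomial.X ^ _), ← mul_assoc]
        rfl
      rw [this, Polynomial.coeff_C_mul, Polynomial.coeff_X_pow]
      split_ifs with h
      · simp
      · rw [mul_zero, MvPolynomial.coeff_zero, MvPolynomial.coeff_monomial, if_neg]
        rintro rfl
        exact h rfl
  rw [← key P, h, mul_comm, Polynomial.coeff_C_mul, Polynomial.coeff_X_pow, if_neg ha]
  simp

lemma coeff_kill (I : Finset (Fin n)) (P : MvPolynomial (Fin n) k) (a : Fin n →₀ ℕ)
    (ha : a.support ⊆ I) :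
    (MvPolynomial.aeval (fun i => if i ∈ I then (MvPolynomial.X i : MvPolynomial (Fin n) k)
      else 0) P).coeff a = P.coeff a := by
  induction P using MvPolynomial.induction_on' with
  | add p q hp hq => simp only [map_add, MvPolynomial.coeff_add, hp, hq]
  | monomial m c =>
    by_cases hm : m.support ⊆ I
    · rw [MvPolynomial.aeval_monomial, Finsupp.prod, Finset.prod_congr rfl
        (fun i hi => by rw [if_pos (hm hi)]), MvPolynomial.monomial_eq]
      rfl
    · obtain ⟨i, hi, hiI⟩ := Finset.not_subset.1 hm
      rw [MvPolynomial.aeval_monomial, Finsupp.prod, Finset.prod_eq_zero hi, mul_zero,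
        MvPolynomial.coeff_zero, MvPolynomial.coeff_monomial, if_neg]
      · rintro rfl
        exact hm ha
      · rw [if_neg hiI, zero_pow (Finsupp.mem_support_iff.1 hi)]

/-- A morphism of strict polynomial functors of degree `d` is determined by its component at
`k^d`. -/
lemma eq_zero_of_app (hφ : app φ (FGModuleCat.of k (Fin d → k)) = 0) : φ = 0 := by
  refine hom_ext fun V => LinearMap.ext fun v => ?_
  refine (Module.forall_dual_apply_eq_zero_iff k _).1 fun l => ?_
  let b := Module.finBasis k V
  let P : MvPolynomial (Fin (Module.finrank k V)) k := coefficient φ V b v l MvPolynomial.X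
  have hP : P = 0 := by
    ext a
    rw [MvPolynomial.coeff_zero]
    by_cases ha : a.degree = d
    · have hI : a.support.card ≤ d := by
        rw [← ha, Finsupp.degree, Finset.card_eq_sum_ones]
        exact Finset.sum_le_sum fun i hi => Nat.one_le_iff_ne_zero.2 (Finsupp.mem_support_iff.1 hi)
      rw [← coeff_kill a.support P a subset_rfl, coefficient_map,
        coefficient_eq_zero V b v l hφ a.support hI _
          (fun i hi => by rw [MvPolynomial.aeval_X, if_neg hi]),
        MvPolynomial.coeff_zero]
    · refine homogeneous_coeff (d := d) ?_ a ha
      rw [coefficient_map]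
      simp only [MvPolynomial.aeval_X]
      rw [coefficient_smul]
      congr 1
      exact (coefficient_map φ V b v l (Polynomial.CAlgHom (R := k)
        (A := MvPolynomial (Fin (Module.finrank k V)) k)) MvPolynomial.X).symm
  have h1 := coefficient_map φ V b v l (MvPolynomial.aeval (fun _ => (1 : k))) MvPolynomial.X
  simp only [MvPolynomial.aeval_X] at h1
  rw [coefficient_one, show coefficient φ V b v l MvPolynomial.X = P from rfl, hP, map_zero] at h1
  exact h1.symm

instance : Module.Finite k (F ⟶ G) :=
  let N := FGModuleCat.of k (Fin d → k)
  let a : (F ⟶ G) →ₗ[k] (F.obj N →ₗ[k] G.obj N) :=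
    { toFun := fun φ => app φ N, map_add' := fun _ _ => rfl, map_smul' := fun _ _ => rfl }
  Module.Finite.of_injective a (by
    rw [← LinearMap.ker_eq_bot, LinearMap.ker_eq_bot']
    exact fun φ h => eq_zero_of_app h)

end StrictPoly

end FiniteHom

section TensorObj

variable {k : Type u} [Field k] {S T : Type u} [CommRing S] [Algebra k S] [CommRing T] [Algebra k T]
  {U U' U'' V V' V'' : FGModuleCat.{u} k}

/-- The tensor product of two finite-dimensional spaces. -/
def tensorObj (U V : FGModuleCat.{u} k) : FGModuleCat.{u} k := FGModuleCat.of k (U ⊗[k] V)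

/-- The tensor product of `S`-linear maps `S ⊗ U → S ⊗ U'` and `S ⊗ V → S ⊗ V'`. -/
def tensorHom (f : S ⊗[k] U →ₗ[S] S ⊗[k] U') (g : S ⊗[k] V →ₗ[S] S ⊗[k] V') :
    S ⊗[k] tensorObj U V →ₗ[S] S ⊗[k] tensorObj U' V' :=
  tensorMap f g

lemma tensorHom_id (U V : FGModuleCat.{u} k) :
    tensorHom (LinearMap.id : S ⊗[k] U →ₗ[S] S ⊗[k] U)
      (LinearMap.id : S ⊗[k] V →ₗ[S] S ⊗[k] V) = LinearMap.id :=
  tensorMap_id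

lemma tensorHom_comp (f' : S ⊗[k] U' →ₗ[S] S ⊗[k] U'') (g' : S ⊗[k] V' →ₗ[S] S ⊗[k] V'')
    (f : S ⊗[k] U →ₗ[S] S ⊗[k] U') (g : S ⊗[k] V →ₗ[S] S ⊗[k] V') :
    tensorHom (f' ∘ₗ f) (g' ∘ₗ g) = tensorHom f' g' ∘ₗ tensorHom f g :=
  tensorMap_comp f' g' f g

lemma tensorHom_smul_left (s : S) (f : S ⊗[k] U →ₗ[S] S ⊗[k] U')
    (g : S ⊗[k] V →ₗ[S] S ⊗[k] V') : tensorHom (s • f) g = s • tensorHom f g :=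
  tensorMap_smul_left s f g

lemma tensorHom_smul_right (s : S) (f : S ⊗[k] U →ₗ[S] S ⊗[k] U')
    (g : S ⊗[k] V →ₗ[S] S ⊗[k] V') : tensorHom f (s • g) = s • tensorHom f g :=
  tensorMap_smul_right s f g

lemma tensorHom_extend (φ : S →ₐ[k] T) (f : S ⊗[k] U →ₗ[S] S ⊗[k] U')
    (g : S ⊗[k] V →ₗ[S] S ⊗[k] V') :
    tensorHom (extend φ f) (extend φ g) = extend φ (tensorHom f g) :=
  tensorMap_extend φ f g

end TensorObj

namespace StrictPoly

variable {k : Type u} [Field k] {d : ℕ}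

/-- The functor `F_U(V) = F(U^* ⊗ V)`. -/
def param (F : StrictPoly k d) (U : FGModuleCat.{u} k) : StrictPoly k d where
  obj V := F.obj (tensorObj (dualObj U) V)
  map S _ _ _ _ f := F.map S (tensorHom LinearMap.id f)
  map_id S _ _ V := by rw [tensorHom_id, F.map_id]
  map_comp S _ _ _ _ _ g f := by
    rw [← F.map_comp, ← tensorHom_comp, LinearMap.id_comp]
  map_smul S _ _ _ _ r f := by rw [tensorHom_smul_right, F.map_smul]
  map_extend φ _ _ f := by
    rw [← F.map_extend, ← tensorHom_extend, extend_id]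

/-- The `d`-th divided power functor `D^d(V) = (S^d(V^*))^*`. -/
def divPow (k : Type u) [Field k] (d : ℕ) : StrictPoly k d := (symPow k d).dual

/-- The functor `D^d_U(V) = D^d(U^* ⊗ V)`. -/
def divPowParam (d : ℕ) (U : FGModuleCat.{u} k) : StrictPoly k d := (divPow k d).param U

/-- The action on `S`-points of the (contravariant, polynomial) functoriality of `D^d_U(V)` in the
parameter `U`. -/
def divPowParamMap (d : ℕ) {S : Type u} [CommRing S] [Algebra k S] {U U' : FGModuleCat.{u} k}
    (f : S ⊗[k] U →ₗ[S] S ⊗[k] U') (V : FGModuleCat.{u} k) :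
    S ⊗[k] (divPowParam d U').obj V →ₗ[S] S ⊗[k] (divPowParam d U).obj V :=
  (divPow k d).map S (tensorHom (dualMap f) (LinearMap.id : S ⊗[k] V →ₗ[S] S ⊗[k] V))

section

variable {S T : Type u} [CommRing S] [Algebra k S] [CommRing T] [Algebra k T]
  {U U' U'' : FGModuleCat.{u} k}

lemma divPowParamMap_id (U V : FGModuleCat.{u} k) :
    divPowParamMap d (LinearMap.id : S ⊗[k] U →ₗ[S] S ⊗[k] U) V = LinearMap.id := by
  rw [divPowParamMap, dualMap_id, tensorHom_id]
  exact (divPow k d).map_id S _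

lemma divPowParamMap_comp (g : S ⊗[k] U' →ₗ[S] S ⊗[k] U'') (f : S ⊗[k] U →ₗ[S] S ⊗[k] U')
    (V : FGModuleCat.{u} k) :
    divPowParamMap d (g ∘ₗ f) V = divPowParamMap d f V ∘ₗ divPowParamMap d g V := by
  rw [divPowParamMap, dualMap_comp, ← LinearMap.id_comp LinearMap.id, tensorHom_comp]
  exact (divPow k d).map_comp S _ _

lemma divPowParamMap_smul (r : S) (f : S ⊗[k] U →ₗ[S] S ⊗[k] U') (V : FGModuleCat.{u} k) :
    divPowParamMap d (r • f) V = r ^ d • divPowParamMap d f V := by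
  rw [divPowParamMap, dualMap_smul, tensorHom_smul_left]
  exact (divPow k d).map_smul S _ _

lemma divPowParamMap_extend (φ : S →ₐ[k] T) (f : S ⊗[k] U →ₗ[S] S ⊗[k] U')
    (V : FGModuleCat.{u} k) :
    divPowParamMap d (extend φ f) V = extend φ (divPowParamMap d f V) := by
  rw [divPowParamMap, dualMap_extend, ← extend_id φ, tensorHom_extend]
  exact (divPow k d).map_extend φ _

lemma divPowParamMap_naturality (f : S ⊗[k] U →ₗ[S] S ⊗[k] U') {V W : FGModuleCat.{u} k}
    (g : S ⊗[k] V →ₗ[S] S ⊗[k] W) :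
    divPowParamMap d f W ∘ₗ (divPowParam d U').map S g =
      (divPowParam d U).map S g ∘ₗ divPowParamMap d f V := by
  refine ((divPow k d).map_comp S _ _).symm.trans (Eq.trans ?_ ((divPow k d).map_comp S _ _))
  rw [← tensorHom_comp, ← tensorHom_comp]
  rfl

end

section HomOver

variable {X G : StrictPoly k d} (S T : Type u) [CommRing S] [Algebra k S] [CommRing T] [Algebra k T]

/-- The `S`-module of families of `S`-linear maps `S ⊗ X(V) → S ⊗ G(V)` which are natural
with respect to `T`-linear maps `T ⊗ V → T ⊗ W`, for all `S`-algebras `T`. -/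
def HomOver (X G : StrictPoly k d) :
    Submodule S (∀ V : FGModuleCat.{u} k, S ⊗[k] X.obj V →ₗ[S] S ⊗[k] G.obj V) where
  carrier := {ψ | ∀ (T : Type u) [CommRing T] [Algebra k T] (φ : S →ₐ[k] T)
    (V W : FGModuleCat.{u} k) (f : T ⊗[k] V →ₗ[T] T ⊗[k] W),
    extend φ (ψ W) ∘ₗ X.map T f = G.map T f ∘ₗ extend φ (ψ V)}
  add_mem' {ψ ψ'} h h' T _ _ φ V W f := by
    rw [Pi.add_apply, Pi.add_apply, extend_add, extend_add, LinearMap.add_comp, LinearMap.comp_add,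
      h, h']
  zero_mem' T _ _ φ V W f := by
    rw [Pi.zero_apply, Pi.zero_apply, extend_zero, extend_zero, LinearMap.zero_comp,
      LinearMap.comp_zero]
  smul_mem' s ψ h T _ _ φ V W f := by
    rw [Pi.smul_apply, Pi.smul_apply, extend_smul, extend_smul, LinearMap.smul_comp,
      LinearMap.comp_smul, h]

instance : Small.{u} (X ⟶ G) :=
  small_of_injective (β := X.obj (FGModuleCat.of k (Fin d → k)) →ₗ[k] G.obj (FGModuleCat.of k (Fin d → k)))
    (f := fun φ => app φ _) (fun φ ψ h => by
      rw [← sub_eq_zero]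
      refine eq_zero_of_app ?_
      have : app (φ - ψ) (FGModuleCat.of k (Fin d → k)) = app φ _ - app ψ _ := by
        rw [sub_eq_add_neg, sub_eq_add_neg]; rfl
      rw [this, sub_eq_zero]
      exact h)

/-- The finite-dimensional vector space of morphisms `X ⟶ G`. -/
def homObj (X G : StrictPoly k d) : FGModuleCat.{u} k :=
  have : Module.Finite k (Shrink.{u} (X ⟶ G)) :=
    Module.Finite.equiv (Shrink.linearEquiv k (X ⟶ G)).symm
  FGModuleCat.of k (Shrink.{u} (X ⟶ G))

/-- The elements of `homObj X G` are the morphisms `X ⟶ G`. -/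
def homEquiv (X G : StrictPoly k d) : homObj X G ≃ₗ[k] (X ⟶ G) :=
  Shrink.linearEquiv k (X ⟶ G)

/-- The canonical map from `S ⊗ Hom(X, G)` to `HomOver S X G`. -/
def toHomOver (X G : StrictPoly k d) : S ⊗[k] homObj X G →ₗ[S] HomOver S X G :=
  LinearMap.liftBaseChange S
    { toFun := fun h => ⟨fun V => (app (homEquiv X G h) V).baseChange S,
        fun T _ _ φ V W f => by rw [extend_baseChange, extend_baseChange, naturality]⟩
      map_add' := fun h h' => Subtype.ext (funext fun V => by simp [LinearMap.baseChange_add])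
      map_smul' := fun r h => Subtype.ext (funext fun V => by
        simp [LinearMap.baseChange_smul]) }

variable {S T}

lemma toHomOver_tmul (s : S) (h : homObj X G) (V : FGModuleCat.{u} k) :
    (toHomOver S X G (s ⊗ₜ h)).1 V = s • (app (homEquiv X G h) V).baseChange S := rfl

variable {ι : Type u} (b : Module.Basis ι k S)

lemma toHomOver_component [DecidableEq ι] (x : S ⊗[k] homObj X G) (V : FGModuleCat.{u} k) (m : X.obj V) (i : ι) :
    equivFinsuppOfBasisLeft b ((toHomOver S X G x).1 V (1 ⊗ₜ m)) i =
      app (homEquiv X G (equivFinsuppOfBasisLeft b x i)) V m := by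
  induction x using TensorProduct.induction_on with
  | zero => simp
  | add x y hx hy =>
    simp only [map_add, Finsupp.add_apply, app_add, LinearMap.add_apply, Submodule.coe_add,
      Pi.add_apply, hx, hy]
  | tmul s h =>
    rw [toHomOver_tmul]
    simp [TensorProduct.smul_tmul']

lemma toHomOver_injective : Function.Injective (toHomOver S X G) := by
  classical
  refine (injective_iff_map_eq_zero (toHomOver S X G)).2 fun x hx => ?_
  let b := Module.Free.chooseBasis k S
  refine (equivFinsuppOfBasisLeft b).injective ?_
  rw [map_zero]
  ext i
  refine (homEquiv X G).injective (hom_ext fun V => LinearMap.ext fun m => ?_)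
  rw [← toHomOver_component, hx]
  simp

/-- The component of an `S`-linear map `S ⊗ M → S ⊗ N` at an element of a basis of `S`. -/
def component [DecidableEq ι] {M N : Type u} [AddCommGroup M] [Module k M] [AddCommGroup N] [Module k N]
    (i : ι) (ψ : S ⊗[k] M →ₗ[S] S ⊗[k] N) : M →ₗ[k] N :=
  Finsupp.lapply i ∘ₗ (equivFinsuppOfBasisLeft b).toLinearMap ∘ₗ ψ.restrictScalars k ∘ₗ
    TensorProduct.mk k S M 1

section

variable {M N : Type u} [AddCommGroup M] [Module k M] [AddCommGroup N] [Module k N]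

/-- The map `(S ⊗ T) ⊗ M → T ⊗ M` given by a coordinate on `S`. -/
def coordMap (T : Type u) [CommRing T] [Algebra k T] (i : ι) (M : Type u) [AddCommGroup M]
    [Module k M] : (S ⊗[k] T) ⊗[k] M →ₗ[k] T ⊗[k] M :=
  ((TensorProduct.lid k T).toLinearMap ∘ₗ (b.coord i).rTensor T).rTensor M

lemma coordMap_smul (i : ι) (s : S) (t : T) (y : T ⊗[k] M) :
    coordMap b T i M ((s ⊗ₜ[k] t : S ⊗[k] T) •
      coeffMap (Algebra.TensorProduct.includeRight : T →ₐ[k] S ⊗[k] T) M y) =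
      b.coord i s • t • y := by
  induction y using TensorProduct.induction_on with
  | zero => simp
  | add x y hx hy => simp only [map_add, smul_add, hx, hy]
  | tmul t' m =>
    simp [coordMap, TensorProduct.smul_tmul']

lemma coordMap_extend (i : ι) (g : T ⊗[k] M →ₗ[T] T ⊗[k] N) (x : (S ⊗[k] T) ⊗[k] M) :
    coordMap b T i N (extend (Algebra.TensorProduct.includeRight : T →ₐ[k] S ⊗[k] T) g x) =
      g (coordMap b T i M x) := by
  induction x using TensorProduct.induction_on with
  | zero => simp
  | add x y hx hy => simp only [map_add, hx, hy]
  | tmul a m =>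
    induction a using TensorProduct.induction_on with
    | zero => simp
    | add x y hx hy => simp only [TensorProduct.add_tmul, map_add, hx, hy]
    | tmul s t =>
      have h1 : ((s ⊗ₜ[k] t : S ⊗[k] T) ⊗ₜ[k] m : (S ⊗[k] T) ⊗[k] M) =
          (s ⊗ₜ[k] t : S ⊗[k] T) •
            coeffMap (Algebra.TensorProduct.includeRight : T →ₐ[k] S ⊗[k] T) M (1 ⊗ₜ m) := by
        simp [TensorProduct.smul_tmul']
      rw [h1, _root_.map_smul, extend_coeffMap, coordMap_smul, coordMap_smul,
        LinearMap.map_smul_of_tower, _root_.map_smul]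

lemma coordMap_coeffMap [DecidableEq ι] (i : ι) (t : T) (y : S ⊗[k] M) :
    coordMap b T i M ((1 ⊗ₜ[k] t : S ⊗[k] T) •
      coeffMap (Algebra.TensorProduct.includeLeft : S →ₐ[k] S ⊗[k] T) M y) =
      t ⊗ₜ equivFinsuppOfBasisLeft b y i := by
  induction y using TensorProduct.induction_on with
  | zero => simp
  | add x y hx hy => simp only [map_add, smul_add, hx, hy, Finsupp.add_apply, TensorProduct.tmul_add]
  | tmul s m =>
    simp [coordMap, TensorProduct.smul_tmul']

lemma coordMap_extend_left [DecidableEq ι] (i : ι) (ψ : S ⊗[k] M →ₗ[S] S ⊗[k] N) (x : T ⊗[k] M) :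
    coordMap b T i N (extend (Algebra.TensorProduct.includeLeft : S →ₐ[k] S ⊗[k] T) ψ
      (coeffMap (Algebra.TensorProduct.includeRight : T →ₐ[k] S ⊗[k] T) M x)) =
      (component b i ψ).baseChange T x := by
  induction x using TensorProduct.induction_on with
  | zero => simp
  | add x y hx hy => simp only [map_add, hx, hy]
  | tmul t m =>
    have h1 : coeffMap (Algebra.TensorProduct.includeRight : T →ₐ[k] S ⊗[k] T) M (t ⊗ₜ m) =
        (1 ⊗ₜ[k] t : S ⊗[k] T) •
          coeffMap (Algebra.TensorProduct.includeLeft : S →ₐ[k] S ⊗[k] T) M (1 ⊗ₜ m) := by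
      simp [TensorProduct.smul_tmul']
    rw [h1, _root_.map_smul, extend_coeffMap, coordMap_coeffMap]
    rfl

end

/-- The components of an element of `HomOver S X G` are morphisms. -/
def componentHom [DecidableEq ι] (i : ι) (ψ : HomOver S X G) : X ⟶ G :=
  mkHom (fun V => component b i (ψ.1 V)) fun T _ _ V W f => LinearMap.ext fun x => by
    have h := ψ.2 (S ⊗[k] T) Algebra.TensorProduct.includeLeft V W
      (extend Algebra.TensorProduct.includeRight f)
    rw [X.map_extend, G.map_extend] at h
    have h2 := congrArg (coordMap b T i _) (LinearMap.congr_fun h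
      (coeffMap Algebra.TensorProduct.includeRight _ x))
    rwa [LinearMap.comp_apply, LinearMap.comp_apply, extend_coeffMap, coordMap_extend_left,
      coordMap_extend, coordMap_extend_left] at h2

lemma finite_componentHom [DecidableEq ι] (ψ : HomOver S X G) : {i | componentHom b i ψ ≠ 0}.Finite := by
  classical
  let N := FGModuleCat.of k (Fin d → k)
  let c := Module.finBasis k (X.obj N)
  refine (Finset.finite_toSet (Finset.univ.biUnion fun j =>
    (equivFinsuppOfBasisLeft b (ψ.1 N (1 ⊗ₜ c j))).support)).subset fun i hi => ?_
  by_contra hc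
  refine hi (eq_zero_of_app (c.ext fun j => ?_))
  simp only [Finset.coe_biUnion, Finset.mem_coe, Finset.mem_univ, Set.iUnion_true, Set.mem_iUnion,
    Finsupp.mem_support_iff, not_exists, not_not] at hc
  exact hc j

lemma toHomOver_surjective : Function.Surjective (toHomOver S X G) := by
  classical
  intro ψ
  let b := Module.Free.chooseBasis k S
  let f : Module.Free.ChooseBasisIndex k S →₀ homObj X G :=
    Finsupp.ofSupportFinite (fun i => (homEquiv X G).symm (componentHom b i ψ))
      ((finite_componentHom b ψ).subset fun i hi h => hi (by
        show (homEquiv X G).symm (componentHom b i ψ) = 0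
        rw [h, map_zero]))
  refine ⟨(equivFinsuppOfBasisLeft b).symm f, Subtype.ext (funext fun V => ext_one fun m =>
    (equivFinsuppOfBasisLeft b).injective (Finsupp.ext fun i => ?_))⟩
  rw [toHomOver_component, LinearEquiv.apply_symm_apply]
  simp only [f, Finsupp.ofSupportFinite_coe, LinearEquiv.apply_symm_apply]
  rfl

/-- Formation of `Hom(X, G)` commutes with extension of scalars: the canonical map
`S ⊗ Hom(X, G) → HomOver S X G` is an isomorphism. -/
def homOverEquiv (S : Type u) [CommRing S] [Algebra k S] (X G : StrictPoly k d) :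
    S ⊗[k] homObj X G ≃ₗ[S] HomOver S X G :=
  LinearEquiv.ofBijective (toHomOver S X G) ⟨toHomOver_injective, toHomOver_surjective⟩

lemma homOverEquiv_coeffMap (φ : S →ₐ[k] T) (x : S ⊗[k] homObj X G) (V : FGModuleCat.{u} k) :
    (homOverEquiv T X G (coeffMap φ _ x)).1 V = extend φ ((homOverEquiv S X G x).1 V) := by
  change (toHomOver T X G (coeffMap φ _ x)).1 V = extend φ ((toHomOver S X G x).1 V)
  induction x using TensorProduct.induction_on with
  | zero => simp [extend_zero]
  | add x y hx hy => simp only [map_add, Submodule.coe_add, Pi.add_apply, hx, hy, extend_add]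
  | tmul s h => rw [coeffMap_tmul, toHomOver_tmul, toHomOver_tmul, extend_smul, extend_baseChange]

end HomOver

section RightKan

variable {s : ℕ} (A : StrictPoly k s)

/-- Composition of a natural family `S ⊗ D^d_U(A(V)) → S ⊗ G(V)` with the family
`S ⊗ D^d_{U'}(A(V)) → S ⊗ D^d_U(A(V))` given by an `S`-point of `Hom(U, U')`. -/
def precompHomOver {S : Type u} [CommRing S] [Algebra k S] {U U' : FGModuleCat.{u} k}
    (G : StrictPoly k (d * s)) (f : S ⊗[k] U →ₗ[S] S ⊗[k] U') :
    HomOver S ((divPowParam d U).comp A) G →ₗ[S] HomOver S ((divPowParam d U').comp A) G where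
  toFun ψ := ⟨fun V => ψ.1 V ∘ₗ divPowParamMap d f (A.obj V), fun T _ _ φ V W g => by
    have h := ψ.2 T φ V W g
    have h2 := divPowParamMap_naturality (d := d) (extend φ f) (A.map T g)
    have e1 : ∀ V : FGModuleCat.{u} k,
        extend φ (ψ.1 V ∘ₗ divPowParamMap d f (A.obj V)) =
        extend φ (ψ.1 V) ∘ₗ divPowParamMap d (extend φ f) (A.obj V) := fun V => by
      rw [divPowParamMap_extend]
      exact extend_comp φ _ _
    refine (congrArg (fun q => q ∘ₗ _) (e1 W)).trans (Eq.trans ?_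
      (congrArg (fun q => _ ∘ₗ q) (e1 V)).symm)
    refine (LinearMap.comp_assoc _ _ _).trans ((congrArg (fun q => _ ∘ₗ q) h2).trans ?_)
    exact congrArg (fun q => q ∘ₗ _) h⟩
  map_add' ψ ψ' := Subtype.ext (funext fun V => LinearMap.add_comp _ _ _)
  map_smul' r ψ := Subtype.ext (funext fun V => LinearMap.smul_comp _ _ _)

/-- The action on `S`-points of the functoriality of `Hom(C_A(D^d_U), G)` in `U`. -/
def kanMap (G : StrictPoly k (d * s)) (S : Type u) [CommRing S] [Algebra k S]
    {U U' : FGModuleCat.{u} k} (f : S ⊗[k] U →ₗ[S] S ⊗[k] U') :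
    S ⊗[k] homObj ((divPowParam d U).comp A) G →ₗ[S] S ⊗[k] homObj ((divPowParam d U').comp A) G :=
  (homOverEquiv S _ G).symm.toLinearMap ∘ₗ precompHomOver A G f ∘ₗ (homOverEquiv S _ G).toLinearMap

lemma homOverEquiv_kanMap (G : StrictPoly k (d * s)) {S : Type u} [CommRing S] [Algebra k S]
    {U U' : FGModuleCat.{u} k} (f : S ⊗[k] U →ₗ[S] S ⊗[k] U')
    (x : S ⊗[k] homObj ((divPowParam d U).comp A) G) (V : FGModuleCat.{u} k) :
    (homOverEquiv S _ G (kanMap A G S f x)).1 V =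
      (homOverEquiv S _ G x).1 V ∘ₗ divPowParamMap d f (A.obj V) := by
  rw [kanMap, LinearMap.comp_apply, LinearMap.comp_apply, LinearEquiv.coe_coe, LinearEquiv.coe_coe,
    LinearEquiv.apply_symm_apply]
  rfl

lemma homOverEquiv_ext {X G : StrictPoly k d} {S : Type u} [CommRing S] [Algebra k S]
    {x y : S ⊗[k] homObj X G}
    (h : ∀ V, (homOverEquiv S X G x).1 V = (homOverEquiv S X G y).1 V) : x = y :=
  (homOverEquiv S X G).injective (Subtype.ext (funext h))

/-- The strict polynomial functor `V ↦ Hom(C_A(D^d_V), G)`. -/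
def kan (A : StrictPoly k s) (G : StrictPoly k (d * s)) : StrictPoly k d where
  obj U := homObj ((divPowParam d U).comp A) G
  map S _ _ _ _ f := kanMap A G S f
  map_id S _ _ U := LinearMap.ext fun x => homOverEquiv_ext fun V => by
    rw [homOverEquiv_kanMap, divPowParamMap_id]
    rfl
  map_comp S _ _ _ _ _ g f := LinearMap.ext fun x => homOverEquiv_ext fun V => by
    rw [homOverEquiv_kanMap, LinearMap.comp_apply, homOverEquiv_kanMap, homOverEquiv_kanMap,
      divPowParamMap_comp]
    rfl
  map_smul S _ _ _ _ r f := LinearMap.ext fun x => homOverEquiv_ext fun V => by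
    rw [homOverEquiv_kanMap, LinearMap.smul_apply, _root_.map_smul, divPowParamMap_smul]
    refine (LinearMap.comp_smul _ _ _).trans ?_
    rw [← homOverEquiv_kanMap]
    rfl
  map_extend φ _ _ f := eq_extend _ _ _ fun x => homOverEquiv_ext fun V => by
    have h1 {X G : StrictPoly k (d * s)} {S T : Type u} [CommRing S] [Algebra k S] [CommRing T]
        [Algebra k T] (φ : S →ₐ[k] T) (x : homObj X G) :
      (1 ⊗ₜ x : T ⊗[k] homObj X G) = coeffMap φ _ (1 ⊗ₜ x) := by simp
    rw [homOverEquiv_kanMap, h1 φ, homOverEquiv_coeffMap, homOverEquiv_coeffMap,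
      homOverEquiv_kanMap, divPowParamMap_extend]
    exact (extend_comp φ _ _).symm

lemma homOverEquiv_comp {X G G' : StrictPoly k d} (η : G ⟶ G') {S : Type u} [CommRing S]
    [Algebra k S] (p : homObj X G →ₗ[k] homObj X G')
    (hp : ∀ h, homEquiv X G' (p h) = homEquiv X G h ≫ η)
    (x : S ⊗[k] homObj X G) (V : FGModuleCat.{u} k) :
    (homOverEquiv S X G' (p.baseChange S x)).1 V =
      (app η V).baseChange S ∘ₗ (homOverEquiv S X G x).1 V := by
  change (toHomOver S X G' (p.baseChange S x)).1 V =
      (app η V).baseChange S ∘ₗ (toHomOver S X G x).1 V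
  induction x using TensorProduct.induction_on with
  | zero => simp
  | add x y hx hy =>
    simp only [map_add, Submodule.coe_add, Pi.add_apply, hx, hy, LinearMap.comp_add]
  | tmul s h =>
    rw [LinearMap.baseChange_tmul, toHomOver_tmul, toHomOver_tmul, hp, app_comp,
      LinearMap.baseChange_comp, LinearMap.comp_smul]

/-- Composition with a morphism `G ⟶ G'`, as a linear map `Hom(X, G) → Hom(X, G')`. -/
def homObjMap (X : StrictPoly k d) {G G' : StrictPoly k d} (η : G ⟶ G') :
    homObj X G →ₗ[k] homObj X G' :=
  (homEquiv X G').symm.toLinearMap ∘ₗ Linear.rightComp k X η ∘ₗ (homEquiv X G).toLinearMap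

lemma homEquiv_homObjMap (X : StrictPoly k d) {G G' : StrictPoly k d} (η : G ⟶ G')
    (h : homObj X G) : homEquiv X G' (homObjMap X η h) = homEquiv X G h ≫ η := by
  simp [homObjMap]

/-- The functor `G ↦ (V ↦ Hom(C_A(D^d_V), G))`. -/
def kanFunctor (d : ℕ) (A : StrictPoly k s) : StrictPoly k (d * s) ⥤ StrictPoly k d where
  obj G := kan A G
  map {G G'} η := mkHom (F := kan A G) (G := kan A G')
    (fun U => homObjMap ((divPowParam d U).comp A) η)
    (fun S _ _ U U' f => LinearMap.ext fun x => homOverEquiv_ext fun V => by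
      refine (homOverEquiv_comp η _ (homEquiv_homObjMap _ η) _ V).trans ?_
      refine Eq.trans ?_ (homOverEquiv_kanMap A G' f _ V).symm
      refine (congrArg (fun q => _ ∘ₗ q) (homOverEquiv_kanMap A G f x V)).trans ?_
      refine Eq.trans ?_ (congrArg (fun q => q ∘ₗ _)
        (homOverEquiv_comp η _ (homEquiv_homObjMap _ η) x V)).symm
      rfl)
  map_id G := hom_ext fun U => LinearMap.ext fun h => (homEquiv _ _).injective <|
    (homEquiv_homObjMap _ _ h).trans (Category.comp_id _)
  map_comp η θ := hom_ext fun U => LinearMap.ext fun h => (homEquiv _ _).injective <|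
    (homEquiv_homObjMap _ _ h).trans <| (Category.assoc _ _ _).symm.trans <| by
      refine Eq.trans ?_ (homEquiv_homObjMap _ _ _).symm
      exact congrArg (· ≫ θ) (homEquiv_homObjMap _ _ h).symm

instance : (kanFunctor d A).Additive where
  map_add {G G' η θ} := hom_ext fun U => LinearMap.ext fun h => (homEquiv _ _).injective <|
    (homEquiv_homObjMap _ _ h).trans <| (Preadditive.comp_add _ _ _ _ _ _).trans <| by
      refine Eq.trans ?_ (map_add (homEquiv _ _) _ _).symm
      exact congrArg₂ (· + ·) (homEquiv_homObjMap _ _ h).symm (homEquiv_homObjMap _ _ h).symm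

end RightKan

end StrictPoly

section BoundedComplexes

open Limits

universe v w v' w'

/-- The property of cochain complexes of being bounded: only finitely many terms are nonzero. -/
def boundedComplexes (C : Type w) [Category.{v} C] [Preadditive C] :
    ObjectProperty (CochainComplex C ℤ) :=
  fun K => ∃ a b : ℤ, ∀ i : ℤ, i < a ∨ b < i → IsZero (K.X i)

/-- The category of bounded cochain complexes. -/
abbrev BoundedComplex (C : Type w) [Category.{v} C] [Preadditive C] :=
  (boundedComplexes C).FullSubcategory

/-- The functor on bounded complexes induced by an additive functor, applied degreewise. -/
def mapBounded {C : Type w} [Category.{v} C] [Preadditive C] {D : Type w'} [Category.{v'} D]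
    [Preadditive D] (F : C ⥤ D) [F.Additive] : BoundedComplex C ⥤ BoundedComplex D :=
  ObjectProperty.lift _ ((boundedComplexes C).ι ⋙ F.mapHomologicalComplex (ComplexShape.up ℤ))
    (fun K => by
      obtain ⟨a, b, h⟩ := K.property
      exact ⟨a, b, fun i hi => F.map_isZero (h i hi)⟩)

/-- The functor on bounded complexes induced by an additive contravariant functor, applied
degreewise: the term of degree `n` of the image of `K` is the image of the term of degree `-n`
of `K`. -/
def mapBoundedOp {C : Type w} [Category.{v} C] [Preadditive C] {D : Type w'} [Category.{v'} D]
    [Preadditive D] (F : Cᵒᵖ ⥤ D) [F.Additive] : (BoundedComplex C)ᵒᵖ ⥤ BoundedComplex D :=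
  ObjectProperty.lift _ ((boundedComplexes C).ι.op ⋙ (CochainComplex.opEquivalence C).functor ⋙
      F.mapHomologicalComplex (ComplexShape.up ℤ))
    (fun K => by
      obtain ⟨a, b, h⟩ := K.unop.property
      exact ⟨-b, -a, fun i hi => F.map_isZero (h (-i) (by omega)).op⟩)

end BoundedComplexes

section DualFunctor

/-- The duality functor on finite-dimensional vector spaces. -/
def dualFunctor (k : Type u) [Field k] : (FGModuleCat.{u} k)ᵒᵖ ⥤ FGModuleCat.{u} k where
  obj V := dualObj V.unop
  map f := ConcreteCategory.ofHom (C := FGModuleCat.{u} k) (X := dualObj _) (Y := dualObj _)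
    (dualLin f.unop.hom.hom)

variable {k : Type u} [Field k]

instance : (dualFunctor k).Additive where
  map_add {_ _ f g} := FGModuleCat.hom_ext (dualLin_add f.unop.hom.hom g.unop.hom.hom)

instance : (dualFunctor k).Faithful where
  map_injective {_ _ f g} h := by
    refine Quiver.Hom.unop_inj (FGModuleCat.hom_ext ?_)
    have h1 : (f.unop.hom.hom).dualMap = (g.unop.hom.hom).dualMap :=
      congrArg (fun q => q.hom.hom) h
    refine LinearMap.ext fun w => ?_
    rw [← sub_eq_zero]
    refine (Module.forall_dual_apply_eq_zero_iff k _).1 fun l => ?_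
    rw [map_sub, sub_eq_zero]
    exact LinearMap.congr_fun (LinearMap.congr_fun h1 l) w

instance : (dualFunctor k).Full where
  map_surjective {V W} f := by
    let g : Module.Dual k V.unop →ₗ[k] Module.Dual k W.unop := f.hom.hom
    refine ⟨Quiver.Hom.op (ConcreteCategory.ofHom (C := FGModuleCat.{u} k) (X := W.unop)
      (Y := V.unop) ((Module.evalEquiv k V.unop).symm.toLinearMap ∘ₗ g.dualMap ∘ₗ
      (Module.evalEquiv k W.unop).toLinearMap)), ?_⟩
    refine FGModuleCat.hom_ext (LinearMap.ext fun l => LinearMap.ext fun w => ?_)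
    let l : Module.Dual k V.unop := l
    change l ((Module.evalEquiv k V.unop).symm (g.dualMap (Module.evalEquiv k W.unop w))) = g l w
    have := Module.apply_evalEquiv_symm_apply k V.unop l
      (g.dualMap (Module.evalEquiv k W.unop w))
    rw [this]
    rfl

instance : (dualFunctor k).EssSurj where
  mem_essImage V := ⟨Opposite.op (dualObj V),
    ⟨(Module.evalEquiv k V).symm.toFGModuleCatIso⟩⟩

instance : (dualFunctor k).IsEquivalence where

instance : (dualFunctor k).PreservesHomology := inferInstance

end DualFunctor

section Derived

variable (k : Type u) [Field k] (d : ℕ) {s : ℕ}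

/-- Quasi-isomorphisms of bounded complexes of strict polynomial functors: morphisms which become
quasi-isomorphisms after evaluation at every finite-dimensional space (kernels, images and
cokernels of strict polynomial functors are computed at every such space). -/
def quasiIsos : MorphismProperty (BoundedComplex (StrictPoly k d)) :=
  fun _ _ f => ∀ V : FGModuleCat.{u} k,
    QuasiIso (((StrictPoly.ev d V).mapHomologicalComplex (ComplexShape.up ℤ)).map f.hom)

/-- The bounded derived category of strict polynomial functors of degree `d`. -/
abbrev DP : Type _ := (quasiIsos k d).Localization

/-- The localization functor. -/
abbrev DPQ : BoundedComplex (StrictPoly k d) ⥤ DP k d := (quasiIsos k d).Q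

variable {k}

lemma quasiIsos_precomp (A : StrictPoly k s) :
    (quasiIsos k d).IsInvertedBy (mapBounded (StrictPoly.precomp d A) ⋙ DPQ k (d * s)) :=
  fun _ _ _ hf => Localization.inverts (DPQ k (d * s)) (quasiIsos k (d * s)) _
    (fun V => hf (A.obj V))

lemma quasiIsos_kuhn :
    (quasiIsos k d).op.IsInvertedBy (mapBoundedOp (StrictPoly.kuhn (k := k) d) ⋙ DPQ k d) :=
  fun _ _ f hf => Localization.inverts (DPQ k d) (quasiIsos k d) _ (fun V => by
    have h := hf (dualObj V)
    rw [quasiIso_iff] at h ⊢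
    intro n
    have h1 := (quasiIsoAt_iff' _ (-(n + 1)) (-n) (-(n - 1)) (by simp; ring) (by simp; ring)).1 (h (-n))
    rw [quasiIsoAt_iff' _ (n - 1) n (n + 1) (by simp) (by simp)]
    rw [← ShortComplex.quasiIso_opMap_iff] at h1
    exact ShortComplex.quasiIso_map_of_preservesLeftHomology (dualFunctor k)
      (ShortComplex.opMap ((HomologicalComplex.shortComplexFunctor' (FGModuleCat.{u} k)
        (ComplexShape.up ℤ) (-(n + 1)) (-n) (-(n - 1))).map
        (((StrictPoly.ev d (dualObj V)).mapHomologicalComplex (ComplexShape.up ℤ)).map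
          f.unop.hom))))

/-- The functor `C_A` of precomposition with `A` on the derived categories. -/
def derivedPrecomp (A : StrictPoly k s) : DP k d ⥤ DP k (d * s) :=
  Localization.lift (mapBounded (StrictPoly.precomp d A) ⋙ DPQ k (d * s))
    (quasiIsos_precomp d A) (DPQ k d)

/-- The Kuhn duality on the derived category. -/
def derivedKuhn : (DP k d)ᵒᵖ ⥤ DP k d :=
  Localization.lift (mapBoundedOp (StrictPoly.kuhn (k := k) d) ⋙ DPQ k d)
    (quasiIsos_kuhn d) (DPQ k d).op

/-- The functor sending a bounded complex `G` to the complex `V ↦ Hom(C_A(D^d_V), G)`, regarded as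
an object of the bounded derived category. -/
def kanComplex (A : StrictPoly k s) : BoundedComplex (StrictPoly k (d * s)) ⥤ DP k d :=
  mapBounded (StrictPoly.kanFunctor d A) ⋙ DPQ k d

/-- The functor `K^r_A(G)(V) = RHom(C_A(D^d_V), G)`: the right derived functor of
`G ↦ (V ↦ Hom(C_A(D^d_V), G))` between the bounded derived categories (when it exists). -/
def rightKan (A : StrictPoly k s)
    [(kanComplex d A).HasPointwiseRightDerivedFunctor (quasiIsos k (d * s))] :
    DP k (d * s) ⥤ DP k d :=
  (kanComplex d A).totalRightDerived (DPQ k (d * s)) (quasiIsos k (d * s))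

/-- The functor `K^l_A(G) = (K^r_{A^#}(G^#))^#`. -/
def leftKan (A : StrictPoly k s)
    [(kanComplex d A.dual).HasPointwiseRightDerivedFunctor (quasiIsos k (d * s))] :
    DP k (d * s) ⥤ DP k d :=
  (derivedKuhn (d * s)).rightOp ⋙ (rightKan d A.dual).op ⋙ derivedKuhn d

end Derived

end SPF

end

/-! Between the abelian categories the right adjoint is formal. A linear map out of `D^d(X)` is the
same thing as a homogeneous polynomial law of degree `d` on `X`. This gives the Yoneda isomorphism
`Hom(D^d_U, F) = F(U)` (`yonedaHom`), and with it the adjunction between `C_A` and `G ↦ (V ↦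
Hom(C_A(D^d_V), G))` (`kanAdjunction`). Since `C_A` is exact, the adjunction passes to the derived
categories once the right adjoint has a right derived functor that is computed by injective
resolutions. As all complexes are bounded, these resolutions have to be bounded too. The substance
is therefore that strict polynomial functors have enough injectives and finite injective dimension
(`enoughInjectives`, `finInj`).

Both facts go by induction on the degree. The scalings of the summand `k` split `F(V ⊕ k)` into
weights between `0` and `d`, and the part of weight `m` is a functor `W_m F` of degree `d - m`. The
functor `Sym^m ⊗ -` is right adjoint to `W_m`; one triangle identity (`symTriangle`) suffices to see
that it preserves injectives. The unit `F → Sym^m ⊗ W_m F` detects the elements of weight `m`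
(`eq_zero_of_symUnit`), and a functor of positive degree without positive weights is zero
(`ExpLE.eq_zero`). So `F` embeds into the product of the `Sym^m ⊗ W_m F` for `m ≥ 1`.

For the finiteness there is a second induction, on a bound for the weights. The comultiplications
`Sym^m ⊗ G → Sym^{m+j} ⊗ W_j G` cut out subfunctors `prim i` of `Sym^m ⊗ G`, and `prim i` is the
kernel of a map from `prim (i + 1)` to a functor `prim 0` built from `W_{i+1} G`. In the weights
that are at least as large as all weights of `G` this map is surjective (`exists_comul_eq`), so its
cokernel has strictly smaller weights and is covered by induction. The surjectivity comes from the
generic block map `gm` of `V ⊕ k`: it is a shear composed with the scaling by one variable `xK`, and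
the largest weight provides exactly the power of `xK` that is needed to divide. The resulting
four-term exact sequences propagate the finiteness (`finInj_prim_succ_iff`).

Finally, Kuhn duality is an equivalence with the opposite category that exchanges `C_A` and
`C_{A^#}`. Conjugating the adjunction for `A^#` by it makes `K^l_A` left adjoint to `C_A`. -/

noncomputable section

namespace SPF

/-! ### Action of strict polynomial functors on ordinary linear maps. -/

section Lin

variable {k : Type u} [Field k] {d : ℕ}

namespace StrictPoly

/-- The linear map `F(V) → F(W)` induced by a linear map `V → W`. -/
def lin (F : StrictPoly k d) {V W : FGModuleCat.{u} k} (f : V →ₗ[k] W) :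
    F.obj V →ₗ[k] F.obj W :=
  (TensorProduct.lid k _).toLinearMap ∘ₗ (F.map k (f.baseChange k)).restrictScalars k ∘ₗ
    (TensorProduct.lid k _).symm.toLinearMap

lemma coeffMap_ofId {R : Type u} [CommRing R] [Algebra k R] {M : Type u} [AddCommGroup M]
    [Module k M] (x : k ⊗[k] M) :
    coeffMap (Algebra.ofId k R) M x = 1 ⊗ₜ TensorProduct.lid k M x := by
  induction x using TensorProduct.induction_on with
  | zero => simp
  | add x y hx hy => simp only [map_add, hx, hy, TensorProduct.tmul_add]
  | tmul c m => simp [Algebra.ofId_apply, Algebra.algebraMap_eq_smul_one, TensorProduct.smul_tmul]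

/-- An ordinary linear map is a `k`-point, and the compatibility with the homomorphism `k → R`
determines the value at its image among the `R`-points. -/
lemma map_baseChange (F : StrictPoly k d) {R : Type u} [CommRing R] [Algebra k R]
    {V W : FGModuleCat.{u} k} (f : V →ₗ[k] W) :
    F.map R (f.baseChange R) = (F.lin f).baseChange R := by
  rw [← extend_baseChange (Algebra.ofId k R), F.map_extend]
  refine (eq_extend _ _ _ fun m => ?_).symm
  rw [coeffMap_ofId]
  simp [lin]

lemma lin_id (F : StrictPoly k d) (V : FGModuleCat.{u} k) :
    F.lin (LinearMap.id : V →ₗ[k] V) = LinearMap.id := by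
  refine LinearMap.ext fun v => ?_
  simp only [lin, LinearMap.baseChange_id, F.map_id]
  simp

lemma lin_comp (F : StrictPoly k d) {U V W : FGModuleCat.{u} k} (g : V →ₗ[k] W) (f : U →ₗ[k] V) :
    F.lin (g ∘ₗ f) = F.lin g ∘ₗ F.lin f := by
  refine LinearMap.ext fun v => ?_
  simp only [lin, LinearMap.baseChange_comp, F.map_comp]
  simp

lemma map_map (F : StrictPoly k d) {R : Type u} [CommRing R] [Algebra k R]
    {U V W : FGModuleCat.{u} k} (g : R ⊗[k] V →ₗ[R] R ⊗[k] W) (f : R ⊗[k] U →ₗ[R] R ⊗[k] V)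
    (x : R ⊗[k] F.obj U) : F.map R g (F.map R f x) = F.map R (g ∘ₗ f) x := by
  rw [F.map_comp]; rfl

lemma map_id_apply (F : StrictPoly k d) {R : Type u} [CommRing R] [Algebra k R]
    {V : FGModuleCat.{u} k} (x : R ⊗[k] F.obj V) : F.map R LinearMap.id x = x := by
  rw [F.map_id]; rfl

lemma map_coeffMap (F : StrictPoly k d) {R S : Type u} [CommRing R] [Algebra k R] [CommRing S]
    [Algebra k S] (φ : R →ₐ[k] S) {V W : FGModuleCat.{u} k} (f : R ⊗[k] V →ₗ[R] R ⊗[k] W)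
    (x : R ⊗[k] F.obj V) :
    F.map S (extend φ f) (coeffMap φ _ x) = coeffMap φ _ (F.map R f x) := by
  rw [F.map_extend, extend_coeffMap]

lemma app_lin {F G : StrictPoly k d} (φ : F ⟶ G) {V W : FGModuleCat.{u} k} (f : V →ₗ[k] W)
    (x : F.obj V) : app φ W (F.lin f x) = G.lin f (app φ V x) := by
  have h := LinearMap.congr_fun (naturality φ k (f.baseChange k)) (1 ⊗ₜ x)
  rw [map_baseChange, map_baseChange] at h
  simpa using congrArg (TensorProduct.lid k _) h

end StrictPoly

end Lin

/-! ### Block maps on `V ⊕ k`. -/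

section Plus

variable {k : Type u} [Field k]

/-- The base field, as a finite-dimensional space. -/
def unitObj (k : Type u) [Field k] : FGModuleCat.{u} k := FGModuleCat.of k k

/-- The space `V ⊕ k`. -/
def plusObj (V : FGModuleCat.{u} k) : FGModuleCat.{u} k := FGModuleCat.of k (V × k)

/-- The inclusion of `V`. -/
def inV (V : FGModuleCat.{u} k) : V →ₗ[k] plusObj V := LinearMap.inl k V k
/-- The inclusion of `k`. -/
def inK (V : FGModuleCat.{u} k) : unitObj k →ₗ[k] plusObj V := LinearMap.inr k V k
/-- The projection to `V`. -/
def prV (V : FGModuleCat.{u} k) : plusObj V →ₗ[k] V := LinearMap.fst k V k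
/-- The projection to `k`. -/
def prK (V : FGModuleCat.{u} k) : plusObj V →ₗ[k] unitObj k := LinearMap.snd k V k

variable (V : FGModuleCat.{u} k)

lemma prV_comp_inV : prV V ∘ₗ inV V = LinearMap.id := LinearMap.fst_comp_inl ..
lemma prV_comp_inK : prV V ∘ₗ inK V = 0 := LinearMap.fst_comp_inr ..
lemma prK_comp_inV : prK V ∘ₗ inV V = 0 := LinearMap.snd_comp_inl ..
lemma prK_comp_inK : prK V ∘ₗ inK V = LinearMap.id := LinearMap.snd_comp_inr ..
lemma in_comp_pr : inV V ∘ₗ prV V + inK V ∘ₗ prK V = LinearMap.id := by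
  refine LinearMap.ext fun x => ?_
  change ((x : V × k).1, (0 : k)) + ((0 : V), (x : V × k).2) = (x : V × k)
  exact Prod.ext (add_zero _) (zero_add _)

variable (R : Type u) [CommRing R] [Algebra k R]

/-- The inclusion of `R ⊗ V`. -/
def rinV : R ⊗[k] V →ₗ[R] R ⊗[k] plusObj V := (inV V).baseChange R
/-- The inclusion of `R ⊗ k`. -/
def rinK : R ⊗[k] unitObj k →ₗ[R] R ⊗[k] plusObj V := (inK V).baseChange R
/-- The projection to `R ⊗ V`. -/
def rprV : R ⊗[k] plusObj V →ₗ[R] R ⊗[k] V := (prV V).baseChange R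
/-- The projection to `R ⊗ k`. -/
def rprK : R ⊗[k] plusObj V →ₗ[R] R ⊗[k] unitObj k := (prK V).baseChange R

@[simp] lemma rprV_rinV : rprV V R ∘ₗ rinV V R = LinearMap.id := by
  rw [rprV, rinV, ← LinearMap.baseChange_comp, prV_comp_inV, LinearMap.baseChange_id]
@[simp] lemma rprV_rinK : rprV V R ∘ₗ rinK V R = 0 := by
  rw [rprV, rinK, ← LinearMap.baseChange_comp, prV_comp_inK, LinearMap.baseChange_zero]
@[simp] lemma rprK_rinV : rprK V R ∘ₗ rinV V R = 0 := by
  rw [rprK, rinV, ← LinearMap.baseChange_comp, prK_comp_inV, LinearMap.baseChange_zero]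
@[simp] lemma rprK_rinK : rprK V R ∘ₗ rinK V R = LinearMap.id := by
  rw [rprK, rinK, ← LinearMap.baseChange_comp, prK_comp_inK, LinearMap.baseChange_id]
lemma rin_rpr : rinV V R ∘ₗ rprV V R + rinK V R ∘ₗ rprK V R = LinearMap.id := by
  rw [rinV, rinK, rprV, rprK, ← LinearMap.baseChange_comp, ← LinearMap.baseChange_comp,
    ← LinearMap.baseChange_add, in_comp_pr, LinearMap.baseChange_id]

variable {V R} {U W X : FGModuleCat.{u} k}

/-- The map to `R ⊗ (V ⊕ k)` with given components. -/
def pair (f : R ⊗[k] U →ₗ[R] R ⊗[k] V) (ξ : R ⊗[k] U →ₗ[R] R ⊗[k] unitObj k) :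
    R ⊗[k] U →ₗ[R] R ⊗[k] plusObj V :=
  rinV V R ∘ₗ f + rinK V R ∘ₗ ξ

@[simp] lemma rprV_pair (f : R ⊗[k] U →ₗ[R] R ⊗[k] V) (ξ : R ⊗[k] U →ₗ[R] R ⊗[k] unitObj k) :
    rprV V R ∘ₗ pair f ξ = f := by
  rw [pair, LinearMap.comp_add, ← LinearMap.comp_assoc, ← LinearMap.comp_assoc]
  simp

@[simp] lemma rprK_pair (f : R ⊗[k] U →ₗ[R] R ⊗[k] V) (ξ : R ⊗[k] U →ₗ[R] R ⊗[k] unitObj k) :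
    rprK V R ∘ₗ pair f ξ = ξ := by
  rw [pair, LinearMap.comp_add, ← LinearMap.comp_assoc, ← LinearMap.comp_assoc]
  simp

@[simp] lemma rprV_pair_comp (f : R ⊗[k] U →ₗ[R] R ⊗[k] V) (ξ : R ⊗[k] U →ₗ[R] R ⊗[k] unitObj k)
    (g : R ⊗[k] W →ₗ[R] R ⊗[k] U) : rprV V R ∘ₗ pair f ξ ∘ₗ g = f ∘ₗ g := by
  rw [← LinearMap.comp_assoc, rprV_pair]

@[simp] lemma rprK_pair_comp (f : R ⊗[k] U →ₗ[R] R ⊗[k] V) (ξ : R ⊗[k] U →ₗ[R] R ⊗[k] unitObj k)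
    (g : R ⊗[k] W →ₗ[R] R ⊗[k] U) : rprK V R ∘ₗ pair f ξ ∘ₗ g = ξ ∘ₗ g := by
  rw [← LinearMap.comp_assoc, rprK_pair]

lemma pair_ext {f g : R ⊗[k] U →ₗ[R] R ⊗[k] plusObj V} (h₁ : rprV V R ∘ₗ f = rprV V R ∘ₗ g)
    (h₂ : rprK V R ∘ₗ f = rprK V R ∘ₗ g) : f = g := by
  rw [← LinearMap.id_comp f, ← LinearMap.id_comp g, ← rin_rpr, LinearMap.add_comp,
    LinearMap.add_comp, LinearMap.comp_assoc, LinearMap.comp_assoc, LinearMap.comp_assoc,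
    LinearMap.comp_assoc, h₁, h₂]

variable {S : Type u} [CommRing S] [Algebra k S] (φ : R →ₐ[k] S)

@[simp] lemma extend_rinV : extend φ (rinV V R) = rinV V S := extend_baseChange _ _
@[simp] lemma extend_rinK : extend φ (rinK V R) = rinK V S := extend_baseChange _ _
@[simp] lemma extend_rprV : extend φ (rprV V R) = rprV V S := extend_baseChange _ _
@[simp] lemma extend_rprK : extend φ (rprK V R) = rprK V S := extend_baseChange _ _
@[simp] lemma extend_pair (f : R ⊗[k] U →ₗ[R] R ⊗[k] V) (ξ : R ⊗[k] U →ₗ[R] R ⊗[k] unitObj k) :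
    extend φ (pair f ξ) = pair (extend φ f) (extend φ ξ) := by
  simp [pair, extend_add, extend_comp]

/-- The diagonal map `(v, t) ↦ (f v, r t)`. -/
def dg (f : R ⊗[k] V →ₗ[R] R ⊗[k] W) (r : R) : R ⊗[k] plusObj V →ₗ[R] R ⊗[k] plusObj W :=
  pair (f ∘ₗ rprV V R) (r • rprK V R)

lemma rprV_dg (f : R ⊗[k] V →ₗ[R] R ⊗[k] W) (r : R) : rprV W R ∘ₗ dg f r = f ∘ₗ rprV V R :=
  rprV_pair _ _

lemma rprK_dg (f : R ⊗[k] V →ₗ[R] R ⊗[k] W) (r : R) : rprK W R ∘ₗ dg f r = r • rprK V R :=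
  rprK_pair _ _

lemma dg_pair (f : R ⊗[k] V →ₗ[R] R ⊗[k] W) (r : R) (g : R ⊗[k] U →ₗ[R] R ⊗[k] V)
    (ξ : R ⊗[k] U →ₗ[R] R ⊗[k] unitObj k) : dg f r ∘ₗ pair g ξ = pair (f ∘ₗ g) (r • ξ) := by
  refine pair_ext ?_ ?_
  · rw [← LinearMap.comp_assoc, rprV_dg, LinearMap.comp_assoc, rprV_pair, rprV_pair]
  · rw [← LinearMap.comp_assoc, rprK_dg, LinearMap.smul_comp, rprK_pair, rprK_pair]

lemma pair_comp (f : R ⊗[k] U →ₗ[R] R ⊗[k] V) (ξ : R ⊗[k] U →ₗ[R] R ⊗[k] unitObj k)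
    (g : R ⊗[k] W →ₗ[R] R ⊗[k] U) : pair f ξ ∘ₗ g = pair (f ∘ₗ g) (ξ ∘ₗ g) :=
  pair_ext (by simp) (by simp)

lemma dg_comp (g : R ⊗[k] V →ₗ[R] R ⊗[k] W) (r : R) (f : R ⊗[k] U →ₗ[R] R ⊗[k] V) (r' : R) :
    dg g r ∘ₗ dg f r' = dg (g ∘ₗ f) (r * r') := by
  conv_lhs => rw [dg.eq_def f r', dg_pair, smul_smul]
  rfl

@[simp] lemma dg_id : dg (LinearMap.id : R ⊗[k] V →ₗ[R] R ⊗[k] V) 1 = LinearMap.id :=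
  pair_ext (by simp [rprV_dg]) (by simp [rprK_dg])

@[simp] lemma extend_dg (f : R ⊗[k] V →ₗ[R] R ⊗[k] W) (r : R) :
    extend φ (dg f r) = dg (extend φ f) (φ r) := by
  simp [dg, extend_comp, extend_smul]

lemma smul_dg (f : R ⊗[k] V →ₗ[R] R ⊗[k] W) (r r' : R) : r' • dg f r = dg (r' • f) (r' * r) :=
  pair_ext (by simp [rprV_dg, LinearMap.comp_smul, LinearMap.smul_comp])
    (by simp [rprK_dg, LinearMap.comp_smul, mul_smul])

variable (V) in
/-- The map `(v, t) ↦ (v, r t)`. -/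
abbrev sc (r : R) : R ⊗[k] plusObj V →ₗ[R] R ⊗[k] plusObj V := dg LinearMap.id r

end Plus

/-! ### Coefficients of elements of `S[T] ⊗ M`. -/

section PolyCoeff

open Polynomial

variable {k : Type u} [Field k] {S : Type u} [CommRing S] [Algebra k S] {M N : Type u}
  [AddCommGroup M] [Module k M] [AddCommGroup N] [Module k N]

/-- The inclusion of constants `S → S[T]`. -/
abbrev cst (k S : Type u) [Field k] [CommRing S] [Algebra k S] : S →ₐ[k] S[X] :=
  Polynomial.CAlgHom (R := k) (A := S)

/-- The coefficient of `T ^ n` of an element of `S[T] ⊗ M`. -/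
def cf (S M : Type u) [CommRing S] [Algebra k S] [AddCommGroup M] [Module k M] (n : ℕ) :
    S[X] ⊗[k] M →ₗ[k] S ⊗[k] M :=
  ((Polynomial.lcoeff S n).restrictScalars k).rTensor M

lemma cf_tmul (n : ℕ) (p : S[X]) (m : M) : cf S M n (p ⊗ₜ[k] m) = p.coeff n ⊗ₜ m := by
  simp [cf]

lemma cf_X_pow_smul (n m : ℕ) (x : S ⊗[k] M) :
    cf S M n ((X ^ m : S[X]) • coeffMap (cst k S) M x) = if n = m then x else 0 := by
  induction x using TensorProduct.induction_on with
  | zero => simp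
  | add x y hx hy =>
    simp only [map_add, smul_add, hx, hy]
    split_ifs <;> simp
  | tmul s m =>
    rw [coeffMap_tmul, TensorProduct.smul_tmul', cf_tmul, smul_eq_mul]
    simp only [Polynomial.CAlgHom_apply, coeff_mul_C, coeff_X_pow]
    split_ifs <;> simp

lemma cf_sum (N : ℕ) (n : ℕ) (hn : n < N) (x : ℕ → S ⊗[k] M) :
    cf S M n (∑ m ∈ Finset.range N, (X ^ m : S[X]) • coeffMap (cst k S) M (x m)) = x n := by
  rw [map_sum, Finset.sum_eq_single n]
  · rw [cf_X_pow_smul, if_pos rfl]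
  · intro m _ hm
    rw [cf_X_pow_smul, if_neg (Ne.symm hm)]
  · intro h
    exact absurd (Finset.mem_range.2 hn) h

/-- The expansion is available for all large `N`, so that two expansions, or an expansion and a
prescribed coefficient, can be compared over a common range. -/
lemma exists_eq_sum_cf (y : S[X] ⊗[k] M) : ∃ N₀, ∀ N, N₀ ≤ N →
    y = ∑ m ∈ Finset.range N, (X ^ m : S[X]) • coeffMap (cst k S) M (cf S M m y) := by
  induction y using TensorProduct.induction_on with
  | zero => exact ⟨0, fun N _ => by simp⟩
  | add x y hx hy =>
    obtain ⟨N₁, h₁⟩ := hx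
    obtain ⟨N₂, h₂⟩ := hy
    refine ⟨max N₁ N₂, fun N hN => ?_⟩
    simp only [map_add, smul_add, Finset.sum_add_distrib]
    rw [← h₁ N (le_trans (le_max_left _ _) hN), ← h₂ N (le_trans (le_max_right _ _) hN)]
  | tmul p m =>
    refine ⟨p.natDegree + 1, fun N hN => ?_⟩
    simp only [cf_tmul, coeffMap_tmul, TensorProduct.smul_tmul', ← TensorProduct.sum_tmul]
    congr 1
    conv_lhs => rw [p.as_sum_range' N (by omega)]
    refine Finset.sum_congr rfl fun i _ => ?_
    rw [← Polynomial.C_mul_X_pow_eq_monomial, mul_comm]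
    rfl

lemma cf_zero_of_X_pow {n m : ℕ} (h : n < m) (y : S[X] ⊗[k] M) :
    cf S M n ((X ^ m : S[X]) • y) = 0 := by
  induction y using TensorProduct.induction_on with
  | zero => simp
  | add x y hx hy => simp only [map_add, smul_add, hx, hy, add_zero]
  | tmul p m' =>
    rw [TensorProduct.smul_tmul', cf_tmul, smul_eq_mul, Polynomial.coeff_X_pow_mul',
      if_neg (by omega), TensorProduct.zero_tmul]

/-- Multiplication by `T ^ n` shifts the coefficients, and an element is recovered from its
coefficients. This cancellation lets all scaling arguments run over `S[T]`, without inverting the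
parameter. -/
lemma X_pow_smul_injective (n : ℕ) :
    Function.Injective (fun y : S[X] ⊗[k] M => (X ^ n : S[X]) • y) := by
  have key : ∀ y : S[X] ⊗[k] M, ∀ i, cf S M (i + n) ((X ^ n : S[X]) • y) = cf S M i y := by
    intro y i
    induction y using TensorProduct.induction_on with
    | zero => simp
    | add x y hx hy => simp only [map_add, smul_add, hx, hy]
    | tmul p m =>
      rw [TensorProduct.smul_tmul', cf_tmul, cf_tmul, smul_eq_mul, Polynomial.coeff_X_pow_mul]
  intro x y h
  obtain ⟨N₁, h₁⟩ := exists_eq_sum_cf x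
  obtain ⟨N₂, h₂⟩ := exists_eq_sum_cf y
  rw [h₁ (max N₁ N₂) (le_max_left _ _), h₂ (max N₁ N₂) (le_max_right _ _)]
  refine Finset.sum_congr rfl fun i _ => ?_
  have h' : cf S M (i + n) ((X ^ n : S[X]) • x) = cf S M (i + n) ((X ^ n : S[X]) • y) :=
    congrArg _ h
  rw [key, key] at h'
  rw [h']

end PolyCoeff

end SPF

namespace SPF

/-! ### Weight decomposition of `F(V ⊕ k)` and the functors `W_m`. -/

section Weights

open Polynomial

variable {k : Type u} [Field k] {R S : Type u} [CommRing R] [Algebra k R] [CommRing S] [Algebra k S]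

lemma baseChange_coeffMap (φ : R →ₐ[k] S) {M N : Type u} [AddCommGroup M] [Module k M]
    [AddCommGroup N] [Module k N] (f : M →ₗ[k] N) (x : R ⊗[k] M) :
    f.baseChange S (coeffMap φ M x) = coeffMap φ N (f.baseChange R x) := by
  rw [← extend_baseChange φ, extend_coeffMap]

lemma coeffMap_id {M : Type u} [AddCommGroup M] [Module k M] (x : R ⊗[k] M) :
    coeffMap (AlgHom.id k R) M x = x := by
  simp [coeffMap]

lemma eq_of_sum_X_pow {M : Type u} [AddCommGroup M] [Module k M] {N : ℕ} {a b : ℕ → R ⊗[k] M}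
    (h : ∑ m ∈ Finset.range N, (X ^ m : R[X]) • coeffMap (cst k R) M (a m) =
      ∑ m ∈ Finset.range N, (X ^ m : R[X]) • coeffMap (cst k R) M (b m)) {n : ℕ} (hn : n < N) :
    a n = b n := by
  have := congrArg (cf R M n) h
  rwa [cf_sum N n hn, cf_sum N n hn] at this

@[simp] lemma extend_sc (φ : R →ₐ[k] S) (V : FGModuleCat.{u} k) (r : R) :
    extend φ (sc V r) = sc V (φ r) := by
  rw [extend_dg, extend_id]

namespace StrictPoly

variable {d : ℕ} (F : StrictPoly k d) (V : FGModuleCat.{u} k)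

/-- The projection of `F(V ⊕ k)` to its part of weight `n` for the scalings of the summand `k`. -/
def wt (n : ℕ) : F.obj (plusObj V) →ₗ[k] F.obj (plusObj V) :=
  (TensorProduct.lid k _).toLinearMap ∘ₗ cf k _ n ∘ₗ
    (F.map k[X] (sc V X)).restrictScalars k ∘ₗ TensorProduct.mk k k[X] _ 1

variable {V}

/-- The variable of `k[T]` is the universal scalar: the expansion at `T` specializes to every scalar
in every algebra, with the same range. -/
lemma exists_map_sc_one (z : F.obj (plusObj V)) : ∃ N₀, ∀ N, N₀ ≤ N →
    ∀ (R : Type u) [CommRing R] [Algebra k R] (r : R),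
      F.map R (sc V r) (1 ⊗ₜ z) = ∑ n ∈ Finset.range N, r ^ n • (1 ⊗ₜ[k] F.wt V n z) := by
  obtain ⟨N₀, h⟩ := exists_eq_sum_cf (F.map k[X] (sc V X) (1 ⊗ₜ z))
  refine ⟨N₀, fun N hN R _ _ r => ?_⟩
  have h1 := congrArg (coeffMap (Polynomial.aeval r : k[X] →ₐ[k] R) _) (h N hN)
  rw [← F.map_coeffMap, coeffMap_tmul, map_one, extend_sc, aeval_X] at h1
  rw [h1, map_sum]
  refine Finset.sum_congr rfl fun n _ => ?_
  rw [coeffMap_smul, coeffMap_comp, map_pow, aeval_X,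
    show (Polynomial.aeval r : k[X] →ₐ[k] R).comp (cst k k) = Algebra.ofId k R from by ext,
    coeffMap_ofId]
  rfl

lemma exists_map_sc (x : R ⊗[k] F.obj (plusObj V)) : ∃ N₀, ∀ N, N₀ ≤ N →
    ∀ (S : Type u) [CommRing S] [Algebra k S] (φ : R →ₐ[k] S) (r : S),
      F.map S (sc V r) (coeffMap φ _ x) =
        ∑ n ∈ Finset.range N, r ^ n • coeffMap φ _ ((F.wt V n).baseChange R x) := by
  induction x using TensorProduct.induction_on with
  | zero => exact ⟨0, fun N _ S _ _ φ r => by simp⟩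
  | add x y hx hy =>
    obtain ⟨N₁, h₁⟩ := hx
    obtain ⟨N₂, h₂⟩ := hy
    refine ⟨max N₁ N₂, fun N hN S _ _ φ r => ?_⟩
    simp only [map_add, smul_add, Finset.sum_add_distrib]
    rw [← h₁ N (le_trans (le_max_left _ _) hN), ← h₂ N (le_trans (le_max_right _ _) hN)]
  | tmul a z =>
    obtain ⟨N₀, h⟩ := F.exists_map_sc_one z
    refine ⟨N₀, fun N hN S _ _ φ r => ?_⟩
    have : (φ a ⊗ₜ[k] z : S ⊗[k] F.obj (plusObj V)) = φ a • (1 ⊗ₜ z) := by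
      simp [TensorProduct.smul_tmul']
    rw [coeffMap_tmul, this, _root_.map_smul, h N hN, Finset.smul_sum]
    refine Finset.sum_congr rfl fun n _ => ?_
    rw [LinearMap.baseChange_tmul, coeffMap_tmul]
    simp [TensorProduct.smul_tmul', mul_comm]

lemma wt_baseChange (n : ℕ) (x : R ⊗[k] F.obj (plusObj V)) :
    (F.wt V n).baseChange R x =
      cf R _ n (F.map R[X] (sc V X) (coeffMap (cst k R) _ x)) := by
  obtain ⟨N₀, h⟩ := F.exists_map_sc x
  -- The bound `n + 1` ensures that the range contains the exponent `n`.
  rw [h (max N₀ (n + 1)) (le_max_left _ _), cf_sum]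
  exact lt_of_lt_of_le (Nat.lt_succ_self n) (le_max_right _ _)

/-- Block-diagonal maps commute with the scalings of the summand `k`, hence with the extraction of
coefficients in the scaling parameter. -/
lemma map_dg_wt {W : FGModuleCat.{u} k} (f : R ⊗[k] V →ₗ[R] R ⊗[k] W) (r : R) (n : ℕ)
    (x : R ⊗[k] F.obj (plusObj V)) :
    F.map R (dg f r) ((F.wt V n).baseChange R x) =
      (F.wt W n).baseChange R (F.map R (dg f r) x) := by
  obtain ⟨N₀, h⟩ := F.exists_map_sc x
  rw [F.wt_baseChange n (F.map R (dg f r) x), ← F.map_coeffMap, extend_dg, F.map_map, dg_comp, LinearMap.id_comp, mul_comm, ← LinearMap.comp_id (extend _ f),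
    ← dg_comp, ← F.map_map, h (max N₀ (n + 1)) (le_max_left _ _), map_sum]
  simp only [_root_.map_smul]
  rw [← extend_dg]
  simp only [F.map_coeffMap]
  rw [cf_sum]
  exact lt_of_lt_of_le (Nat.lt_succ_self n) (le_max_right _ _)

/-- The scaling by a product of two independent variables is the composite of the two scalings.
Comparing the coefficients of the `n`-th power of one variable shows that the `n`-th component is an
eigenvector for the other. -/
lemma map_sc_wt_X (n : ℕ) (x : R ⊗[k] F.obj (plusObj V)) :
    F.map R[X] (sc V X) (coeffMap (cst k R) _ ((F.wt V n).baseChange R x)) =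
      (X ^ n : R[X]) • coeffMap (cst k R) _ ((F.wt V n).baseChange R x) := by
  obtain ⟨N₀, h⟩ := F.exists_map_sc x
  have e : sc V (C X : R[X][X]) ∘ₗ sc V X = sc V (C X * X) := dg_comp _ _ _ _
  have h1 := LinearMap.congr_fun (F.map_comp R[X][X] (sc V (C X)) (sc V X))
    (coeffMap ((cst k R[X]).comp (cst k R)) _ x)
  set N := max N₀ (n + 1) with hN
  rw [e, LinearMap.comp_apply, h N (le_max_left _ _), h N (le_max_left _ _), map_sum] at h1
  simp only [_root_.map_smul, ← coeffMap_comp] at h1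
  rw [show (C X : R[X][X]) = cst k R[X] X from rfl, ← extend_sc] at h1
  simp only [F.map_coeffMap, mul_pow, mul_comm _ (X ^ _ : R[X][X]), mul_smul, ← map_pow,
    ← coeffMap_smul] at h1
  exact (eq_of_sum_X_pow h1 (lt_of_lt_of_le (Nat.lt_succ_self n) (le_max_right _ _))).symm

lemma map_sc_wt (n : ℕ) (r : R) (x : R ⊗[k] F.obj (plusObj V)) :
    F.map R (sc V r) ((F.wt V n).baseChange R x) = r ^ n • (F.wt V n).baseChange R x := by
  let ev : R[X] →ₐ[k] R := (Polynomial.aeval (R := R) r).restrictScalars k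
  have h := congrArg (coeffMap ev _) (F.map_sc_wt_X n x)
  rw [← F.map_coeffMap, extend_sc, coeffMap_smul, coeffMap_comp,
    show ev.comp (cst k R) = AlgHom.id k R from AlgHom.ext fun a => by simp [ev],
    coeffMap_id] at h
  simpa [ev] using h

lemma wt_wt_same (n : ℕ) (x : R ⊗[k] F.obj (plusObj V)) :
    (F.wt V n).baseChange R ((F.wt V n).baseChange R x) = (F.wt V n).baseChange R x := by
  conv_lhs => rw [F.wt_baseChange n ((F.wt V n).baseChange R x)]
  rw [map_sc_wt_X, cf_X_pow_smul, if_pos rfl]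

lemma wt_wt_ne {m n : ℕ} (h : m ≠ n) (x : R ⊗[k] F.obj (plusObj V)) :
    (F.wt V m).baseChange R ((F.wt V n).baseChange R x) = 0 := by
  rw [F.wt_baseChange m ((F.wt V n).baseChange R x), map_sc_wt_X, cf_X_pow_smul, if_neg h]

/-- Scaling `V` and scaling `k` compose to the homothety of `V ⊕ k`, which acts by `T ^ d` by
homogeneity. On weight `n` this rules out `n > d` and forces the scalings of `V` to act through `d -
n`. -/
lemma X_pow_smul_map_dg (n : ℕ) (x : R ⊗[k] F.obj (plusObj V)) :
    (X ^ n : R[X]) • F.map R[X] (dg ((X : R[X]) • LinearMap.id) 1)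
      (coeffMap (cst k R) _ ((F.wt V n).baseChange R x)) =
      (X ^ d : R[X]) • coeffMap (cst k R) _ ((F.wt V n).baseChange R x) := by
  have e : dg ((X : R[X]) • LinearMap.id) (1 : R[X]) ∘ₗ sc V (X : R[X]) = (X : R[X]) • LinearMap.id := by
    rw [dg_comp, ← dg_id (V := V) (R := R[X]), smul_dg]
    simp
  rw [← _root_.map_smul, ← F.map_sc_wt_X, F.map_map, e, F.map_smul,
    F.map_id]
  rfl

lemma wt_baseChange_eq_zero {n : ℕ} (h : d < n) (x : R ⊗[k] F.obj (plusObj V)) :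
    (F.wt V n).baseChange R x = 0 := by
  have := congrArg (cf R _ d) (F.X_pow_smul_map_dg n x)
  rw [cf_zero_of_X_pow h, cf_X_pow_smul, if_pos rfl] at this
  exact this.symm

lemma map_dg_smul_wt {m e : ℕ} (h : m + e = d) (r : R) (x : R ⊗[k] F.obj (plusObj V)) :
    F.map R (dg (r • LinearMap.id) 1) ((F.wt V m).baseChange R x) =
      r ^ e • (F.wt V m).baseChange R x := by
  have h1 := F.X_pow_smul_map_dg m x
  have hX : (X ^ d : R[X]) = X ^ m * X ^ e := by rw [← pow_add, h]
  rw [hX, mul_smul] at h1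
  have h2 := X_pow_smul_injective (k := k) (S := R) m h1
  let ev : R[X] →ₐ[k] R := (Polynomial.aeval (R := R) r).restrictScalars k
  have h3 := congrArg (coeffMap ev _) h2
  rw [← F.map_coeffMap, extend_dg, extend_smul, extend_id, coeffMap_smul, coeffMap_comp,
    show ev.comp (cst k R) = AlgHom.id k R from AlgHom.ext fun a => by simp [ev],
    coeffMap_id, map_one] at h3
  simpa [ev] using h3

lemma map_sc_eq_sum (r : R) (x : R ⊗[k] F.obj (plusObj V)) :
    F.map R (sc V r) x = ∑ n ∈ Finset.range (d + 1), r ^ n • (F.wt V n).baseChange R x := by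
  obtain ⟨N₀, h⟩ := F.exists_map_sc x
  have h1 := h (max N₀ (d + 1)) (le_max_left _ _) R (AlgHom.id k R) r
  simp only [coeffMap_id] at h1
  rw [h1]
  symm
  refine Finset.sum_subset (Finset.range_subset_range.2 (le_max_right _ _)) fun n _ hn => ?_
  rw [F.wt_baseChange_eq_zero (by simpa using hn), smul_zero]

lemma sum_wt (x : R ⊗[k] F.obj (plusObj V)) :
    ∑ n ∈ Finset.range (d + 1), (F.wt V n).baseChange R x = x := by
  have h := F.map_sc_eq_sum (V := V) (1 : R) x
  simp only [one_pow, one_smul] at h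
  rw [← h, sc, dg_id, F.map_id_apply]

section

variable {F} {G : StrictPoly k d} (φ : F ⟶ G)

lemma app_wt (n : ℕ) (x : R ⊗[k] F.obj (plusObj V)) :
    (app φ (plusObj V)).baseChange R ((F.wt V n).baseChange R x) =
      (G.wt V n).baseChange R ((app φ (plusObj V)).baseChange R x) := by
  have h := LinearMap.congr_fun (naturality φ R[X] (sc V X)) (coeffMap (cst k R) _ x)
  rw [LinearMap.comp_apply, LinearMap.comp_apply, map_sc_eq_sum, map_sc_eq_sum, map_sum] at h
  by_cases hn : n < d + 1
  · simp only [_root_.map_smul, baseChange_coeffMap] at h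
    exact eq_of_sum_X_pow h hn
  · rw [F.wt_baseChange_eq_zero (by omega), G.wt_baseChange_eq_zero (by omega), map_zero]

end

/-! The same statements over the base field. -/

section

lemma tmul_injective {M : Type u} [AddCommGroup M] [Module k M] :
    Function.Injective (fun m : M => (1 : k) ⊗ₜ[k] m) := fun m m' h => by
  simpa using congrArg (TensorProduct.lid k M) h

lemma wt_same (n : ℕ) (z : F.obj (plusObj V)) : F.wt V n (F.wt V n z) = F.wt V n z :=
  tmul_injective (by simpa using F.wt_wt_same (R := k) n (1 ⊗ₜ z))

lemma wt_eq_zero {n : ℕ} (h : d < n) (z : F.obj (plusObj V)) : F.wt V n z = 0 :=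
  tmul_injective (k := k) (by simpa using F.wt_baseChange_eq_zero (R := k) h (1 ⊗ₜ z))

lemma app_wt_apply {G : StrictPoly k d} (φ : F ⟶ G) (n : ℕ) (z : F.obj (plusObj V)) :
    app φ (plusObj V) (F.wt V n z) = G.wt V n (app φ (plusObj V) z) :=
  tmul_injective (by simpa using app_wt (R := k) φ n (1 ⊗ₜ z))

end

variable (V) in
/-- The part of weight `m` of `F(V ⊕ k)`. -/
def wtSpace (m : ℕ) : FGModuleCat.{u} k := FGModuleCat.of k (LinearMap.range (F.wt V m))

variable (V) in
/-- The inclusion of the part of weight `m`. -/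
def wtI (m : ℕ) : F.wtSpace V m →ₗ[k] F.obj (plusObj V) := (LinearMap.range (F.wt V m)).subtype

variable (V) in
/-- The projection to the part of weight `m`. -/
def wtP (m : ℕ) : F.obj (plusObj V) →ₗ[k] F.wtSpace V m := (F.wt V m).rangeRestrict

lemma wtI_comp_wtP (m : ℕ) : F.wtI V m ∘ₗ F.wtP V m = F.wt V m := rfl

lemma wtI_val_injective (m : ℕ) : Function.Injective (F.wtI V m) := Subtype.val_injective

lemma wtP_comp_wtI (m : ℕ) : F.wtP V m ∘ₗ F.wtI V m = LinearMap.id := by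
  refine LinearMap.ext fun x => F.wtI_val_injective m ?_
  obtain ⟨z, hz⟩ := x.2
  change F.wt V m (F.wtI V m x) = F.wtI V m x
  change F.wt V m z = F.wtI V m x at hz
  rw [← hz, wt_same]

/-- The functor `V ↦ F(V ⊕ k)_m`, of degree `d - m`. -/
def wtObj (m : ℕ) {e : ℕ} (h : m + e = d) (F : StrictPoly k d) : StrictPoly k e where
  obj V := F.wtSpace V m
  map S _ _ V W f :=
    (F.wtP W m).baseChange S ∘ₗ F.map S (dg f 1) ∘ₗ (F.wtI V m).baseChange S
  map_id S _ _ V := by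
    rw [dg_id, F.map_id, LinearMap.id_comp, ← LinearMap.baseChange_comp, wtP_comp_wtI,
      LinearMap.baseChange_id]
  map_comp S _ _ U V W g f := by
    have key (y : S ⊗[k] F.obj (plusObj V)) : (F.wtI V m).baseChange S ((F.wtP V m).baseChange S y) =
        (F.wt V m).baseChange S y := by
      rw [← wtI_comp_wtP, LinearMap.baseChange_comp, LinearMap.comp_apply]
    have key2 (x : S ⊗[k] F.wtSpace U m) : (F.wt U m).baseChange S ((F.wtI U m).baseChange S x) =
        (F.wtI U m).baseChange S x := by
      rw [← LinearMap.comp_apply, ← LinearMap.baseChange_comp, ← wtI_comp_wtP, LinearMap.comp_assoc,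
        wtP_comp_wtI, LinearMap.comp_id]
    refine LinearMap.ext fun x => ?_
    simp only [LinearMap.comp_apply]
    rw [key, ← F.map_dg_wt, key2, F.map_map, dg_comp, mul_one]
  map_smul S _ _ V W r f := by
    -- Only `V` is scaled and the summand `k` stays fixed; on weight `m` this multiplies by `r ^ e`,
    -- where `e = d - m`.
    have : dg (r • f) (1 : S) = dg f 1 ∘ₗ dg (r • LinearMap.id) 1 := by
      rw [dg_comp, mul_one, LinearMap.comp_smul, LinearMap.comp_id]
    have h2 : F.map S (dg (r • LinearMap.id) 1) ∘ₗ (F.wtI V m).baseChange S =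
        r ^ e • (F.wtI V m).baseChange S := by
      have h3 : F.map S (dg (r • LinearMap.id) 1) ∘ₗ (F.wt V m).baseChange S =
        r ^ e • (F.wt V m).baseChange S := LinearMap.ext fun x => F.map_dg_smul_wt h r x
      have h4 := congrArg (fun q => q ∘ₗ (F.wtI V m).baseChange S) h3
      simpa only [← wtI_comp_wtP, LinearMap.baseChange_comp, LinearMap.comp_assoc,
        LinearMap.smul_comp, ← LinearMap.baseChange_comp _ (F.wtP V m), wtP_comp_wtI,
        LinearMap.baseChange_id, LinearMap.comp_id] using h4
    rw [this, F.map_comp, LinearMap.comp_assoc, h2, LinearMap.comp_smul, LinearMap.comp_smul]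
  map_extend φ V W f := by
    rw [extend_comp, extend_comp, extend_baseChange, extend_baseChange, ← F.map_extend, extend_dg,
      map_one]

section

variable {e : ℕ} (m : ℕ) (h : m + e = d)

variable (V) in
/-- The inclusion of `F(V ⊕ k)_m`. -/
def wtι : (wtObj m h F).obj V →ₗ[k] F.obj (plusObj V) := F.wtI V m

variable (V) in
/-- The projection to `F(V ⊕ k)_m`. -/
def wtπ : F.obj (plusObj V) →ₗ[k] (wtObj m h F).obj V := F.wtP V m

lemma wtι_comp_wtπ : F.wtι V m h ∘ₗ F.wtπ V m h = F.wt V m := rfl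

lemma wtπ_comp_wtι : F.wtπ V m h ∘ₗ F.wtι V m h = LinearMap.id := F.wtP_comp_wtI m

lemma wtι_injective : Function.Injective ((F.wtι V m h).baseChange R) :=
  Module.Flat.lTensor_preserves_injective_linearMap (M := R) (F.wtι V m h) Subtype.val_injective

@[simp] lemma wtπ_wtι_apply (x : R ⊗[k] (wtObj m h F).obj V) :
    (F.wtπ V m h).baseChange R ((F.wtι V m h).baseChange R x) = x := by
  rw [← LinearMap.comp_apply, ← LinearMap.baseChange_comp, wtπ_comp_wtι]
  simp

@[simp] lemma wtι_wtπ_apply (x : R ⊗[k] F.obj (plusObj V)) :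
    (F.wtι V m h).baseChange R ((F.wtπ V m h).baseChange R x) = (F.wt V m).baseChange R x := by
  rw [← LinearMap.comp_apply, ← LinearMap.baseChange_comp, wtι_comp_wtπ]

@[simp] lemma wt_wtι_apply (x : R ⊗[k] (wtObj m h F).obj V) :
    (F.wt V m).baseChange R ((F.wtι V m h).baseChange R x) = (F.wtι V m h).baseChange R x := by
  rw [← wtι_wtπ_apply F m h, wtπ_wtι_apply]

@[simp] lemma wtπ_wtι (x : (wtObj m h F).obj V) : F.wtπ V m h (F.wtι V m h x) = x :=
  LinearMap.congr_fun (F.wtπ_comp_wtι m h) x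

@[simp] lemma wtι_wtπ (x : F.obj (plusObj V)) : F.wtι V m h (F.wtπ V m h x) = F.wt V m x := rfl

@[simp] lemma wt_wtι (x : (wtObj m h F).obj V) : F.wt V m (F.wtι V m h x) = F.wtι V m h x := by
  rw [← wtι_wtπ F m h, wtπ_wtι]

lemma wtObj_map {W : FGModuleCat.{u} k} (f : R ⊗[k] V →ₗ[R] R ⊗[k] W) :
    (wtObj m h F).map R f =
      (F.wtπ W m h).baseChange R ∘ₗ F.map R (dg f 1) ∘ₗ (F.wtι V m h).baseChange R := rfl

/-- The projection in the definition of `wtObj` loses nothing, because block-diagonal maps preserve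
weights. -/
lemma wtι_map {W : FGModuleCat.{u} k}
    (f : R ⊗[k] V →ₗ[R] R ⊗[k] W) (x : R ⊗[k] (wtObj m h F).obj V) :
    (F.wtι W m h).baseChange R ((wtObj m h F).map R f x) =
      F.map R (dg f 1) ((F.wtι V m h).baseChange R x) := by
  rw [wtObj_map, LinearMap.comp_apply, wtι_wtπ_apply, LinearMap.comp_apply, ← F.map_dg_wt,
    wt_wtι_apply]

end

/-- The functor `F ↦ (V ↦ F(V ⊕ k)_m)`. -/
def wtFunctor (m : ℕ) {e : ℕ} (h : m + e = d) : StrictPoly k d ⥤ StrictPoly k e where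
  obj F := wtObj m h F
  map {F G} φ := mkHom (fun V => G.wtπ V m h ∘ₗ app φ (plusObj V) ∘ₗ F.wtι V m h)
    (fun S _ _ V W f => LinearMap.ext fun x => G.wtι_injective m h <| by
      rw [LinearMap.comp_apply, LinearMap.comp_apply, wtι_map]
      simp only [LinearMap.baseChange_comp, LinearMap.comp_apply, wtι_wtπ_apply]
      rw [wtι_map, ← app_wt, ← app_wt, wt_wtι_apply, ← F.map_dg_wt, wt_wtι_apply]
      exact LinearMap.congr_fun (naturality φ S (dg f 1)) _)
  map_id F := hom_ext fun V => by
    rw [app_mkHom]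
    exact F.wtπ_comp_wtι m h
  map_comp {F G H} φ ψ := hom_ext fun V => by
    refine LinearMap.ext fun x => ?_
    simp only [app_mkHom, app_comp, LinearMap.comp_apply, wtι_wtπ]
    rw [← app_wt_apply, wt_wtι]

lemma wtι_wtFunctor_map (m : ℕ) {e : ℕ} (h : m + e = d) {G : StrictPoly k d} (φ : F ⟶ G)
    (x : (wtObj m h F).obj V) :
    G.wtι V m h (app ((wtFunctor m h).map φ) V x) = app φ (plusObj V) (F.wtι V m h x) := by
  change G.wt V m (app φ (plusObj V) (F.wtι V m h x)) = _
  rw [← app_wt_apply, wt_wtι]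

end StrictPoly

end Weights

end SPF

namespace SPF

/-! ### Points and grading of the symmetric algebra. -/

section SymPoints

open Polynomial

variable {k : Type u} [Field k] {S T B : Type u} [CommRing S] [Algebra k S] [CommRing T]
  [Algebra k T] [CommRing B] [Algebra k B] {U V W : FGModuleCat.{u} k}

lemma cf_baseChange {M N : Type u} [AddCommGroup M] [Module k M] [AddCommGroup N] [Module k N]
    (f : M →ₗ[k] N) (n : ℕ) (y : S[X] ⊗[k] M) :
    f.baseChange S (cf S M n y) = cf S N n (f.baseChange S[X] y) := by
  induction y using TensorProduct.induction_on with
  | zero => simp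
  | add x y hx hy => simp only [map_add, hx, hy]
  | tmul p m => simp [cf_tmul]

/-- The evaluation `B ⊗ V → B` of a `B`-valued linear form. -/
def evalForm (l : V →ₗ[k] B) : B ⊗[k] V →ₗ[B] B := LinearMap.liftBaseChange B l

/-- The generator of the one-dimensional space `k`. -/
def oneU (k : Type u) [Field k] : unitObj k := (1 : k)

/-- A `B`-valued linear form on `V`, as a map to `B ⊗ k`. -/
def formMap (l : V →ₗ[k] B) : B ⊗[k] V →ₗ[B] B ⊗[k] unitObj k :=
  LinearMap.liftBaseChange B ((TensorProduct.mk k B (unitObj k)).flip (oneU k) ∘ₗ l)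

lemma formMap_one_tmul (l : V →ₗ[k] B) (v : V) :
    formMap l (1 ⊗ₜ v) = l v ⊗ₜ[k] oneU k := by
  simp [formMap]

lemma formMap_eq (l : V →ₗ[k] B) (x : B ⊗[k] V) :
    formMap l x = evalForm l x ⊗ₜ[k] oneU k := by
  induction x using TensorProduct.induction_on with
  | zero => simp
  | add x y hx hy => simp only [map_add, hx, hy, TensorProduct.add_tmul]
  | tmul b v => simp [formMap, evalForm, TensorProduct.smul_tmul']

lemma extend_formMap (φ : B →ₐ[k] S) (l : V →ₗ[k] B) :
    extend φ (formMap l) = formMap (φ.toLinearMap ∘ₗ l) :=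
  (eq_extend _ _ _ fun m => by rw [formMap_one_tmul, formMap_one_tmul, coeffMap_tmul]; rfl).symm

lemma smul_formMap (b : B) (l : V →ₗ[k] B) : b • formMap l = formMap (b • l) :=
  ext_one fun v => by
    rw [LinearMap.smul_apply, formMap_one_tmul, formMap_one_tmul, TensorProduct.smul_tmul']; rfl

lemma formMap_comp_baseChange (l : V →ₗ[k] B) (f : U →ₗ[k] V) :
    formMap l ∘ₗ f.baseChange B = formMap (l ∘ₗ f) :=
  ext_one fun v => by
    rw [LinearMap.comp_apply, LinearMap.baseChange_tmul, formMap_one_tmul, formMap_one_tmul]; rfl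

/-- The homomorphism `S ⊗ Sym(V) → B` given by a homomorphism `S → B` and a linear map `V → B`. -/
def symPt (a : S →ₐ[k] B) (l : V →ₗ[k] B) : S ⊗[k] SymmetricAlgebra k V →ₐ[k] B :=
  Algebra.TensorProduct.lift a (SymmetricAlgebra.lift l) (fun _ _ => Commute.all _ _)

@[simp] lemma symPt_tmul_one (a : S →ₐ[k] B) (l : V →ₗ[k] B) (s : S) :
    symPt a l (s ⊗ₜ 1) = a s := by simp [symPt]

@[simp] lemma symPt_ι (a : S →ₐ[k] B) (l : V →ₗ[k] B) (v : V) :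
    symPt a l (1 ⊗ₜ SymmetricAlgebra.ι k V v) = l v := by simp [symPt]

lemma symPt_tmul (a : S →ₐ[k] B) (l : V →ₗ[k] B) (s : S) (p : SymmetricAlgebra k V) :
    symPt a l (s ⊗ₜ p) = a s * SymmetricAlgebra.lift l p := by simp [symPt]

lemma symPt_comp_includeLeft (a : S →ₐ[k] B) (l : V →ₗ[k] B) :
    (symPt a l).comp Algebra.TensorProduct.includeLeft = a :=
  AlgHom.ext fun s => by simp

lemma symPt_comp_includeRight (a : S →ₐ[k] B) (l : V →ₗ[k] B) :
    (symPt a l).comp Algebra.TensorProduct.includeRight = SymmetricAlgebra.lift l :=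
  SymmetricAlgebra.algHom_ext (LinearMap.ext fun v => by simp)

lemma symPt_ext {f g : S ⊗[k] SymmetricAlgebra k V →ₐ[k] B} (h₁ : ∀ s : S, f (s ⊗ₜ 1) = g (s ⊗ₜ 1))
    (h₂ : ∀ v : V, f (1 ⊗ₜ SymmetricAlgebra.ι k V v) = g (1 ⊗ₜ SymmetricAlgebra.ι k V v)) : f = g :=
  Algebra.TensorProduct.ext (AlgHom.ext h₁)
    (SymmetricAlgebra.algHom_ext (LinearMap.ext fun v => h₂ v))

/-- `symAlg` as a homomorphism of `k`-algebras. -/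
def symAlgK (f : S ⊗[k] V →ₗ[S] S ⊗[k] W) :
    S ⊗[k] SymmetricAlgebra k V →ₐ[k] S ⊗[k] SymmetricAlgebra k W :=
  (symAlg f).restrictScalars k

@[simp] lemma symAlgK_apply (f : S ⊗[k] V →ₗ[S] S ⊗[k] W) (x : S ⊗[k] SymmetricAlgebra k V) :
    symAlgK f x = symAlg f x := rfl

lemma symAlgK_tmul_one (f : S ⊗[k] V →ₗ[S] S ⊗[k] W) (s : S) :
    symAlgK f (s ⊗ₜ 1) = s ⊗ₜ 1 :=
  (symAlg f).commutes s

lemma symPt_baseChange_ι (a : S →ₐ[k] B) (l : W →ₗ[k] B) (y : S ⊗[k] W) :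
    symPt a l ((SymmetricAlgebra.ι k W).baseChange S y) = evalForm l (coeffMap a W y) := by
  induction y using TensorProduct.induction_on with
  | zero => simp
  | add x y hx hy => simp only [map_add, hx, hy]
  | tmul s w => simp [evalForm, symPt_tmul]

/-- A `B`-valued point of the symmetric algebra of `W` is a linear form on `W`, and pulling it back
along `f` composes the form with `f`. Most identities between homomorphisms out of `S ⊗ Sym(V)`
reduce to this. -/
lemma symPt_comp_symAlgK (a : S →ₐ[k] B) (l : W →ₗ[k] B) (f : S ⊗[k] V →ₗ[S] S ⊗[k] W) :
    (symPt a l).comp (symAlgK f) =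
      symPt a ((evalForm l).restrictScalars k ∘ₗ (extend a f).restrictScalars k ∘ₗ
        TensorProduct.mk k B V 1) := by
  refine symPt_ext (fun s => ?_) fun v => ?_
  · rw [AlgHom.comp_apply, symAlgK_tmul_one]; simp
  · rw [AlgHom.comp_apply, symAlgK_apply, symAlg_tmul_ι, symPt_baseChange_ι, ← extend_coeffMap]
    simp

/-- The homomorphism which multiplies the elements of degree `n` by `T ^ n`. -/
def degHom (V : FGModuleCat.{u} k) : SymmetricAlgebra k V →ₐ[k] (SymmetricAlgebra k V)[X] :=
  SymmetricAlgebra.lift ((X : (SymmetricAlgebra k V)[X]) •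
    ((cst k (SymmetricAlgebra k V)).toLinearMap ∘ₗ SymmetricAlgebra.ι k V))

lemma degHom_ι (v : V) : degHom V (SymmetricAlgebra.ι k V v) =
    (X : (SymmetricAlgebra k V)[X]) * C (SymmetricAlgebra.ι k V v) := by
  rw [degHom, SymmetricAlgebra.lift_ι_apply]; rfl

lemma degHom_of_mem {n : ℕ} {p : SymmetricAlgebra k V} (hp : p ∈ symSub k n V) :
    degHom V p = (X : (SymmetricAlgebra k V)[X]) ^ n * C p := by
  induction hp using Submodule.pow_induction_on_left' with
  | algebraMap r => rw [AlgHom.commutes, pow_zero, one_mul]; rfl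
  | add x y i _ _ hx hy => rw [map_add, hx, hy, map_add, mul_add]
  | mem_mul m hm i x _ hx =>
    obtain ⟨v, rfl⟩ := hm
    rw [map_mul, degHom_ι, hx, map_mul, pow_succ]
    ring

lemma coeff_degHom_mem (n : ℕ) (p : SymmetricAlgebra k V) :
    (degHom V p).coeff n ∈ symSub k n V := by
  -- `Sym(V)` is generated by `V`, so the homogeneous parts span it; on each of them `degHom`
  -- produces a single power of the variable.
  have key : p ∈ ⨆ n, symSub k n V := by
    have : (⊤ : Subalgebra k (SymmetricAlgebra k V)) ≤
        Algebra.adjoin k (Set.range (SymmetricAlgebra.ι k V)) := by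
      intro x _
      induction x using SymmetricAlgebra.induction with
      | algebraMap r => exact Subalgebra.algebraMap_mem _ r
      | ι x => exact Algebra.subset_adjoin ⟨x, rfl⟩
      | mul a b ha hb => exact Subalgebra.mul_mem _ (ha trivial) (hb trivial)
      | add a b ha hb => exact Subalgebra.add_mem _ (ha trivial) (hb trivial)
    have h2 := this (x := p) trivial
    induction h2 using Algebra.adjoin_induction with
    | mem x hx =>
      refine Submodule.mem_iSup_of_mem 1 ?_
      rw [symSub, pow_one]
      exact hx
    | algebraMap r =>
      refine Submodule.mem_iSup_of_mem 0 ?_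
      rw [symSub, pow_zero]
      exact Submodule.algebraMap_mem r
    | add x y _ _ hx hy => exact add_mem hx hy
    | mul x y h₁ h₂ hx hy =>
      clear h₁ h₂
      induction hx using Submodule.iSup_induction' with
      | zero => rw [zero_mul]; exact zero_mem _
      | add a b _ _ ha hb => rw [add_mul]; exact add_mem ha hb
      | mem i a ha =>
        induction hy using Submodule.iSup_induction' with
        | zero => rw [mul_zero]; exact zero_mem _
        | add c e _ _ hc he => rw [mul_add]; exact add_mem hc he
        | mem j c hc =>
          refine Submodule.mem_iSup_of_mem (i + j) ?_
          rw [symSub, pow_add]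
          exact Submodule.mul_mem_mul ha hc
  induction key using Submodule.iSup_induction' with
  | zero => rw [map_zero, coeff_zero]; exact zero_mem _
  | add x y _ _ hx hy => rw [map_add, coeff_add]; exact add_mem hx hy
  | mem i x hx =>
    rw [degHom_of_mem hx, coeff_mul_C, coeff_X_pow]
    split_ifs with h
    · rw [one_mul, h]; exact hx
    · rw [zero_mul]; exact zero_mem _

/-- The projection of `Sym(V)` to its component of degree `n`. -/
def symProj (n : ℕ) (V : FGModuleCat.{u} k) : SymmetricAlgebra k V →ₗ[k] symSub k n V :=
  (((Polynomial.lcoeff (SymmetricAlgebra k V) n).restrictScalars k) ∘ₗ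
    (degHom V).toLinearMap).codRestrict _ (coeff_degHom_mem n)

lemma coe_symProj (n : ℕ) (p : SymmetricAlgebra k V) :
    (symProj n V p : SymmetricAlgebra k V) = (degHom V p).coeff n := rfl

lemma symProj_coe (n : ℕ) (p : symSub k n V) : symProj n V (p : SymmetricAlgebra k V) = p := by
  refine Subtype.ext ?_
  rw [coe_symProj, degHom_of_mem p.2, coeff_mul_C, coeff_X_pow, if_pos rfl, one_mul]

end SymPoints

/-! ### The functors `Sym^m ⊗ G`, inside `Sym(V) ⊗ G(V)`. -/

namespace StrictPoly

open Polynomial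

variable {k : Type u} [Field k] {S T B : Type u} [CommRing S] [Algebra k S] [CommRing T]
  [Algebra k T] [CommRing B] [Algebra k B] {U V W : FGModuleCat.{u} k} {d e : ℕ}

/-- The functor `Sym^m ⊗ G`. -/
def symTensor (m : ℕ) (h : m + e = d) (G : StrictPoly k e) : StrictPoly k d where
  obj V := tensorObj ((symPow k m).obj V) (G.obj V)
  map S _ _ _ _ f := tensorHom ((symPow k m).map S f) (G.map S f)
  map_id S _ _ V := by rw [(symPow k m).map_id, G.map_id, tensorHom_id]
  map_comp S _ _ _ _ _ g f := by rw [(symPow k m).map_comp, G.map_comp, tensorHom_comp]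
  map_smul S _ _ _ _ r f := by
    rw [(symPow k m).map_smul, G.map_smul, tensorHom_smul_left, tensorHom_smul_right, smul_smul,
      ← pow_add, h]
  map_extend φ _ _ f := by rw [(symPow k m).map_extend, G.map_extend, tensorHom_extend]

variable (m : ℕ) (h : m + e = d) (G : StrictPoly k e)

/-- The inclusion `Sym^m(V) ⊗ G(V) → Sym(V) ⊗ G(V)`. -/
def stι (V : FGModuleCat.{u} k) :
    (symTensor m h G).obj V →ₗ[k] SymmetricAlgebra k V ⊗[k] G.obj V :=
  ((symSub k m V).subtype).rTensor (G.obj V)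

/-- The projection `Sym(V) ⊗ G(V) → Sym^m(V) ⊗ G(V)`. -/
def stπ (V : FGModuleCat.{u} k) :
    SymmetricAlgebra k V ⊗[k] G.obj V →ₗ[k] (symTensor m h G).obj V :=
  (symProj m V).rTensor (G.obj V)

/-- An element of `Sym^m(V) ⊗ G(V)`. -/
def stMk (p : symSub k m V) (g : G.obj V) : (symTensor m h G).obj V := p ⊗ₜ[k] g

lemma st_induction {motive : (symTensor m h G).obj V → Prop} (x : (symTensor m h G).obj V)
    (zero : motive 0) (mk : ∀ p g, motive (stMk m h G p g))
    (add : ∀ x y, motive x → motive y → motive (x + y)) : motive x :=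
  TensorProduct.induction_on (motive := motive) x zero mk add

lemma stι_mk (p : symSub k m V) (g : G.obj V) : stι m h G V (stMk m h G p g) = p.1 ⊗ₜ g := rfl

lemma stπ_tmul (p : SymmetricAlgebra k V) (g : G.obj V) :
    stπ m h G V (p ⊗ₜ g) = stMk m h G (symProj m V p) g := rfl

lemma stπ_stι (x : (symTensor m h G).obj V) : stπ m h G V (stι m h G V x) = x := by
  induction x using st_induction with
  | zero => simp
  | add x y hx hy => simp only [map_add, hx, hy]
  | mk p g => rw [stι_mk, stπ_tmul, symProj_coe]

lemma stι_injective : Function.Injective (stι m h G V) :=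
  Function.LeftInverse.injective (stπ_stι m h G)

lemma stι_stπ (y : SymmetricAlgebra k V ⊗[k] G.obj V) :
    stι m h G V (stπ m h G V y) = cf _ _ m (coeffMap (degHom V) _ y) := by
  induction y using TensorProduct.induction_on with
  | zero => simp
  | add x y hx hy => simp only [map_add, hx, hy]
  | tmul p g => rw [stπ_tmul, stι_mk, coe_symProj, coeffMap_tmul, cf_tmul]

lemma degHom_stι (x : (symTensor m h G).obj V) :
    coeffMap (degHom V) _ (stι m h G V x) =
      (X ^ m : (SymmetricAlgebra k V)[X]) • coeffMap (cst k _) _ (stι m h G V x) := by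
  induction x using st_induction with
  | zero => simp
  | add x y hx hy => simp only [map_add, smul_add, hx, hy]
  | mk p g =>
    rw [stι_mk, coeffMap_tmul, coeffMap_tmul, degHom_of_mem p.2, TensorProduct.smul_tmul']
    rfl

/-- The criterion by which elements of `Sym(V) ⊗ G(V)` are recognized as lying in `Sym^m(V) ⊗ G(V)`:
the degree homomorphism has to multiply them by the `m`-th power of the variable. -/
lemma stι_stπ_of_homogeneous (y : SymmetricAlgebra k V ⊗[k] G.obj V)
    (hy : coeffMap (degHom V) _ y =
      (X ^ m : (SymmetricAlgebra k V)[X]) • coeffMap (cst k _) _ y) :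
    stι m h G V (stπ m h G V y) = y := by
  rw [stι_stπ, hy, cf_X_pow_smul, if_pos rfl]

variable (S) in
/-- The inclusion `S ⊗ (Sym^m(V) ⊗ G(V)) → (S ⊗ Sym(V)) ⊗ G(V)`. -/
def rstι (V : FGModuleCat.{u} k) :
    S ⊗[k] (symTensor m h G).obj V →ₗ[k] (S ⊗[k] SymmetricAlgebra k V) ⊗[k] G.obj V :=
  (TensorProduct.assoc k S (SymmetricAlgebra k V) (G.obj V)).symm.toLinearMap ∘ₗ
    (stι m h G V).lTensor S

lemma rstι_mk (s : S) (p : symSub k m V) (g : G.obj V) :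
    rstι S m h G V (s ⊗ₜ stMk m h G p g) = (s ⊗ₜ p.1) ⊗ₜ g := rfl

lemma rstι_injective : Function.Injective (rstι S m h G V) := by
  refine (TensorProduct.assoc k S (SymmetricAlgebra k V) (G.obj V)).symm.injective.comp ?_
  exact Module.Flat.lTensor_preserves_injective_linearMap (M := S) (stι m h G V) (stι_injective m h G)

lemma rst_induction {motive : S ⊗[k] (symTensor m h G).obj V → Prop}
    (x : S ⊗[k] (symTensor m h G).obj V) (zero : motive 0)
    (mk : ∀ s p g, motive (s ⊗ₜ stMk m h G p g))
    (add : ∀ x y, motive x → motive y → motive (x + y)) : motive x := by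
  induction x using TensorProduct.induction_on with
  | zero => exact zero
  | add x y hx hy => exact add x y hx hy
  | tmul s y =>
    induction y using st_induction with
    | zero => rw [TensorProduct.tmul_zero]; exact zero
    | add x y hx hy => rw [TensorProduct.tmul_add]; exact add _ _ hx hy
    | mk p g => exact mk s p g

lemma rstι_one_tmul (x : (symTensor m h G).obj V) :
    rstι S m h G V (1 ⊗ₜ x) =
      coeffMap (Algebra.TensorProduct.includeRight : _ →ₐ[k] S ⊗[k] SymmetricAlgebra k V) _
        (stι m h G V x) := by
  induction x using st_induction with
  | zero => simp
  | add x y hx hy => simp only [map_add, TensorProduct.tmul_add, hx, hy]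
  | mk p g => rw [rstι_mk, stι_mk, coeffMap_tmul]; rfl

lemma rstι_smul (s : S) (x : S ⊗[k] (symTensor m h G).obj V) :
    rstι S m h G V (s • x) = (s ⊗ₜ[k] 1 : S ⊗[k] SymmetricAlgebra k V) • rstι S m h G V x := by
  induction x using rst_induction with
  | zero => simp
  | add x y hx hy => simp only [map_add, smul_add, hx, hy]
  | mk t p g =>
    rw [TensorProduct.smul_tmul', rstι_mk, rstι_mk, TensorProduct.smul_tmul']
    simp

/-- The canonical isomorphism `(S ⊗ Sym^m(V)) ⊗_S (S ⊗ G(V)) ≃ S ⊗ (Sym^m(V) ⊗ G(V))`. -/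
def stDistrib (S : Type u) [CommRing S] [Algebra k S] (V : FGModuleCat.{u} k) :
    (S ⊗[k] symSub k m V) ⊗[S] (S ⊗[k] G.obj V) ≃ₗ[S] S ⊗[k] (symTensor m h G).obj V :=
  (AlgebraTensorModule.distribBaseChange k S (symSub k m V) (G.obj V)).symm

lemma stDistrib_tmul (s t : S) (p : symSub k m V) (g : G.obj V) :
    stDistrib m h G S V ((s ⊗ₜ p) ⊗ₜ (t ⊗ₜ g)) = (s * t) ⊗ₜ stMk m h G p g :=
  AlgebraTensorModule.distribBaseChange_symm_tmul ..

lemma stDistrib_map (f : S ⊗[k] V →ₗ[S] S ⊗[k] W) (a : S ⊗[k] symSub k m V) (b : S ⊗[k] G.obj V) :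
    (symTensor m h G).map S f (stDistrib m h G S V (a ⊗ₜ b)) =
      stDistrib m h G S W (symMap m f a ⊗ₜ G.map S f b) := by
  change tensorMap (symMap m f) (G.map S f)
    ((AlgebraTensorModule.distribBaseChange k S (symSub k m V) (G.obj V)).symm (a ⊗ₜ b)) =
    (AlgebraTensorModule.distribBaseChange k S (symSub k m W) (G.obj W)).symm _
  rw [tensorMap, LinearMap.comp_apply, LinearMap.comp_apply]
  simp

lemma rstι_distrib (a : S ⊗[k] symSub k m V) (b : S ⊗[k] G.obj V) :
    rstι S m h G V (stDistrib m h G S V (a ⊗ₜ b)) =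
      symIncl S m V a • coeffMap Algebra.TensorProduct.includeLeft _ b := by
  have key (s : S) (p : symSub k m V) : rstι S m h G V (stDistrib m h G S V ((s ⊗ₜ p) ⊗ₜ b)) =
      symIncl S m V (s ⊗ₜ p) • coeffMap Algebra.TensorProduct.includeLeft _ b := by
    induction b using TensorProduct.induction_on with
    | zero => simp
    | add x y hx hy => simp only [map_add, TensorProduct.tmul_add, smul_add, hx, hy]
    | tmul t g =>
      rw [stDistrib_tmul, rstι_mk]
      simp [symIncl, TensorProduct.smul_tmul']
  induction a using TensorProduct.induction_on with
  | zero => simpa only [TensorProduct.zero_tmul] using key 0 0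
  | add x y hx hy => simp only [map_add, TensorProduct.add_tmul, add_smul, hx, hy]
  | tmul s p => exact key s p

/-- Elements are regarded as values of `G` with coefficients in `S ⊗ Sym(V)`: change the
coefficients along `symAlgK f`, then apply `G` to `f`. Naturality of maps between such functors
thereby becomes an identity between linear maps over `S ⊗ Sym(W)`. -/
lemma rstι_map (f : S ⊗[k] V →ₗ[S] S ⊗[k] W) (x : S ⊗[k] (symTensor m h G).obj V) :
    rstι S m h G W ((symTensor m h G).map S f x) =
      G.map (S ⊗[k] SymmetricAlgebra k W) (extend Algebra.TensorProduct.includeLeft f)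
        (coeffMap (symAlgK f) _ (rstι S m h G V x)) := by
  induction x using rst_induction with
  | zero => simp
  | add x y hx hy => simp only [map_add, hx, hy]
  | mk s p g =>
    rw [rstι_mk, coeffMap_tmul, ← mul_one s, ← stDistrib_tmul, stDistrib_map, rstι_distrib,
      symIncl_symMap, mul_one]
    have h3 : (symAlgK f (s ⊗ₜ p.1) ⊗ₜ[k] g : (S ⊗[k] SymmetricAlgebra k W) ⊗[k] G.obj V) =
        symAlgK f (s ⊗ₜ p.1) • coeffMap Algebra.TensorProduct.includeLeft _ ((1 : S) ⊗ₜ[k] g) := by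
      rw [coeffMap_tmul, map_one, TensorProduct.smul_tmul', smul_eq_mul, mul_one]
    rw [h3, _root_.map_smul, G.map_extend, extend_coeffMap]
    rfl

end StrictPoly

end SPF

namespace SPF

/-! ### Comultiplications `Sym^m ⊗ G → Sym^{m+j} ⊗ W_j G`, and unit and counit for `W_m` and `Sym^m
⊗ -`. -/

namespace StrictPoly

open Polynomial

variable {k : Type u} [Field k] {S T B : Type u} [CommRing S] [Algebra k S] [CommRing T]
  [Algebra k T] [CommRing B] [Algebra k B] {U V W : FGModuleCat.{u} k} {d e e' : ℕ}

lemma wtπ_sc {F : StrictPoly k d} (m : ℕ) (h : m + e = d) (r : S) (x : S ⊗[k] F.obj (plusObj V)) :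
    (F.wtπ V m h).baseChange S (F.map S (sc V r) x) = r ^ m • (F.wtπ V m h).baseChange S x := by
  refine F.wtι_injective m h ?_
  rw [_root_.map_smul, wtι_wtπ_apply, wtι_wtπ_apply, ← F.map_sc_wt, F.map_dg_wt]

lemma wtObj_map_wtπ {F : StrictPoly k d} (m : ℕ) (h : m + e = d) (f : S ⊗[k] V →ₗ[S] S ⊗[k] W)
    (x : S ⊗[k] F.obj (plusObj V)) :
    (wtObj m h F).map S f ((F.wtπ V m h).baseChange S x) =
      (F.wtπ W m h).baseChange S (F.map S (dg f 1) x) := by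
  refine F.wtι_injective m h ?_
  rw [wtι_map, wtι_wtπ_apply, wtι_wtπ_apply, F.map_dg_wt]

/-- The map `v ↦ (v, v)` from `V` to `V ⊕ k` over `Sym(V)`. -/
def symCol (V : FGModuleCat.{u} k) :
    SymmetricAlgebra k V ⊗[k] V →ₗ[SymmetricAlgebra k V] SymmetricAlgebra k V ⊗[k] plusObj V :=
  pair LinearMap.id (formMap (SymmetricAlgebra.ι k V))

lemma extend_symCol (φ : SymmetricAlgebra k V →ₐ[k] B) :
    extend φ (symCol V) = pair LinearMap.id (formMap (φ.toLinearMap ∘ₗ SymmetricAlgebra.ι k V)) := by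
  rw [symCol, extend_pair, extend_id, extend_formMap]

/-- The tautological linear form has degree one in `Sym(V)`, so the degree parameter of the
coefficients acts on the column as a scaling of the summand `k`. This converts weights into degrees.
-/
lemma extend_degHom_symCol (V : FGModuleCat.{u} k) :
    extend (degHom V) (symCol V) = sc V X ∘ₗ extend (cst k _) (symCol V) := by
  rw [extend_symCol, extend_symCol, dg_pair, LinearMap.id_comp, smul_formMap]
  congr 2
  refine LinearMap.ext fun v => ?_
  exact degHom_ι v

/-- `includeRight`, with values in `S ⊗ Sym(V)`. -/
abbrev symR (S : Type u) [CommRing S] [Algebra k S] (V : FGModuleCat.{u} k) :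
    SymmetricAlgebra k V →ₐ[k] S ⊗[k] SymmetricAlgebra k V := Algebra.TensorProduct.includeRight

/-- `includeLeft`, with values in `S ⊗ Sym(V)`. -/
abbrev symL (S : Type u) [CommRing S] [Algebra k S] (V : FGModuleCat.{u} k) :
    S →ₐ[k] S ⊗[k] SymmetricAlgebra k V := Algebra.TensorProduct.includeLeft

/-- Both composites are `v ↦ (f v, f v)`, the second entry being read in `S ⊗ Sym(W)`. -/
lemma symCol_naturality (f : S ⊗[k] V →ₗ[S] S ⊗[k] W) :
    extend (symR S W) (symCol W) ∘ₗ extend (symL S W) f =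
      dg (extend (symL S W) f) 1 ∘ₗ extend (symAlgK f) (extend (symR S V) (symCol V)) := by
  rw [extend_extend, extend_symCol, extend_symCol, dg_pair, pair_comp, LinearMap.comp_id, one_smul,
    LinearMap.id_comp]
  congr 1
  refine ext_one fun v => ?_
  have h1 : (1 ⊗ₜ v : (S ⊗[k] SymmetricAlgebra k W) ⊗[k] V) = coeffMap (symL S W) _ (1 ⊗ₜ v) := by
    rw [coeffMap_tmul, map_one]
  rw [LinearMap.comp_apply, formMap_one_tmul, h1, extend_coeffMap, formMap_eq]
  congr 1
  change _ = symAlg f (1 ⊗ₜ SymmetricAlgebra.ι k V v)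
  rw [symAlg_tmul_ι]
  generalize f (1 ⊗ₜ v) = y
  induction y using TensorProduct.induction_on with
  | zero => simp
  | add x y hx hy => simp only [map_add, hx, hy]
  | tmul s w => simp [evalForm]

section comul

variable {m m' j : ℕ} (h : m + e = d) (h' : m' + e' = d) (hj : j + e' = e) (G : StrictPoly k e)

/-- The components of `comul`. -/
def comulApp (V : FGModuleCat.{u} k) :
    (symTensor m h G).obj V →ₗ[k] (symTensor m' h' (wtObj j hj G)).obj V :=
  stπ m' h' (wtObj j hj G) V ∘ₗ
    ((G.wtπ V j hj).baseChange (SymmetricAlgebra k V)).restrictScalars k ∘ₗ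
    (G.map (SymmetricAlgebra k V) (symCol V)).restrictScalars k ∘ₗ stι m h G V

variable (hm : m + j = m')

include hm in
-- The degree `m` of the coefficients and the weight `j` add up: the element on the right is
-- homogeneous of degree `m + j`, and the projection to `Sym^{m'}` discards nothing.
lemma stι_comulApp (x : (symTensor m h G).obj V) :
    stι m' h' (wtObj j hj G) V (comulApp h h' hj G V x) =
      (G.wtπ V j hj).baseChange (SymmetricAlgebra k V)
        (G.map (SymmetricAlgebra k V) (symCol V) (stι m h G V x)) := by
  refine stι_stπ_of_homogeneous m' h' _ _ ?_
  change coeffMap (degHom V) _ ((G.wtπ V j hj).baseChange _ (G.map _ (symCol V) (stι m h G V x))) =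
    _ • coeffMap (cst k _) _ ((G.wtπ V j hj).baseChange _ (G.map _ (symCol V) (stι m h G V x)))
  rw [← baseChange_coeffMap, ← baseChange_coeffMap, ← G.map_coeffMap, ← G.map_coeffMap,
    extend_degHom_symCol, ← G.map_map, wtπ_sc, degHom_stι, _root_.map_smul, _root_.map_smul,
    smul_smul, ← pow_add, ← hm, add_comm]

include hm in
lemma rstι_comulApp (x : S ⊗[k] (symTensor m h G).obj V) :
    rstι S m' h' (wtObj j hj G) V ((comulApp h h' hj G V).baseChange S x) =
      (G.wtπ V j hj).baseChange _
        (G.map (S ⊗[k] SymmetricAlgebra k V) (extend (symR S V) (symCol V))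
          (rstι S m h G V x)) := by
  induction x using TensorProduct.induction_on with
  | zero => simp
  | add x y hx hy => simp only [map_add, hx, hy]
  | tmul s x =>
    have : (s ⊗ₜ x : S ⊗[k] (symTensor m h G).obj V) = s • (1 ⊗ₜ x) := by
      simp [TensorProduct.smul_tmul']
    rw [this, _root_.map_smul, rstι_smul, rstι_smul, _root_.map_smul, _root_.map_smul,
      LinearMap.baseChange_tmul, rstι_one_tmul, rstι_one_tmul, G.map_coeffMap, baseChange_coeffMap,
      stι_comulApp h h' hj G hm]

/-- The comultiplication `Sym^m ⊗ G → Sym^{m + j} ⊗ W_j G`. -/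
def comul : symTensor m h G ⟶ symTensor m' h' (wtObj j hj G) :=
  mkHom (comulApp h h' hj G) fun S _ _ V W f => LinearMap.ext fun x =>
    rstι_injective m' h' (wtObj j hj G) <| by
      rw [LinearMap.comp_apply, LinearMap.comp_apply, rstι_map, rstι_comulApp h h' hj G hm,
        rstι_comulApp h h' hj G hm, rstι_map, G.map_map, ← baseChange_coeffMap, wtObj_map_wtπ,
        ← G.map_coeffMap, G.map_map, symCol_naturality]

lemma stι_comul (x : (symTensor m h G).obj V) :
    stι m' h' (wtObj j hj G) V (app (comul h h' hj G hm) V x) =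
      (G.wtπ V j hj).baseChange (SymmetricAlgebra k V)
        (G.map (SymmetricAlgebra k V) (symCol V) (stι m h G V x)) :=
  stι_comulApp h h' hj G hm x

end comul

section Functor

/-- The components of the morphism `Sym^m ⊗ G → Sym^m ⊗ G'` induced by a morphism `G → G'`. -/
def stMap (m : ℕ) (h : m + e = d) {G G' : StrictPoly k e} (φ : G ⟶ G') (V : FGModuleCat.{u} k) :
    (symTensor m h G).obj V →ₗ[k] (symTensor m h G').obj V :=
  (app φ V).lTensor (symSub k m V)

lemma rstι_stMap (m : ℕ) (h : m + e = d) {G G' : StrictPoly k e} (φ : G ⟶ G')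
    (x : S ⊗[k] (symTensor m h G).obj V) :
    rstι S m h G' V ((stMap m h φ V).baseChange S x) =
      (app φ V).baseChange _ (rstι S m h G V x) := by
  induction x using rst_induction with
  | zero => simp
  | add x y hx hy => simp only [map_add, hx, hy]
  | mk s p g => rfl

/-- The morphism `Sym^m ⊗ G → Sym^m ⊗ G'` induced by a morphism `G → G'`. -/
def symTensorMap (m : ℕ) (h : m + e = d) {G G' : StrictPoly k e} (φ : G ⟶ G') :
    symTensor m h G ⟶ symTensor m h G' :=
  mkHom (stMap m h φ) fun S _ _ V W f => LinearMap.ext fun x => rstι_injective m h G' <| by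
    rw [LinearMap.comp_apply, LinearMap.comp_apply, rstι_stMap, rstι_map, rstι_map, rstι_stMap,
      ← baseChange_coeffMap]
    exact LinearMap.congr_fun (naturality φ _ _) _

/-- The functor `G ↦ Sym^m ⊗ G`. -/
def symTensorFunctor (m : ℕ) (h : m + e = d) : StrictPoly k e ⥤ StrictPoly k d where
  obj G := symTensor m h G
  map φ := symTensorMap m h φ
  map_id _ := hom_ext fun _ => LinearMap.lTensor_id _ _
  map_comp _ _ := hom_ext fun _ => LinearMap.lTensor_comp _ _ _

instance (m : ℕ) (h : m + e = d) : (symTensorFunctor (k := k) m h).Additive where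
  map_add := hom_ext fun _ => LinearMap.lTensor_add _ _ _

lemma stι_symTensorMap (m : ℕ) (h : m + e = d) {G G' : StrictPoly k e} (φ : G ⟶ G')
    (x : (symTensor m h G).obj V) :
    stι m h G' V (app (symTensorMap m h φ) V x) =
      (app φ V).baseChange _ (stι m h G V x) := by
  change stι m h G' V (stMap m h φ V x) = _
  induction x using st_induction with
  | zero => simp
  | add x y hx hy => simp only [map_add, hx, hy]
  | mk p g => rfl

/-- The canonical morphism `F → Sym^0 ⊗ F`. -/
def toSymZero (F : StrictPoly k d) : F ⟶ symTensor 0 (Nat.zero_add d) F :=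
  mkHom (F := F) (G := symTensor 0 (Nat.zero_add d) F)
    (fun V => stπ 0 (Nat.zero_add d) F V ∘ₗ TensorProduct.mk k _ _ 1)
    (fun S _ _ V W f => LinearMap.ext fun x => rstι_injective 0 (Nat.zero_add d) F <| by
      have key (V : FGModuleCat.{u} k) (x : S ⊗[k] F.obj V) :
          rstι S 0 (Nat.zero_add d) F V ((stπ 0 (Nat.zero_add d) F V ∘ₗ
            TensorProduct.mk k _ _ 1).baseChange S x) = coeffMap (symL S V) _ x := by
        induction x using TensorProduct.induction_on with
        | zero => simp
        | add x y hx hy => simp only [map_add, hx, hy]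
        | tmul s g =>
          rw [LinearMap.baseChange_tmul, LinearMap.comp_apply, TensorProduct.mk_apply, stπ_tmul,
            rstι_mk, coe_symProj, map_one, coeff_one_zero]
          simp
      rw [LinearMap.comp_apply, LinearMap.comp_apply, key, rstι_map, key, ← F.map_coeffMap,
        coeffMap_comp]
      have hc : (symAlgK f).comp (symL S V) = symL S W := AlgHom.ext fun s => symAlgK_tmul_one f s
      rw [hc])

lemma stι_toSymZero {F : StrictPoly k d} (x : F.obj V) :
    stι 0 (Nat.zero_add d) F V (app (toSymZero F) V x) = 1 ⊗ₜ x := by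
  change stι 0 (Nat.zero_add d) F V (stπ 0 (Nat.zero_add d) F V (1 ⊗ₜ x)) = _
  rw [stπ_tmul, stι_mk, coe_symProj, map_one, coeff_one_zero]

lemma toSymZero_bijective (F : StrictPoly k d) (V : FGModuleCat.{u} k) :
    Function.Bijective (app (toSymZero F) V) := by
  refine ⟨fun x y h => ?_, fun x => ?_⟩
  · have h1 := congrArg (coeffMap (SymmetricAlgebra.algebraMapInv (R := k) (M := V)) _)
      (congrArg (stι 0 (Nat.zero_add d) F V) h)
    rw [stι_toSymZero, stι_toSymZero, coeffMap_tmul, coeffMap_tmul, map_one] at h1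
    exact tmul_injective h1
  · induction x using st_induction with
    | zero => exact ⟨0, map_zero _⟩
    | add x y hx hy =>
      obtain ⟨a, rfl⟩ := hx
      obtain ⟨b, rfl⟩ := hy
      exact ⟨a + b, map_add _ _ _⟩
    | mk p g =>
      have hp : p.1 ∈ (1 : Submodule k (SymmetricAlgebra k V)) :=
        (pow_zero (LinearMap.range (SymmetricAlgebra.ι k V))).le p.2
      rw [Submodule.mem_one] at hp
      obtain ⟨c, hc⟩ := hp
      refine ⟨c • g, stι_injective 0 (Nat.zero_add d) F ?_⟩
      rw [stι_toSymZero, stι_mk, ← hc, Algebra.algebraMap_eq_smul_one, TensorProduct.smul_tmul]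

variable (m : ℕ) (h : m + e = d)

/-- The canonical morphism `F → Sym^m ⊗ W_m F`. -/
def symUnit (F : StrictPoly k d) : F ⟶ symTensor m h (wtObj m h F) :=
  toSymZero F ≫ comul (Nat.zero_add d) h h F (Nat.zero_add m)

lemma stι_symUnit {F : StrictPoly k d} (x : F.obj V) :
    stι m h (wtObj m h F) V (app (symUnit m h F) V x) =
      (F.wtπ V m h).baseChange (SymmetricAlgebra k V)
        (F.map (SymmetricAlgebra k V) (symCol V) (1 ⊗ₜ x)) := by
  rw [symUnit, app_comp, LinearMap.comp_apply, stι_comul, stι_toSymZero]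

/-- The morphism `W_m F → W_m G` induced by a morphism `F → G`. -/
def wtMap {F G : StrictPoly k d} (φ : F ⟶ G) : wtObj m h F ⟶ wtObj m h G := (wtFunctor m h).map φ

lemma wtι_wtMap {F G : StrictPoly k d} (φ : F ⟶ G) (x : (wtObj m h F).obj V) :
    G.wtι V m h (app (wtMap m h φ) V x) = app φ (plusObj V) (F.wtι V m h x) :=
  wtι_wtFunctor_map F m h φ x

lemma symUnit_naturality {F G : StrictPoly k d} (φ : F ⟶ G) :
    symUnit m h F ≫ symTensorMap m h (wtMap m h φ) = φ ≫ symUnit m h G := by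
  refine hom_ext fun V => LinearMap.ext fun x => stι_injective m h _ ?_
  rw [app_comp, app_comp, LinearMap.comp_apply, LinearMap.comp_apply, stι_symTensorMap,
    stι_symUnit, stι_symUnit]
  have h1 := LinearMap.congr_fun (naturality φ (SymmetricAlgebra k V) (symCol V)) (1 ⊗ₜ x)
  rw [LinearMap.comp_apply, LinearMap.comp_apply, LinearMap.baseChange_tmul] at h1
  rw [← h1]
  refine G.wtι_injective m h ?_
  generalize F.map (SymmetricAlgebra k V) (symCol V) (1 ⊗ₜ x) = y
  induction y using TensorProduct.induction_on with
  | zero => simp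
  | add x y hx hy => simp only [map_add, hx, hy]
  | tmul a z =>
    simp only [LinearMap.baseChange_tmul]
    congr 1
    rw [wtι_wtMap, wtι_wtπ, wtι_wtπ, app_wt_apply]

variable (G : StrictPoly k e)

/-- The projection of `V ⊕ k` to `k`, as a linear form. -/
def sndK (V : FGModuleCat.{u} k) : plusObj V →ₗ[k] k := LinearMap.snd k V k

/-- The homomorphism `Sym(V ⊕ k) → k` given by the projection to `k`. -/
def augK (V : FGModuleCat.{u} k) : SymmetricAlgebra k (plusObj V) →ₐ[k] k :=
  SymmetricAlgebra.lift (sndK V)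

/-- The map `Sym^m(V ⊕ k) ⊗ G(V ⊕ k) → G(V)` given by the projections of `V ⊕ k`. -/
def symCounitAux (V : FGModuleCat.{u} k) : (symTensor m h G).obj (plusObj V) →ₗ[k] G.obj V :=
  G.lin (prV V) ∘ₗ (TensorProduct.lid k _).toLinearMap ∘ₗ coeffMap (augK V) _ ∘ₗ
    stι m h G (plusObj V)

/-- The homomorphism `S ⊗ Sym(V ⊕ k) → S` given by the projection to `k`. -/
def augS (S : Type u) [CommRing S] [Algebra k S] (V : FGModuleCat.{u} k) :
    S ⊗[k] SymmetricAlgebra k (plusObj V) →ₐ[k] S :=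
  symPt (AlgHom.id k S) ((Algebra.linearMap k S) ∘ₗ sndK V)

lemma symCounitAux_baseChange (x : S ⊗[k] (symTensor m h G).obj (plusObj V)) :
    (symCounitAux m h G V).baseChange S x =
      G.map S (rprV V S) (coeffMap (augS S V) _ (rstι S m h G (plusObj V) x)) := by
  rw [rprV, map_baseChange]
  induction x using rst_induction with
  | zero => simp
  | add x y hx hy => simp only [map_add, hx, hy]
  | mk s p g =>
    have h1 : SymmetricAlgebra.lift ((Algebra.linearMap k S) ∘ₗ sndK V) =
        (Algebra.ofId k S).comp (augK V) :=
      SymmetricAlgebra.algHom_ext (LinearMap.ext fun v => by simp [augK, Algebra.ofId_apply])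
    rw [rstι_mk, coeffMap_tmul, augS, symPt_tmul, LinearMap.baseChange_tmul,
      LinearMap.baseChange_tmul]
    change s ⊗ₜ G.lin (prV V) (TensorProduct.lid k _ (coeffMap (augK V) _ (p.1 ⊗ₜ g))) = _
    rw [coeffMap_tmul, TensorProduct.lid_tmul, _root_.map_smul, ← TensorProduct.smul_tmul]
    congr 1
    have h2 := DFunLike.congr_fun h1 p.1
    refine Eq.trans ?_ (congrArg (fun q => s * q) h2).symm
    rw [AlgHom.comp_apply, Algebra.ofId_apply, Algebra.smul_def, mul_comm]

lemma symCounitAux_map (f : S ⊗[k] U →ₗ[S] S ⊗[k] plusObj W)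
    (x : S ⊗[k] (symTensor m h G).obj U) :
    (symCounitAux m h G W).baseChange S ((symTensor m h G).map S f x) =
      G.map S (rprV W S ∘ₗ f) (coeffMap ((augS S W).comp (symAlgK f)) _
        (rstι S m h G U x)) := by
  rw [symCounitAux_baseChange, rstι_map, ← G.map_coeffMap, extend_extend, augS,
    symPt_comp_includeLeft, coeffMap_comp, G.map_map]
  congr 3
  have : extend (AlgHom.id k S) f = f := (eq_extend _ _ _ fun m => by rw [coeffMap_id]).symm
  rw [this]

end Functor

end StrictPoly

end SPF

namespace SPF

open Polynomial

section

variable {k : Type u} [Field k] {S T B : Type u} [CommRing S] [Algebra k S] [CommRing T]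
  [Algebra k T] [CommRing B] [Algebra k B] {U V W : FGModuleCat.{u} k}

lemma cf_extend_cst {M N : Type u} [AddCommGroup M] [Module k M] [AddCommGroup N] [Module k N]
    (f : S ⊗[k] M →ₗ[S] S ⊗[k] N) (n : ℕ) (y : S[X] ⊗[k] M) :
    cf S N n (extend (cst k S) f y) = f (cf S M n y) := by
  obtain ⟨N₀, h⟩ := exists_eq_sum_cf y
  conv_lhs => rw [h (max N₀ (n + 1)) (le_max_left _ _), map_sum]
  simp only [_root_.map_smul, extend_coeffMap]
  exact cf_sum _ _ (lt_of_lt_of_le (Nat.lt_succ_self n) (le_max_right _ _)) _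

/-- The canonical isomorphism `S ⊗ k → S`. -/
def valK (S : Type u) [CommRing S] [Algebra k S] : S ⊗[k] unitObj k →ₗ[S] S :=
  LinearMap.liftBaseChange S (Algebra.linearMap k S)

lemma valK_tmul_oneU (s : S) : valK S (s ⊗ₜ[k] oneU k) = s := by
  have h1 : valK S (s ⊗ₜ[k] oneU k) = s • algebraMap k S 1 := rfl
  rw [h1, map_one, smul_eq_mul, mul_one]

lemma valK_formMap (l : V →ₗ[k] B) (x : B ⊗[k] V) : valK B (formMap l x) = evalForm l x := by
  rw [formMap_eq, valK_tmul_oneU]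

variable (S) in
/-- The projection of `V ⊕ k` to `k`, with values in `S`. -/
def sndS (V : FGModuleCat.{u} k) : plusObj V →ₗ[k] S := Algebra.linearMap k S ∘ₗ StrictPoly.sndK V

lemma prK_eq (v : plusObj V) : prK V v = StrictPoly.sndK V v • oneU k :=
  (mul_one (StrictPoly.sndK V v)).symm

lemma formMap_sndS : formMap (sndS S V) = rprK V S :=
  ext_one fun v => by
    rw [formMap_one_tmul, rprK, LinearMap.baseChange_tmul, prK_eq, ← TensorProduct.smul_tmul,
      Algebra.smul_def, mul_one]
    rfl

lemma valK_rprK (x : S ⊗[k] plusObj V) : valK S (rprK V S x) = evalForm (sndS S V) x := by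
  rw [← formMap_sndS, valK_formMap]

lemma evalForm_one_tmul (l : V →ₗ[k] B) (v : V) : evalForm l (1 ⊗ₜ v) = l v := by simp [evalForm]

lemma evalForm_sndS_dg (f : S ⊗[k] V →ₗ[S] S ⊗[k] W) (r : S) (x : S ⊗[k] plusObj V) :
    evalForm (sndS S W) (dg f r x) = r * evalForm (sndS S V) x := by
  have h := LinearMap.congr_fun (rprK_dg f r) x
  rw [LinearMap.comp_apply, LinearMap.smul_apply] at h
  rw [← valK_rprK, h, _root_.map_smul, valK_rprK, smul_eq_mul]

lemma sc_zero (V : FGModuleCat.{u} k) : sc V (0 : S) = rinV V S ∘ₗ rprV V S := by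
  rw [sc, dg, pair, zero_smul, LinearMap.comp_zero, add_zero, LinearMap.id_comp]

lemma sc_rinV (r : S) : sc V r ∘ₗ rinV V S = rinV V S := by
  refine pair_ext ?_ ?_
  · rw [← LinearMap.comp_assoc, rprV_dg, LinearMap.id_comp]
  · rw [← LinearMap.comp_assoc, rprK_dg, LinearMap.smul_comp, rprK_rinV, smul_zero]

lemma rprV_sc (r : S) : rprV V S ∘ₗ sc V r = rprV V S := by
  rw [rprV_dg, LinearMap.id_comp]

lemma pair_rprV_rprK : pair (rprV V S) (rprK V S) = LinearMap.id :=
  pair_ext (by simp) (by simp)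

lemma sc_tmul (r b : S) (v : plusObj V) :
    sc V r (b ⊗ₜ v) = b ⊗ₜ inV V (prV V v) + (r * b) ⊗ₜ inK V (prK V v) := by
  have : sc V r (b ⊗ₜ v) = rinV V S (rprV V S (b ⊗ₜ v)) + rinK V S (r • rprK V S (b ⊗ₜ v)) := rfl
  rw [this, rprV, rprK, LinearMap.baseChange_tmul, LinearMap.baseChange_tmul, rinV, rinK,
    LinearMap.baseChange_tmul, TensorProduct.smul_tmul', LinearMap.baseChange_tmul, smul_eq_mul]

end

namespace StrictPoly

variable {k : Type u} [Field k] {S T B : Type u} [CommRing S] [Algebra k S] [CommRing T]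
  [Algebra k T] [CommRing B] [Algebra k B] {U V W : FGModuleCat.{u} k} {d e e' : ℕ}

/-! ### The counit and the triangle identity. -/

section Counit

variable (m : ℕ) (h : m + e = d) (G : StrictPoly k e)

lemma augS_comp_symAlgK_dg (f : S ⊗[k] V →ₗ[S] S ⊗[k] W) :
    (augS S W).comp (symAlgK (dg f 1)) = augS S V := by
  rw [augS, symPt_comp_symAlgK, augS]
  congr 1
  refine LinearMap.ext fun v => ?_
  change evalForm (sndS S W) (extend (AlgHom.id k S) (dg f 1) (1 ⊗ₜ v)) = sndS S V v
  rw [extend_dg, evalForm_sndS_dg, map_one, one_mul, evalForm_one_tmul]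

/-- The morphism `W_m (Sym^m ⊗ G) → G`. -/
def symCounit : wtObj m h (symTensor m h G) ⟶ G :=
  mkHom (fun V => symCounitAux m h G V ∘ₗ (symTensor m h G).wtι V m h)
    fun S _ _ V W f => LinearMap.ext fun x => by
      simp only [LinearMap.baseChange_comp, LinearMap.comp_apply]
      rw [wtι_map, symCounitAux_map, augS_comp_symAlgK_dg, rprV_dg, symCounitAux_baseChange, G.map_map]

lemma mapAlgHom_comp_cst {R R' : Type u} [CommRing R] [Algebra k R] [CommRing R'] [Algebra k R']
    (f : R →ₐ[k] R') : (Polynomial.mapAlgHom f).comp (cst k R) = (cst k R').comp f :=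
  AlgHom.ext fun a => by simp

lemma augS_comp_symAlgK_sc : ((augS k[X] V).comp (symAlgK (sc V X))).comp (symR k[X] (plusObj V)) =
    (Polynomial.mapAlgHom (augK V)).comp (degHom (plusObj V)) := by
  rw [augS, symPt_comp_symAlgK, symPt_comp_includeRight]
  refine SymmetricAlgebra.algHom_ext (LinearMap.ext fun v => ?_)
  change SymmetricAlgebra.lift _ (SymmetricAlgebra.ι k _ v) =
    Polynomial.mapAlgHom (augK V) (degHom (plusObj V) (SymmetricAlgebra.ι k _ v))
  rw [SymmetricAlgebra.lift_ι_apply, degHom_ι]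
  change evalForm (sndS k[X] V) (extend (AlgHom.id k k[X]) (dg LinearMap.id X) (1 ⊗ₜ v)) = _
  rw [extend_dg, extend_id, evalForm_sndS_dg, evalForm_one_tmul]
  simp [augK, sndS]

/-- The counit projects `V ⊕ k` to `V` inside `G` and to `k` inside `Sym^m`. A scaling of `k` is
invisible to the former and contributes the `m`-th power to the latter, so only the part of weight
`m` has a nonzero image. -/
lemma symCounitAux_wt (x : (symTensor m h G).obj (plusObj V)) :
    symCounitAux m h G V ((symTensor m h G).wt V m x) = symCounitAux m h G V x := by
  refine tmul_injective (k := k) ?_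
  change (1 : k) ⊗ₜ[k] _ = (1 : k) ⊗ₜ[k] _
  rw [← LinearMap.baseChange_tmul, ← LinearMap.baseChange_tmul, wt_baseChange, cf_baseChange,
    symCounitAux_map, rprV_sc, coeffMap_tmul, map_one, rstι_one_tmul, coeffMap_comp,
    augS_comp_symAlgK_sc, ← coeffMap_comp, degHom_stι, coeffMap_smul, _root_.map_smul, coeffMap_comp,
    mapAlgHom_comp_cst, ← coeffMap_comp, ← extend_rprV (cst k k), G.map_coeffMap, map_pow]
  rw [show Polynomial.mapAlgHom (augK V) X = (X : k[X]) by simp, cf_X_pow_smul, if_pos rfl,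
    rprV, map_baseChange]
  have h1 (y : k ⊗[k] G.obj (plusObj V)) : y = 1 ⊗ₜ TensorProduct.lid k _ y :=
    (TensorProduct.lid k _).injective (by simp)
  exact (congrArg _ (h1 _)).trans (LinearMap.baseChange_tmul ..)

/-- The column `v ↦ (v, v)` followed by the projection to `V` is the identity, and followed by the
projection to `k` it is the tautological form, which leaves the elements of `Sym(V)` unchanged. This
half of the adjunction is what the preservation of injectives needs. -/
lemma symTriangle :
    symUnit m h (symTensor m h G) ≫ symTensorMap m h (symCounit m h G) = 𝟙 _ := by
  refine hom_ext fun V => LinearMap.ext fun x => stι_injective m h _ ?_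
  rw [app_comp, LinearMap.comp_apply, stι_symTensorMap, stι_symUnit, symCounit, app_mkHom,
    LinearMap.baseChange_comp, LinearMap.comp_apply, wtι_wtπ_apply, app_id, LinearMap.id_apply]
  have h1 : symCounitAux m h G V ∘ₗ (symTensor m h G).wt V m = symCounitAux m h G V :=
    LinearMap.ext fun x => symCounitAux_wt m h G x
  rw [← LinearMap.comp_apply, ← LinearMap.baseChange_comp, h1, symCounitAux_map, rstι_one_tmul,
    coeffMap_comp, symCol, rprV_pair, G.map_id_apply]
  -- On generators: the `k`-component of the column at `v` is `v` itself in `Sym(V)`.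
  have h2 : ((augS (SymmetricAlgebra k V) V).comp (symAlgK (symCol V))).comp
      (symR (SymmetricAlgebra k V) V) = AlgHom.id k _ := by
    rw [augS, symPt_comp_symAlgK, symPt_comp_includeRight]
    refine SymmetricAlgebra.algHom_ext (LinearMap.ext fun v => ?_)
    change SymmetricAlgebra.lift _ (SymmetricAlgebra.ι k _ v) = SymmetricAlgebra.ι k _ v
    rw [SymmetricAlgebra.lift_ι_apply]
    change evalForm (sndS _ V) (extend (AlgHom.id k _) (symCol V) (1 ⊗ₜ v)) = _
    have h3 := LinearMap.congr_fun (rprK_pair LinearMap.id (formMap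
      ((AlgHom.id k (SymmetricAlgebra k V)).toLinearMap ∘ₗ SymmetricAlgebra.ι k V))) (1 ⊗ₜ v)
    rw [LinearMap.comp_apply] at h3
    rw [extend_symCol, ← valK_rprK, h3, formMap_one_tmul, valK_tmul_oneU]
    rfl
  exact (congrArg (fun q => coeffMap q _ _) h2).trans (coeffMap_id _)

end Counit

/-! ### Duplication of the summand `k`, and bounds on the weights. -/

section Weights

variable (F : StrictPoly k d)

/-- The map `(v, t) ↦ ((v, t), t)`. -/
def dup (S : Type u) [CommRing S] [Algebra k S] (V : FGModuleCat.{u} k) :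
    S ⊗[k] plusObj V →ₗ[S] S ⊗[k] plusObj (plusObj V) := pair LinearMap.id (rprK V S)

lemma extend_dup (φ : S →ₐ[k] T) : extend φ (dup S V) = dup T V := by
  rw [dup, extend_pair, extend_id, extend_rprK]; rfl

lemma dg_sc_dup (r : S) : dg (sc V r) r ∘ₗ dup S V = dup S V ∘ₗ sc V r := by
  rw [dup, dg_pair, pair_comp, LinearMap.comp_id, LinearMap.id_comp, rprK_dg]

lemma dg_sc_zero_dup : dg (sc V (0 : S)) 1 ∘ₗ dup S V = dg (rinV V S) 1 := by
  rw [dup, dg_pair, LinearMap.comp_id, sc_zero]; rfl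

lemma map_sc_wt' {n : ℕ} {y : S ⊗[k] F.obj (plusObj V)} (hy : (F.wt V n).baseChange S y = y) (r : S) :
    F.map S (sc V r) y = r ^ n • y := by
  rw [← hy, map_sc_wt]

lemma wt_coeffMap (φ : S →ₐ[k] T) {n : ℕ} {y : S ⊗[k] F.obj (plusObj V)}
    (hy : (F.wt V n).baseChange S y = y) :
    (F.wt V n).baseChange T (coeffMap φ _ y) = coeffMap φ _ y := by
  rw [baseChange_coeffMap, hy]

/-- Duplication intertwines the scaling of `k` with the simultaneous scaling of both copies of `k`,
so the total weight stays `i`. On the part of outer weight `j` the inner scaling must account for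
the rest, `i - j`. -/
lemma wt_dup_aux {i j : ℕ} {y : S ⊗[k] F.obj (plusObj V)} (hy : (F.wt V i).baseChange S y = y) :
    (X ^ j : S[X]) • F.map S[X] (dg (sc V X) 1)
      (coeffMap (cst k S) _ ((F.wt (plusObj V) j).baseChange S (F.map S (dup S V) y))) =
    (X ^ i : S[X]) • coeffMap (cst k S) _ ((F.wt (plusObj V) j).baseChange S (F.map S (dup S V) y)) := by
  have h1 : F.map S[X] (dg (sc V X) X) (coeffMap (cst k S) _ (F.map S (dup S V) y)) =
      (X ^ i : S[X]) • coeffMap (cst k S) _ (F.map S (dup S V) y) := by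
    rw [← F.map_coeffMap, extend_dup, F.map_map, dg_sc_dup, ← F.map_map,
      F.map_sc_wt' (F.wt_coeffMap _ hy), _root_.map_smul]
  have h2 : dg (sc V (X : S[X])) X = dg (sc V X) 1 ∘ₗ sc (plusObj V) X := by
    rw [dg_comp, LinearMap.comp_id, one_mul]
  have h3 := congrArg ((F.wt (plusObj V) j).baseChange S[X]) h1
  rw [h2, ← F.map_map, ← F.map_dg_wt, ← F.map_dg_wt, F.map_sc_wt, _root_.map_smul, _root_.map_smul,
    baseChange_coeffMap] at h3
  exact h3

/-- The outer weight cannot exceed the total weight. -/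
lemma wt_dup_of_lt {i j : ℕ} (hij : i < j) {y : S ⊗[k] F.obj (plusObj V)}
    (hy : (F.wt V i).baseChange S y = y) :
    (F.wt (plusObj V) j).baseChange S (F.map S (dup S V) y) = 0 := by
  have h := congrArg (cf S _ i) (F.wt_dup_aux (j := j) hy)
  rw [cf_zero_of_X_pow hij, cf_X_pow_smul, if_pos rfl] at h
  exact h.symm

/-- When the outer copy carries the whole weight, the inner weight is zero. The inner scaling then
acts trivially and may be specialized to `0`, which erases the inner copy. -/
lemma wt_dup_self {i : ℕ} {y : S ⊗[k] F.obj (plusObj V)}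
    (hy : (F.wt V i).baseChange S y = y) :
    (F.wt (plusObj V) i).baseChange S (F.map S (dup S V) y) = F.map S (dg (rinV V S) 1) y := by
  have h1 := X_pow_smul_injective (k := k) (S := S) i (F.wt_dup_aux (j := i) hy)
  let ev : S[X] →ₐ[k] S := (Polynomial.aeval (R := S) (0 : S)).restrictScalars k
  have h3 := congrArg (coeffMap ev _) h1
  have e1 : ev.comp (cst k S) = AlgHom.id k S := AlgHom.ext fun a => by simp [ev]
  have e2 : ev X = 0 := by simp [ev]
  rw [← F.map_coeffMap, extend_dg, extend_sc, coeffMap_comp, e1, coeffMap_id, e2, map_one,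
    F.map_dg_wt, F.map_map, dg_sc_zero_dup, ← F.map_dg_wt, hy] at h3
  exact h3.symm

lemma wt_map_rinV {n : ℕ} (hn : n ≠ 0) (z : S ⊗[k] F.obj V) :
    (F.wt V n).baseChange S (F.map S (rinV V S) z) = 0 := by
  rw [wt_baseChange, ← F.map_coeffMap, extend_rinV, F.map_map, sc_rinV, ← extend_rinV (cst k S),
    F.map_coeffMap, ← one_smul S[X] (coeffMap _ _ _), ← pow_zero X, cf_X_pow_smul, if_neg hn]

/-- An element of weight zero is fixed by all scalings, in particular by the scaling by `0`, which
is the projection to `V`. -/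
lemma map_eq_of_wt_zero {y : S ⊗[k] F.obj (plusObj V)} (hy : ∀ l, l ≠ 0 → (F.wt V l).baseChange S y = 0) :
    F.map S (rinV V S ∘ₗ rprV V S) y = y := by
  have h0 : (F.wt V 0).baseChange S y = y := by
    conv_rhs => rw [← F.sum_wt y]
    rw [Finset.sum_eq_single 0 (fun b _ hb => hy b hb) (fun h => absurd (by simp) h)]
  rw [← sc_zero, F.map_sc_wt' h0, pow_zero, one_smul]

/-- All weights of the functor are at most `m`. -/
def ExpLE (m : ℕ) : Prop := ∀ (V : FGModuleCat.{u} k) (n : ℕ), m < n → F.wt V n = 0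

variable {F}

lemma ExpLE.mono {m n : ℕ} (h : F.ExpLE m) (hmn : m ≤ n) : F.ExpLE n :=
  fun V l hl => h V l (lt_of_le_of_lt hmn hl)

lemma expLE_self : F.ExpLE d := fun _ _ hn => LinearMap.ext fun z => F.wt_eq_zero hn z

lemma ExpLE.sum_wt {t : ℕ} (h : F.ExpLE t) (y : S ⊗[k] F.obj (plusObj V)) :
    ∑ n ∈ Finset.range (t + 1), (F.wt V n).baseChange S y = y := by
  conv_rhs => rw [← F.sum_wt y]
  have h0 : ∀ n, t < n → (F.wt V n).baseChange S y = 0 := fun n hn => by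
    rw [h V n hn, LinearMap.baseChange_zero, LinearMap.zero_apply]
  have h1 : ∀ N, t ≤ N → ∑ n ∈ Finset.range (t + 1), (F.wt V n).baseChange S y =
      ∑ n ∈ Finset.range (N + 1), (F.wt V n).baseChange S y := fun N hN =>
    Finset.sum_subset (Finset.range_subset_range.2 (by omega)) fun n _ hn => h0 n (by simpa using hn)
  have h2 : ∑ n ∈ Finset.range (d + 1), (F.wt V n).baseChange S y =
      ∑ n ∈ Finset.range (max t d + 1), (F.wt V n).baseChange S y :=
    Finset.sum_subset (Finset.range_subset_range.2 (by omega)) fun n _ hn =>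
      F.wt_baseChange_eq_zero (by simpa using hn) y
  rw [h1 _ (le_max_left t d), h2]

/-- The unit at `V ⊕ k` retains all elements of weight `m`: specializing the coefficients `Sym(V ⊕
k) → k` by the projection to `k` turns the column into `(v, t) ↦ ((v, t), t)`, and projecting the
inner space to `V` recovers `(v, t)`. -/
lemma eq_zero_of_symUnit (m : ℕ) (h : m + e = d) {z : F.obj (plusObj V)} (hz : F.wt V m z = z)
    (h0 : app (symUnit m h F) (plusObj V) z = 0) : z = 0 := by
  have h1 := congrArg (stι m h (wtObj m h F) (plusObj V)) h0
  rw [stι_symUnit, map_zero] at h1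
  have h2 := congrArg ((F.wtι (plusObj V) m h).baseChange _) h1
  rw [wtι_wtπ_apply, map_zero] at h2
  have h3 := congrArg (coeffMap (augK V) _) h2
  rw [← baseChange_coeffMap, ← F.map_coeffMap, map_zero, coeffMap_tmul, map_one, extend_symCol] at h3
  have h4 := congrArg (F.map k (dg (rprV V k) 1)) h3
  rw [F.map_dg_wt, F.map_map, dg_pair, LinearMap.comp_id, one_smul, map_zero] at h4
  have h5 : (augK V).toLinearMap ∘ₗ SymmetricAlgebra.ι k (plusObj V) = sndS k V :=
    LinearMap.ext fun v => by simp [augK, sndS]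
  rw [h5, formMap_sndS, pair_rprV_rprK, F.map_id_apply, LinearMap.baseChange_tmul, hz] at h4
  exact tmul_injective (k := k) (by simpa using h4)

end Weights

end StrictPoly

end SPF

namespace SPF

open Polynomial

namespace StrictPoly

variable {k : Type u} [Field k] {S T B : Type u} [CommRing S] [Algebra k S] [CommRing T]
  [Algebra k T] [CommRing B] [Algebra k B] {U V W : FGModuleCat.{u} k} {d e e' : ℕ}

/-! ### The generic block map of `V ⊕ k` and coassociativity. -/

section Shear

lemma formMap_add (l l' : V →ₗ[k] B) : formMap (l + l') = formMap l + formMap l' :=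
  ext_one fun v => by
    rw [LinearMap.add_apply, formMap_one_tmul, formMap_one_tmul, formMap_one_tmul,
      LinearMap.add_apply, TensorProduct.add_tmul]

lemma formMap_zero : formMap (0 : V →ₗ[k] B) = 0 :=
  ext_one fun v => by
    rw [formMap_one_tmul, LinearMap.zero_apply, LinearMap.zero_apply, TensorProduct.zero_tmul]

/-- The map `(v, t) ↦ (v, (v, t))` over `Sym(V ⊕ k)`. -/
def gm (V : FGModuleCat.{u} k) : SymmetricAlgebra k (plusObj V) ⊗[k] plusObj V
    →ₗ[SymmetricAlgebra k (plusObj V)] SymmetricAlgebra k (plusObj V) ⊗[k] plusObj V :=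
  pair (rprV V _) (formMap (SymmetricAlgebra.ι k (plusObj V)))

/-- The linear form on `V` with values in `Sym(V ⊕ k)`. -/
def formV (V : FGModuleCat.{u} k) : V →ₗ[k] SymmetricAlgebra k (plusObj V) :=
  SymmetricAlgebra.ι k (plusObj V) ∘ₗ inV V

/-- The generator of the summand `k`, in `Sym(V ⊕ k)`. -/
def xK (V : FGModuleCat.{u} k) : SymmetricAlgebra k (plusObj V) :=
  SymmetricAlgebra.ι k (plusObj V) (inK V (oneU k))

/-- The map `(v, t) ↦ (v, v + t)` over `Sym(V ⊕ k)`. -/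
def shear (V : FGModuleCat.{u} k) : SymmetricAlgebra k (plusObj V) ⊗[k] plusObj V
    →ₗ[SymmetricAlgebra k (plusObj V)] SymmetricAlgebra k (plusObj V) ⊗[k] plusObj V :=
  pair (rprV V _) (rprK V _ + formMap (formV V) ∘ₗ rprV V _)

/-- The map `(v, t) ↦ (v, t - v)` over `Sym(V ⊕ k)`. -/
def shearInv (V : FGModuleCat.{u} k) : SymmetricAlgebra k (plusObj V) ⊗[k] plusObj V
    →ₗ[SymmetricAlgebra k (plusObj V)] SymmetricAlgebra k (plusObj V) ⊗[k] plusObj V :=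
  pair (rprV V _) (rprK V _ + formMap (-formV V) ∘ₗ rprV V _)

lemma shear_shearInv (V : FGModuleCat.{u} k) : shear V ∘ₗ shearInv V = LinearMap.id := by
  rw [shear, pair_comp, LinearMap.add_comp, LinearMap.comp_assoc, shearInv, rprV_pair, rprK_pair,
    add_assoc, ← LinearMap.add_comp, ← formMap_add, neg_add_cancel, formMap_zero,
    LinearMap.zero_comp, add_zero, pair_rprV_rprK]

lemma shearInv_shear (V : FGModuleCat.{u} k) : shearInv V ∘ₗ shear V = LinearMap.id := by
  rw [shearInv, pair_comp, LinearMap.add_comp, LinearMap.comp_assoc, shear, rprV_pair, rprK_pair,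
    add_assoc, ← LinearMap.add_comp, ← formMap_add, add_neg_cancel, formMap_zero,
    LinearMap.zero_comp, add_zero, pair_rprV_rprK]

lemma in_pr (v : plusObj V) : v = inV V (prV V v) + sndK V v • inK V (oneU k) := by
  conv_lhs => rw [← LinearMap.id_apply (R := k) v, ← in_comp_pr]
  rw [LinearMap.add_apply, LinearMap.comp_apply, LinearMap.comp_apply, prK_eq, _root_.map_smul]

/-- The generic linear form on `V ⊕ k` is its restriction to `V` plus the coordinate of `k`
multiplied by the variable `xK`; the former is the shear, the latter the scaling. -/
lemma gm_eq (V : FGModuleCat.{u} k) : gm V = shear V ∘ₗ sc V (xK V) := by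
  rw [gm, shear, pair_comp, LinearMap.add_comp, LinearMap.comp_assoc, rprV_dg, rprK_dg,
    LinearMap.id_comp, ← formMap_sndS, smul_formMap, rprV, formMap_comp_baseChange]
  congr 1
  refine ext_one fun v => ?_
  rw [LinearMap.add_apply, formMap_one_tmul, formMap_one_tmul, formMap_one_tmul, ← TensorProduct.add_tmul]
  congr 1
  conv_lhs => rw [in_pr v, map_add, _root_.map_smul, add_comm]
  congr 1
  rw [LinearMap.smul_apply, sndS, LinearMap.comp_apply, Algebra.linearMap_apply, smul_eq_mul,
    mul_comm, ← Algebra.smul_def, xK]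

lemma xK_ne_zero (V : FGModuleCat.{u} k) : xK V ≠ 0 := fun h => by
  have h1 := congrArg (augK V) h
  rw [xK, augK, SymmetricAlgebra.lift_ι_apply, map_zero] at h1
  exact one_ne_zero (α := k) h1

lemma xK_pow_smul_injective (n : ℕ) (M : Type u) [AddCommGroup M] [Module k M]
    (x : SymmetricAlgebra k (plusObj V) ⊗[k] M) (hx : xK V ^ n • x = 0) : x = 0 :=
  (smul_eq_zero.1 hx).resolve_left (pow_ne_zero _ (xK_ne_zero V))

/-- The generic block map is invertible up to the scaling by `xK`. That scaling acts on weight `n`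
as multiplication by `xK ^ n`, which is injective since `Sym(V ⊕ k)` has no zero divisors. -/
lemma map_gm_injective (F : StrictPoly k d)
    (x : SymmetricAlgebra k (plusObj V) ⊗[k] F.obj (plusObj V)) (hx : F.map _ (gm V) x = 0) : x = 0 := by
  have h1 := congrArg (F.map _ (shearInv V)) hx
  rw [F.map_map, map_zero, gm_eq, ← LinearMap.comp_assoc, shearInv_shear, LinearMap.id_comp] at h1
  rw [← F.sum_wt x]
  refine Finset.sum_eq_zero fun n _ => xK_pow_smul_injective n _ _ ?_
  rw [← F.map_sc_wt, F.map_dg_wt, h1, map_zero]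

lemma extend_degHom_gm (V : FGModuleCat.{u} k) :
    extend (degHom (plusObj V)) (gm V) = sc V X ∘ₗ extend (cst k _) (gm V) := by
  rw [gm, extend_pair, extend_pair, extend_rprV, extend_rprV, extend_formMap, extend_formMap, dg_pair,
    LinearMap.id_comp, smul_formMap]
  congr 2
  exact LinearMap.ext fun v => degHom_ι v

variable {m m' j : ℕ} (h : m + e = d) (h' : m' + e' = d) (hj : j + e' = e) (G : StrictPoly k e)
  (hm : m + j = m')

/-- The value of `G` at the generic block map contains all comultiplications at `V ⊕ k` at once:
projecting the inner space of the column of `V ⊕ k` to `V` gives `gm V`. -/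
lemma wt_map_gm (x : (symTensor m h G).obj (plusObj V)) :
    (G.wt V j).baseChange _ (G.map _ (gm V) (stι m h G _ x)) =
      G.map _ (dg (rprV V _) 1) ((G.wtι _ j hj).baseChange _
        (stι m' h' _ _ (app (comul h h' hj G hm) (plusObj V) x))) := by
  rw [stι_comul, wtι_wtπ_apply, G.map_dg_wt, G.map_map, symCol, dg_pair, LinearMap.comp_id, one_smul]
  rfl

lemma dup_gm (V : FGModuleCat.{u} k) : dup _ V ∘ₗ gm V = dg (gm V) 1 ∘ₗ symCol (plusObj V) := by
  rw [dup, pair_comp, symCol, dg_pair, LinearMap.comp_id, LinearMap.id_comp, one_smul, gm, rprK_pair]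

lemma map_gm_comul (x : (symTensor m h G).obj (plusObj V)) :
    (wtObj j hj G).map _ (gm V) (stι m' h' _ _ (app (comul h h' hj G hm) (plusObj V) x)) =
      (G.wtπ _ j hj).baseChange _ (G.map _ (dup _ V) (G.map _ (gm V) (stι m h G _ x))) := by
  rw [stι_comul, wtObj_map_wtπ, G.map_map, G.map_map, dup_gm]

lemma wtπ_eq_zero_iff {F : StrictPoly k d} {x : S ⊗[k] F.obj (plusObj V)} :
    (F.wtπ V m h).baseChange S x = 0 ↔ (F.wt V m).baseChange S x = 0 := by
  rw [← wtι_wtπ_apply F m h]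
  exact ((F.wtι V m h).baseChange S).map_eq_zero_iff (F.wtι_injective m h) |>.symm

variable {l e'' m'' : ℕ} (h'' : m'' + e'' = d) (hl : l + e'' = e') (hm' : m' + l = m'')

include h h'' hl hm hm' in
-- Two successive columns are one column followed by the duplication of `k`. Split the image of `x`
-- by weight: the parts of weight `i < j` have no outer weight `j`, those of weight `i > j` vanish
-- by hypothesis, and the part of weight `j` spends all its weight on the outer copy. Nothing of
-- positive inner weight `l` is left.
lemma comul_comul_eq_zero (hl0 : l ≠ 0) (x : (symTensor m h G).obj V)
    (hx : ∀ (i e₁ m₁ : ℕ) (h₁ : m₁ + e₁ = d) (hi : i + e₁ = e) (hm₁ : m + i = m₁), j < i →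
      app (comul h h₁ hi G hm₁) V x = 0) :
    app (comul h' h'' hl (wtObj j hj G) hm') V (app (comul h h' hj G hm) V x) = 0 := by
  refine stι_injective m'' h'' _ ?_
  rw [map_zero, stι_comul, stι_comul, wtObj_map_wtπ]
  set y := G.map _ (symCol V) (stι m h G V x) with hy
  have e1 : dg (symCol V) 1 ∘ₗ symCol V = dup _ V ∘ₗ symCol V := by
    rw [dup, pair_comp, LinearMap.id_comp]
    conv_lhs => rw [symCol.eq_def, dg_pair, LinearMap.comp_id, one_smul]
    rw [symCol, rprK_pair]
  have e2 : G.map _ (dg (symCol V) 1) y = G.map _ (dup _ V) y := by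
    rw [hy, G.map_map, G.map_map, e1]
  rw [e2, ← G.sum_wt y, map_sum, map_sum, map_sum]
  refine Finset.sum_eq_zero fun i hi => ?_
  have hi : i ≤ e := by simpa [Nat.lt_succ_iff] using hi
  rcases lt_trichotomy i j with hij | rfl | hij
  · rw [(wtπ_eq_zero_iff hj).2 (G.wt_dup_of_lt hij (G.wt_wt_same i y)), map_zero]
  · have e3 : (G.wtπ (plusObj V) i hj).baseChange _ (G.map _ (dup _ V) ((G.wt V i).baseChange _ y)) =
        (wtObj i hj G).map _ (rinV V _) ((G.wtπ V i hj).baseChange _ ((G.wt V i).baseChange _ y)) := by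
      rw [wtObj_map_wtπ]
      refine G.wtι_injective i hj ?_
      rw [wtι_wtπ_apply, wtι_wtπ_apply, G.wt_dup_self (G.wt_wt_same i y), ← G.map_dg_wt,
        G.wt_wt_same]
    rw [e3]
    exact (wtπ_eq_zero_iff hl).2 ((wtObj i hj G).wt_map_rinV hl0 _)
  · have := congrArg (stι (m + i) (by omega) _ V) (hx i (e - i) (m + i) (by omega) (by omega) rfl hij)
    rw [map_zero, stι_comul, wtπ_eq_zero_iff] at this
    rw [← hy] at this
    rw [this, map_zero, map_zero, map_zero]

end Shear

/-! ### The weights of `W_j G` are bounded by those of `G`. -/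

section Swap

/-- The exchange of the two summands `k` of `(V ⊕ k) ⊕ k`. -/
def swapK (V : FGModuleCat.{u} k) : plusObj (plusObj V) →ₗ[k] plusObj (plusObj V) :=
  let a : (V × k) × k →ₗ[k] (V × k) × k :=
    { toFun := fun x => ((x.1.1, x.2), x.1.2), map_add' := fun _ _ => rfl, map_smul' := fun _ _ => rfl }
  a

lemma swapK_swapK (V : FGModuleCat.{u} k) : swapK V ∘ₗ swapK V = LinearMap.id := rfl

/-- The map `((v, s), t) ↦ ((v, rs), t)` on vector spaces with scalars `S`. -/
lemma dg_sc_swapK (r : S) : (swapK V).baseChange S ∘ₗ dg (sc V r) 1 =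
    sc (plusObj V) r ∘ₗ (swapK V).baseChange S := by
  refine ext_one fun v => ?_
  have h1 (v : plusObj (plusObj V)) : dg (sc V r) (1 : S) (1 ⊗ₜ v) =
      1 ⊗ₜ inV _ (inV _ (prV _ (prV _ v))) + r ⊗ₜ inV _ (inK _ (prK _ (prV _ v))) +
        1 ⊗ₜ inK _ (prK _ v) := by
    have : dg (sc V r) (1 : S) (1 ⊗ₜ v) = rinV _ S (sc V r (rprV _ S (1 ⊗ₜ v))) +
      rinK _ S ((1 : S) • rprK _ S (1 ⊗ₜ v)) := rfl
    rw [this, rprV, rprK, LinearMap.baseChange_tmul, LinearMap.baseChange_tmul, sc_tmul, one_smul,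
      map_add, rinV, rinK, LinearMap.baseChange_tmul, LinearMap.baseChange_tmul,
      LinearMap.baseChange_tmul, mul_one]
  rw [LinearMap.comp_apply, LinearMap.comp_apply, h1, LinearMap.baseChange_tmul, sc_tmul, map_add,
    map_add, LinearMap.baseChange_tmul, LinearMap.baseChange_tmul, LinearMap.baseChange_tmul, mul_one]
  rw [add_right_comm, ← TensorProduct.tmul_add, ← map_add]
  have h2 : swapK V (inV _ (inV _ (prV _ (prV _ v))) + inK _ (prK _ v)) =
      inV _ (prV _ (swapK V v)) := by
    obtain ⟨⟨a, b⟩, c⟩ := (v : (V × k) × k)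
    exact Prod.ext (Prod.ext (add_zero a) (zero_add c)) (add_zero (0 : k))
  rw [h2]
  rfl

/-- Exchanging the two copies of `k` in `(V ⊕ k) ⊕ k` turns the inner scaling, which defines the
weights of `W_j G`, into the outer one, which defines the weights of `G` over `V ⊕ k`. -/
lemma ExpLE.wtObj {G : StrictPoly k e} {m j : ℕ} (hj : j + e' = e) (h : G.ExpLE m) :
    (wtObj j hj G).ExpLE m := by
  intro V n hn
  refine LinearMap.ext fun z => tmul_injective (k := k) ?_
  change (1 : k) ⊗ₜ[k] _ = (1 : k) ⊗ₜ[k] _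
  rw [← LinearMap.baseChange_tmul, wt_baseChange, LinearMap.zero_apply, TensorProduct.tmul_zero]
  refine G.wtι_injective j hj ?_
  rw [cf_baseChange, wtι_map, map_zero, baseChange_coeffMap]
  set y := (G.wtι (plusObj V) j hj).baseChange k (1 ⊗ₜ z)
  have h1 : dg (sc V (X : k[X])) 1 =
      ((swapK V).baseChange k[X] ∘ₗ sc (plusObj V) X) ∘ₗ (swapK V).baseChange k[X] := by
    rw [LinearMap.comp_assoc, ← dg_sc_swapK, ← LinearMap.comp_assoc, ← LinearMap.baseChange_comp,
      swapK_swapK, LinearMap.baseChange_id, LinearMap.id_comp]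
  rw [h1, ← G.map_map, ← G.map_map, map_baseChange, ← cf_baseChange, baseChange_coeffMap,
    ← wt_baseChange, h _ n hn, LinearMap.baseChange_zero, LinearMap.zero_apply, map_zero]

end Swap

/-! ### Surjectivity of the comultiplication in large weights. -/

section Surjectivity

variable {m m' i : ℕ} (h : m + e = d) (h' : m' + e' = d) (hi : i + e' = e) (G : StrictPoly k e)
  (hm : m + i = m')

/-- The homomorphism `Sym(V ⊕ k) → Sym(V ⊕ k)` which sends the generator of `k` to `1`. -/
def dehom (V : FGModuleCat.{u} k) : SymmetricAlgebra k (plusObj V) →ₐ[k] SymmetricAlgebra k (plusObj V) :=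
  SymmetricAlgebra.lift (formV V ∘ₗ prV V + sndS _ V)

/-- The weight `t` of an element is shared between the power of the variable `xK` in `Sym` and the
weight in `G`. The scaling by `xK` turns the second share into a power of `xK` as well, so that `xK
^ t` splits off and the dehomogenized element remains. -/
lemma map_sc_xK {t : ℕ} {w : (symTensor m h G).obj (plusObj V)}
    (hw : (symTensor m h G).wt V t w = w) :
    G.map _ (sc V (xK V)) (stι m h G _ w) = xK V ^ t • coeffMap (dehom V) _ (stι m h G _ w) := by
  have h1 : ((symTensor m h G).wt V t).baseChange k[X] (1 ⊗ₜ w) = 1 ⊗ₜ w := by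
    rw [LinearMap.baseChange_tmul, hw]
  have h2 := congrArg (rstι k[X] m h G (plusObj V)) ((symTensor m h G).map_sc_wt' h1 X)
  rw [rstι_map, rstι_smul, rstι_one_tmul] at h2
  -- Specialize the scaling parameter to `xK` and, in `Sym(V ⊕ k)`, the generator of `k` to `1`.
  -- Scaling the generator first and then setting it to `1` gives back `xK`, so `ψ` after the
  -- scaling is the identity (`h4`).
  let ψ : k[X] ⊗[k] SymmetricAlgebra k (plusObj V) →ₐ[k] SymmetricAlgebra k (plusObj V) :=
    symPt (Polynomial.aeval (xK V)) (formV V ∘ₗ prV V + sndS _ V)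
  have h3 := congrArg (coeffMap ψ _) h2
  rw [← G.map_coeffMap, extend_extend, symPt_comp_includeLeft, extend_sc, aeval_X, coeffMap_smul,
    coeffMap_comp, coeffMap_comp, coeffMap_comp, symPt_comp_includeRight, symPt_tmul_one, map_pow,
    aeval_X] at h3
  have h4 : (ψ.comp (symAlgK (sc V X))).comp (symR k[X] (plusObj V)) = AlgHom.id k _ := by
    rw [symPt_comp_symAlgK, symPt_comp_includeRight]
    refine SymmetricAlgebra.algHom_ext (LinearMap.ext fun v => ?_)
    change SymmetricAlgebra.lift _ (SymmetricAlgebra.ι k _ v) = SymmetricAlgebra.ι k _ v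
    rw [SymmetricAlgebra.lift_ι_apply]
    change evalForm (formV V ∘ₗ prV V + sndS _ V)
      (extend (Polynomial.aeval (xK V)) (sc V X) (1 ⊗ₜ v)) = _
    rw [extend_sc, aeval_X, sc_tmul, map_add, mul_one]
    have e1 (v : V) : prV V (inV V v) = v := rfl
    have e2 (v : V) : sndS (SymmetricAlgebra k (plusObj V)) V (inV V v) = 0 :=
      map_zero (algebraMap k (SymmetricAlgebra k (plusObj V)))
    have e3 : prV V (inK V (oneU k)) = 0 := rfl
    have e4 : sndS (SymmetricAlgebra k (plusObj V)) V (inK V (oneU k)) = 1 :=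
      map_one (algebraMap k (SymmetricAlgebra k (plusObj V)))
    have e5 (b : SymmetricAlgebra k (plusObj V)) (v : plusObj V) :
        evalForm (formV V ∘ₗ prV V + sndS _ V) (b ⊗ₜ v) =
          b * (formV V (prV V v) + sndS _ V v) := rfl
    rw [e5, e5, e1, e2, prK_eq, _root_.map_smul, _root_.map_smul, _root_.map_smul, _root_.map_smul, e3, e4, map_zero,
      smul_zero, one_mul, add_zero, zero_add]
    conv_rhs => rw [in_pr v, map_add, _root_.map_smul]
    rw [mul_smul_comm, mul_one]
    rfl
  rw [h4, coeffMap_id] at h3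
  exact h3

include h h' hi hm in
-- After applying the generic block map, the required preimage must become an element `y` that is
-- determined by `w`. Undoing `gm` costs a division by `xK ^ a` on each weight `a` of `G`; since `w`
-- has weight `t` and all weights of `G` are at most `t`, the element `y` is divisible by enough
-- powers of `xK`.
lemma exists_comul_eq {t : ℕ} (hG : G.ExpLE t)
    (w : (symTensor m' h' (wtObj i hi G)).obj (plusObj V))
    (hw : (symTensor m' h' (wtObj i hi G)).wt V t w = w)
    (hD : ∀ (l e₁ m₁ : ℕ) (h₁ : m₁ + e₁ = d) (hl : l + e₁ = e') (hm₁ : m' + l = m₁), l ≠ 0 →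
      app (comul h' h₁ hl (wtObj i hi G) hm₁) (plusObj V) w = 0) :
    ∃ x : (symTensor m h G).obj (plusObj V), app (comul h h' hi G hm) (plusObj V) x = w ∧
      ∀ (j e₁ m₁ : ℕ) (h₁ : m₁ + e₁ = d) (hj : j + e₁ = e) (hm₁ : m + j = m₁), i < j →
        app (comul h h₁ hj G hm₁) (plusObj V) x = 0 := by
  let O := SymmetricAlgebra k (plusObj V)
  let y' := (wtObj i hi G).map O (gm V) (stι m' h' _ _ w)
  have hy0 : y' = xK V ^ t • (wtObj i hi G).map O (shear V)
      (coeffMap (dehom V) _ (stι m' h' _ _ w)) := by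
    rw [← _root_.map_smul, ← map_sc_xK h' (wtObj i hi G) hw, map_map, ← gm_eq]
  -- The nonzero weights of `y'` are governed by the comultiplications of `w`, which vanish by `hD`;
  -- so `y'` comes from `V`.
  have hy' : (wtObj i hi G).map O (rinV V O ∘ₗ rprV V O) y' = y' := by
    refine map_eq_of_wt_zero _ fun l hl => ?_
    by_cases hle : l ≤ e'
    · rw [wt_map_gm h' (m' := m' + l) (e' := e' - l) (by omega) (by omega) _ rfl,
        hD _ _ _ _ _ _ hl, map_zero, map_zero, map_zero]
    · exact (wtObj i hi G).wt_baseChange_eq_zero (by omega) _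
  let y := G.map O (dg (rprV V O) 1) ((G.wtι _ i hi).baseChange O y')
  have hy_wt : (G.wt V i).baseChange O y = y := by
    rw [← G.map_dg_wt, wt_wtι_apply]
  -- The degree parameter also scales the inner copy of `k` through `gm`, but this is absorbed by
  -- the projection of that copy away; the degree `m'` of `w` remains.
  have hyd : coeffMap (degHom (plusObj V)) _ y = (X ^ (m' ) : O[X]) • coeffMap (cst k O) _ y := by
    have e1 : coeffMap (degHom (plusObj V)) _ y' =
        (X ^ m' : O[X]) • (wtObj i hi G).map O[X] (sc V X) (coeffMap (cst k O) _ y') := by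
      rw [← map_coeffMap, degHom_stι, extend_degHom_gm, ← map_map, _root_.map_smul, _root_.map_smul,
        map_coeffMap]
    have e2 : dg (rprV V O[X]) 1 ∘ₗ dg (sc V X) 1 = dg (rprV V O[X]) 1 := by
      rw [dg_comp, rprV_sc, one_mul]
    rw [← G.map_coeffMap, ← baseChange_coeffMap, e1, _root_.map_smul, wtι_map, _root_.map_smul,
      extend_dg, extend_rprV, map_one, G.map_map, e2, baseChange_coeffMap,
      ← extend_rprV (cst k O), ← map_one (cst k O), ← extend_dg, G.map_coeffMap]
  let y0 := G.map O (dg (rprV V O) 1) ((G.wtι _ i hi).baseChange O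
    ((wtObj i hi G).map O (shear V) (coeffMap (dehom V) _ (stι m' h' _ _ w))))
  have hyy0 : y = xK V ^ t • y0 := by
    change G.map O _ ((G.wtι _ i hi).baseChange O y') = _
    rw [hy0, _root_.map_smul, _root_.map_smul]
  -- The scaling by `xK` multiplies the part of weight `a` by `xK ^ a`, so the factor `xK ^ (t - a)`
  -- completes it to `xK ^ t`. All weights of `G` occur in this range by `hG`.
  let x' : O ⊗[k] G.obj (plusObj V) := ∑ a ∈ Finset.range (t + 1),
    xK V ^ (t - a) • (G.wt V a).baseChange O (G.map O (shearInv V) y0)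
  have hx' : G.map O (gm V) x' = y := by
    have e1 : G.map O (sc V (xK V)) x' = xK V ^ t • G.map O (shearInv V) y0 := by
      conv_rhs => rw [← hG.sum_wt (G.map O (shearInv V) y0)]
      rw [map_sum, Finset.smul_sum]
      refine Finset.sum_congr rfl fun a ha => ?_
      rw [_root_.map_smul, map_sc_wt, smul_smul, ← pow_add]
      congr 2
      have := Finset.mem_range.1 ha
      omega
    rw [gm_eq, ← G.map_map, e1, _root_.map_smul, G.map_map, shear_shearInv, G.map_id_apply, hyy0]
  -- Nothing guarantees that `x'` is homogeneous, but its component of degree `m` has the same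
  -- image: `gm` converts weight into degree, and `y` has weight `i` and degree `m' = m + i`.
  have hx : G.map O (gm V) (stι m h G _ (stπ m h G _ x')) = y := by
    rw [stι_stπ, ← cf_extend_cst, ← G.map_extend]
    set Z := G.map O[X] (extend (cst k O) (gm V)) (coeffMap (degHom (plusObj V)) _ x') with hZ
    have e1 : G.map O[X] (sc V X) Z = (X ^ m' : O[X]) • coeffMap (cst k O) _ y := by
      rw [hZ, G.map_map, ← extend_degHom_gm, G.map_coeffMap, hx', hyd]
    have e2 (n : ℕ) : (X ^ n : O[X]) • (G.wt V n).baseChange O[X] Z =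
        (X ^ m' : O[X]) • coeffMap (cst k O) _ ((G.wt V n).baseChange O y) := by
      rw [← G.map_sc_wt, G.map_dg_wt, e1, _root_.map_smul, baseChange_coeffMap]
    have e3 (n : ℕ) (hn : n ≠ i) : (G.wt V n).baseChange O[X] Z = 0 := by
      refine X_pow_smul_injective (k := k) (S := O) n ?_
      change (X ^ n : O[X]) • _ = (X ^ n : O[X]) • _
      rw [e2, ← hy_wt, G.wt_wt_ne hn, map_zero, smul_zero, smul_zero]
    have e4 : (G.wt V i).baseChange O[X] Z = (X ^ m : O[X]) • coeffMap (cst k O) _ y := by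
      refine X_pow_smul_injective (k := k) (S := O) i ?_
      change (X ^ i : O[X]) • _ = (X ^ i : O[X]) • _
      rw [e2, hy_wt, smul_smul, ← pow_add, ← hm, add_comm]
    have e5 : Z = (X ^ m : O[X]) • coeffMap (cst k O) _ y := by
      rw [← e4]
      conv_lhs => rw [← G.sum_wt Z]
      exact Finset.sum_eq_single i (fun b _ hb => e3 b hb)
        (fun hb => absurd (Finset.mem_range.2 (by omega)) hb)
    rw [e5, cf_X_pow_smul, if_pos rfl]
  refine ⟨stπ m h G _ x', ?_, fun j e₁ m₁ h₁ hj hm₁ hij => ?_⟩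
  -- Both claims about the comultiplications are tested after the injective generic block map, where
  -- they become statements about the duplication of the element `y` of weight `i`.
  · refine stι_injective m' h' _ (sub_eq_zero.1 (map_gm_injective (wtObj i hi G) _ ?_))
    rw [map_sub, map_gm_comul, hx, sub_eq_zero]
    refine G.wtι_injective i hi ?_
    rw [wtι_wtπ_apply, G.wt_dup_self hy_wt, G.map_map, dg_comp, mul_one, ← wtι_map]
    exact congrArg _ hy'
  · refine stι_injective m₁ h₁ _ ?_
    rw [map_zero]
    refine map_gm_injective (wtObj j hj G) _ ?_
    rw [map_gm_comul, hx, wtπ_eq_zero_iff, G.wt_dup_of_lt hij hy_wt]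

end Surjectivity

end StrictPoly

end SPF

namespace SPF

open Limits

/-! ### Kernels and images under extension of scalars. -/

section LinearAlgebra

variable {k : Type u} [Field k] {S : Type u} [CommRing S] [Algebra k S]
  {M N : Type u} [AddCommGroup M] [Module k M] [AddCommGroup N] [Module k N]

lemma baseChange_injective {f : M →ₗ[k] N} (hf : Function.Injective f) :
    Function.Injective (f.baseChange S) :=
  Module.Flat.lTensor_preserves_injective_linearMap (M := S) f hf

/-- In a basis of `S` over `k` the vanishing can be read coordinate by coordinate, so even an
infinite common kernel commutes with the extension of scalars. -/
lemma mem_range_baseChange_subtype {ι : Type*} {P : ι → Type u} [∀ i, AddCommGroup (P i)]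
    [∀ i, Module k (P i)] (f : ∀ i, M →ₗ[k] P i) (x : S ⊗[k] M)
    (hx : ∀ i, (f i).baseChange S x = 0) :
    x ∈ LinearMap.range ((⨅ i, LinearMap.ker (f i)).subtype.baseChange S) := by
  classical
  let b := Module.Free.chooseBasis k S
  let K := ⨅ i, LinearMap.ker (f i)
  have key (i) (x : S ⊗[k] M) (j) : f i (equivFinsuppOfBasisLeft b x j) =
      equivFinsuppOfBasisLeft b ((f i).baseChange S x) j := by
    induction x using TensorProduct.induction_on with
    | zero => simp
    | add x y hx hy => simp only [map_add, Finsupp.add_apply, hx, hy]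
    | tmul s m => simp
  have h1 (j) : equivFinsuppOfBasisLeft b x j ∈ K := by
    rw [Submodule.mem_iInf]
    intro i
    rw [LinearMap.mem_ker, key, hx, map_zero, Finsupp.zero_apply]
  have h2 : x = ∑ j ∈ (equivFinsuppOfBasisLeft b x).support, b j ⊗ₜ equivFinsuppOfBasisLeft b x j := by
    refine (equivFinsuppOfBasisLeft b).injective (Finsupp.ext fun j => ?_)
    rw [map_sum, Finsupp.finsetSum_apply]
    simp only [equivFinsuppOfBasisLeft_apply_tmul_apply, Module.Basis.repr_self]
    rw [Finset.sum_eq_single j]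
    · simp
    · intro i _ hij
      rw [Finsupp.single_eq_of_ne (Ne.symm hij), zero_smul]
    · intro hj
      rw [Finsupp.notMem_support_iff.1 hj, smul_zero]
  rw [h2]
  refine Submodule.sum_mem _ fun j _ => ⟨b j ⊗ₜ ⟨_, h1 j⟩, by simp⟩

lemma exists_baseChange_eq {P : Type u} [AddCommGroup P] [Module k P] {f : M →ₗ[k] N} {g : N →ₗ[k] P}
    (h : ∀ y, g y = 0 → ∃ x, f x = y) (y : S ⊗[k] N) (hy : g.baseChange S y = 0) :
    ∃ x, f.baseChange S x = y := by
  obtain ⟨z, rfl⟩ := mem_range_baseChange_subtype (fun _ : Unit => g) y (fun _ => hy)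
  induction z using TensorProduct.induction_on with
  | zero => exact ⟨0, by simp⟩
  | add a b ha hb =>
    have hker (z : S ⊗[k] (⨅ _ : Unit, LinearMap.ker g : Submodule k N)) :
        g.baseChange S ((⨅ _ : Unit, LinearMap.ker g : Submodule k N).subtype.baseChange S z) = 0 := by
      rw [← LinearMap.comp_apply, ← LinearMap.baseChange_comp]
      have : g ∘ₗ (⨅ _ : Unit, LinearMap.ker g : Submodule k N).subtype = 0 :=
        LinearMap.ext fun x => by simpa using x.2
      rw [this]; simp
    obtain ⟨x, hx⟩ := ha (hker a)
    obtain ⟨y, hy⟩ := hb (hker b)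
    exact ⟨x + y, by rw [map_add, map_add, hx, hy]⟩
  | tmul s m =>
    obtain ⟨x, hx⟩ := h m.1 (by simpa using m.2)
    exact ⟨s ⊗ₜ x, by simp [hx]⟩

end LinearAlgebra

/-! ### Strict polynomial functors form an abelian category. -/

namespace StrictPoly

variable {k : Type u} [Field k] {d : ℕ}

section Sub

variable (F : StrictPoly k d)

/-- The data of subspaces of the spaces `F(V)`, stable under the action of the maps `F.map`. -/
structure SubData where
  /-- the spaces -/
  obj : FGModuleCat.{u} k → FGModuleCat.{u} k
  /-- the inclusions -/
  i : ∀ V, obj V →ₗ[k] F.obj V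
  inj : ∀ V, Function.Injective (i V)
  mem : ∀ (S : Type u) [CommRing S] [Algebra k S] {V W : FGModuleCat.{u} k}
    (f : S ⊗[k] V →ₗ[S] S ⊗[k] W) (x : S ⊗[k] obj V),
    ∃ y : S ⊗[k] obj W, (i W).baseChange S y = F.map S f ((i V).baseChange S x)

variable {F} (D : SubData F)

/-- A retraction of the inclusion. -/
def SubData.r (V : FGModuleCat.{u} k) : F.obj V →ₗ[k] D.obj V :=
  ((D.i V).exists_leftInverse_of_injective (LinearMap.ker_eq_bot.2 (D.inj V))).choose

lemma SubData.r_i (V : FGModuleCat.{u} k) : D.r V ∘ₗ D.i V = LinearMap.id :=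
  ((D.i V).exists_leftInverse_of_injective (LinearMap.ker_eq_bot.2 (D.inj V))).choose_spec

lemma SubData.i_r_map {S : Type u} [CommRing S] [Algebra k S] {V W : FGModuleCat.{u} k}
    (f : S ⊗[k] V →ₗ[S] S ⊗[k] W) (x : S ⊗[k] D.obj V) :
    (D.i W).baseChange S ((D.r W).baseChange S (F.map S f ((D.i V).baseChange S x))) =
      F.map S f ((D.i V).baseChange S x) := by
  obtain ⟨y, hy⟩ := D.mem S f x
  rw [← hy, ← LinearMap.comp_apply (LinearMap.baseChange S (D.r W)), ← LinearMap.baseChange_comp,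
    D.r_i, LinearMap.baseChange_id, LinearMap.id_apply]

/-- The subfunctor given by a stable family of subspaces. -/
def SubData.functor : StrictPoly k d where
  obj V := D.obj V
  map S _ _ V W f := (D.r W).baseChange S ∘ₗ F.map S f ∘ₗ (D.i V).baseChange S
  map_id S _ _ V := by
    rw [F.map_id, LinearMap.id_comp, ← LinearMap.baseChange_comp, D.r_i, LinearMap.baseChange_id]
  map_comp S _ _ U V W g f := LinearMap.ext fun x => by
    simp only [LinearMap.comp_apply]
    rw [D.i_r_map, F.map_map]
  map_smul S _ _ V W r f := by
    rw [F.map_smul, LinearMap.smul_comp, LinearMap.comp_smul]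
  map_extend φ V W f := by
    rw [F.map_extend, extend_comp, extend_comp, extend_baseChange, extend_baseChange]

/-- The inclusion of a subfunctor. -/
def SubData.incl : D.functor ⟶ F :=
  mkHom (F := D.functor) (G := F) D.i
    fun _ _ _ _ _ f => LinearMap.ext fun x => D.i_r_map f x

/-- The common kernel of a family of morphisms. -/
def kerData {ι : Type*} {P : ι → StrictPoly k d} (φ : ∀ i, F ⟶ P i) : SubData F where
  obj V := FGModuleCat.of k (⨅ i, LinearMap.ker (app (φ i) V) : Submodule k (F.obj V))
  i V := (⨅ i, LinearMap.ker (app (φ i) V) : Submodule k (F.obj V)).subtype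
  inj V := Subtype.val_injective
  mem S _ _ V W f x := by
    refine mem_range_baseChange_subtype (fun i => app (φ i) W) _ fun i => ?_
    rw [← LinearMap.comp_apply, naturality, LinearMap.comp_apply]
    have : app (φ i) V ∘ₗ (⨅ i, LinearMap.ker (app (φ i) V) : Submodule k (F.obj V)).subtype = 0 :=
      LinearMap.ext fun x => (Submodule.mem_iInf _).1 x.2 i
    have h2 := LinearMap.congr_fun (congrArg (LinearMap.baseChange S) this) x
    rw [LinearMap.baseChange_comp, LinearMap.comp_apply] at h2
    exact (congrArg _ h2).trans (by simp)

variable {ι : Type*} {P : ι → StrictPoly k d} (φ : ∀ i, F ⟶ P i)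

/-- The common kernel of a family of morphisms. -/
def kerFun : StrictPoly k d := (kerData φ).functor

/-- The inclusion of the common kernel of a family of morphisms. -/
def kerι : kerFun φ ⟶ F := (kerData φ).incl

lemma kerι_injective (V : FGModuleCat.{u} k) : Function.Injective (app (kerι φ) V) :=
  (kerData φ).inj V

lemma app_kerι (i : ι) (V : FGModuleCat.{u} k) (x : (kerFun φ).obj V) :
    app (φ i) V (app (kerι φ) V x) = 0 :=
  (Submodule.mem_iInf _).1 (Subtype.prop (p := fun y => y ∈ (⨅ i, LinearMap.ker (app (φ i) V) :
    Submodule k (F.obj V))) x) i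

lemma exists_kerι (V : FGModuleCat.{u} k) (x : F.obj V) (hx : ∀ i, app (φ i) V x = 0) :
    ∃ y, app (kerι φ) V y = x :=
  ⟨⟨x, (Submodule.mem_iInf _).2 hx⟩, rfl⟩

end Sub

section Lift

variable {F G H : StrictPoly k d}

/-- Linear retractions of the components give the lift space by space. The retractions are not
natural, but the lift is, since naturality may be tested after the injective maps `φ`. -/
lemma exists_lift (φ : F ⟶ G) (hφ : ∀ V, Function.Injective (app φ V)) (ψ : H ⟶ G)
    (h : ∀ V x, ∃ y, app φ V y = app ψ V x) : ∃ χ : H ⟶ F, χ ≫ φ = ψ := by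
  have h1 (V) := (app φ V).exists_leftInverse_of_injective (LinearMap.ker_eq_bot.2 (hφ V))
  choose l hl using h1
  have h2 (V) : app φ V ∘ₗ l V ∘ₗ app ψ V = app ψ V := LinearMap.ext fun x => by
    obtain ⟨y, hy⟩ := h V x
    rw [LinearMap.comp_apply, LinearMap.comp_apply, ← hy, ← LinearMap.comp_apply (l V), hl]
    rfl
  refine ⟨mkHom (fun V => l V ∘ₗ app ψ V) fun S _ _ V W f => LinearMap.ext fun x =>
    baseChange_injective (hφ W) ?_, hom_ext h2⟩
  have h3 (V) (x : S ⊗[k] H.obj V) : (app φ V).baseChange S ((l V ∘ₗ app ψ V).baseChange S x) =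
      (app ψ V).baseChange S x := by
    rw [← LinearMap.comp_apply, ← LinearMap.baseChange_comp, h2]
  have h4 (x) := LinearMap.congr_fun (naturality φ S f) x
  have h5 (x) := LinearMap.congr_fun (naturality ψ S f) x
  simp only [LinearMap.comp_apply] at h4 h5
  rw [LinearMap.comp_apply, LinearMap.comp_apply, h3, h4, h3, h5]

lemma exists_desc (φ : F ⟶ G) (hφ : ∀ V, Function.Surjective (app φ V)) (ψ : F ⟶ H)
    (h : ∀ V x, app φ V x = 0 → app ψ V x = 0) : ∃ χ : G ⟶ H, φ ≫ χ = ψ := by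
  have h1 (V) := (app φ V).exists_rightInverse_of_surjective (LinearMap.range_eq_top.2 (hφ V))
  choose σ hσ using h1
  have h2 (V) : (app ψ V ∘ₗ σ V) ∘ₗ app φ V = app ψ V := LinearMap.ext fun x => by
    rw [← sub_eq_zero]
    change app ψ V (σ V (app φ V x)) - app ψ V x = 0
    rw [← map_sub]
    refine h V _ ?_
    rw [map_sub, sub_eq_zero]
    exact LinearMap.congr_fun (hσ V) _
  refine ⟨mkHom (fun V => app ψ V ∘ₗ σ V) fun S _ _ V W f => LinearMap.ext fun x => ?_, hom_ext h2⟩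
  obtain ⟨x, rfl⟩ : ∃ y, (app φ V).baseChange S y = x :=
    ⟨(σ V).baseChange S x, by rw [← LinearMap.comp_apply, ← LinearMap.baseChange_comp, hσ]; simp⟩
  have h3 (V) (x : S ⊗[k] F.obj V) : (app ψ V ∘ₗ σ V).baseChange S ((app φ V).baseChange S x) =
      (app ψ V).baseChange S x := by
    rw [← LinearMap.comp_apply, ← LinearMap.baseChange_comp, h2]
  have h4 (x) := LinearMap.congr_fun (naturality φ S f) x
  have h5 (x) := LinearMap.congr_fun (naturality ψ S f) x
  simp only [LinearMap.comp_apply] at h4 h5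
  rw [LinearMap.comp_apply, LinearMap.comp_apply, ← h4, h3, h3, h5]

lemma mono_of_injective (φ : F ⟶ G) (hφ : ∀ V, Function.Injective (app φ V)) : Mono φ where
  right_cancellation a b h := hom_ext fun V => LinearMap.ext fun x => hφ V (by
    have := congrArg (fun q => app q V x) h
    exact this)

lemma epi_of_surjective (φ : F ⟶ G) (hφ : ∀ V, Function.Surjective (app φ V)) : Epi φ where
  left_cancellation a b h := hom_ext fun V => LinearMap.ext fun x => by
    obtain ⟨y, rfl⟩ := hφ V x
    have := congrArg (fun q => app q V y) h
    exact this

lemma injective_of_mono (φ : F ⟶ G) [Mono φ] (V : FGModuleCat.{u} k) :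
    Function.Injective (app φ V) := by
  have h0 : kerι (fun _ : Unit => φ) = 0 := by
    rw [← cancel_mono φ, zero_comp]
    exact hom_ext fun V => LinearMap.ext fun x => app_kerι (fun _ : Unit => φ) () V x
  refine (injective_iff_map_eq_zero _).2 fun x hx => ?_
  obtain ⟨y, rfl⟩ := exists_kerι (fun _ : Unit => φ) V x (fun _ => hx)
  rw [h0, app_zero, LinearMap.zero_apply]

lemma isIso_of_bijective (φ : F ⟶ G) (hφ : ∀ V, Function.Bijective (app φ V)) : IsIso φ := by
  obtain ⟨χ, hχ⟩ := exists_lift φ (fun V => (hφ V).1) (𝟙 G) (fun V x => (hφ V).2 x)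
  have := mono_of_injective φ (fun V => (hφ V).1)
  exact ⟨χ, by rw [← cancel_mono φ, Category.assoc, hχ, Category.comp_id, Category.id_comp], hχ⟩

end Lift

section Quotient

variable {F G : StrictPoly k d} (φ : F ⟶ G)

/-- The cokernel of a component. -/
def cokObj (V : FGModuleCat.{u} k) : FGModuleCat.{u} k :=
  FGModuleCat.of k (G.obj V ⧸ LinearMap.range (app φ V))

/-- The projection to the cokernel of a component. -/
def cokProj (V : FGModuleCat.{u} k) : G.obj V →ₗ[k] cokObj φ V :=
  (LinearMap.range (app φ V)).mkQ

lemma cokProj_surjective (V : FGModuleCat.{u} k) : Function.Surjective (cokProj φ V) :=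
  Submodule.mkQ_surjective _

lemma cokProj_eq_zero (V : FGModuleCat.{u} k) (y : G.obj V) :
    cokProj φ V y = 0 ↔ ∃ x, app φ V x = y :=
  (Submodule.Quotient.mk_eq_zero _).trans LinearMap.mem_range

/-- A section of the projection to the cokernel. -/
def cokSec (V : FGModuleCat.{u} k) : cokObj φ V →ₗ[k] G.obj V :=
  ((cokProj φ V).exists_rightInverse_of_surjective
    (LinearMap.range_eq_top.2 (cokProj_surjective φ V))).choose

lemma cokProj_cokSec (V : FGModuleCat.{u} k) : cokProj φ V ∘ₗ cokSec φ V = LinearMap.id :=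
  ((cokProj φ V).exists_rightInverse_of_surjective
    (LinearMap.range_eq_top.2 (cokProj_surjective φ V))).choose_spec

/-- Two lifts of an element of the cokernel differ by an element of the image of `φ`, which is
stable under `G.map`. Hence the action on the cokernel does not depend on the chosen section. -/
lemma cokProj_map {S : Type u} [CommRing S] [Algebra k S] {V W : FGModuleCat.{u} k}
    (f : S ⊗[k] V →ₗ[S] S ⊗[k] W) (x : S ⊗[k] G.obj V) :
    (cokProj φ W).baseChange S (G.map S f ((cokSec φ V).baseChange S
      ((cokProj φ V).baseChange S x))) = (cokProj φ W).baseChange S (G.map S f x) := by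
  rw [← sub_eq_zero, ← map_sub, ← map_sub]
  obtain ⟨y, hy⟩ := exists_baseChange_eq (S := S) (fun y => (cokProj_eq_zero φ V y).1)
    ((cokSec φ V).baseChange S ((cokProj φ V).baseChange S x) - x) (by
      rw [map_sub, ← LinearMap.comp_apply, ← LinearMap.baseChange_comp, cokProj_cokSec]
      simp)
  have h1 := LinearMap.congr_fun (naturality φ S f) y
  simp only [LinearMap.comp_apply] at h1
  have h2 : cokProj φ W ∘ₗ app φ W = 0 := LinearMap.ext fun x => (cokProj_eq_zero φ W _).2 ⟨x, rfl⟩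
  rw [← hy, ← h1, ← LinearMap.comp_apply, ← LinearMap.baseChange_comp, h2]
  simp

/-- The cokernel of a morphism. -/
def cokFun : StrictPoly k d where
  obj V := cokObj φ V
  map S _ _ V W f := (cokProj φ W).baseChange S ∘ₗ G.map S f ∘ₗ (cokSec φ V).baseChange S
  map_id S _ _ V := by
    rw [G.map_id, LinearMap.id_comp, ← LinearMap.baseChange_comp, cokProj_cokSec,
      LinearMap.baseChange_id]
  map_comp S _ _ U V W g f := LinearMap.ext fun x => by
    simp only [LinearMap.comp_apply]
    rw [cokProj_map, G.map_map]
  map_smul S _ _ V W r f := by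
    rw [G.map_smul, LinearMap.smul_comp, LinearMap.comp_smul]
  map_extend φ V W f := by
    rw [G.map_extend, extend_comp, extend_comp, extend_baseChange, extend_baseChange]

/-- The projection to the cokernel. -/
def cokπ : G ⟶ cokFun φ :=
  mkHom (F := G) (G := cokFun φ) (cokProj φ)
    fun _ _ _ _ _ f => LinearMap.ext fun x => (cokProj_map φ f x).symm

lemma cokπ_surjective (V : FGModuleCat.{u} k) : Function.Surjective (app (cokπ φ) V) :=
  cokProj_surjective φ V

lemma cokπ_eq_zero (V : FGModuleCat.{u} k) (y : G.obj V) :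
    app (cokπ φ) V y = 0 ↔ ∃ x, app φ V x = y := cokProj_eq_zero φ V y

lemma comp_cokπ : φ ≫ cokπ φ = 0 :=
  hom_ext fun V => LinearMap.ext fun x => (cokπ_eq_zero φ V _).2 ⟨x, rfl⟩

lemma surjective_of_epi [Epi φ] (V : FGModuleCat.{u} k) : Function.Surjective (app φ V) := by
  have h0 : cokπ φ = 0 := by rw [← cancel_epi φ, comp_zero, comp_cokπ]
  intro y
  refine (cokπ_eq_zero φ V y).1 ?_
  rw [h0, app_zero, LinearMap.zero_apply]

end Quotient

section Abelian

variable {F G H : StrictPoly k d}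

/-- A morphism which is injective with image the kernel of another one is a kernel. -/
def isLimitKernelFork (φ : F ⟶ G) (ψ : G ⟶ H) (w : φ ≫ ψ = 0)
    (hφ : ∀ V, Function.Injective (app φ V)) (h : ∀ V y, app ψ V y = 0 → ∃ x, app φ V x = y) :
    IsLimit (KernelFork.ofι φ w) :=
  have := mono_of_injective φ hφ
  KernelFork.IsLimit.ofι' φ w fun {_} a ha =>
    have h1 := exists_lift φ hφ a (fun V x => h V _ (congrArg (fun q => app q V x) ha))
    ⟨h1.choose, h1.choose_spec⟩

/-- A surjective morphism with kernel the image of another one is a cokernel. -/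
def isColimitCokernelCofork (φ : F ⟶ G) (ψ : G ⟶ H) (w : φ ≫ ψ = 0)
    (hψ : ∀ V, Function.Surjective (app ψ V)) (h : ∀ V y, app ψ V y = 0 → ∃ x, app φ V x = y) :
    IsColimit (CokernelCofork.ofπ ψ w) :=
  have := epi_of_surjective ψ hψ
  CokernelCofork.IsColimit.ofπ' ψ w fun {A} a ha =>
    have h1 := exists_desc ψ hψ a (fun V x hx => by
      obtain ⟨y, rfl⟩ := h V x hx
      exact congrArg (fun q => app q V y) ha)
    ⟨h1.choose, h1.choose_spec⟩

instance : HasKernels (StrictPoly k d) where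
  has_limit {_ _} φ := ⟨⟨_, isLimitKernelFork (kerι (fun _ : Unit => φ)) φ
    (hom_ext fun V => LinearMap.ext fun x => app_kerι (fun _ : Unit => φ) () V x)
    (kerι_injective _) (fun V y hy => exists_kerι _ V y fun _ => hy)⟩⟩

instance : HasCokernels (StrictPoly k d) where
  has_colimit {_ _} φ := ⟨⟨_, isColimitCokernelCofork φ (cokπ φ) (comp_cokπ φ)
    (cokπ_surjective φ) (fun V y hy => (cokπ_eq_zero φ V y).1 hy)⟩⟩

instance : IsNormalMonoCategory (StrictPoly k d) where
  normalMonoOfMono φ _ := ⟨⟨_, cokπ φ, comp_cokπ φ, isLimitKernelFork φ (cokπ φ) (comp_cokπ φ)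
    (injective_of_mono φ) (fun V y hy => (cokπ_eq_zero φ V y).1 hy)⟩⟩

instance : IsNormalEpiCategory (StrictPoly k d) where
  normalEpiOfEpi φ _ := ⟨⟨_, kerι (fun _ : Unit => φ),
    hom_ext fun V => LinearMap.ext fun x => app_kerι (fun _ : Unit => φ) () V x,
    isColimitCokernelCofork _ φ _ (surjective_of_epi φ)
      (fun V y hy => exists_kerι _ V y fun _ => hy)⟩⟩

/-- The product of two spaces. -/
def prodObj (X Y : FGModuleCat.{u} k) : FGModuleCat.{u} k := FGModuleCat.of k (X × Y)

/-- The first inclusion. -/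
def prodInl (X Y : FGModuleCat.{u} k) : X →ₗ[k] prodObj X Y := LinearMap.inl k X Y

/-- The second inclusion. -/
def prodInr (X Y : FGModuleCat.{u} k) : Y →ₗ[k] prodObj X Y := LinearMap.inr k X Y

/-- The first projection. -/
def prodFst (X Y : FGModuleCat.{u} k) : prodObj X Y →ₗ[k] X := LinearMap.fst k X Y

/-- The second projection. -/
def prodSnd (X Y : FGModuleCat.{u} k) : prodObj X Y →ₗ[k] Y := LinearMap.snd k X Y

lemma prod_total (X Y : FGModuleCat.{u} k) :
    prodInl X Y ∘ₗ prodFst X Y + prodInr X Y ∘ₗ prodSnd X Y = LinearMap.id :=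
  LinearMap.ext fun _ => Prod.ext (add_zero _) (zero_add _)

section

variable {S : Type u} [CommRing S] [Algebra k S] (X Y : FGModuleCat.{u} k)

lemma prodFst_inl (x : S ⊗[k] X) :
    (prodFst X Y).baseChange S ((prodInl X Y).baseChange S x) = x := by
  rw [← LinearMap.comp_apply, ← LinearMap.baseChange_comp]
  have : prodFst X Y ∘ₗ prodInl X Y = LinearMap.id := rfl
  rw [this, LinearMap.baseChange_id, LinearMap.id_apply]

lemma prodSnd_inr (x : S ⊗[k] Y) :
    (prodSnd X Y).baseChange S ((prodInr X Y).baseChange S x) = x := by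
  rw [← LinearMap.comp_apply, ← LinearMap.baseChange_comp]
  have : prodSnd X Y ∘ₗ prodInr X Y = LinearMap.id := rfl
  rw [this, LinearMap.baseChange_id, LinearMap.id_apply]

lemma prodFst_inr (x : S ⊗[k] Y) :
    (prodFst X Y).baseChange S ((prodInr X Y).baseChange S x) = 0 := by
  rw [← LinearMap.comp_apply, ← LinearMap.baseChange_comp]
  have : prodFst X Y ∘ₗ prodInr X Y = 0 := rfl
  rw [this, LinearMap.baseChange_zero, LinearMap.zero_apply]

lemma prodSnd_inl (x : S ⊗[k] X) :
    (prodSnd X Y).baseChange S ((prodInl X Y).baseChange S x) = 0 := by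
  rw [← LinearMap.comp_apply, ← LinearMap.baseChange_comp]
  have : prodSnd X Y ∘ₗ prodInl X Y = 0 := rfl
  rw [this, LinearMap.baseChange_zero, LinearMap.zero_apply]

end

variable (F G)

/-- The product of two functors. -/
def prodFun : StrictPoly k d where
  obj V := prodObj (F.obj V) (G.obj V)
  map S _ _ V W f :=
    (prodInl (F.obj W) (G.obj W)).baseChange S ∘ₗ F.map S f ∘ₗ
      (prodFst (F.obj V) (G.obj V)).baseChange S +
    (prodInr (F.obj W) (G.obj W)).baseChange S ∘ₗ G.map S f ∘ₗ
      (prodSnd (F.obj V) (G.obj V)).baseChange S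
  map_id S _ _ V := by
    rw [F.map_id, G.map_id, LinearMap.id_comp, LinearMap.id_comp, ← LinearMap.baseChange_comp,
      ← LinearMap.baseChange_comp, ← LinearMap.baseChange_add, prod_total, LinearMap.baseChange_id]
  map_comp S _ _ U V W g f := LinearMap.ext fun x => by
    rw [F.map_comp, G.map_comp]
    simp only [LinearMap.add_apply, LinearMap.comp_apply, map_add, prodFst_inl, prodFst_inr,
      prodSnd_inl, prodSnd_inr, map_zero, add_zero, zero_add]
  map_smul S _ _ V W r f := by
    rw [F.map_smul, G.map_smul]
    simp only [LinearMap.smul_comp, LinearMap.comp_smul, smul_add]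
  map_extend φ V W f := by
    rw [F.map_extend, G.map_extend]
    simp only [extend_add, extend_comp, extend_baseChange]

/-- The first projection. -/
def fstHom : prodFun F G ⟶ F :=
  mkHom (F := prodFun F G) (G := F) (fun V => prodFst (F.obj V) (G.obj V))
    fun S _ _ V W f => LinearMap.ext fun x => by
      change (prodFst _ _).baseChange S ((prodInl _ _).baseChange S _ +
        (prodInr _ _).baseChange S _) = _
      rw [map_add, prodFst_inl, prodFst_inr, add_zero]
      rfl

/-- The second projection. -/
def sndHom : prodFun F G ⟶ G :=
  mkHom (F := prodFun F G) (G := G) (fun V => prodSnd (F.obj V) (G.obj V))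
    fun S _ _ V W f => LinearMap.ext fun x => by
      change (prodSnd _ _).baseChange S ((prodInl _ _).baseChange S _ +
        (prodInr _ _).baseChange S _) = _
      rw [map_add, prodSnd_inl, prodSnd_inr, zero_add]
      rfl

/-- The first inclusion. -/
def inlHom : F ⟶ prodFun F G :=
  mkHom (F := F) (G := prodFun F G) (fun V => prodInl (F.obj V) (G.obj V))
    fun S _ _ V W f => LinearMap.ext fun x => by
      change _ = (prodInl _ _).baseChange S (F.map S f ((prodFst _ _).baseChange S
        ((prodInl _ _).baseChange S x))) + (prodInr _ _).baseChange S (G.map S f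
        ((prodSnd _ _).baseChange S ((prodInl _ _).baseChange S x)))
      rw [prodFst_inl, prodSnd_inl, map_zero, map_zero, add_zero]
      rfl

/-- The second inclusion. -/
def inrHom : G ⟶ prodFun F G :=
  mkHom (F := G) (G := prodFun F G) (fun V => prodInr (F.obj V) (G.obj V))
    fun S _ _ V W f => LinearMap.ext fun x => by
      change _ = (prodInl _ _).baseChange S (F.map S f ((prodFst _ _).baseChange S
        ((prodInr _ _).baseChange S x))) + (prodInr _ _).baseChange S (G.map S f
        ((prodSnd _ _).baseChange S ((prodInr _ _).baseChange S x)))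
      rw [prodSnd_inr, prodFst_inr, map_zero, map_zero, zero_add]
      rfl

instance : HasBinaryBiproducts (StrictPoly k d) where
  has_binary_biproduct F G := hasBinaryBiproduct_of_total
    { pt := prodFun F G
      fst := fstHom F G
      snd := sndHom F G
      inl := inlHom F G
      inr := inrHom F G
      inl_fst := hom_ext fun V => LinearMap.ext fun x => rfl
      inl_snd := hom_ext fun V => LinearMap.ext fun x => rfl
      inr_fst := hom_ext fun V => LinearMap.ext fun x => rfl
      inr_snd := hom_ext fun V => LinearMap.ext fun x => rfl } (by
      refine hom_ext fun V => ?_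
      rw [app_add]
      exact prod_total _ _)

variable (k d) in
/-- The zero functor. -/
def zeroFun : StrictPoly k d where
  obj V := FGModuleCat.of k PUnit
  map S _ _ V W f := 0
  map_id S _ _ V := ext_one fun v => by
    rw [Subsingleton.elim v 0, TensorProduct.tmul_zero, map_zero, map_zero]
  map_comp S _ _ U V W g f := by simp
  map_smul S _ _ V W r f := by simp
  map_extend φ V W f := (extend_zero φ).symm

instance : HasZeroObject (StrictPoly k d) where
  zero := ⟨zeroFun k d, (IsZero.iff_id_eq_zero _).2 (hom_ext fun _ => LinearMap.ext fun _ =>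
    Subsingleton.elim (α := PUnit) _ _)⟩

instance : HasFiniteProducts (StrictPoly k d) :=
  hasFiniteProducts_of_has_binary_and_terminal

instance : Abelian (StrictPoly k d) where

end Abelian

end StrictPoly

end SPF

namespace SPF

open Limits

namespace StrictPoly

variable {k : Type u} [Field k] {d : ℕ}

/-! ### Exactness and quasi-isomorphisms are pointwise. -/

section ShortExact

variable {F G H : StrictPoly k d}

lemma shortExact_mk (φ : F ⟶ G) (ψ : G ⟶ H) (w : φ ≫ ψ = 0)
    (hφ : ∀ V, Function.Injective (app φ V)) (hψ : ∀ V, Function.Surjective (app ψ V))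
    (h : ∀ V y, app ψ V y = 0 → ∃ x, app φ V x = y) : (ShortComplex.mk φ ψ w).ShortExact where
  mono_f := mono_of_injective φ hφ
  epi_g := epi_of_surjective ψ hψ
  exact := ShortComplex.exact_of_f_is_kernel _ (isLimitKernelFork φ ψ w hφ h)

lemma app_g_f (S : ShortComplex (StrictPoly k d)) (V : FGModuleCat.{u} k) (x : S.X₁.obj V) :
    app S.g V (app S.f V x) = 0 :=
  congrArg (fun q => app q V x) S.zero

lemma exists_app_eq {S : ShortComplex (StrictPoly k d)} (hS : S.ShortExact)
    (V : FGModuleCat.{u} k) (y : S.X₂.obj V) (hy : app S.g V y = 0) : ∃ x, app S.f V x = y := by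
  have := hS.mono_f
  obtain ⟨z, rfl⟩ := exists_kerι (fun _ : Unit => S.g) V y (fun _ => hy)
  have w : kerι (fun _ : Unit => S.g) ≫ S.g = 0 :=
    hom_ext fun V => LinearMap.ext fun x => app_kerι (fun _ : Unit => S.g) () V x
  exact ⟨app (hS.exact.lift _ w) V z, congrArg (fun q => app q V z) (hS.exact.lift_f _ w)⟩

/-- The components are vector spaces, so the evaluated sequence splits, and an explicit splitting
proves exactness. -/
lemma shortExact_map_ev {S : ShortComplex (StrictPoly k d)} (hS : S.ShortExact)
    (V : FGModuleCat.{u} k) : (S.map (ev d V)).ShortExact := by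
  have := hS.mono_f
  have := hS.epi_g
  obtain ⟨l, hl⟩ := (app S.f V).exists_leftInverse_of_injective
    (LinearMap.ker_eq_bot.2 (injective_of_mono S.f V))
  obtain ⟨σ, hσ⟩ := (app S.g V).exists_rightInverse_of_surjective
    (LinearMap.range_eq_top.2 (surjective_of_epi S.g V))
  have hl (x) : l (app S.f V x) = x := LinearMap.congr_fun hl x
  have hσ (x) : app S.g V (σ x) = x := LinearMap.congr_fun hσ x
  -- A retraction compatible with the section `σ`: the correction term puts the argument of `l` into
  -- the image of `S.f`.
  let r : S.X₂.obj V →ₗ[k] S.X₁.obj V := l ∘ₗ (LinearMap.id - σ ∘ₗ app S.g V)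
  have hr (x) : app S.f V (r x) = x - σ (app S.g V x) := by
    obtain ⟨y, hy⟩ := exists_app_eq hS V (x - σ (app S.g V x)) (by rw [map_sub, hσ, sub_self])
    change app S.f V (l (x - σ (app S.g V x))) = _
    rw [← hy, hl]
  exact ShortComplex.Splitting.shortExact
    { r := ConcreteCategory.ofHom (C := FGModuleCat.{u} k) (X := S.X₂.obj V) (Y := S.X₁.obj V) r
      s := ConcreteCategory.ofHom (C := FGModuleCat.{u} k) (X := S.X₃.obj V) (Y := S.X₂.obj V) σ
      f_r := FGModuleCat.hom_ext (LinearMap.ext fun (x : S.X₁.obj V) => by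
        change l (app S.f V x - σ (app S.g V (app S.f V x))) = x
        rw [app_g_f, map_zero, sub_zero, hl])
      s_g := FGModuleCat.hom_ext (LinearMap.ext hσ)
      id := FGModuleCat.hom_ext (LinearMap.ext fun (x : S.X₂.obj V) => by
        change app S.f V (r x) + σ (app S.g V x) = x
        rw [hr, sub_add_cancel]) }

instance (V : FGModuleCat.{u} k) : (ev (k := k) d V).PreservesHomology :=
  ((ev (k := k) d V).exact_tfae.out 0 2).1 fun _ hS => shortExact_map_ev hS V

lemma isIso_of_ev (φ : F ⟶ G) (h : ∀ V, IsIso ((ev d V).map φ)) : IsIso φ := by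
  refine isIso_of_bijective φ fun V => ?_
  have := h V
  exact ConcreteCategory.bijective_of_isIso ((ev d V).map φ)

end ShortExact

end StrictPoly

open StrictPoly

/-- Evaluations preserve homology and jointly detect isomorphisms. This gives access to the
homological algebra of the abelian category. -/
lemma quasiIsos_iff {k : Type u} [Field k] {d : ℕ} {K L : BoundedComplex (StrictPoly k d)}
    (f : K ⟶ L) : quasiIsos k d f ↔ QuasiIso f.hom := by
  constructor
  · intro h
    refine (quasiIso_iff _).2 fun n => ?_
    rw [quasiIsoAt_iff, ShortComplex.quasiIso_iff]
    refine isIso_of_ev _ fun V => ?_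
    have h1 := (quasiIso_iff _).1 (h V) n
    rw [quasiIsoAt_iff, ShortComplex.quasiIso_iff] at h1
    let φ := (HomologicalComplex.shortComplexFunctor (StrictPoly k d) (ComplexShape.up ℤ) n).map f.hom
    let e₁ := ShortComplex.mapHomologyIso
      ((HomologicalComplex.shortComplexFunctor (StrictPoly k d) (ComplexShape.up ℤ) n).obj K.obj)
      (ev d V)
    let e₂ := ShortComplex.mapHomologyIso
      ((HomologicalComplex.shortComplexFunctor (StrictPoly k d) (ComplexShape.up ℤ) n).obj L.obj)
      (ev d V)
    let ψ : (ShortComplex.map _ (ev d V)).homology ⟶ (ShortComplex.map _ (ev d V)).homology :=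
      ShortComplex.homologyMap ((ev d V).mapShortComplex.map φ)
    have h1 : IsIso ψ := h1
    have h2 : ψ ≫ e₂.hom = e₁.hom ≫ (ev d V).map (ShortComplex.homologyMap φ) :=
      ShortComplex.mapHomologyIso_hom_naturality φ (ev d V)
    have h3 : IsIso (e₁.hom ≫ (ev d V).map (ShortComplex.homologyMap φ)) :=
      h2 ▸ inferInstance
    exact IsIso.of_isIso_comp_left e₁.hom _
  · intro h V
    exact HomologicalComplex.quasiIso_map_of_preservesHomology f.hom _

end SPF

namespace SPF

open Limits

namespace StrictPoly

variable {k : Type u} [Field k] {d e e' : ℕ}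

/-! ### Injective objects. -/

section SymTensorExact

variable (m : ℕ) (h : m + e = d)

lemma symTensorMap_comp {F G H : StrictPoly k e} (φ : F ⟶ G) (ψ : G ⟶ H) :
    symTensorMap m h (φ ≫ ψ) = symTensorMap m h φ ≫ symTensorMap m h ψ :=
  (symTensorFunctor m h).map_comp φ ψ

lemma symTensorMap_injective {F G : StrictPoly k e} {φ : F ⟶ G}
    (hφ : ∀ V, Function.Injective (app φ V)) (V : FGModuleCat.{u} k) :
    Function.Injective (app (symTensorMap m h φ) V) :=
  Module.Flat.lTensor_preserves_injective_linearMap (M := symSub k m V) (app φ V) (hφ V)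

lemma symTensorMap_shortExact {F G H : StrictPoly k e} (φ : F ⟶ G) (ψ : G ⟶ H) (w : φ ≫ ψ = 0)
    (hφ : ∀ V, Function.Injective (app φ V)) (hψ : ∀ V, Function.Surjective (app ψ V))
    (hex : ∀ V y, app ψ V y = 0 → ∃ x, app φ V x = y) :
    (ShortComplex.mk (symTensorMap m h φ) (symTensorMap m h ψ)
      ((symTensorMap_comp m h φ ψ).symm.trans
        ((congrArg _ w).trans ((symTensorFunctor m h).map_zero _ _)))).ShortExact := by
  refine shortExact_mk _ _ _ (symTensorMap_injective m h hφ)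
    (fun V => LinearMap.lTensor_surjective (symSub k m V) (hψ V)) fun V y hy => ?_
  have hE : Function.Exact (app φ V) (app ψ V) := fun y => ⟨hex V y, by
    rintro ⟨x, rfl⟩
    exact congrArg (fun q => app q V x) w⟩
  exact (lTensor_exact (symSub k m V) hE (hψ V) y).1 hy

lemma wtMap_injective {F G : StrictPoly k d} {φ : F ⟶ G}
    (hφ : ∀ V, Function.Injective (app φ V)) (V : FGModuleCat.{u} k) :
    Function.Injective (app (wtMap m h φ) V) := by
  intro x y hxy
  refine F.wtI_val_injective m (hφ (plusObj V) ?_)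
  have := congrArg (G.wtι V m h) hxy
  rwa [wtι_wtMap, wtι_wtMap] at this

/-- A functor with a left adjoint that preserves monomorphisms preserves injectives. Here the
adjoint morphism is extended along `W_m` of the given monomorphism and carried back by the unit. -/
instance injective_symTensor (G : StrictPoly k e) [Injective G] : Injective (symTensor m h G) where
  factors {X Y} g f _ := by
    have : Mono (wtMap m h f) := mono_of_injective _ (wtMap_injective m h (injective_of_mono f))
    let b := Injective.factorThru (wtMap m h g ≫ symCounit m h G) (wtMap m h f)
    have hb : wtMap m h f ≫ b = wtMap m h g ≫ symCounit m h G := Injective.comp_factorThru _ _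
    refine ⟨symUnit m h Y ≫ symTensorMap m h b, ?_⟩
    rw [← Category.assoc, ← symUnit_naturality, Category.assoc, ← symTensorMap_comp, hb,
      symTensorMap_comp, ← Category.assoc, symUnit_naturality, Category.assoc, symTriangle,
      Category.comp_id]

end SymTensorExact

section DegreeZero

/-- In degree zero, homogeneity for the scalar `0` reads `F(0 • g) = 0 ^ 0 • F(g) = F(g)`, so `F`
takes the same value on all maps. -/
lemma map_eq_lin_zero (F : StrictPoly k 0) (S : Type u) [CommRing S] [Algebra k S]
    {V W : FGModuleCat.{u} k} (f : S ⊗[k] V →ₗ[S] S ⊗[k] W) :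
    F.map S f = (F.lin (0 : V →ₗ[k] W)).baseChange S := by
  have h (g : S ⊗[k] V →ₗ[S] S ⊗[k] W) : F.map S (0 : S ⊗[k] V →ₗ[S] S ⊗[k] W) = F.map S g := by
    have := F.map_smul S (0 : S) g
    rwa [pow_zero, one_smul, zero_smul] at this
  rw [← h, ← map_baseChange, LinearMap.baseChange_zero]

lemma lin_zero_eq_id (F : StrictPoly k 0) (V : FGModuleCat.{u} k) :
    F.lin (0 : V →ₗ[k] V) = LinearMap.id := by
  have h := F.map_eq_lin_zero k (LinearMap.id : k ⊗[k] V →ₗ[k] k ⊗[k] V)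
  rw [F.map_id] at h
  exact LinearMap.ext fun x => tmul_injective (k := k) (LinearMap.congr_fun h (1 ⊗ₜ x)).symm

/-- Functors of degree zero are constant up to canonical isomorphism, so the extension problem is
one of linear algebra at the zero space `Z`. -/
lemma injective_of_degree_zero (I : StrictPoly k 0) : Injective I where
  factors {X Y} g f _ := by
    let Z : FGModuleCat.{u} k := FGModuleCat.of k PUnit
    obtain ⟨l, hl⟩ := (app f Z).exists_leftInverse_of_injective
      (LinearMap.ker_eq_bot.2 (injective_of_mono f Z))
    have hcomp (F : StrictPoly k 0) {U V W : FGModuleCat.{u} k} (x : F.obj U) :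
        F.lin (0 : V →ₗ[k] W) (F.lin (0 : U →ₗ[k] V) x) = F.lin (0 : U →ₗ[k] W) x := by
      rw [← LinearMap.comp_apply, ← lin_comp, LinearMap.comp_zero]
    refine ⟨mkHom (fun V => I.lin (0 : Z →ₗ[k] V) ∘ₗ app g Z ∘ₗ l ∘ₗ Y.lin (0 : V →ₗ[k] Z))
      fun S _ _ V W q => ?_, hom_ext fun V => LinearMap.ext fun x => ?_⟩
    · rw [map_eq_lin_zero, map_eq_lin_zero, ← LinearMap.baseChange_comp, ← LinearMap.baseChange_comp]
      congr 1
      refine LinearMap.ext fun y => ?_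
      simp only [LinearMap.comp_apply, hcomp]
    · rw [app_comp, app_mkHom]
      simp only [LinearMap.comp_apply]
      rw [← app_lin f (0 : V →ₗ[k] Z) x]
      have := LinearMap.congr_fun hl (X.lin (0 : V →ₗ[k] Z) x)
      rw [LinearMap.comp_apply] at this
      rw [this, LinearMap.id_apply, app_lin, hcomp, lin_zero_eq_id, LinearMap.id_apply]

end DegreeZero

/-- Without positive weights, `F` does not see the summand `k` of `V ⊕ k`, hence is unchanged when a
map of rank one is added to its argument. Removing the rank-one terms of the identity gives `F(id) =
F(0)`, which is zero in positive degree. -/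
lemma ExpLE.eq_zero {F : StrictPoly k d} (hF : F.ExpLE 0) (hd : d ≠ 0) (V : FGModuleCat.{u} k)
    (x : F.obj V) : x = 0 := by
  have h1 (V : FGModuleCat.{u} k) : F.lin (inV V ∘ₗ prV V) = LinearMap.id := by
    refine LinearMap.ext fun y => tmul_injective (k := k) ?_
    have := map_eq_of_wt_zero (F := F) (S := k) (y := 1 ⊗ₜ[k] y) fun l hl => by
      rw [hF V l (Nat.pos_of_ne_zero hl), LinearMap.baseChange_zero, LinearMap.zero_apply]
    have h2 : rinV V k ∘ₗ rprV V k = (inV V ∘ₗ prV V).baseChange k := by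
      rw [LinearMap.baseChange_comp]; rfl
    rw [h2, map_baseChange, LinearMap.baseChange_tmul] at this
    exact this
  have h2 (f : V →ₗ[k] V) (l : V →ₗ[k] k) (v : V) : F.lin (f + l.smulRight v) = F.lin f := by
    let p : V →ₗ[k] plusObj V := LinearMap.prod LinearMap.id l
    let q : plusObj V →ₗ[k] V := LinearMap.coprod f (LinearMap.toSpanSingleton k V v)
    have e1 : f + l.smulRight v = q ∘ₗ p := LinearMap.ext fun x => rfl
    have e2 : f = q ∘ₗ (inV V ∘ₗ prV V) ∘ₗ p := LinearMap.ext fun x => by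
      change f x = f x + (0 : k) • v
      rw [zero_smul, add_zero]
    conv_rhs => rw [e2, lin_comp, lin_comp, h1, LinearMap.id_comp, ← lin_comp]
    rw [e1]
  let b := Module.finBasis k V
  have h3 (s : Finset (Fin (Module.finrank k V))) :
      F.lin (∑ i ∈ s, (b.coord i).smulRight (b i)) = F.lin (0 : V →ₗ[k] V) := by
    classical
    induction s using Finset.induction_on with
    | empty => rw [Finset.sum_empty]
    | insert i s hi ih => rw [Finset.sum_insert hi, add_comm, h2, ih]
  have h4 : ∑ i, (b.coord i).smulRight (b i) = (LinearMap.id : V →ₗ[k] V) :=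
    LinearMap.ext fun v => by simp [LinearMap.sum_apply, b.sum_repr]
  have h5 : F.lin (0 : V →ₗ[k] V) = 0 := by
    refine LinearMap.ext fun y => tmul_injective (k := k) ?_
    have := LinearMap.congr_fun (F.map_smul k (0 : k) (0 : k ⊗[k] V →ₗ[k] k ⊗[k] V)) (1 ⊗ₜ y)
    rw [zero_pow hd, zero_smul, zero_smul, ← LinearMap.baseChange_zero, map_baseChange,
      LinearMap.baseChange_tmul] at this
    change (1 : k) ⊗ₜ[k] _ = (1 : k) ⊗ₜ[k] _
    rw [this]; simp
  have h6 := h3 Finset.univ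
  rw [h4, h5, lin_id] at h6
  exact LinearMap.congr_fun h6 x

section EnoughInjectives

/-- The common kernel of the units for `m ≥ 1` is a subfunctor. It has no positive weights by
`eq_zero_of_symUnit`, so it vanishes by `ExpLE.eq_zero`. -/
lemma eq_zero_of_symUnit_eq_zero (hd : d ≠ 0) {V : FGModuleCat.{u} k} {F : StrictPoly k d}
    (x : F.obj V) (hx : ∀ (m e : ℕ) (h : m + e = d), m ≠ 0 → app (symUnit m h F) V x = 0) :
    x = 0 := by
  -- The index `i` stands for `m = i + 1`, which runs over `1, …, d`.
  let φ (i : Fin d) : F ⟶ symTensor (i + 1) _ (wtObj (i + 1) _ F) :=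
    symUnit (i + 1) (by omega : (i + 1 : ℕ) + (d - (i + 1)) = d) F
  obtain ⟨y, rfl⟩ := exists_kerι φ V x fun i => hx _ _ _ (Nat.succ_ne_zero _)
  have hK : (kerFun φ).ExpLE 0 := fun V n hn => LinearMap.ext fun z => by
    by_cases hnd : n ≤ d
    · refine kerι_injective φ _ ?_
      rw [LinearMap.zero_apply, map_zero]
      obtain ⟨n, rfl⟩ := Nat.exists_eq_add_of_lt hn
      have h0 := app_kerι φ ⟨0 + n, by omega⟩ (plusObj V) ((kerFun φ).wt V (0 + n + 1) z)
      refine eq_zero_of_symUnit (0 + n + 1) _ ?_ h0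
      rw [app_wt_apply, wt_same]
    · rw [wt_eq_zero _ (by omega), LinearMap.zero_apply]
  rw [hK.eq_zero hd V y, map_zero]

/-- For `m ≥ 1` the functor `W_m F` has smaller degree and embeds into an injective `J`. The
functors `Sym^m ⊗ J` are injective, and the units embed `F` into their product. -/
instance enoughInjectives (d : ℕ) : EnoughInjectives (StrictPoly k d) := by
  induction d using Nat.strong_induction_on with
  | _ d ih =>
  refine ⟨fun F => ?_⟩
  by_cases hd : d = 0
  · subst hd
    exact ⟨⟨F, injective_of_degree_zero F, 𝟙 F, inferInstance⟩⟩
  have h (i : Fin d) : (i + 1 : ℕ) + (d - (i + 1)) = d := by omega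
  have h2 (i : Fin d) : ∃ (J : StrictPoly k (d - (i + 1))) (f : wtObj (i + 1) (h i) F ⟶ J),
      Injective J ∧ Mono f :=
    have := ih (d - (i + 1)) (by omega)
    ⟨_, Injective.ι _, inferInstance, inferInstance⟩
  choose J ι hJ hι using h2
  let I (i : Fin d) : StrictPoly k d := symTensor (i + 1) (h i) (J i)
  have hI (i : Fin d) : Injective (I i) :=
    have := hJ i
    injective_symTensor _ _ _
  let φ : F ⟶ ∏ᶜ I := Pi.lift fun i => symUnit (i + 1) (h i) F ≫ symTensorMap (i + 1) (h i) (ι i)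
  refine ⟨⟨∏ᶜ I, inferInstance, φ, mono_of_injective _ fun V => ?_⟩⟩
  refine (injective_iff_map_eq_zero _).2 fun x hx => eq_zero_of_symUnit_eq_zero hd x ?_
  intro m e hme hm
  obtain ⟨i, rfl⟩ := Nat.exists_eq_succ_of_ne_zero hm
  obtain rfl : e = d - (i + 1) := by omega
  let j : Fin d := ⟨i, by omega⟩
  have h1 := congrArg (app (Pi.π I j) V) hx
  rw [map_zero, ← LinearMap.comp_apply, ← app_comp, Pi.lift_π, app_comp, LinearMap.comp_apply] at h1
  have := hι j
  exact symTensorMap_injective _ _ (injective_of_mono (ι j)) V (h1.trans (map_zero _).symm)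

end EnoughInjectives

end StrictPoly

end SPF

namespace SPF

open Limits

namespace StrictPoly

variable {k : Type u} [Field k] {d e e' : ℕ}

/-! ### Finite injective dimension in exact sequences. -/

section FiniteInjectiveDimension

/-- The functors of finite injective dimension. -/
def FinInj (F : StrictPoly k d) : Prop := ∃ n, HasInjectiveDimensionLT F n

lemma FinInj.of_injective (F : StrictPoly k d) [Injective F] : FinInj F := ⟨1, inferInstance⟩

lemma FinInj.of_bijective {F G : StrictPoly k d} (φ : F ⟶ G)
    (hφ : ∀ V, Function.Bijective (app φ V)) (hF : FinInj F) : FinInj G := by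
  obtain ⟨n, hn⟩ := hF
  have := isIso_of_bijective φ hφ
  exact ⟨n, hasInjectiveDimensionLT_of_iso (asIso φ) n⟩

lemma FinInj.of_bijective' {F G : StrictPoly k d} (φ : F ⟶ G)
    (hφ : ∀ V, Function.Bijective (app φ V)) (hG : FinInj G) : FinInj F := by
  obtain ⟨n, hn⟩ := hG
  have := isIso_of_bijective φ hφ
  exact ⟨n, hasInjectiveDimensionLT_of_iso (asIso φ).symm n⟩

lemma FinInj.of_forall_eq_zero {F : StrictPoly k d} (hF : ∀ V (x : F.obj V), x = 0) : FinInj F :=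
  ⟨0, ((IsZero.iff_id_eq_zero F).2 (hom_ext fun V => LinearMap.ext fun x =>
    (hF V x).trans (hF V _).symm)).hasInjectiveDimensionLT_zero⟩

lemma FinInj.X₂ {S : ShortComplex (StrictPoly k d)} (hS : S.ShortExact) (h₁ : FinInj S.X₁)
    (h₃ : FinInj S.X₃) : FinInj S.X₂ := by
  obtain ⟨m, hm⟩ := h₁
  obtain ⟨n, hn⟩ := h₃
  exact ⟨m + n, hS.hasInjectiveDimensionLT_X₂ _ inferInstance inferInstance⟩

lemma FinInj.X₁ {S : ShortComplex (StrictPoly k d)} (hS : S.ShortExact) (h₂ : FinInj S.X₂)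
    (h₃ : FinInj S.X₃) : FinInj S.X₁ := by
  obtain ⟨m, hm⟩ := h₂
  obtain ⟨n, hn⟩ := h₃
  exact ⟨m + n + 1, hS.hasInjectiveDimensionLT_X₁ _ inferInstance inferInstance⟩

variable {K F G : StrictPoly k d}

/-- The four-term exact sequence of `κ`, `φ` and the cokernel of `φ` is cut at the image of `φ`. The
image has finite injective dimension as the kernel of the epimorphism from `G` to the cokernel. -/
lemma exists_image (κ : K ⟶ F) (φ : F ⟶ G) (hκ : ∀ V, Function.Injective (app κ V))
    (hex : ∀ V y, app φ V y = 0 ↔ ∃ x, app κ V x = y) (hG : FinInj G) (hC : FinInj (cokFun φ)) :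
    ∃ S : ShortComplex (StrictPoly k d), S.ShortExact ∧ S.X₁ = K ∧ S.X₂ = F ∧ FinInj S.X₃ := by
  let ι := kerι (fun _ : Unit => cokπ φ)
  obtain ⟨p, hp⟩ := exists_lift ι (kerι_injective _) φ fun V x =>
    exists_kerι _ V _ fun _ => (cokπ_eq_zero φ V _).2 ⟨x, rfl⟩
  have hp' (V x) : app ι V (app p V x) = app φ V x := congrArg (fun q => app q V x) hp
  have h0 : FinInj (kerFun (fun _ : Unit => cokπ φ)) :=
    FinInj.X₁ (shortExact_mk ι (cokπ φ) (hom_ext fun V => LinearMap.ext fun x =>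
      app_kerι (fun _ : Unit => cokπ φ) () V x) (kerι_injective _) (cokπ_surjective φ)
      fun V y hy => exists_kerι _ V y fun _ => hy) hG hC
  refine ⟨ShortComplex.mk κ p (hom_ext fun V => LinearMap.ext fun x => kerι_injective _ V ?_),
    shortExact_mk _ _ _ hκ (fun V y => ?_) (fun V y hy => ?_), rfl, rfl, h0⟩
  · change app ι V (app p V (app κ V x)) = app ι V 0
    rw [hp', map_zero]
    exact (hex V _).2 ⟨x, rfl⟩
  · obtain ⟨x, hx⟩ := (cokπ_eq_zero φ V _).1 (app_kerι (fun _ : Unit => cokπ φ) () V y)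
    exact ⟨x, kerι_injective _ V ((hp' V x).trans hx)⟩
  · refine (hex V y).1 ?_
    rw [← hp', hy, map_zero]

lemma FinInj.of_cok (κ : K ⟶ F) (φ : F ⟶ G) (hκ : ∀ V, Function.Injective (app κ V))
    (hex : ∀ V y, app φ V y = 0 ↔ ∃ x, app κ V x = y) (hG : FinInj G) (hC : FinInj (cokFun φ)) :
    FinInj F ↔ FinInj K := by
  obtain ⟨S, hS, rfl, rfl, h3⟩ := exists_image κ φ hκ hex hG hC
  exact ⟨fun h => FinInj.X₁ hS h h3, fun h => FinInj.X₂ hS h h3⟩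

/-- Dimension shifting: `Sym^m ⊗ -` is exact and preserves injectives. -/
lemma FinInj.symTensor {G : StrictPoly k e} (hG : FinInj G) (m : ℕ) (h : m + e = d) :
    FinInj (symTensor m h G) := by
  obtain ⟨n, hn⟩ := hG
  -- With the bound `n + 1` the induction starts at an injective object.
  have hn1 : HasInjectiveDimensionLT G (n + 1) := hasInjectiveDimensionLT_of_ge G n (n + 1) (by omega)
  clear hn
  induction n generalizing G with
  | zero =>
    have : Injective G := injective_iff_hasInjectiveDimensionLT_one.2 hn1
    exact FinInj.of_injective _
  | succ n ih =>
    let I := Injective.under G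
    let ι : G ⟶ I := Injective.ι G
    have hι := injective_of_mono ι
    have hS := shortExact_mk ι (cokπ ι) (comp_cokπ ι) hι (cokπ_surjective ι)
      fun V y hy => (cokπ_eq_zero ι V y).1 hy
    have hC : HasInjectiveDimensionLT (cokFun ι) (n + 1) :=
      hS.hasInjectiveDimensionLT_X₃ (n + 1) (inferInstanceAs (HasInjectiveDimensionLT I (n + 1))) hn1
    exact FinInj.X₁ (symTensorMap_shortExact m h ι (cokπ ι) (comp_cokπ ι) hι (cokπ_surjective ι)
      fun V y hy => (cokπ_eq_zero ι V y).1 hy) (FinInj.of_injective (SPF.StrictPoly.symTensor m h I)) (ih hC)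

end FiniteInjectiveDimension

/-! ### The filtration by `prim` and the finiteness theorem. -/

section Primitive

/-- The subfunctor of `Sym^m ⊗ G` on which the comultiplications `Sym^m ⊗ G → Sym^{m + j} ⊗ W_j G`
vanish for `j > i`. -/
def prim (i m : ℕ) (h : m + e = d) (G : StrictPoly k e) : StrictPoly k d :=
  kerFun fun j : {j : ℕ // i < j ∧ j ≤ e} =>
    comul h (by have := j.2.2; omega : (m + j.1) + (e - j.1) = d) (Nat.add_sub_of_le j.2.2) G rfl

/-- The inclusion of `prim`. -/
def primι (i m : ℕ) (h : m + e = d) (G : StrictPoly k e) : prim i m h G ⟶ symTensor m h G :=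
  kerι _

variable (i m : ℕ) (h : m + e = d) (G : StrictPoly k e)

lemma primι_injective (V : FGModuleCat.{u} k) : Function.Injective (app (primι i m h G) V) :=
  kerι_injective _ V

lemma comul_primι (V : FGModuleCat.{u} k) (x : (prim i m h G).obj V) (j e₁ m₁ : ℕ)
    (h₁ : m₁ + e₁ = d) (hj : j + e₁ = e) (hm₁ : m + j = m₁) (hij : i < j) :
    app (comul h h₁ hj G hm₁) V (app (primι i m h G) V x) = 0 := by
  subst hm₁
  obtain rfl : e₁ = e - j := by omega
  exact app_kerι (fun j : {j : ℕ // i < j ∧ j ≤ e} =>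
    comul h (by have := j.2.2; omega : (m + j.1) + (e - j.1) = d) (Nat.add_sub_of_le j.2.2) G rfl)
    ⟨j, hij, by omega⟩ V x

lemma exists_primι (V : FGModuleCat.{u} k) (x : (symTensor m h G).obj V)
    (hx : ∀ (j e₁ m₁ : ℕ) (h₁ : m₁ + e₁ = d) (hj : j + e₁ = e) (hm₁ : m + j = m₁), i < j →
      app (comul h h₁ hj G hm₁) V x = 0) : ∃ y, app (primι i m h G) V y = x :=
  exists_kerι _ V x fun j => hx _ _ _ _ _ _ j.2.1

/-- The comultiplication for `j = i + 1` maps `prim (i + 1)` to `prim 0` by `comul_comul_eq_zero`,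
and its kernel is `prim i` by definition. The cokernel has weights at most `t`, hence finite
injective dimension, and `FinInj.of_cok` applies. -/
lemma finInj_prim_succ_iff {t : ℕ} (ht : ∀ C : StrictPoly k d, C.ExpLE t → FinInj C)
    (hG : G.ExpLE (t + 1)) {m' e' : ℕ} (h' : m' + e' = d) (hi : (i + 1) + e' = e)
    (hm : m + (i + 1) = m') (hR : FinInj (prim 0 m' h' (wtObj (i + 1) hi G))) :
    FinInj (prim (i + 1) m h G) ↔ FinInj (prim i m h G) := by
  obtain ⟨χ, hχ⟩ := exists_lift (primι 0 m' h' (wtObj (i + 1) hi G)) (primι_injective _ _ _ _)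
    (primι (i + 1) m h G ≫ comul h h' hi G hm) fun V x =>
      exists_primι _ _ _ _ V _ fun l e₁ m₁ h₁ hl hm₁ h0 => by
        rw [app_comp, LinearMap.comp_apply]
        exact comul_comul_eq_zero h h' hi G hm h₁ hl hm₁ h0.ne' _
          fun j e₂ m₂ h₂ hj hm₂ hij => comul_primι _ _ _ _ V x _ _ _ _ _ _ hij
  have hχ' (V x) : app (primι 0 m' h' (wtObj (i + 1) hi G)) V (app χ V x) =
      app (comul h h' hi G hm) V (app (primι (i + 1) m h G) V x) :=
    congrArg (fun q => app q V x) hχ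
  obtain ⟨κ, hκ⟩ := exists_lift (primι (i + 1) m h G) (primι_injective _ _ _ _) (primι i m h G)
    fun V x => exists_primι _ _ _ _ V _ fun l e₁ m₁ h₁ hl hm₁ h0 =>
      comul_primι _ _ _ _ V x _ _ _ _ _ _ (by omega)
  have hκ' (V x) : app (primι (i + 1) m h G) V (app κ V x) = app (primι i m h G) V x :=
    congrArg (fun q => app q V x) hκ
  refine FinInj.of_cok κ χ (fun V x y hxy => ?_) (fun V y => ⟨fun hy => ?_, ?_⟩) hR (ht _ ?_)
  · refine primι_injective _ _ _ _ V ?_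
    rw [← hκ', ← hκ', hxy]
  · obtain ⟨x, hx⟩ := exists_primι i m h G V (app (primι (i + 1) m h G) V y)
      fun l e₁ m₁ h₁ hl hm₁ h0 => by
        obtain h2 | h2 := Nat.lt_or_eq_of_le (Nat.succ_le_of_lt h0)
        · exact comul_primι _ _ _ _ V y _ _ _ _ _ _ h2
        · subst hm₁
          subst hm
          obtain rfl : l = i + 1 := h2.symm
          obtain rfl : e₁ = e' := by omega
          rw [← hχ', hy, map_zero]
    exact ⟨x, primι_injective _ _ _ _ V ((hκ' V x).trans hx)⟩
  · rintro ⟨x, rfl⟩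
    refine primι_injective _ _ _ _ V ?_
    rw [hχ', hκ', map_zero]
    exact comul_primι _ _ _ _ V x _ _ _ _ _ _ (Nat.lt_succ_self i)
  -- A weight `n > t` is at least `t + 1`, so it dominates all weights of `G`; `exists_comul_eq`
  -- then gives a preimage of every element of weight `n`, and the cokernel has no such weight.
  · intro V n hn
    refine LinearMap.ext fun y => ?_
    obtain ⟨w, rfl⟩ := cokπ_surjective χ _ y
    rw [← app_wt_apply, LinearMap.zero_apply, cokπ_eq_zero]
    set w' := (prim 0 m' h' (wtObj (i + 1) hi G)).wt V n w with hw'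
    obtain ⟨x, hx1, hx2⟩ := exists_comul_eq h h' hi G hm (hG.mono (by omega : t + 1 ≤ n))
      (app (primι 0 m' h' (wtObj (i + 1) hi G)) _ w') (by rw [← app_wt_apply, hw', wt_same])
      (fun l e₁ m₁ h₁ hl hm₁ h0 => comul_primι _ _ _ _ _ w' _ _ _ _ _ _ (Nat.pos_of_ne_zero h0))
    obtain ⟨z, rfl⟩ := exists_primι (i + 1) m h G _ x hx2
    exact ⟨z, primι_injective _ _ _ _ _ ((hχ' _ _).trans hx1)⟩

/-- Descend from `prim e`, which is the whole of `Sym^m ⊗ G`, to `prim 0`. Each step involves a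
`prim 0` for some `W_{q+1} G`, of smaller degree and with weights bounded as before. As `m` is
positive, `G` has degree less than `d`, so the induction on the degree applies to `Sym^m ⊗ G`. -/
lemma finInj_prim {t : ℕ} (ih : ∀ e, e < d → ∀ G : StrictPoly k e, FinInj G)
    (ht : ∀ C : StrictPoly k d, C.ExpLE t → FinInj C) {e : ℕ} (m : ℕ) (h : m + e = d)
    (hm : t + 1 ≤ m) (G : StrictPoly k e) (hG : G.ExpLE (t + 1)) : FinInj (prim 0 m h G) := by
  induction e using Nat.strong_induction_on generalizing m with
  | _ e ihe =>
  have key (i : ℕ) (hi : i ≤ e) : FinInj (prim (e - i) m h G) := by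
    induction i with
    | zero =>
      -- No `j ≤ e` exceeds `e`, so there is no condition to satisfy.
      refine FinInj.of_bijective' (primι (e - 0) m h G) (fun V => ⟨primι_injective _ _ _ _ V,
        fun x => exists_primι _ _ _ _ V x fun j e₁ m₁ h₁ hj hm₁ hij => by omega⟩) ?_
      exact FinInj.symTensor (ih e (by omega) G) m h
    | succ i ihi =>
      have h1 := ihi (by omega)
      obtain ⟨q, hq⟩ : ∃ q, e = q + (i + 1) := ⟨e - (i + 1), by omega⟩
      have e1 : e - i = q + 1 := by omega
      have e2 : e - (i + 1) = q := by omega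
      rw [e1] at h1
      rw [e2]
      exact (finInj_prim_succ_iff q m h G ht hG (m' := m + (q + 1)) (e' := i) (by omega) (by omega)
        rfl (ihe i (by omega) _ _ (by omega) _ (hG.wtObj _))).1 h1
  have := key e le_rfl
  rwa [Nat.sub_self] at this

/-- If the weights of `F` are at most `t + 1`, then `F` is `Sym^0 ⊗ F = prim (t + 1)`, and it
suffices to treat `prim t`. On `prim t` the units for `n > t` vanish, so there are no weights above
`t` and the induction on `t` applies. -/
lemma finInj_of_expLE (hd : d ≠ 0) (ih : ∀ e, e < d → ∀ G : StrictPoly k e, FinInj G) (t : ℕ)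
    (F : StrictPoly k d) (hF : F.ExpLE t) : FinInj F := by
  induction t generalizing F with
  | zero => exact FinInj.of_forall_eq_zero (hF.eq_zero hd)
  | succ t iht =>
    by_cases htd : t + 1 ≤ d
    swap
    · exact iht F (expLE_self.mono (by omega))
    refine FinInj.of_bijective' (toSymZero F) (toSymZero_bijective F) ?_
    refine FinInj.of_bijective (primι (t + 1) 0 (Nat.zero_add d) F) (fun V => ⟨primι_injective _ _ _ _ V,
        fun x => exists_primι _ _ _ _ V x fun j e₁ m₁ h₁ hj hm₁ hij => ?_⟩) ?_
    · refine stι_injective _ h₁ _ ?_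
      rw [stι_comul, map_zero, wtπ_eq_zero_iff hj, hF V j hij, LinearMap.baseChange_zero,
        LinearMap.zero_apply]
    · refine (finInj_prim_succ_iff t 0 _ F iht hF (by omega : (t + 1) + (d - (t + 1)) = d) (by omega)
        (by omega) (finInj_prim ih iht _ _ le_rfl _ (hF.wtObj _))).2 (iht _ fun V n hn => ?_)
      refine LinearMap.ext fun z => ?_
      by_cases hnd : n ≤ d
      swap
      · rw [wt_eq_zero _ (by omega), LinearMap.zero_apply]
      refine primι_injective _ _ _ _ _ ?_
      obtain ⟨y, hy⟩ := (toSymZero_bijective F (plusObj V)).2 (app (primι t 0 (Nat.zero_add d) F) _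
        ((prim t 0 (Nat.zero_add d) F).wt V n z))
      have hy1 : F.wt V n y = y := by
        refine (toSymZero_bijective F (plusObj V)).1 ?_
        rw [app_wt_apply, hy, ← app_wt_apply, wt_same]
      have hy2 := eq_zero_of_symUnit n (by omega : n + (d - n) = d) hy1 (by
        rw [symUnit, app_comp, LinearMap.comp_apply, hy]
        exact comul_primι _ _ _ _ _ _ _ _ _ _ _ _ hn)
      rw [← hy, hy2, map_zero, LinearMap.zero_apply, map_zero]

/-- Strict polynomial functors have finite injective dimension. -/
theorem finInj (F : StrictPoly k d) : FinInj F := by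
  induction d using Nat.strong_induction_on with
  | _ d ih =>
  by_cases hd : d = 0
  · subst hd
    have := injective_of_degree_zero F
    exact FinInj.of_injective F
  · exact finInj_of_expLE hd ih d F expLE_self

end Primitive

end StrictPoly

end SPF

namespace SPF

open Limits

universe v w v' w' v'' w''

/-! ### Bounded injective resolutions of bounded complexes. -/

namespace BoundedComplex

variable {C : Type w} [Category.{v} C] [Abelian C]

section Resolution

lemma exists_isStrictlyGE (K : BoundedComplex C) : ∃ a, K.obj.IsStrictlyGE a := by
  obtain ⟨a, b, h⟩ := K.property
  exact ⟨a, (CochainComplex.isStrictlyGE_iff _ _).2 fun i hi => h i (Or.inl hi)⟩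

lemma exists_isStrictlyLE (K : BoundedComplex C) : ∃ b, K.obj.IsStrictlyLE b := by
  obtain ⟨a, b, h⟩ := K.property
  exact ⟨b, (CochainComplex.isStrictlyLE_iff _ _).2 fun i hi => h i (Or.inr hi)⟩

/-- The complexes with injective terms. -/
def IsInj (J : BoundedComplex C) : Prop := ∀ n, Injective (J.obj.X n)

lemma IsInj.isKInjective {J : BoundedComplex C} (hJ : J.IsInj) : J.obj.IsKInjective := by
  obtain ⟨a, ha⟩ := exists_isStrictlyGE J
  have (n : ℤ) : Injective (J.obj.X n) := hJ n
  exact CochainComplex.isKInjective_of_injective J.obj a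

/-- Exactness in degree `n + 1` gives the short exact sequence of the cycles in degree `n`, the
injective term and the cycles in degree `n + 1`, which lowers the dimension by one. -/
lemma hasInjectiveDimensionLT_cycles (L : CochainComplex C ℤ) (hL : ∀ n, Injective (L.X n))
    (n : ℤ) (N : ℕ) (h : L.ExactAt (n + 1)) (hN : HasInjectiveDimensionLT (L.cycles n) (N + 2)) :
    HasInjectiveDimensionLT (L.cycles (n + 1)) (N + 1) := by
  have w : L.iCycles n ≫ L.toCycles n (n + 1) = 0 := by
    rw [← cancel_mono (L.iCycles (n + 1)), Category.assoc, L.toCycles_i, L.iCycles_d, zero_comp]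
  have he : Epi (L.toCycles n (n + 1)) :=
    Preadditive.epi_of_isZero_cokernel' _ (L.homologyIsCokernel n (n + 1) (by simp))
      ((L.exactAt_iff_isZero_homology _).1 h)
  have hS : (ShortComplex.mk (L.iCycles n) (L.toCycles n (n + 1)) w).ShortExact :=
    { mono_f := inferInstanceAs (Mono (L.iCycles n))
      epi_g := he
      exact := ShortComplex.exact_of_f_is_kernel _
        (isKernelOfComp _ _ (L.cyclesIsKernel n (n + 1) (by simp)) w (L.toCycles_i n (n + 1))) }
  have := hL n
  exact hS.hasInjectiveDimensionLT_X₃ (N + 1)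
    (hasInjectiveDimensionLT_of_ge (L.X n) 1 (N + 1) (by omega)) hN

/-- A bounded below injective model `L` is exact above the top degree `b` of `K`. Each further step
lowers the injective dimension of the cycles, so these become injective after `N` steps, and the
truncation of `L` there is a bounded complex of injectives. -/
lemma exists_injective_resolution [EnoughInjectives C]
    (hfin : ∀ X : C, ∃ n, HasInjectiveDimensionLT X n) (K : BoundedComplex C) :
    ∃ (J : BoundedComplex C) (i : K ⟶ J), J.IsInj ∧ QuasiIso i.hom := by
  obtain ⟨a, ha⟩ := exists_isStrictlyGE K
  obtain ⟨b, hb⟩ := exists_isStrictlyLE K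
  obtain ⟨L, i, hi, hL, hLa⟩ :=
    CochainComplex.Plus.modelCategoryQuillen.exists_quasiIso_injective K.obj a
  have hex (n : ℤ) (hn : b < n) : L.ExactAt n := by
    rw [L.exactAt_iff_isZero_homology]
    have h1 := (quasiIsoAt_iff_isIso_homologyMap i n).1 inferInstance
    exact ((K.obj.exactAt_iff_isZero_homology n).1 (K.obj.exactAt_of_isLE b n hn)).of_iso
      (asIso (HomologicalComplex.homologyMap i n)).symm
  obtain ⟨N, hN⟩ := hfin (L.cycles b)
  have key (j : ℕ) (hj : j ≤ N) : HasInjectiveDimensionLT (L.cycles (b + j)) (N - j + 1) := by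
    induction j with
    | zero =>
      rw [Nat.cast_zero, add_zero]
      exact hasInjectiveDimensionLT_of_ge _ N _ (by omega)
    | succ j ih =>
      have h1 := ih (by omega)
      rw [show N - j + 1 = (N - (j + 1)) + 2 by omega] at h1
      have h2 := hasInjectiveDimensionLT_cycles L hL (b + j) _ (hex _ (by omega)) h1
      rwa [show (b + j + 1 : ℤ) = b + (j + 1 : ℕ) by push_cast; ring] at h2
  have hinj : Injective (L.cycles (b + N)) := by
    have := key N le_rfl
    rw [Nat.sub_self] at this
    exact injective_iff_hasInjectiveDimensionLT_one.2 this
  let n : ℤ := b + N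
  have hK : K.obj.IsStrictlyLE n := K.obj.isStrictlyLE_of_le b n (by omega)
  have hLn : L.IsLE n := (L.isLE_iff n).2 fun i hi => hex i (by omega)
  have h1 : IsIso (K.obj.ιTruncLE n) := (K.obj.isIso_ιTruncLE_iff n).2 hK
  have h2 : QuasiIso (L.ιTruncLE n) := (L.quasiIso_ιTruncLE_iff n).2 hLn
  let J : BoundedComplex C := ⟨L.truncLE n, min a n, n, fun i hi => by
    obtain hi | hi := hi
    · refine IsZero.of_iso ?_ (L.truncLEXIso n i (lt_of_lt_of_le hi (min_le_right a n)))
      exact L.isZero_of_isStrictlyGE a i (lt_of_lt_of_le hi (min_le_left a n))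
    · exact (L.truncLE n).isZero_of_isStrictlyLE n i hi⟩
  -- Since `K` lives in degrees at most `n`, it equals its own truncation, and the truncation of `i`
  -- has source `K`.
  refine ⟨J, ObjectProperty.homMk (inv (K.obj.ιTruncLE n) ≫ CochainComplex.truncLEMap i n),
    fun m => ?_, ?_⟩
  · obtain hm | rfl | hm := lt_trichotomy m n
    · exact Injective.of_iso (L.truncLEXIso n m hm).symm (hL m)
    · exact Injective.of_iso (L.truncLEXIsoCycles _).symm hinj
    · exact ((L.truncLE n).isZero_of_isStrictlyLE n m hm).injective
  · have h3 : (inv (K.obj.ιTruncLE n) ≫ CochainComplex.truncLEMap i n) ≫ L.ιTruncLE n = i := by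
      rw [Category.assoc, CochainComplex.ιTruncLE_naturality, IsIso.inv_hom_id_assoc]
    exact quasiIso_of_comp_right (φ := inv (K.obj.ιTruncLE n) ≫ CochainComplex.truncLEMap i n)
      (φ' := L.ιTruncLE n) (hφφ' := by rw [h3]; exact hi)

end Resolution

/-! ### Morphisms to complexes of injectives in the localization. -/

section Homotopy

/-- The cylinder of a bounded complex is bounded, and its projection is a quasi-isomorphism with
both end inclusions as sections. Any functor inverting quasi-isomorphisms thus identifies the two
inclusions, and with them homotopic maps. -/
lemma map_eq_of_homotopy {D : Type w'} [Category.{v'} D] (F : BoundedComplex C ⥤ D)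
    (hF : ∀ ⦃K L : BoundedComplex C⦄ (f : K ⟶ L), QuasiIso f.hom → IsIso (F.map f))
    {K L : BoundedComplex C} {f g : K ⟶ L} (h : Homotopy f.hom g.hom) : F.map f = F.map g := by
  let Z : BoundedComplex C := ⟨K.obj.cylinder, by
    obtain ⟨a, b, hK⟩ := K.property
    have h2 (i : ℤ) (hi : i < a ∨ b < i) : IsZero ((K.obj ⊞ K.obj).X i) := by
      have := hK i hi
      exact IsZero.of_iso ((biprod_isZero_iff _ _).2 ⟨hK i hi, hK i hi⟩)
        (HomologicalComplex.biprodXIso _ _ i)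
    refine ⟨a - 1, b, fun i hi => IsZero.of_iso ((biprod_isZero_iff _ _).2
      ⟨hK (i + 1) (by omega), h2 i (by omega)⟩)
      (HomologicalComplex.homotopyCofiber.XIsoBiprod (biprod.lift (𝟙 K.obj) (-𝟙 K.obj)) i (i + 1) (by simp))⟩⟩
  let i₀ : K ⟶ Z := ObjectProperty.homMk (HomologicalComplex.cylinder.ι₀ K.obj)
  let i₁ : K ⟶ Z := ObjectProperty.homMk (HomologicalComplex.cylinder.ι₁ K.obj)
  let p : Z ⟶ K := ObjectProperty.homMk (HomologicalComplex.cylinder.π K.obj)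
  let q : Z ⟶ L := ObjectProperty.homMk (HomologicalComplex.cylinder.desc f.hom g.hom h)
  have hp : IsIso (F.map p) := hF p
    (HomologicalComplex.cylinder.homotopyEquiv K.obj (fun n => ⟨n - 1, by simp⟩)).quasiIso_hom
  have e0 : i₀ ≫ p = 𝟙 K := ObjectProperty.hom_ext _ (HomologicalComplex.cylinder.ι₀_π K.obj)
  have e1 : i₁ ≫ p = 𝟙 K := ObjectProperty.hom_ext _ (HomologicalComplex.cylinder.ι₁_π K.obj)
  have e2 : i₀ ≫ q = f := ObjectProperty.hom_ext _ (HomologicalComplex.cylinder.ι₀_desc _ _ _)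
  have e3 : i₁ ≫ q = g := ObjectProperty.hom_ext _ (HomologicalComplex.cylinder.ι₁_desc _ _ _)
  have e4 : F.map i₀ = F.map i₁ := by
    rw [← cancel_mono (F.map p), ← F.map_comp, ← F.map_comp, e0, e1]
  rw [← e2, ← e3, F.map_comp, F.map_comp, e4]

attribute [local instance] HasDerivedCategory.standard in
-- Bounded complexes of injectives are K-injective: the map `s⁻¹ φ` of the unbounded derived
-- category is represented by a chain map, unique up to homotopy.
lemma exists_comp_homotopy {X Y J : BoundedComplex C} (hJ : J.IsInj) (s : X ⟶ Y)
    (hs : QuasiIso s.hom) (φ : X ⟶ J) : ∃ g : Y ⟶ J, Nonempty (Homotopy (s ≫ g).hom φ.hom) := by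
  have := hJ.isKInjective
  have : IsIso (DerivedCategory.Q.map s.hom) := (DerivedCategory.isIso_Q_map_iff_quasiIso C s.hom).2 hs
  let q : DerivedCategory.Q.obj Y.obj ⟶ DerivedCategory.Q.obj J.obj :=
    inv (DerivedCategory.Q.map s.hom) ≫ DerivedCategory.Q.map φ.hom
  obtain ⟨g, hg⟩ := (CochainComplex.IsKInjective.Qh_map_bijective
    ((HomotopyCategory.quotient C _).obj Y.obj) J.obj).2 q
  obtain ⟨g, rfl⟩ := (HomotopyCategory.quotient C _).map_surjective g
  refine ⟨ObjectProperty.homMk g, ⟨HomotopyCategory.homotopyOfEq _ _ ?_⟩⟩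
  refine (CochainComplex.IsKInjective.Qh_map_bijective _ J.obj).1 ?_
  change DerivedCategory.Q.map (s.hom ≫ g) = DerivedCategory.Q.map φ.hom
  change DerivedCategory.Q.map g = q at hg
  rw [Functor.map_comp, hg, IsIso.hom_inv_id_assoc]

variable {D : Type w'} [Category.{v'} D] (L : BoundedComplex C ⥤ D)
  (W : MorphismProperty (BoundedComplex C)) [L.IsLocalization W]
  (hW : ∀ ⦃K L : BoundedComplex C⦄ (f : K ⟶ L), W f ↔ QuasiIso f.hom)

include hW in
lemma localization_map_eq {K K' : BoundedComplex C} {f g : K ⟶ K'} (h : Homotopy f.hom g.hom) :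
    L.map f = L.map g :=
  map_eq_of_homotopy L (fun _ _ f hf => Localization.inverts L W f ((hW f).2 hf)) h

include hW in
-- A morphism of the localization is a zigzag. Working back from the target `J`, every inverted
-- quasi-isomorphism is removed by `exists_comp_homotopy`.
lemma exists_map_eq {X J : BoundedComplex C} (hJ : J.IsInj) (f : L.obj X ⟶ L.obj J) :
    ∃ φ : X ⟶ J, L.map φ = f := by
  suffices h : ∀ g : CostructuredArrow L (L.obj J), ∃ φ : g.left ⟶ J, L.map φ = g.hom from
    h (CostructuredArrow.mk f)
  refine fun g => Localization.induction_costructuredArrow L W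
    (fun g : CostructuredArrow L (L.obj J) => ∃ φ : g.left ⟶ J, L.map φ = g.hom)
    ⟨𝟙 J, L.map_id J⟩ ?_ ?_ g
  · rintro X₁ X₂ g ψ ⟨φ, hφ⟩
    have hφ : L.map φ = ψ := hφ
    exact ⟨g ≫ φ, (L.map_comp _ _).trans (by rw [hφ]; rfl)⟩
  · rintro X₁ X₂ s hs ψ ⟨φ, hφ⟩
    have hφ : L.map φ = ψ := hφ
    obtain ⟨g, ⟨hg⟩⟩ := exists_comp_homotopy hJ s ((hW s).1 hs) φ
    refine ⟨g, ?_⟩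
    change L.map g = (Localization.isoOfHom L W s hs).inv ≫ ψ
    rw [← hφ, Iso.eq_inv_comp, Localization.isoOfHom_hom, ← L.map_comp]
    exact localization_map_eq L W hW hg

attribute [local instance] HasDerivedCategory.standard in
include hW in
lemma homotopy_of_map_eq {X J : BoundedComplex C} (hJ : J.IsInj) {φ φ' : X ⟶ J}
    (h : L.map φ = L.map φ') : Nonempty (Homotopy φ.hom φ'.hom) := by
  have := hJ.isKInjective
  have hinv : W.IsInvertedBy ((boundedComplexes C).ι ⋙ DerivedCategory.Q) := fun _ _ f hf => by
    have := (hW f).1 hf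
    exact inferInstanceAs (IsIso (DerivedCategory.Q.map f.hom))
  have h1 : ((boundedComplexes C).ι ⋙ DerivedCategory.Q).map φ =
      ((boundedComplexes C).ι ⋙ DerivedCategory.Q).map φ' := by
    rw [← NatIso.naturality_1 (Localization.fac _ hinv L) φ,
      ← NatIso.naturality_1 (Localization.fac _ hinv L) φ', Functor.comp_map, Functor.comp_map, h]
  exact ⟨HomotopyCategory.homotopyOfEq _ _
    ((CochainComplex.IsKInjective.Qh_map_bijective _ J.obj).1 h1)⟩

end Homotopy

end BoundedComplex

end SPF

namespace SPF

open Limits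

universe v w v' w' v'' w''

/-! ### Right derived functors by bounded injective resolutions. -/

namespace BoundedComplex

variable {C : Type w} [Category.{v} C] [Abelian C] {D : Type w'} [Category.{v'} D]
  {L : BoundedComplex C ⥤ D} (W : MorphismProperty (BoundedComplex C)) [L.IsLocalization W]
  (hW : ∀ ⦃K L : BoundedComplex C⦄ (f : K ⟶ L), W f ↔ QuasiIso f.hom)
  {H : Type w''} [Category.{v''} H] {F : BoundedComplex C ⥤ H}
  (hF : ∀ ⦃K K' : BoundedComplex C⦄ ⦃f g : K ⟶ K'⦄, Homotopy f.hom g.hom → F.map f = F.map g)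

section

variable {W} {J : BoundedComplex C} (hJ : J.IsInj)

/-- A functor `RF` with `F ⟶ L ⋙ RF` which is an isomorphism at a complex with injective terms is
a pointwise right derived functor of `F` at this complex. -/
def isPointwiseLeftKanExtensionAt (hW : ∀ ⦃K L : BoundedComplex C⦄ (f : K ⟶ L), W f ↔ QuasiIso f.hom)
    (hJ : J.IsInj) {RF : D ⥤ H} (α : F ⟶ L ⋙ RF) (q : RF.obj (L.obj J) ⟶ F.obj J)
    (hq : α.app J ≫ q = 𝟙 _) (hq' : q ≫ α.app J = 𝟙 _) :
    (Functor.LeftExtension.mk RF α).IsPointwiseLeftKanExtensionAt (L.obj J) where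
  desc s := q ≫ s.ι.app (CostructuredArrow.mk (𝟙 (L.obj J)))
  fac s j := by
    obtain ⟨φ, hφ⟩ := exists_map_eq L W hW hJ j.hom
    let p : j ⟶ CostructuredArrow.mk (𝟙 (L.obj J)) :=
      CostructuredArrow.homMk φ ((Category.comp_id _).trans hφ)
    let t : F.obj J ⟶ s.pt := s.ι.app (CostructuredArrow.mk (𝟙 (L.obj J)))
    have h3 : F.map φ ≫ t = s.ι.app j := (s.ι.naturality p).trans (Category.comp_id _)
    have h4 : F.map φ ≫ α.app J = α.app j.left ≫ RF.map (L.map φ) := α.naturality φ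
    rw [← h3]
    change (α.app j.left ≫ RF.map j.hom) ≫ q ≫ t = _
    rw [← hφ, ← h4, Category.assoc, reassoc_of% hq]
  uniq s m hm := by
    let m' : RF.obj (L.obj J) ⟶ s.pt := m
    have h1 : (α.app J ≫ RF.map (𝟙 (L.obj J))) ≫ m' =
      s.ι.app (CostructuredArrow.mk (𝟙 (L.obj J))) := hm (CostructuredArrow.mk (𝟙 (L.obj J)))
    have h2 : α.app J ≫ RF.map (𝟙 (L.obj J)) = α.app J := by
      rw [RF.map_id]
      exact Category.comp_id _
    rw [← h1, h2]
    change m' = q ≫ α.app J ≫ m'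
    rw [reassoc_of% hq']

include hF hW hJ

/-- The identity of `L.obj J` acts as a terminal object of the comma category after `F` is applied:
every object maps to it, and any two such maps are homotopic, hence equal under `F`. The colimit is
therefore the value `F.obj J`. -/
lemma exists_isPointwiseLeftKanExtensionAt : ∃ (c : Cocone (CostructuredArrow.proj L (L.obj J) ⋙ F))
    (_ : IsColimit c), IsIso (show F.obj J ⟶ c.pt from c.ι.app (CostructuredArrow.mk (𝟙 (L.obj J)))) := by
  choose φ hφ using fun j : CostructuredArrow L (L.obj J) => exists_map_eq L W hW hJ j.hom
  have key {X : BoundedComplex C} {a b : X ⟶ J} (h : L.map a = L.map b) : F.map a = F.map b := by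
    obtain ⟨e⟩ := homotopy_of_map_eq L W hW hJ h
    exact hF e
  let c : Cocone (CostructuredArrow.proj L (L.obj J) ⋙ F) :=
    { pt := F.obj J
      ι :=
        { app := fun j => F.map (φ j)
          naturality := fun i j f => by
            refine Eq.trans ?_ (Category.comp_id _).symm
            refine (F.map_comp f.left (φ j)).symm.trans (key ?_)
            rw [L.map_comp, hφ, hφ]
            exact CostructuredArrow.w f } }
  have h1 : F.map (φ (CostructuredArrow.mk (𝟙 (L.obj J)))) = 𝟙 _ := by
    rw [← F.map_id]
    refine key ?_
    rw [hφ, L.map_id]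
    rfl
  refine ⟨c, ⟨fun s => s.ι.app (CostructuredArrow.mk (𝟙 (L.obj J))), fun s j => ?_, fun s m hm => ?_⟩, ?_⟩
  · let q : j ⟶ CostructuredArrow.mk (𝟙 (L.obj J)) :=
      CostructuredArrow.homMk (φ j) ((Category.comp_id _).trans (hφ j))
    exact (s.ι.naturality q).trans (Category.comp_id _)
  · rw [← hm (CostructuredArrow.mk (𝟙 (L.obj J)))]
    exact ((congrArg (· ≫ m) h1).trans (Category.id_comp m)).symm
  · change IsIso (F.map (φ (CostructuredArrow.mk (𝟙 (L.obj J)))))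
    rw [h1]
    infer_instance

lemma isIso_app_of_isPointwiseLeftKanExtensionAt {RF : D ⥤ H} (α : F ⟶ L ⋙ RF)
    (hE : (Functor.LeftExtension.mk RF α).IsPointwiseLeftKanExtensionAt (L.obj J)) :
    IsIso (α.app J) := by
  obtain ⟨c, hc, h⟩ := exists_isPointwiseLeftKanExtensionAt (L := L) hW hF hJ
  let e := hc.coconePointUniqueUpToIso hE
  have h1 : (show F.obj J ⟶ c.pt from c.ι.app (CostructuredArrow.mk (𝟙 (L.obj J)))) ≫ e.hom =
      α.app J ≫ RF.map (𝟙 (L.obj J)) :=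
    hc.comp_coconePointUniqueUpToIso_hom hE (CostructuredArrow.mk (𝟙 (L.obj J)))
  rw [RF.map_id] at h1
  erw [Category.comp_id] at h1
  rw [← h1]
  have h2 : IsIso e.hom := e.isIso_hom
  exact IsIso.comp_isIso' h h2

end

variable [EnoughInjectives C] (hfin : ∀ X : C, ∃ n, HasInjectiveDimensionLT X n)

include hF hW hfin

variable (F) in
theorem hasPointwiseRightDerivedFunctor : F.HasPointwiseRightDerivedFunctor W := by
  intro X
  obtain ⟨J, i, hJ, hi⟩ := exists_injective_resolution hfin X
  -- Pointwise existence depends only on the object of the localization, so `X` may be replaced by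
  -- its resolution `J`.
  rw [Functor.hasPointwiseRightDerivedFunctorAt_iff_of_mem F W i ((hW i).2 hi),
    Functor.hasPointwiseRightDerivedFunctorAt_iff F W.Q W]
  obtain ⟨c, hc, -⟩ := exists_isPointwiseLeftKanExtensionAt (L := W.Q) hW hF hJ
  exact ⟨⟨c, hc⟩⟩

omit hF in
-- Every object of the localization is isomorphic to a complex of injectives, so agreement with `F`
-- on these characterizes the derived functor. This recognizes the composite of `K^r_A` and `C_A` as
-- a derived functor.
theorem isRightDerivedFunctor (RF : D ⥤ H) (α : F ⟶ L ⋙ RF)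
    (h : ∀ J : BoundedComplex C, J.IsInj → IsIso (α.app J)) : RF.IsRightDerivedFunctor α W where
  isLeftKanExtension := by
    refine Functor.LeftExtension.IsPointwiseLeftKanExtension.isLeftKanExtension
      (E := Functor.LeftExtension.mk RF α) fun Y => ?_
    have := Localization.essSurj L W
    have hX := exists_injective_resolution hfin (L.objPreimage Y)
    let J := hX.choose
    have hJ : J.IsInj := hX.choose_spec.choose_spec.1
    let i : L.objPreimage Y ⟶ J := hX.choose_spec.choose
    have hi : W i := (hW i).2 hX.choose_spec.choose_spec.2
    exact (Functor.LeftExtension.mk _ α).isPointwiseLeftKanExtensionAtEquivOfIso'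
      ((Localization.isoOfHom L W i hi).symm ≪≫ L.objObjPreimageIso Y)
      (isPointwiseLeftKanExtensionAt hW hJ α (@asIso _ _ _ _ (α.app J) (h J hJ)).inv (@asIso _ _ _ _ (α.app J) (h J hJ)).hom_inv_id
        (@asIso _ _ _ _ (α.app J) (h J hJ)).inv_hom_id)

omit hfin [EnoughInjectives C] in
theorem isIso_app_of_isRightDerivedFunctor [F.HasPointwiseRightDerivedFunctor W]
    (RF : D ⥤ H) (α : F ⟶ L ⋙ RF) [RF.IsRightDerivedFunctor α W] {J : BoundedComplex C}
    (hJ : J.IsInj) : IsIso (α.app J) :=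
  isIso_app_of_isPointwiseLeftKanExtensionAt hW hF hJ α
    (Functor.isPointwiseLeftKanExtensionOfHasPointwiseRightDerivedFunctor RF α W _)

end BoundedComplex

end SPF

namespace SPF

/-! ### Points of `U^* ⊗ W` as linear maps. -/

section PointHom

variable {k : Type u} [Field k] {S T : Type u} [CommRing S] [Algebra k S] [CommRing T] [Algebra k T]
  {U U' W W' : FGModuleCat.{u} k}

/-- The map `U → W` given by an element of `U^* ⊗ W`. -/
def tensorToHom (U W : FGModuleCat.{u} k) : tensorObj (dualObj U) W ≃ₗ[k] (U →ₗ[k] W) :=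
  dualTensorHomEquiv (R := k) (M := U) (N := W)

/-- The `S`-linear map `S ⊗ U → S ⊗ W` given by an element of `S ⊗ (U^* ⊗ W)`. -/
def pointHom : S ⊗[k] tensorObj (dualObj U) W →ₗ[S] S ⊗[k] U →ₗ[S] S ⊗[k] W :=
  LinearMap.liftBaseChange S (LinearMap.baseChangeHom k S U W ∘ₗ (tensorToHom U W).toLinearMap)

lemma pointHom_tmul (s : S) (t : tensorObj (dualObj U) W) :
    pointHom (s ⊗ₜ[k] t) = s • (tensorToHom U W t).baseChange S := rfl

lemma pointHom_coeffMap (φ : S →ₐ[k] T) (ξ : S ⊗[k] tensorObj (dualObj U) W) :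
    pointHom (coeffMap φ _ ξ) = extend φ (pointHom ξ) := by
  induction ξ using TensorProduct.induction_on with
  | zero => simp [extend_zero]
  | add x y hx hy => simp only [map_add, hx, hy, extend_add]
  | tmul s t => rw [coeffMap_tmul, pointHom_tmul, pointHom_tmul, extend_smul, extend_baseChange]

/-- The element of `S ⊗ (U^* ⊗ W)` given by elements of `S ⊗ U^*` and `S ⊗ W`. -/
def pureTensor (a : S ⊗[k] dualObj U) (y : S ⊗[k] W) : S ⊗[k] tensorObj (dualObj U) W :=
  (AlgebraTensorModule.distribBaseChange k S (dualObj U) W).symm (a ⊗ₜ[S] y)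

lemma pureTensor_induction {motive : S ⊗[k] tensorObj (dualObj U) W → Prop}
    (ξ : S ⊗[k] tensorObj (dualObj U) W) (zero : motive 0)
    (pure : ∀ a y, motive (pureTensor a y))
    (add : ∀ x y, motive x → motive y → motive (x + y)) : motive ξ := by
  obtain ⟨z, rfl⟩ := (AlgebraTensorModule.distribBaseChange k S (dualObj U) W).symm.surjective ξ
  induction z using TensorProduct.induction_on with
  | zero => rw [map_zero]; exact zero
  | add x y hx hy => rw [map_add]; exact add _ _ hx hy
  | tmul a y => exact pure a y

lemma tensorHom_pureTensor (f : S ⊗[k] dualObj U →ₗ[S] S ⊗[k] dualObj U')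
    (g : S ⊗[k] W →ₗ[S] S ⊗[k] W') (a : S ⊗[k] dualObj U) (y : S ⊗[k] W) :
    tensorHom f g (pureTensor a y) = pureTensor (f a) (g y) := by
  have h : AlgebraTensorModule.distribBaseChange k S (dualObj U) W (pureTensor a y) = a ⊗ₜ[S] y :=
    LinearEquiv.apply_symm_apply _ _
  change (AlgebraTensorModule.distribBaseChange k S (dualObj U') W').symm
    (TensorProduct.map f g (AlgebraTensorModule.distribBaseChange k S (dualObj U) W
      (pureTensor a y))) = _
  rw [h]
  rfl

variable (S U) in
/-- The isomorphism between `S ⊗ U^*` and the dual of `S ⊗ U`. -/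
def dualObjEquiv : S ⊗[k] dualObj U ≃ₗ[S] Module.Dual S (S ⊗[k] U) := dualEquiv S U

/-- The pairing between `S ⊗ U^*` and `S ⊗ U`. -/
def dualPairing (a : S ⊗[k] dualObj U) (z : S ⊗[k] U) : S := dualObjEquiv S U a z

lemma dualPairing_dualMap (f : S ⊗[k] U →ₗ[S] S ⊗[k] U') (a : S ⊗[k] dualObj U') (z : S ⊗[k] U) :
    dualPairing (dualMap f a) z = dualPairing a (f z) :=
  dualEquiv_transpose f a z

lemma dualPairing_coeffMap (φ : S →ₐ[k] T) (a : S ⊗[k] dualObj U) (z : S ⊗[k] U) :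
    dualPairing (coeffMap φ _ a) (coeffMap φ _ z) = φ (dualPairing a z) :=
  dualEquiv_coeffMap φ a z

lemma dualPairing_add_left (a b : S ⊗[k] dualObj U) (z : S ⊗[k] U) :
    dualPairing (a + b) z = dualPairing a z + dualPairing b z := by
  simp only [dualPairing, map_add, LinearMap.add_apply]

lemma dualPairing_smul_left (s : S) (a : S ⊗[k] dualObj U) (z : S ⊗[k] U) :
    dualPairing (s • a) z = s * dualPairing a z := by
  simp only [dualPairing, map_smul, LinearMap.smul_apply, smul_eq_mul]

lemma dualPairing_add_right (a : S ⊗[k] dualObj U) (z z' : S ⊗[k] U) :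
    dualPairing a (z + z') = dualPairing a z + dualPairing a z' := map_add _ _ _

lemma dualPairing_zero_left (z : S ⊗[k] U) : dualPairing (0 : S ⊗[k] dualObj U) z = 0 := by
  simp only [dualPairing, map_zero, LinearMap.zero_apply]

lemma dualPairing_zero_right (a : S ⊗[k] dualObj U) : dualPairing a (0 : S ⊗[k] U) = 0 :=
  map_zero _

lemma dualPairing_ext {a b : S ⊗[k] dualObj U} (h : ∀ z, dualPairing a z = dualPairing b z) :
    a = b := (dualObjEquiv S U).injective (LinearMap.ext h)

/-- The value of a linear form. -/
def formVal (l : dualObj U) (u : U) : k := Module.Dual.eval k U u l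

lemma dualPairing_tmul (s t : S) (l : dualObj U) (u : U) :
    dualPairing (s ⊗ₜ[k] l) (t ⊗ₜ[k] u) = s * t * algebraMap k S (formVal l u) :=
  dualEquiv_tmul s t l u

lemma tensorToHom_tmul (l : dualObj U) (w : W) (u : U) :
    tensorToHom U W (show tensorObj (dualObj U) W from l ⊗ₜ[k] w) u = formVal l u • w := rfl

lemma pureTensor_tmul (s t : S) (l : dualObj U) (w : W) :
    pureTensor (s ⊗ₜ[k] l) (t ⊗ₜ[k] w) =
      (s * t) ⊗ₜ[k] (show tensorObj (dualObj U) W from l ⊗ₜ[k] w) := by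
  change (AlgebraTensorModule.distribBaseChange k S (dualObj U) W).symm _ = _
  simp
  rfl

lemma pureTensor_add_left (a b : S ⊗[k] dualObj U) (y : S ⊗[k] W) :
    pureTensor (a + b) y = pureTensor a y + pureTensor b y := by
  rw [pureTensor, add_tmul, map_add]; rfl

lemma pureTensor_add_right (a : S ⊗[k] dualObj U) (y z : S ⊗[k] W) :
    pureTensor a (y + z) = pureTensor a y + pureTensor a z := by
  rw [pureTensor, tmul_add, map_add]; rfl

lemma pureTensor_zero_left (y : S ⊗[k] W) : pureTensor (0 : S ⊗[k] dualObj U) y = 0 := by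
  rw [pureTensor, zero_tmul, map_zero]; rfl

lemma pureTensor_zero_right (a : S ⊗[k] dualObj U) : pureTensor a (0 : S ⊗[k] W) = 0 := by
  rw [pureTensor, tmul_zero, map_zero]; rfl

lemma pointHom_pureTensor (a : S ⊗[k] dualObj U) (y : S ⊗[k] W) (z : S ⊗[k] U) :
    pointHom (pureTensor a y) z = dualPairing a z • y := by
  induction a using TensorProduct.induction_on with
  | zero => rw [pureTensor_zero_left, map_zero, dualPairing_zero_left, zero_smul]; rfl
  | add a b ha hb =>
    rw [pureTensor_add_left, map_add, LinearMap.add_apply, ha, hb, dualPairing_add_left, add_smul]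
  | tmul s l =>
    induction y using TensorProduct.induction_on with
    | zero => rw [pureTensor_zero_right, map_zero, smul_zero]; rfl
    | add x y hx hy => rw [pureTensor_add_right, map_add, LinearMap.add_apply, hx, hy, smul_add]
    | tmul t w =>
      induction z using TensorProduct.induction_on with
      | zero => rw [map_zero, dualPairing_zero_right, zero_smul]
      | add x y hx hy => rw [map_add, hx, hy, dualPairing_add_right, add_smul]
      | tmul r u =>
        rw [pureTensor_tmul, pointHom_tmul, LinearMap.smul_apply, LinearMap.baseChange_tmul,
          tensorToHom_tmul, dualPairing_tmul, TensorProduct.smul_tmul', TensorProduct.smul_tmul',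
          TensorProduct.tmul_smul, TensorProduct.smul_tmul', Algebra.smul_def]
        congr 1
        simp only [smul_eq_mul]
        ring

lemma pointHom_tensorHom (f : S ⊗[k] U' →ₗ[S] S ⊗[k] U) (g : S ⊗[k] W →ₗ[S] S ⊗[k] W')
    (ξ : S ⊗[k] tensorObj (dualObj U) W) :
    pointHom (tensorHom (dualMap f) g ξ) = g ∘ₗ pointHom ξ ∘ₗ f := by
  induction ξ using pureTensor_induction with
  | zero => simp
  | add x y hx hy => rw [map_add, map_add, map_add, hx, hy, LinearMap.add_comp, LinearMap.comp_add]
  | pure a y =>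
    refine LinearMap.ext fun z => ?_
    rw [tensorHom_pureTensor, pointHom_pureTensor, LinearMap.comp_apply, LinearMap.comp_apply,
      pointHom_pureTensor, map_smul, dualPairing_dualMap]

lemma pointHom_tensorHom_left (f : S ⊗[k] U' →ₗ[S] S ⊗[k] U)
    (ξ : S ⊗[k] tensorObj (dualObj U) W) :
    pointHom (tensorHom (dualMap f) LinearMap.id ξ) = pointHom ξ ∘ₗ f :=
  pointHom_tensorHom f LinearMap.id ξ

lemma pointHom_tensorHom_right (g : S ⊗[k] W →ₗ[S] S ⊗[k] W')
    (ξ : S ⊗[k] tensorObj (dualObj U) W) :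
    pointHom (tensorHom LinearMap.id g ξ) = g ∘ₗ pointHom ξ := by
  rw [← dualMap_id, pointHom_tensorHom, LinearMap.comp_id]

/-- The element of `U^* ⊗ U` which corresponds to the identity. -/
def idTensor (U : FGModuleCat.{u} k) : tensorObj (dualObj U) U :=
  (tensorToHom U U).symm LinearMap.id

lemma pointHom_idTensor (U : FGModuleCat.{u} k) :
    pointHom (1 ⊗ₜ[k] idTensor U : S ⊗[k] tensorObj (dualObj U) U) = LinearMap.id := by
  rw [pointHom_tmul, idTensor, LinearEquiv.apply_symm_apply, LinearMap.baseChange_id, one_smul]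

/-- The map `U^* ⊗ W → U^* ⊗ W'` induced by a linear map `W → W'`. -/
def tensorLin (U : FGModuleCat.{u} k) (g : W →ₗ[k] W') :
    tensorObj (dualObj U) W →ₗ[k] tensorObj (dualObj U) W' := g.lTensor (dualObj U)

lemma tensorLin_idTensor (t : tensorObj (dualObj U) W) :
    tensorLin U (tensorToHom U W t) (idTensor U) = t := by
  refine (tensorToHom U W).injective ?_
  have h : tensorToHom U W (tensorLin U (tensorToHom U W t) (idTensor U)) =
      tensorToHom U W t ∘ₗ tensorToHom U U (idTensor U) :=
    LinearMap.congr_fun (dualTensorHom_comp_lTensor (R := k) (M := U) (tensorToHom U W t))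
      (idTensor U)
  rw [h, idTensor, LinearEquiv.apply_symm_apply, LinearMap.comp_id]

lemma tensorHom_baseChange (g : W →ₗ[k] W') :
    tensorHom (LinearMap.id : S ⊗[k] dualObj U →ₗ[S] _) (g.baseChange S) =
      (tensorLin U g).baseChange S := by
  refine LinearMap.ext fun z => ?_
  induction z using pureTensor_induction with
  | zero => rw [map_zero, map_zero]
  | add x y hx hy => rw [map_add, map_add, hx, hy]
  | pure a y =>
    rw [tensorHom_pureTensor, LinearMap.id_apply]
    induction a using TensorProduct.induction_on with
    | zero => rw [pureTensor_zero_left, pureTensor_zero_left, map_zero]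
    | add x y hx hy => rw [pureTensor_add_left, pureTensor_add_left, map_add, hx, hy]
    | tmul s l =>
      induction y using TensorProduct.induction_on with
      | zero => rw [pureTensor_zero_right, map_zero, map_zero, pureTensor_zero_right]
      | add x y hx hy => rw [pureTensor_add_right, map_add, map_add, pureTensor_add_right, hx, hy]
      | tmul t w =>
        rw [LinearMap.baseChange_tmul, pureTensor_tmul, pureTensor_tmul, LinearMap.baseChange_tmul]
        rfl

/-- A tensor is recovered by applying the map it represents to the canonical tensor `idTensor U`.
The injectivity of `pointHom` is the consequence in use. -/
lemma tensorHom_pointHom (ξ : S ⊗[k] tensorObj (dualObj U) W) :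
    tensorHom LinearMap.id (pointHom ξ) (1 ⊗ₜ[k] idTensor U) = ξ := by
  induction ξ using TensorProduct.induction_on with
  | zero =>
    have h := LinearMap.congr_fun (tensorHom_smul_right (0 : S)
      (LinearMap.id : S ⊗[k] dualObj U →ₗ[S] _) (pointHom (0 : S ⊗[k] tensorObj (dualObj U) W)))
      (1 ⊗ₜ[k] idTensor U)
    rw [zero_smul, zero_smul, LinearMap.zero_apply] at h
    rw [map_zero]
    exact h
  | add x y hx hy =>
    have h (g g' : S ⊗[k] U →ₗ[S] S ⊗[k] W) : tensorHom LinearMap.id (g + g') =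
        tensorHom (LinearMap.id : S ⊗[k] dualObj U →ₗ[S] S ⊗[k] dualObj U) g +
          tensorHom LinearMap.id g' := by
      refine LinearMap.ext fun z => ?_
      induction z using pureTensor_induction with
      | zero => simp
      | add x y hx hy => rw [map_add, map_add, hx, hy]
      | pure a y =>
        rw [LinearMap.add_apply, tensorHom_pureTensor, tensorHom_pureTensor, tensorHom_pureTensor,
          LinearMap.add_apply, pureTensor_add_right]
    rw [map_add, h, LinearMap.add_apply, hx, hy]
  | tmul s t =>
    rw [pointHom_tmul, tensorHom_smul_right, LinearMap.smul_apply, tensorHom_baseChange,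
      LinearMap.baseChange_tmul, tensorLin_idTensor,
      TensorProduct.smul_tmul', smul_eq_mul, mul_one]

lemma pointHom_injective : Function.Injective (pointHom (S := S) (U := U) (W := W)) := fun x y h => by
  rw [← tensorHom_pointHom x, h, tensorHom_pointHom]

end PointHom

end SPF

namespace SPF

open Polynomial StrictPoly

variable {k : Type u} [Field k] {S T R : Type u} [CommRing S] [Algebra k S] [CommRing T]
  [Algebra k T] [CommRing R] [Algebra k R] {U V W X : FGModuleCat.{u} k} {d : ℕ}
  {M N : Type u} [AddCommGroup M] [Module k M] [AddCommGroup N] [Module k N]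

/-! ### Polynomial functions and the generic point. -/

section EvalPoint

/-- The evaluation of linear forms at an element of `S ⊗ X`. -/
def formAt (ξ : S ⊗[k] X) : dualObj X →ₗ[k] S where
  toFun l := dualPairing (1 ⊗ₜ[k] l) ξ
  map_add' l l' := by rw [tmul_add, dualPairing_add_left]
  map_smul' r l := by
    rw [TensorProduct.tmul_smul, ← algebraMap_smul S r (1 ⊗ₜ[k] l : S ⊗[k] dualObj X),
      dualPairing_smul_left, Algebra.smul_def]
    rfl

lemma formAt_apply (ξ : S ⊗[k] X) (l : dualObj X) : formAt ξ l = dualPairing (1 ⊗ₜ[k] l) ξ := rfl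

lemma formAt_tmul (s : S) (x : X) (l : dualObj X) :
    formAt (s ⊗ₜ[k] x) l = formVal l x • s := by
  rw [formAt_apply, dualPairing_tmul, Algebra.smul_def, one_mul, mul_comm]

/-- The evaluation of polynomial functions at an element of `S ⊗ X`. -/
def evalAt (ξ : S ⊗[k] X) : SymmetricAlgebra k (dualObj X) →ₐ[k] S :=
  SymmetricAlgebra.lift (formAt ξ)

@[simp] lemma evalAt_ι (ξ : S ⊗[k] X) (l : dualObj X) :
    evalAt ξ (SymmetricAlgebra.ι k _ l) = formAt ξ l := SymmetricAlgebra.lift_ι_apply _ _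

lemma formAt_coeffMap (φ : S →ₐ[k] T) (ξ : S ⊗[k] X) :
    formAt (coeffMap φ _ ξ) = φ.toLinearMap ∘ₗ formAt ξ := LinearMap.ext fun l => by
  rw [formAt_apply, ← map_one φ, ← coeffMap_tmul, dualPairing_coeffMap]
  rfl

lemma evalAt_coeffMap (φ : S →ₐ[k] T) (ξ : S ⊗[k] X) :
    evalAt (coeffMap φ _ ξ) = φ.comp (evalAt ξ) :=
  SymmetricAlgebra.algHom_ext (LinearMap.ext fun l => by
    change evalAt _ (SymmetricAlgebra.ι k _ l) = φ (evalAt ξ (SymmetricAlgebra.ι k _ l))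
    rw [evalAt_ι, evalAt_ι, formAt_coeffMap]
    rfl)

lemma formAt_zero : formAt (0 : S ⊗[k] X) = 0 :=
  LinearMap.ext fun l => (formAt_apply 0 l).trans (dualPairing_zero_right _)

lemma formAt_add (a b : S ⊗[k] X) : formAt (a + b) = formAt a + formAt b :=
  LinearMap.ext fun l => (formAt_apply (a + b) l).trans (dualPairing_add_right _ _ _)

/-- A pure tensor. -/
def tmulObj (u : U) (v : V) : tensorObj U V := u ⊗ₜ[k] v

lemma tensorObj_induction {motive : tensorObj U V → Prop} (t : tensorObj U V) (zero : motive 0)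
    (tmul : ∀ u v, motive (tmulObj u v)) (add : ∀ x y, motive x → motive y → motive (x + y)) :
    motive t :=
  TensorProduct.induction_on (motive := motive) t zero tmul add

/-- The map `X^* ⊗ X → R ⊗ X` given by a linear map `X^* → R`. -/
def formTensor (f : dualObj X →ₗ[k] R) : tensorObj (dualObj X) X →ₗ[k] R ⊗[k] X := f.rTensor X

lemma formTensor_tmul (f : dualObj X →ₗ[k] R) (l : dualObj X) (x : X) :
    formTensor f (tmulObj l x) = f l ⊗ₜ[k] x := rfl

lemma formTensor_add (f g : dualObj X →ₗ[k] R) (t : tensorObj (dualObj X) X) :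
    formTensor (f + g) t = formTensor f t + formTensor g t :=
  LinearMap.congr_fun (LinearMap.rTensor_add X f g) t

lemma formTensor_zero (t : tensorObj (dualObj X) X) :
    formTensor (0 : dualObj X →ₗ[k] R) t = 0 :=
  LinearMap.congr_fun (LinearMap.rTensor_zero X) t

/-- The element of `R ⊗ X` given by a linear map `X^* → R`. -/
def ofForm (f : dualObj X →ₗ[k] R) : R ⊗[k] X := formTensor f (idTensor X)

lemma formTensor_formAt_tmul (s : S) (x : X) (t : tensorObj (dualObj X) X) :
    formTensor (formAt (s ⊗ₜ[k] x)) t = s ⊗ₜ[k] tensorToHom X X t x := by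
  induction t using tensorObj_induction with
  | zero => rw [map_zero, map_zero, LinearMap.zero_apply, tmul_zero]
  | add a b ha hb => rw [map_add, ha, hb, map_add, LinearMap.add_apply, tmul_add]
  | tmul l y => rw [formTensor_tmul, formAt_tmul, smul_tmul]; rfl

lemma ofForm_formAt (ξ : S ⊗[k] X) : ofForm (formAt ξ) = ξ := by
  induction ξ using TensorProduct.induction_on with
  | zero => rw [formAt_zero, ofForm, formTensor_zero]
  | add a b ha hb =>
    rw [ofForm, formAt_add, formTensor_add]
    exact congrArg₂ (· + ·) ha hb
  | tmul s x =>
    rw [ofForm, formTensor_formAt_tmul, idTensor, LinearEquiv.apply_symm_apply]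
    rfl

lemma coeffMap_ofForm (φ : R →ₐ[k] S) (f : dualObj X →ₗ[k] R) :
    coeffMap φ X (ofForm f) = ofForm (φ.toLinearMap ∘ₗ f) :=
  (LinearMap.congr_fun (LinearMap.rTensor_comp X φ.toLinearMap f) (idTensor X)).symm

lemma smul_ofForm (r : R) (f : dualObj X →ₗ[k] R) : r • ofForm f = ofForm (r • f) := by
  have h (t : tensorObj (dualObj X) X) : r • formTensor f t = formTensor (r • f) t := by
    induction t using tensorObj_induction with
    | zero => rw [map_zero, map_zero, smul_zero]
    | add a b ha hb => rw [map_add, map_add, smul_add, ha, hb]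
    | tmul l y => rw [formTensor_tmul, formTensor_tmul, TensorProduct.smul_tmul']; rfl
  exact h _

lemma formAt_formTensor (f : dualObj X →ₗ[k] R) (t : tensorObj (dualObj X) X) (l : dualObj X) :
    formAt (formTensor f t) l = f (dualLin (tensorToHom X X t) l) := by
  induction t using tensorObj_induction with
  | zero =>
    have h : dualLin (0 : X →ₗ[k] X) l = 0 := LinearMap.comp_zero (show Module.Dual k X from l)
    rw [map_zero, map_zero, formAt_zero, h, map_zero, LinearMap.zero_apply]
  | add a b ha hb =>
    rw [map_add, formAt_add, LinearMap.add_apply, ha, hb, map_add, dualLin_add,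
      LinearMap.add_apply, map_add]
  | tmul l' y =>
    rw [formTensor_tmul, formAt_tmul, ← _root_.map_smul]
    congr 1
    refine LinearMap.ext fun u => ?_
    change (formVal l y • (show Module.Dual k X from l')) u =
      (show Module.Dual k X from l) (formVal l' u • y)
    rw [LinearMap.smul_apply, _root_.map_smul, smul_eq_mul, smul_eq_mul, mul_comm]
    rfl

lemma formAt_ofForm (f : dualObj X →ₗ[k] R) : formAt (ofForm f) = f := by
  refine LinearMap.ext fun l => ?_
  rw [ofForm, formAt_formTensor, idTensor, LinearEquiv.apply_symm_apply]
  rfl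

/-- The generic point of `X`, with coefficients in the algebra of polynomial functions on `X`. -/
def genericPoint (X : FGModuleCat.{u} k) : SymmetricAlgebra k (dualObj X) ⊗[k] X :=
  ofForm (SymmetricAlgebra.ι k (dualObj X))

lemma evalAt_genericPoint : evalAt (genericPoint X) = AlgHom.id k _ :=
  SymmetricAlgebra.algHom_ext (by
    rw [genericPoint, evalAt, formAt_ofForm]
    exact SymmetricAlgebra.lift_comp_ι _)

/-- The generic point is the tautological form `X^* → Sym(X^*)`, and evaluation at `ξ` specializes
this form to the one given by `ξ`. -/
lemma coeffMap_genericPoint (ξ : S ⊗[k] X) : coeffMap (evalAt ξ) X (genericPoint X) = ξ := by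
  rw [genericPoint, coeffMap_ofForm]
  have : (evalAt ξ).toLinearMap ∘ₗ SymmetricAlgebra.ι k (dualObj X) = formAt ξ :=
    SymmetricAlgebra.lift_comp_ι _
  rw [this, ofForm_formAt]

lemma degHom_genericPoint : coeffMap (degHom (dualObj X)) X (genericPoint X) =
    (Polynomial.X : (SymmetricAlgebra k (dualObj X))[X]) • coeffMap (cst k _) X (genericPoint X) := by
  rw [genericPoint, coeffMap_ofForm, coeffMap_ofForm, smul_ofForm]
  congr 1
  refine LinearMap.ext fun l => ?_
  exact degHom_ι l

end EvalPoint

/-! ### Divided powers and polynomial laws. -/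

section DivPoint

/-- The space of homogeneous polynomial functions of degree `d` on `X`. -/
abbrev polyObj (d : ℕ) (X : FGModuleCat.{u} k) : FGModuleCat.{u} k := (symPow k d).obj (dualObj X)

/-- The inclusion of the homogeneous polynomial functions. -/
def polyIncl (d : ℕ) (X : FGModuleCat.{u} k) :
    polyObj d X →ₗ[k] SymmetricAlgebra k (dualObj X) := (symSub k d (dualObj X)).subtype

/-- The homogeneous component of degree `d` of a polynomial function. -/
def polyProj (d : ℕ) (X : FGModuleCat.{u} k) :
    SymmetricAlgebra k (dualObj X) →ₗ[k] polyObj d X := symProj d (dualObj X)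

lemma polyProj_polyIncl (p : polyObj d X) : polyProj d X (polyIncl d X p) = p := symProj_coe d p

/-- The pairing of `S ⊗ D^d(X)` with the homogeneous polynomial functions. -/
def divPairing (a : S ⊗[k] (divPow k d).obj X) (y : S ⊗[k] polyObj d X) : S :=
  dualPairing (U := polyObj d X) a y

lemma divPairing_ext {a b : S ⊗[k] (divPow k d).obj X}
    (h : ∀ p, divPairing a (1 ⊗ₜ[k] p) = divPairing b (1 ⊗ₜ[k] p)) : a = b := by
  refine (dualObjEquiv S (polyObj d X)).injective ?_
  refine TensorProduct.AlgebraTensorModule.ext fun s p => ?_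
  have : (s ⊗ₜ[k] p : S ⊗[k] polyObj d X) = s • (1 ⊗ₜ[k] p) := by
    rw [TensorProduct.smul_tmul', smul_eq_mul, mul_one]
  rw [this, _root_.map_smul, _root_.map_smul]
  exact congrArg (s • ·) (h p)

variable (d) in
/-- The divided power of an element of `S ⊗ X`. -/
def divPoint (ξ : S ⊗[k] X) : S ⊗[k] (divPow k d).obj X :=
  (dualObjEquiv S (polyObj d X)).symm
    (LinearMap.liftBaseChange S ((evalAt ξ).toLinearMap ∘ₗ polyIncl d X))

lemma divPairing_divPoint (ξ : S ⊗[k] X) (s : S) (p : polyObj d X) :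
    divPairing (divPoint d ξ) (s ⊗ₜ[k] p) = s * evalAt ξ (polyIncl d X p) := by
  have h : dualObjEquiv S (polyObj d X) (divPoint d ξ) =
    LinearMap.liftBaseChange S ((evalAt ξ).toLinearMap ∘ₗ polyIncl d X) :=
      LinearEquiv.apply_symm_apply _ _
  exact (LinearMap.congr_fun h _).trans (by simp)

lemma divPoint_coeffMap (φ : S →ₐ[k] T) (ξ : S ⊗[k] X) :
    divPoint d (coeffMap φ _ ξ) = coeffMap φ _ (divPoint d ξ) := by
  refine divPairing_ext fun p => ?_
  have h : divPairing (coeffMap φ _ (divPoint d ξ)) (coeffMap φ _ (1 ⊗ₜ[k] p)) =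
      φ (divPairing (divPoint d ξ) (1 ⊗ₜ[k] p)) := dualPairing_coeffMap φ _ _
  rw [coeffMap_tmul, map_one, divPairing_divPoint] at h
  rw [divPairing_divPoint, h, evalAt_coeffMap, one_mul, one_mul]
  rfl

/-- The homomorphism of `S`-algebras which evaluates polynomial functions at an element of
`S ⊗ X`. -/
def evalAtS (ξ : S ⊗[k] X) : S ⊗[k] SymmetricAlgebra k (dualObj X) →ₐ[S] S :=
  Algebra.TensorProduct.lift (Algebra.ofId S S) (evalAt ξ) (fun _ _ => Commute.all _ _)

lemma evalAtS_tmul (ξ : S ⊗[k] X) (s : S) (p : SymmetricAlgebra k (dualObj X)) :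
    evalAtS ξ (s ⊗ₜ[k] p) = s * evalAt ξ p := Algebra.TensorProduct.lift_tmul _ _ _ _ _

lemma evalAtS_ι (ξ : S ⊗[k] X) (z : S ⊗[k] dualObj X) :
    evalAtS ξ ((SymmetricAlgebra.ι k (dualObj X)).baseChange S z) = dualPairing z ξ := by
  induction z using TensorProduct.induction_on with
  | zero => rw [map_zero, map_zero, dualPairing_zero_left]
  | add x y hx hy => rw [map_add, map_add, hx, hy, dualPairing_add_left]
  | tmul s l =>
    rw [LinearMap.baseChange_tmul, evalAtS_tmul, evalAt_ι, formAt_apply, ← dualPairing_smul_left,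
      TensorProduct.smul_tmul', smul_eq_mul, mul_one]

lemma evalAtS_symAlg {Y : FGModuleCat.{u} k} (f : S ⊗[k] X →ₗ[S] S ⊗[k] Y) (ξ : S ⊗[k] X)
    (y : S ⊗[k] SymmetricAlgebra k (dualObj Y)) :
    evalAtS ξ (symAlg (dualMap f) y) = evalAtS (f ξ) y := by
  have h : (evalAtS ξ).comp (symAlg (dualMap f)) = evalAtS (f ξ) := by
    refine symAlg_ext fun l => ?_
    rw [AlgHom.comp_apply, symAlg_tmul_ι, evalAtS_ι, dualPairing_dualMap, evalAtS_tmul,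
      evalAt_ι, formAt_apply, one_mul]
  exact DFunLike.congr_fun h y

lemma divPairing_divPoint' (ξ : S ⊗[k] X) (y : S ⊗[k] polyObj d X) :
    divPairing (divPoint d ξ) y = evalAtS ξ ((polyIncl d X).baseChange S y) := by
  induction y using TensorProduct.induction_on with
  | zero =>
    rw [map_zero, map_zero]
    exact dualPairing_zero_right _
  | add x y hx hy =>
    rw [map_add, map_add, ← hx, ← hy]
    exact dualPairing_add_right _ _ _
  | tmul s p => rw [divPairing_divPoint, LinearMap.baseChange_tmul, evalAtS_tmul]

lemma map_divPoint {Y : FGModuleCat.{u} k} (f : S ⊗[k] X →ₗ[S] S ⊗[k] Y) (ξ : S ⊗[k] X) :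
    (divPow k d).map S f (divPoint d ξ) = divPoint d (f ξ) := by
  refine divPairing_ext fun p => ?_
  have h : divPairing ((divPow k d).map S f (divPoint d ξ)) (1 ⊗ₜ[k] p) =
    divPairing (divPoint d ξ) ((symPow k d).map S (dualMap f) (1 ⊗ₜ[k] p)) :=
      dualPairing_dualMap _ _ _
  have h2 (y : S ⊗[k] polyObj d Y) : (polyIncl d X).baseChange S ((symPow k d).map S (dualMap f) y) =
      symAlg (dualMap f) ((polyIncl d Y).baseChange S y) := symIncl_symMap (dualMap f) y
  rw [h, divPairing_divPoint', h2, evalAtS_symAlg, divPairing_divPoint']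

section Reduction

/-- The map `(S ⊗ R) ⊗ M → S ⊗ M` given by a linear form on `R`. -/
def reduction (S : Type u) [CommRing S] [Algebra k S] (l : R →ₗ[k] k) (M : Type u) [AddCommGroup M]
    [Module k M] : (S ⊗[k] R) ⊗[k] M →ₗ[k] S ⊗[k] M :=
  ((TensorProduct.rid k S).toLinearMap ∘ₗ l.lTensor S).rTensor M

lemma reduction_tmul (l : R →ₗ[k] k) (s : S) (r : R) (m : M) :
    reduction S l M ((s ⊗ₜ[k] r) ⊗ₜ[k] m) = (l r • s) ⊗ₜ m := by
  simp [reduction]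

lemma reduction_extend (l : R →ₗ[k] k) (f : S ⊗[k] M →ₗ[S] S ⊗[k] N) (x : (S ⊗[k] R) ⊗[k] M) :
    reduction S l N (extend (Algebra.TensorProduct.includeLeft : S →ₐ[k] S ⊗[k] R) f x) =
      f (reduction S l M x) := by
  have h (s : S) (r : R) (y : S ⊗[k] N) : reduction S l N ((s ⊗ₜ[k] r : S ⊗[k] R) •
      coeffMap (Algebra.TensorProduct.includeLeft : S →ₐ[k] S ⊗[k] R) N y) = (l r • s) • y := by
    induction y using TensorProduct.induction_on with
    | zero => simp
    | add x y hx hy => rw [map_add, smul_add, map_add, hx, hy, smul_add]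
    | tmul t n =>
      rw [coeffMap_tmul, TensorProduct.smul_tmul', TensorProduct.smul_tmul', smul_eq_mul,
        Algebra.TensorProduct.includeLeft_apply, Algebra.TensorProduct.tmul_mul_tmul,
        mul_one, reduction_tmul, smul_eq_mul, smul_mul_assoc]
  induction x using TensorProduct.induction_on with
  | zero => simp
  | add x y hx hy => rw [map_add, map_add, map_add, map_add, hx, hy]
  | tmul a m =>
    induction a using TensorProduct.induction_on with
    | zero => simp
    | add x y hx hy => rw [add_tmul, map_add, map_add, map_add, map_add, hx, hy]
    | tmul s r =>
      have h1 : ((s ⊗ₜ[k] r) ⊗ₜ[k] m : (S ⊗[k] R) ⊗[k] M) = (s ⊗ₜ[k] r : S ⊗[k] R) •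
          coeffMap (Algebra.TensorProduct.includeLeft : S →ₐ[k] S ⊗[k] R) M (1 ⊗ₜ m) := by
        rw [coeffMap_tmul, map_one, TensorProduct.smul_tmul', smul_eq_mul, mul_one]
      rw [h1, _root_.map_smul, extend_coeffMap, h, ← h1, reduction_tmul, ← _root_.map_smul,
        TensorProduct.smul_tmul', smul_eq_mul, mul_one]

lemma divPairing_tmul_left (s : S) (a : (divPow k d).obj X) (p : polyObj d X) :
    divPairing (s ⊗ₜ[k] a) (1 ⊗ₜ[k] p) = algebraMap k S (formVal (U := polyObj d X) a p) * s := by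
  have h := dualPairing_tmul (U := polyObj d X) s 1 a p
  rw [mul_one, mul_comm] at h
  exact h

lemma divPairing_reduction (l : R →ₗ[k] k) (y : R ⊗[k] (divPow k d).obj X) (p : polyObj d X) :
    divPairing (reduction S l _ (coeffMap Algebra.TensorProduct.includeRight _ y)) (1 ⊗ₜ[k] p) =
      algebraMap k S (l (divPairing y (1 ⊗ₜ[k] p))) := by
  induction y using TensorProduct.induction_on with
  | zero =>
    rw [map_zero, map_zero]
    exact (dualPairing_zero_left _).trans (by
      rw [← map_zero (algebraMap k S), ← map_zero l]
      exact congrArg _ (congrArg _ (dualPairing_zero_left (U := polyObj d X) _).symm))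
  | add x y hx hy =>
    rw [map_add, map_add]
    have h (S : Type u) [CommRing S] [Algebra k S] (a b : S ⊗[k] (divPow k d).obj X) : divPairing (a + b) (1 ⊗ₜ[k] p) =
        divPairing a (1 ⊗ₜ[k] p) + divPairing b (1 ⊗ₜ[k] p) :=
      dualPairing_add_left (U := polyObj d X) a b _
    rw [h, h, hx, hy, map_add, map_add]
  | tmul r a =>
    rw [coeffMap_tmul, Algebra.TensorProduct.includeRight_apply, reduction_tmul,
      divPairing_tmul_left, divPairing_tmul_left, ← Algebra.smul_def, ← Algebra.smul_def,
      _root_.map_smul, smul_eq_mul, map_mul, ← Algebra.smul_def, ← Algebra.algebraMap_eq_smul_one]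

/-- The linear form on the algebra of polynomial functions on `X` given by an element
of `D^d(X)`. -/
def divForm (a : (divPow k d).obj X) : SymmetricAlgebra k (dualObj X) →ₗ[k] k :=
  (show Module.Dual k (polyObj d X) from a) ∘ₗ polyProj d X

/-- An element `a` of `D^d(X)` is a functional on polynomials of degree `d`. Applied to the
coefficients of the divided power of the generic point it returns `a`; so divided powers of points
over all algebras determine linear maps out of `D^d(X)`. -/
lemma reduction_divPoint (a : (divPow k d).obj X) :
    reduction S (divForm a) _ (divPoint d (coeffMap Algebra.TensorProduct.includeRight _
      (genericPoint X))) = 1 ⊗ₜ[k] a := by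
  refine divPairing_ext fun p => ?_
  rw [divPoint_coeffMap, divPairing_reduction, divPairing_divPoint, evalAt_genericPoint,
    divPairing_tmul_left, mul_one, one_mul]
  congr 1
  exact congrArg (show Module.Dual k (polyObj d X) from a) (polyProj_polyIncl p)

/-- An `S`-linear map out of `S ⊗ D^d(X)` is determined by its values at divided powers. -/
lemma divPow_ext {f g : S ⊗[k] (divPow k d).obj X →ₗ[S] S ⊗[k] M}
    (h : ∀ (T : Type u) [CommRing T] [Algebra k T] (φ : S →ₐ[k] T) (ξ : T ⊗[k] X),
      extend φ f (divPoint d ξ) = extend φ g (divPoint d ξ)) : f = g := by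
  refine ext_one fun a => ?_
  rw [← reduction_divPoint, ← reduction_extend, ← reduction_extend, h]

lemma divPow_lin_ext {f g : (divPow k d).obj X →ₗ[k] M}
    (h : ∀ (T : Type u) [CommRing T] [Algebra k T] (ξ : T ⊗[k] X),
      f.baseChange T (divPoint d ξ) = g.baseChange T (divPoint d ξ)) : f = g := by
  have h1 : f.baseChange k = g.baseChange k := divPow_ext fun T _ _ φ ξ => by
    rw [extend_baseChange, extend_baseChange, h]
  refine LinearMap.ext fun x => tmul_injective (k := k) ?_
  exact LinearMap.congr_fun h1 (1 ⊗ₜ[k] x)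

end Reduction

section DivHom

/-- The linear map `D^d(X) → M` given by an element of `Sym(X^*) ⊗ M`. -/
def divHom : SymmetricAlgebra k (dualObj X) ⊗[k] M →ₗ[k] ((divPow k d).obj X →ₗ[k] M) :=
  TensorProduct.lift ((LinearMap.smulRightₗ (R := k) (M := M) (M₂ := (divPow k d).obj X)) ∘ₗ
    (Module.Dual.eval k (polyObj d X)) ∘ₗ polyProj d X)

lemma divHom_tmul (p : SymmetricAlgebra k (dualObj X)) (m : M) (a : (divPow k d).obj X) :
    divHom (p ⊗ₜ[k] m) a = formVal (U := polyObj d X) a (polyProj d X p) • m := rfl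

/-- An element of `Sym^d(X^*) ⊗ M` is a polynomial law of degree `d` from `X` to `M`, and the linear
map it defines sends the divided power of `ξ` to the value of the law at `ξ`. Homogeneity is
essential, because `divHom` only sees the component of degree `d`. -/
lemma divHom_baseChange (c : SymmetricAlgebra k (dualObj X) ⊗[k] M)
    (hc : coeffMap (degHom (dualObj X)) M c =
      (Polynomial.X ^ d : (SymmetricAlgebra k (dualObj X))[X]) • coeffMap (cst k _) M c)
    (ξ : T ⊗[k] X) :
    (divHom (d := d) c).baseChange T (divPoint d ξ) = coeffMap (evalAt ξ) M c := by
  have h1 : c = (polyIncl d X).rTensor M ((polyProj d X).rTensor M c) := by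
    have h2 : (polyIncl d X).rTensor M ((polyProj d X).rTensor M c) =
        cf _ _ d (coeffMap (degHom (dualObj X)) M c) := by
      generalize c = c
      induction c using TensorProduct.induction_on with
      | zero => simp
      | add x y hx hy => simp only [map_add, hx, hy]
      | tmul p m => rw [LinearMap.rTensor_tmul, LinearMap.rTensor_tmul, coeffMap_tmul, cf_tmul]; rfl
    rw [h2, hc, cf_X_pow_smul, if_pos rfl]
  rw [h1]
  generalize (polyProj d X).rTensor M c = y
  induction y using TensorProduct.induction_on with
  | zero => simp
  | add x y hx hy => rw [map_add, map_add, map_add, LinearMap.baseChange_add, LinearMap.add_apply, hx, hy]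
  | tmul p m =>
    have h3 (z : T ⊗[k] (divPow k d).obj X) :
        (divHom (d := d) ((polyIncl d X p) ⊗ₜ[k] m)).baseChange T z =
          divPairing z (1 ⊗ₜ[k] p) ⊗ₜ[k] m := by
      induction z using TensorProduct.induction_on with
      | zero =>
        rw [map_zero]
        exact (zero_tmul _ _).symm.trans (congrArg (· ⊗ₜ[k] m) (dualPairing_zero_left _).symm)
      | add x y hx hy =>
        rw [map_add, hx, hy, ← add_tmul]
        exact congrArg (· ⊗ₜ[k] m) (dualPairing_add_left _ _ _).symm
      | tmul t a =>
        rw [LinearMap.baseChange_tmul, divHom_tmul, polyProj_polyIncl, divPairing_tmul_left,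
          tmul_smul, ← Algebra.smul_def, TensorProduct.smul_tmul']
    rw [LinearMap.rTensor_tmul, h3, divPairing_divPoint, one_mul, coeffMap_tmul]

end DivHom

end DivPoint

end SPF

namespace SPF

namespace StrictPoly

variable {k : Type u} [Field k] {S T R : Type u} [CommRing S] [Algebra k S] [CommRing T]
  [Algebra k T] [CommRing R] [Algebra k R] {U V W X : FGModuleCat.{u} k} {d s : ℕ}

/-! ### The Yoneda lemma for the functors `D^d_U`. -/

section Yoneda

variable (F G : StrictPoly k d)

/-- The value of `F` at the generic linear map from `U` to `W`. -/
def genericValue (U W : FGModuleCat.{u} k) :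
    F.obj U →ₗ[k] SymmetricAlgebra k (dualObj (tensorObj (dualObj U) W)) ⊗[k] F.obj W :=
  ((F.map _ (pointHom (genericPoint (tensorObj (dualObj U) W)))).restrictScalars k) ∘ₗ
    TensorProduct.mk k _ (F.obj U) 1

lemma genericValue_apply (x : F.obj U) : F.genericValue U W x =
    F.map _ (pointHom (genericPoint (tensorObj (dualObj U) W))) (1 ⊗ₜ[k] x) := rfl

/-- The degree parameter multiplies the generic linear map, and `F` is homogeneous of degree `d`. -/
lemma degHom_genericValue (x : F.obj U) :
    coeffMap (degHom _) _ (F.genericValue U W x) = (Polynomial.X ^ d :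
      Polynomial (SymmetricAlgebra k (dualObj (tensorObj (dualObj U) W)))) •
        coeffMap (cst k _) _ (F.genericValue U W x) := by
  rw [genericValue_apply, ← F.map_coeffMap, ← F.map_coeffMap, ← pointHom_coeffMap,
    degHom_genericPoint, _root_.map_smul, F.map_smul, LinearMap.smul_apply, pointHom_coeffMap,
    coeffMap_tmul, coeffMap_tmul, map_one, map_one]

lemma coeffMap_genericValue (ξ : T ⊗[k] tensorObj (dualObj U) W) (x : F.obj U) :
    coeffMap (evalAt ξ) _ (F.genericValue U W x) = F.map T (pointHom ξ) (1 ⊗ₜ[k] x) := by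
  rw [genericValue_apply, ← F.map_coeffMap, ← pointHom_coeffMap, coeffMap_genericPoint,
    coeffMap_tmul, map_one]

/-- The component at `W` of the morphism `D^d_U → F` given by an element of `F(U)`. -/
def yonedaApp (x : F.obj U) (W : FGModuleCat.{u} k) : (divPowParam d U).obj W →ₗ[k] F.obj W :=
  divHom (F.genericValue U W x)

variable (d) in
/-- The divided power of an `S`-point of `U^* ⊗ W`, as an `S`-point of `D^d_U(W)`. -/
def paramPoint (ξ : S ⊗[k] tensorObj (dualObj U) W) : S ⊗[k] (divPowParam d U).obj W :=
  divPoint d ξ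

lemma paramPoint_coeffMap (φ : S →ₐ[k] T) (ξ : S ⊗[k] tensorObj (dualObj U) W) :
    paramPoint d (coeffMap φ _ ξ) = coeffMap φ _ (paramPoint d ξ) := divPoint_coeffMap φ ξ

lemma yonedaApp_paramPoint (x : F.obj U) (ξ : T ⊗[k] tensorObj (dualObj U) W) :
    (F.yonedaApp x W).baseChange T (paramPoint d ξ) = F.map T (pointHom ξ) (1 ⊗ₜ[k] x) := by
  rw [← coeffMap_genericValue]
  exact divHom_baseChange _ (F.degHom_genericValue x) ξ

lemma divPowParam_map_paramPoint {W W' : FGModuleCat.{u} k} (f : S ⊗[k] W →ₗ[S] S ⊗[k] W')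
    (ξ : S ⊗[k] tensorObj (dualObj U) W) :
    (divPowParam d U).map S f (paramPoint d ξ) = paramPoint d (tensorHom LinearMap.id f ξ) :=
  map_divPoint _ _

lemma divPowParamMap_paramPoint {U U' : FGModuleCat.{u} k} (f : S ⊗[k] U →ₗ[S] S ⊗[k] U')
    (ξ : S ⊗[k] tensorObj (dualObj U') W) :
    divPowParamMap d f W (paramPoint d ξ) = paramPoint d (tensorHom (dualMap f) LinearMap.id ξ) :=
  map_divPoint _ _

/-- A family of `S`-linear maps out of `D^d_U(W)` is determined by its values at divided powers. -/
lemma divPowParam_ext {M : Type u} [AddCommGroup M] [Module k M]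
    {f g : S ⊗[k] (divPowParam d U).obj W →ₗ[S] S ⊗[k] M}
    (h : ∀ (T : Type u) [CommRing T] [Algebra k T] (φ : S →ₐ[k] T)
      (ξ : T ⊗[k] tensorObj (dualObj U) W),
      extend φ f (paramPoint d ξ) = extend φ g (paramPoint d ξ)) : f = g :=
  divPow_ext h

lemma divPowParam_lin_ext {M : Type u} [AddCommGroup M] [Module k M]
    {f g : (divPowParam d U).obj W →ₗ[k] M}
    (h : ∀ (T : Type u) [CommRing T] [Algebra k T] (ξ : T ⊗[k] tensorObj (dualObj U) W),
      f.baseChange T (paramPoint d ξ) = g.baseChange T (paramPoint d ξ)) : f = g :=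
  divPow_lin_ext h

variable {F G}

/-- The morphism `D^d_U → F` given by an element of `F(U)`. -/
def yonedaHom (x : F.obj U) : divPowParam d U ⟶ F :=
  mkHom (F.yonedaApp x) fun S _ _ W W' f => divPowParam_ext fun T _ _ φ ξ => by
    rw [extend_comp, extend_comp, LinearMap.comp_apply, LinearMap.comp_apply, extend_baseChange,
      extend_baseChange, ← map_extend, ← map_extend, yonedaApp_paramPoint, divPowParam_map_paramPoint,
      yonedaApp_paramPoint, pointHom_tensorHom_right, F.map_map]

lemma yonedaHom_paramPoint (x : F.obj U) (ξ : T ⊗[k] tensorObj (dualObj U) W) :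
    (app (yonedaHom x) W).baseChange T (paramPoint d ξ) = F.map T (pointHom ξ) (1 ⊗ₜ[k] x) :=
  F.yonedaApp_paramPoint x ξ

lemma yonedaHom_comp (x : F.obj U) (φ : F ⟶ G) : yonedaHom x ≫ φ = yonedaHom (app φ U x) :=
  hom_ext fun W => divPowParam_lin_ext fun T _ _ ξ => by
    rw [yonedaHom_paramPoint, app_comp, LinearMap.baseChange_comp, LinearMap.comp_apply,
      yonedaHom_paramPoint]
    exact LinearMap.congr_fun (naturality φ T (pointHom ξ)) (1 ⊗ₜ[k] x)

/-- The linear map `F(U) → Hom(D^d_U, F)`. -/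
def yonedaLin (F : StrictPoly k d) (U : FGModuleCat.{u} k) : F.obj U →ₗ[k] (divPowParam d U ⟶ F) where
  toFun := yonedaHom
  map_add' x y := hom_ext fun W => by
    change divHom _ = divHom _ + divHom _
    rw [_root_.map_add, _root_.map_add]
    rfl
  map_smul' r x := hom_ext fun W => by
    change divHom _ = r • divHom _
    rw [_root_.map_smul, _root_.map_smul]
    rfl

variable (d) in
/-- The divided power of the identity, as an element of `D^d_U(U)`. -/
def divId (U : FGModuleCat.{u} k) : (divPowParam d U).obj U :=
  TensorProduct.lid k ((divPowParam d U).obj U) (paramPoint d (1 ⊗ₜ[k] idTensor U))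

lemma tmul_divId (U : FGModuleCat.{u} k) :
    (1 ⊗ₜ[k] divId d U : S ⊗[k] (divPowParam d U).obj U) = paramPoint d (1 ⊗ₜ[k] idTensor U) := by
  have h : (1 ⊗ₜ[k] idTensor U : S ⊗[k] tensorObj (dualObj U) U) =
    coeffMap (Algebra.ofId k S) _ (1 ⊗ₜ[k] idTensor U) := by rw [coeffMap_tmul, map_one]
  rw [h, paramPoint_coeffMap, coeffMap_ofId]
  rfl

/-- The divided power of the identity is universal: all others are its images under the
functoriality in the parameter. -/
lemma divPowParamMap_divId (ξ : S ⊗[k] tensorObj (dualObj U) W) :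
    divPowParamMap d (pointHom ξ) W (1 ⊗ₜ[k] divId d W) = paramPoint d ξ := by
  rw [tmul_divId, divPowParamMap_paramPoint]
  congr 1
  refine pointHom_injective ?_
  rw [pointHom_tensorHom_left, pointHom_idTensor, LinearMap.id_comp]

/-- Composing the identity with `g` on either side gives the divided power of `g`. This makes the
counit natural in `V`, which occurs there both as parameter and as argument. -/
lemma divPowParam_map_divId (g : S ⊗[k] U →ₗ[S] S ⊗[k] W) :
    (divPowParam d U).map S g (1 ⊗ₜ[k] divId d U) = divPowParamMap d g W (1 ⊗ₜ[k] divId d W) := by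
  rw [tmul_divId, tmul_divId, divPowParamMap_paramPoint, divPowParam_map_paramPoint]
  congr 1
  refine pointHom_injective ?_
  rw [pointHom_tensorHom_left, pointHom_tensorHom_right, pointHom_idTensor, pointHom_idTensor,
    LinearMap.id_comp, LinearMap.comp_id]

lemma yonedaHom_divId (x : F.obj U) : app (yonedaHom x) U (divId d U) = x := by
  refine tmul_injective (k := k) ?_
  change (1 : k) ⊗ₜ[k] _ = (1 : k) ⊗ₜ[k] _
  rw [← LinearMap.baseChange_tmul, tmul_divId, yonedaHom_paramPoint, pointHom_idTensor, F.map_id_apply]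

end Yoneda

/-! ### The adjunction between the abelian categories. -/

section Adjunction

variable (A : StrictPoly k s)

instance : (precomp d A).Linear k where

/-- The map `F(U) → Hom(C_A(D^d_U), C_A(F))`. -/
def kanUnitApp (F : StrictPoly k d) (U : FGModuleCat.{u} k) :
    F.obj U →ₗ[k] (kan A (F.comp A)).obj U :=
  (homEquiv ((divPowParam d U).comp A) (F.comp A)).symm.toLinearMap ∘ₗ
    (precomp d A).mapLinearMap k ∘ₗ yonedaLin F U

/-- The morphism given by an element of `Hom(C_A(D^d_U), G)`. -/
def kanHom {G : StrictPoly k (d * s)} (h : (kan A G).obj U) : (divPowParam d U).comp A ⟶ G :=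
  homEquiv _ G h

lemma kanHom_injective {G : StrictPoly k (d * s)} {h h' : (kan A G).obj U}
    (e : kanHom A h = kanHom A h') : h = h' := (homEquiv _ G).injective e

/-- The component at `V` of the morphism given by an element of `Hom(C_A(D^d_U), G)`. -/
def kanElt {G : StrictPoly k (d * s)} (h : (kan A G).obj U) (V : FGModuleCat.{u} k) :
    (divPowParam d U).obj (A.obj V) →ₗ[k] G.obj V := app (kanHom A h) V

lemma kanHom_kanUnitApp (F : StrictPoly k d) (x : F.obj U) :
    kanHom A (kanUnitApp A F U x) = (precomp d A).map (yonedaHom x) :=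
  LinearEquiv.apply_symm_apply _ _

lemma kanHom_map {G G' : StrictPoly k (d * s)} (η : G ⟶ G') (h : (kan A G).obj U) :
    kanHom A (app ((kanFunctor d A).map η) U h) = kanHom A h ≫ η := homEquiv_homObjMap _ η h

/-- The `S`-linear map `S ⊗ X(V) → S ⊗ G(V)` given by an element of `S ⊗ Hom(X, G)`. -/
def homOverApp {X G : StrictPoly k d} (x : S ⊗[k] homObj X G) (V : FGModuleCat.{u} k) :
    S ⊗[k] X.obj V →ₗ[S] S ⊗[k] G.obj V := (homOverEquiv S X G x).1 V

lemma homOverApp_tmul {X G : StrictPoly k d} (a : S) (h : homObj X G) (V : FGModuleCat.{u} k) :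
    homOverApp (a ⊗ₜ[k] h) V = a • (app (homEquiv X G h) V).baseChange S :=
  toHomOver_tmul a h V

lemma homOverApp_add {X G : StrictPoly k d} (x y : S ⊗[k] homObj X G) (V : FGModuleCat.{u} k) :
    homOverApp (x + y) V = homOverApp x V + homOverApp y V := by
  rw [homOverApp, map_add]; rfl

lemma homOverApp_zero {X G : StrictPoly k d} (V : FGModuleCat.{u} k) :
    homOverApp (0 : S ⊗[k] homObj X G) V = 0 := by
  rw [homOverApp, map_zero]; rfl

lemma homOverApp_naturality {X G : StrictPoly k d} (x : S ⊗[k] homObj X G)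
    (f : S ⊗[k] V →ₗ[S] S ⊗[k] W) (z : S ⊗[k] X.obj V) :
    homOverApp x W (X.map S f z) = G.map S f (homOverApp x V z) := by
  have h := (homOverEquiv S X G x).2 S (AlgHom.id k S) V W f
  have e (V : FGModuleCat.{u} k) : extend (AlgHom.id k S) ((homOverEquiv S X G x).1 V) =
      homOverApp x V := (eq_extend _ _ _ fun m => (coeffMap_id _).symm).symm
  rw [e, e] at h
  exact LinearMap.congr_fun h z

/-- The `S`-linear map `S ⊗ D^d_U(A(V)) → S ⊗ G(V)` given by an element
of `S ⊗ Hom(C_A(D^d_U), G)`. -/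
def kanApp {G : StrictPoly k (d * s)} (x : S ⊗[k] (kan A G).obj U) (V : FGModuleCat.{u} k) :
    S ⊗[k] (divPowParam d U).obj (A.obj V) →ₗ[S] S ⊗[k] G.obj V :=
  homOverApp (X := (divPowParam d U).comp A) x V

lemma kanApp_ext {G : StrictPoly k (d * s)} {x y : S ⊗[k] (kan A G).obj U}
    (h : ∀ V, kanApp A x V = kanApp A y V) : x = y := homOverEquiv_ext h

lemma kanApp_tmul {G : StrictPoly k (d * s)} (a : S) (h : (kan A G).obj U)
    (V : FGModuleCat.{u} k) : kanApp A (a ⊗ₜ[k] h) V = a • (kanElt A h V).baseChange S :=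
  homOverApp_tmul a h V

lemma kanApp_add {G : StrictPoly k (d * s)} (x y : S ⊗[k] (kan A G).obj U)
    (V : FGModuleCat.{u} k) : kanApp A (x + y) V = kanApp A x V + kanApp A y V :=
  homOverApp_add x y V

lemma kanApp_zero {G : StrictPoly k (d * s)} (V : FGModuleCat.{u} k) :
    kanApp A (0 : S ⊗[k] (kan A G).obj U) V = 0 := homOverApp_zero V

lemma kanApp_naturality {G : StrictPoly k (d * s)} (x : S ⊗[k] (kan A G).obj U)
    (f : S ⊗[k] V →ₗ[S] S ⊗[k] W) (z : S ⊗[k] (divPowParam d U).obj (A.obj V)) :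
    kanApp A x W ((divPowParam d U).map S (A.map S f) z) = G.map S f (kanApp A x V z) :=
  homOverApp_naturality (X := (divPowParam d U).comp A) x f z

lemma kanApp_map {G : StrictPoly k (d * s)} {U U' : FGModuleCat.{u} k}
    (f : S ⊗[k] U →ₗ[S] S ⊗[k] U') (x : S ⊗[k] (kan A G).obj U) (V : FGModuleCat.{u} k) :
    kanApp A ((kan A G).map S f x) V = kanApp A x V ∘ₗ divPowParamMap d f (A.obj V) :=
  homOverEquiv_kanMap A G f x V

/-- The map `S ⊗ D^d_U(A(V)) → S ⊗ F(A(V))` given by an element of `S ⊗ F(U)`. -/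
def kanUnitMap (F : StrictPoly k d) (x : S ⊗[k] F.obj U) (V : FGModuleCat.{u} k) :
    S ⊗[k] (divPowParam d U).obj (A.obj V) →ₗ[S] S ⊗[k] F.obj (A.obj V) :=
  kanApp A ((kanUnitApp A F U).baseChange S x) V

/-- On divided powers the unit is the action of `F` on points, so its naturality reduces to the
functoriality of `F`. -/
lemma kanUnitMap_paramPoint (F : StrictPoly k d) (x : S ⊗[k] F.obj U) (V : FGModuleCat.{u} k)
    (φ : S →ₐ[k] T) (ξ : T ⊗[k] tensorObj (dualObj U) (A.obj V)) :
    extend φ (kanUnitMap A F x V) (paramPoint d ξ) = F.map T (pointHom ξ) (coeffMap φ _ x) := by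
  induction x using TensorProduct.induction_on with
  | zero =>
    have h : kanUnitMap A F (0 : S ⊗[k] F.obj U) V = 0 := by
      rw [kanUnitMap, map_zero]
      exact kanApp_zero A V
    rw [h, extend_zero, map_zero, map_zero]
    rfl
  | add x y hx hy =>
    have h : kanUnitMap A F (x + y) V = kanUnitMap A F x V + kanUnitMap A F y V := by
      rw [kanUnitMap, map_add]
      exact kanApp_add A _ _ V
    rw [h, extend_add, LinearMap.add_apply, map_add, map_add, hx, hy]
  | tmul a x =>
    have h : kanUnitMap A F (a ⊗ₜ[k] x) V = a • (app (yonedaHom x) (A.obj V)).baseChange S := by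
      rw [kanUnitMap, LinearMap.baseChange_tmul, kanApp_tmul, kanElt, kanHom_kanUnitApp]
      rfl
    rw [h, extend_smul, extend_baseChange, LinearMap.smul_apply, coeffMap_tmul,
      yonedaHom_paramPoint, ← _root_.map_smul, TensorProduct.smul_tmul', smul_eq_mul, mul_one]

lemma kanUnitMap_map (F : StrictPoly k d) {U U' : FGModuleCat.{u} k}
    (f : S ⊗[k] U →ₗ[S] S ⊗[k] U') (x : S ⊗[k] F.obj U) (V : FGModuleCat.{u} k) :
    kanUnitMap A F (F.map S f x) V = kanUnitMap A F x V ∘ₗ divPowParamMap d f (A.obj V) := by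
  refine divPowParam_ext fun T _ _ φ ξ => ?_
  rw [extend_comp, LinearMap.comp_apply, ← divPowParamMap_extend, divPowParamMap_paramPoint,
    kanUnitMap_paramPoint, kanUnitMap_paramPoint, pointHom_tensorHom_left, ← F.map_coeffMap,
    F.map_map]

/-- The morphism `F → Hom(C_A(D^d_U), C_A(F))`. -/
def kanUnit (F : StrictPoly k d) : F ⟶ kan A (F.comp A) :=
  mkHom (G := kan A (F.comp A)) (kanUnitApp A F) fun S _ _ U _ f => LinearMap.ext fun x =>
    kanApp_ext A fun V => (kanUnitMap_map A F f x V).trans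
      (kanApp_map A (G := F.comp A) f ((kanUnitApp A F U).baseChange S x) V).symm

/-- The map `Hom(C_A(D^d_{A(V)}), G) → G(V)`. -/
def kanCounitApp (G : StrictPoly k (d * s)) (V : FGModuleCat.{u} k) :
    (kan A G).obj (A.obj V) →ₗ[k] G.obj V where
  toFun h := kanElt A h V (divId d (A.obj V))
  map_add' x y := by
    have h : kanHom A (x + y) = kanHom A x + kanHom A y :=
      map_add (homEquiv ((divPowParam d (A.obj V)).comp A) G) _ _
    rw [kanElt, h]
    rfl
  map_smul' r x := by
    have h : kanHom A (r • x) = r • kanHom A x :=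
      _root_.map_smul (homEquiv ((divPowParam d (A.obj V)).comp A) G) _ _
    rw [kanElt, h]
    rfl

lemma kanCounitApp_apply (G : StrictPoly k (d * s)) (V : FGModuleCat.{u} k)
    (h : (kan A G).obj (A.obj V)) :
    kanCounitApp A G V h = kanElt A h V (divId d (A.obj V)) := rfl

lemma kanCounitApp_baseChange (G : StrictPoly k (d * s)) (V : FGModuleCat.{u} k)
    (x : S ⊗[k] (kan A G).obj (A.obj V)) :
    (kanCounitApp A G V).baseChange S x = kanApp A x V (1 ⊗ₜ[k] divId d (A.obj V)) := by
  induction x using TensorProduct.induction_on with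
  | zero => rw [map_zero, kanApp_zero, LinearMap.zero_apply]
  | add x y hx hy => rw [map_add, hx, hy, kanApp_add, LinearMap.add_apply]
  | tmul a h =>
    rw [LinearMap.baseChange_tmul, kanApp_tmul, LinearMap.smul_apply, LinearMap.baseChange_tmul,
      TensorProduct.smul_tmul', smul_eq_mul, mul_one, kanCounitApp_apply]

lemma kanCounitApp_map (G : StrictPoly k (d * s)) {V W : FGModuleCat.{u} k}
    (f : S ⊗[k] V →ₗ[S] S ⊗[k] W) (x : S ⊗[k] (kan A G).obj (A.obj V)) :
    (kanCounitApp A G W).baseChange S ((kan A G).map S (A.map S f) x) =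
      G.map S f ((kanCounitApp A G V).baseChange S x) := by
  rw [kanCounitApp_baseChange, kanCounitApp_baseChange, kanApp_map, ← kanApp_naturality,
    LinearMap.comp_apply, divPowParam_map_divId]

/-- The morphism `C_A(V ↦ Hom(C_A(D^d_V), G)) → G`. -/
def kanCounit (G : StrictPoly k (d * s)) : (kan A G).comp A ⟶ G :=
  mkHom (F := (kan A G).comp A) (kanCounitApp A G) fun _ _ _ _ _ f => LinearMap.ext fun x =>
    kanCounitApp_map A G f x

lemma kanUnit_naturality {F G : StrictPoly k d} (φ : F ⟶ G) :
    φ ≫ kanUnit A G = kanUnit A F ≫ (kanFunctor d A).map ((precomp d A).map φ) :=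
  hom_ext fun U => LinearMap.ext fun x => by
    refine kanHom_injective A ((kanHom_kanUnitApp A G (app φ U x)).trans ?_)
    refine Eq.trans ?_ (kanHom_map A ((precomp d A).map φ) (kanUnitApp A F U x)).symm
    rw [← yonedaHom_comp]
    exact ((precomp d A).map_comp _ _).trans
      (congrArg (· ≫ (precomp d A).map φ) (kanHom_kanUnitApp A F x).symm)

lemma kanCounit_naturality {G G' : StrictPoly k (d * s)} (η : G ⟶ G') :
    (precomp d A).map ((kanFunctor d A).map η) ≫ kanCounit A G' = kanCounit A G ≫ η :=
  hom_ext fun V => LinearMap.ext fun (h : (kan A G).obj (A.obj V)) => by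
    change app (kanHom A (app ((kanFunctor d A).map η) (A.obj V) h)) V (divId d (A.obj V)) = _
    rw [kanHom_map]
    rfl

lemma kan_left_triangle (F : StrictPoly k d) (x : F.obj (A.obj V)) :
    kanCounitApp A (F.comp A) V (kanUnitApp A F (A.obj V) x) = x := by
  rw [kanCounitApp_apply, kanElt, kanHom_kanUnitApp]
  exact yonedaHom_divId x

/-- Tested on the divided power of `ξ`: the Yoneda morphism precomposes `h` with `ξ`, and the counit
evaluates the result at the divided power of the identity, which `ξ` carries to that of `ξ`. -/
lemma kan_right_triangle (G : StrictPoly k (d * s)) (h : (kan A G).obj U) :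
    (precomp d A).map (yonedaHom h) ≫ kanCounit A G = kanHom A h :=
  hom_ext fun V => by
    change kanCounitApp A G V ∘ₗ app (yonedaHom h) (A.obj V) = kanElt A h V
    refine divPowParam_lin_ext fun T _ _ ξ => ?_
    rw [LinearMap.baseChange_comp, LinearMap.comp_apply, yonedaHom_paramPoint,
      kanCounitApp_baseChange, kanApp_map, LinearMap.comp_apply, divPowParamMap_divId, kanApp_tmul,
      one_smul]

/-- The functor `G ↦ (V ↦ Hom(C_A(D^d_V), G))` is right adjoint to the precomposition with `A`. -/
def kanAdjunction (d : ℕ) (A : StrictPoly k s) : precomp d A ⊣ kanFunctor d A :=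
  Adjunction.mkOfUnitCounit
    { unit :=
        { app := fun F => kanUnit A F
          naturality := fun _ _ φ => kanUnit_naturality A φ }
      counit :=
        { app := fun G => kanCounit A G
          naturality := fun _ _ η => kanCounit_naturality A η }
      left_triangle := by
        ext F : 2
        exact hom_ext fun V => LinearMap.ext fun x => kan_left_triangle A F x
      right_triangle := by
        ext G : 2
        refine hom_ext fun U => LinearMap.ext fun (h : (kan A G).obj U) => kanHom_injective A ?_
        change kanHom A (app ((kanFunctor d A).map (kanCounit A G)) U
          (kanUnitApp A (kan A G) U h)) = kanHom A h
        rw [kanHom_map, kanHom_kanUnitApp]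
        exact kan_right_triangle A G h }

end Adjunction

end StrictPoly

end SPF

namespace SPF

open Limits

universe v w v' w' v'' w''

/-! ### Bounded complexes and the derived adjunction. -/

section MapBounded

variable {C : Type w} [Category.{v} C] [Preadditive C] {D : Type w'} [Category.{v'} D]
  [Preadditive D]

/-- Adjoint additive functors induce adjoint functors between the categories of bounded
complexes. -/
def mapBoundedAdjunction {F : C ⥤ D} {G : D ⥤ C} [F.Additive] [G.Additive] (adj : F ⊣ G) :
    mapBounded F ⊣ mapBounded G :=
  Adjunction.mkOfUnitCounit
    { unit :=
        { app := fun K => ObjectProperty.homMk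
            { f := fun i => adj.unit.app (K.obj.X i)
              comm' := fun i j _ => (adj.unit.naturality (K.obj.d i j)).symm }
          naturality := fun K L f => ObjectProperty.hom_ext _ (by
            ext i
            exact adj.unit.naturality (f.hom.f i)) }
      counit :=
        { app := fun K => ObjectProperty.homMk
            { f := fun i => adj.counit.app (K.obj.X i)
              comm' := fun i j _ => (adj.counit.naturality (K.obj.d i j)).symm }
          naturality := fun K L f => ObjectProperty.hom_ext _ (by
            ext i
            exact adj.counit.naturality (f.hom.f i)) }
      left_triangle := by
        ext K : 2
        refine ObjectProperty.hom_ext _ ?_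
        ext i
        refine Eq.trans ?_ (adj.left_triangle_components (K.obj.X i))
        exact congrArg (_ ≫ ·) (Category.id_comp _)
      right_triangle := by
        ext K : 2
        refine ObjectProperty.hom_ext _ ?_
        ext i
        refine Eq.trans ?_ (adj.right_triangle_components (K.obj.X i))
        exact congrArg (_ ≫ ·) (Category.id_comp _) }

/-- The homotopy between the images of homotopic morphisms of bounded complexes. -/
def mapBoundedHomotopy (F : C ⥤ D) [F.Additive] {K L : BoundedComplex C} {f g : K ⟶ L}
    (h : Homotopy f.hom g.hom) : Homotopy ((mapBounded F).map f).hom ((mapBounded F).map g).hom :=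
  F.mapHomotopy h

end MapBounded

variable {k : Type u} [Field k] (d : ℕ) {s : ℕ} (A : StrictPoly k s)

lemma kanComplex_map_eq_of_homotopy {K L : BoundedComplex (StrictPoly k (d * s))} {f g : K ⟶ L}
    (h : Homotopy f.hom g.hom) : (kanComplex d A).map f = (kanComplex d A).map g :=
  BoundedComplex.localization_map_eq (DPQ k d) (quasiIsos k d) (fun _ _ f => quasiIsos_iff f)
    (mapBoundedHomotopy (StrictPoly.kanFunctor d A) h)

/-- The functor `G ↦ (V ↦ Hom(C_A(D^d_V), G))` has a pointwise right derived functor. -/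
theorem kanComplex_hasPointwiseRightDerivedFunctor :
    (kanComplex d A).HasPointwiseRightDerivedFunctor (quasiIsos k (d * s)) :=
  BoundedComplex.hasPointwiseRightDerivedFunctor (quasiIsos k (d * s)) (fun _ _ f => quasiIsos_iff f)
    (kanComplex d A) (fun _ _ _ _ h => kanComplex_map_eq_of_homotopy d A h) StrictPoly.finInj

section

variable [(kanComplex d A).HasPointwiseRightDerivedFunctor (quasiIsos k (d * s))]

/-- The isomorphism which characterizes the functor `C_A` on the derived categories. -/
def derivedPrecompIso : DPQ k d ⋙ derivedPrecomp d A ≅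
    mapBounded (StrictPoly.precomp d A) ⋙ DPQ k (d * s) :=
  Localization.fac (mapBounded (StrictPoly.precomp d A) ⋙ DPQ k (d * s)) (quasiIsos_precomp d A)
    (DPQ k d)

/-- The canonical morphism from `G ↦ (V ↦ Hom(C_A(D^d_V), G))` to its right derived functor. -/
def rightKanUnit : mapBounded (StrictPoly.kanFunctor d A) ⋙ DPQ k d ⟶
    DPQ k (d * s) ⋙ rightKan d A :=
  (kanComplex d A).totalRightDerivedUnit (DPQ k (d * s)) (quasiIsos k (d * s))

instance : (rightKan d A).IsRightDerivedFunctor (rightKanUnit d A) (quasiIsos k (d * s)) :=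
  inferInstanceAs (((kanComplex d A).totalRightDerived (DPQ k (d * s))
    (quasiIsos k (d * s))).IsRightDerivedFunctor ((kanComplex d A).totalRightDerivedUnit
      (DPQ k (d * s)) (quasiIsos k (d * s))) (quasiIsos k (d * s)))

lemma isIso_rightKanUnit_app {J : BoundedComplex (StrictPoly k (d * s))} (hJ : J.IsInj) :
    IsIso ((rightKanUnit d A).app J) :=
  BoundedComplex.isIso_app_of_isRightDerivedFunctor (quasiIsos k (d * s))
    (fun _ _ f => quasiIsos_iff f) (F := kanComplex d A)
    (fun _ _ _ _ h => kanComplex_map_eq_of_homotopy d A h)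
    ((kanComplex d A).totalRightDerived (DPQ k (d * s)) (quasiIsos k (d * s)))
    ((kanComplex d A).totalRightDerivedUnit (DPQ k (d * s)) (quasiIsos k (d * s))) hJ

/-- Precomposition preserves quasi-isomorphisms, so the functor it induces is its own left derived
functor. -/
instance : (derivedPrecomp d A).IsLeftDerivedFunctor (derivedPrecompIso d A).hom (quasiIsos k d) :=
  Functor.isLeftDerivedFunctor_of_inverts _ _ _

instance : (derivedPrecomp d A ⋙ rightKan d A).IsLeftDerivedFunctor
    ((Functor.associator _ _ _).inv ≫
      Functor.whiskerRight (derivedPrecompIso d A).hom (rightKan d A)) (quasiIsos k d) :=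
  Functor.isLeftDerivedFunctor_of_inverts (quasiIsos k d) _
    ((Functor.associator _ _ _).symm ≪≫ Functor.isoWhiskerRight (derivedPrecompIso d A) _)

/-- At a complex of injectives the unit of `K^r_A` is an isomorphism, and it stays one under `C_A`.
With both composites recognized as derived functors, unit and counit descend through
`Adjunction.derived`. -/
instance : (rightKan d A ⋙ derivedPrecomp d A).IsRightDerivedFunctor
    (Functor.whiskerRight (rightKanUnit d A) (derivedPrecomp d A) ≫
      (Functor.associator _ _ _).hom) (quasiIsos k (d * s)) :=
  BoundedComplex.isRightDerivedFunctor (quasiIsos k (d * s)) (fun _ _ f => quasiIsos_iff f)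
    StrictPoly.finInj _ _ (fun J hJ => by
      have := isIso_rightKanUnit_app d A hJ
      have h : IsIso ((derivedPrecomp d A).map ((rightKanUnit d A).app J)) := inferInstance
      exact IsIso.comp_isIso' h inferInstance)

/-- The functor `K^r_A` is right adjoint to `C_A`. -/
def derivedAdjunction : derivedPrecomp d A ⊣ rightKan d A :=
  (mapBoundedAdjunction (StrictPoly.kanAdjunction d A)).derived (quasiIsos k d)
    (quasiIsos k (d * s)) (derivedPrecompIso d A).hom (rightKanUnit d A)

end

end SPF

/-! ### Biduality, and Kuhn duality against precomposition. -/

namespace SPF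

variable {k : Type u} [Field k] {S : Type u} [CommRing S] [Algebra k S]
  {V W : FGModuleCat.{u} k}

/-- The canonical isomorphism between a finite-dimensional space and its double dual. -/
def biduality (V : FGModuleCat.{u} k) : V ≃ₗ[k] dualObj (dualObj V) := Module.evalEquiv k V

/-- The canonical isomorphism between a finite-dimensional space and its double dual, as a
linear map. -/
def bidual (V : FGModuleCat.{u} k) : V →ₗ[k] dualObj (dualObj V) := (biduality V).toLinearMap

lemma bidual_bijective (V : FGModuleCat.{u} k) : Function.Bijective (bidual V) :=
  (biduality V).bijective

lemma formVal_bidual (l : dualObj V) (v : V) :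
    formVal (U := dualObj V) (bidual V v) l = formVal l v := rfl

lemma dualPairing_bidual (v : S ⊗[k] V) (a : S ⊗[k] dualObj V) :
    dualPairing ((bidual V).baseChange S v) a = dualPairing a v := by
  induction v using TensorProduct.induction_on with
  | zero => rw [map_zero, dualPairing_zero_left, dualPairing_zero_right]
  | add x y hx hy => rw [map_add, dualPairing_add_left, dualPairing_add_right, hx, hy]
  | tmul s v =>
    induction a using TensorProduct.induction_on with
    | zero => rw [dualPairing_zero_left, dualPairing_zero_right]
    | add x y hx hy => rw [dualPairing_add_left, dualPairing_add_right, hx, hy]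
    | tmul t l =>
      rw [LinearMap.baseChange_tmul, dualPairing_tmul, dualPairing_tmul, formVal_bidual,
        mul_comm s t]

lemma dualMap_dualMap_comp_bidual (f : S ⊗[k] V →ₗ[S] S ⊗[k] W) :
    dualMap (dualMap f) ∘ₗ (bidual V).baseChange S = (bidual W).baseChange S ∘ₗ f :=
  LinearMap.ext fun v => dualPairing_ext fun a => by
    rw [LinearMap.comp_apply, LinearMap.comp_apply, dualPairing_dualMap, dualPairing_bidual,
      dualPairing_dualMap, dualPairing_bidual]

namespace StrictPoly

variable {d s : ℕ}

lemma lin_bijective (F : StrictPoly k d) {f : V →ₗ[k] W} (hf : Function.Bijective f) :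
    Function.Bijective (F.lin f) := by
  let e := LinearEquiv.ofBijective f hf
  have h1 : e.symm.toLinearMap ∘ₗ f = LinearMap.id := LinearMap.ext fun x => e.symm_apply_apply x
  have h2 : f ∘ₗ e.symm.toLinearMap = LinearMap.id := LinearMap.ext fun x => e.apply_symm_apply x
  have h3 (x) : F.lin e.symm.toLinearMap (F.lin f x) = x := by
    rw [← LinearMap.comp_apply, ← lin_comp, h1, lin_id, LinearMap.id_apply]
  have h4 (x) : F.lin f (F.lin e.symm.toLinearMap x) = x := by
    rw [← LinearMap.comp_apply, ← lin_comp, h2, lin_id, LinearMap.id_apply]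
  exact ⟨Function.LeftInverse.injective h3, Function.RightInverse.surjective h4⟩

lemma dualLin_bijective {f : V →ₗ[k] W} (hf : Function.Bijective f) :
    Function.Bijective (dualLin f) :=
  (LinearEquiv.ofBijective f hf).dualMap.bijective

lemma bidual_comp_lin_naturality (F : StrictPoly k d) (f : S ⊗[k] V →ₗ[S] S ⊗[k] W) :
    (bidual (F.obj (dualObj (dualObj W))) ∘ₗ F.lin (bidual W)).baseChange S ∘ₗ F.map S f =
      dualMap (dualMap (F.map S (dualMap (dualMap f)))) ∘ₗ
        (bidual (F.obj (dualObj (dualObj V))) ∘ₗ F.lin (bidual V)).baseChange S := by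
  rw [LinearMap.baseChange_comp, LinearMap.baseChange_comp, ← map_baseChange, ← map_baseChange,
    ← LinearMap.comp_assoc, dualMap_dualMap_comp_bidual, LinearMap.comp_assoc,
    LinearMap.comp_assoc, ← map_comp, ← map_comp, dualMap_dualMap_comp_bidual]

/-- The morphism `F → F^##`. -/
def toBidual (F : StrictPoly k d) : F ⟶ F.dual.dual :=
  mkHom (G := F.dual.dual) (fun V => bidual (F.obj (dualObj (dualObj V))) ∘ₗ F.lin (bidual V))
    fun _ _ _ _ _ f => F.bidual_comp_lin_naturality f

lemma toBidual_bijective (F : StrictPoly k d) (V : FGModuleCat.{u} k) :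
    Function.Bijective (app (toBidual F) V) :=
  (bidual_bijective (F.obj (dualObj (dualObj V)))).comp (F.lin_bijective (bidual_bijective V))

/-- The Kuhn duality is an involution. -/
def kuhnBidual (k : Type u) [Field k] (d : ℕ) :
    𝟭 (StrictPoly k d) ≅ (kuhn (k := k) d).rightOp ⋙ kuhn d :=
  have (F : StrictPoly k d) : IsIso (toBidual F) := isIso_of_bijective _ (toBidual_bijective F)
  NatIso.ofComponents (fun F => @asIso _ _ _ _ (toBidual F) (this F)) fun {F G} φ => hom_ext fun V => by
    refine LinearMap.ext fun x => ?_
    change bidual (G.obj (dualObj (dualObj V))) (G.lin (bidual V) (app φ V x)) =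
      dualLin (dualLin (app φ (dualObj (dualObj V)))) (bidual (F.obj (dualObj (dualObj V)))
        (F.lin (bidual V) x))
    rw [← app_lin]
    rfl

variable (A : StrictPoly k s)

lemma dualLin_lin_bidual_naturality (F : StrictPoly k d) (g : S ⊗[k] V →ₗ[S] S ⊗[k] W) :
    (dualLin (F.lin (bidual V))).baseChange S ∘ₗ dualMap (F.map S (dualMap (dualMap g))) =
      dualMap (F.map S g) ∘ₗ (dualLin (F.lin (bidual W))).baseChange S := by
  rw [← dualMap_baseChange, ← dualMap_baseChange, ← map_baseChange, ← map_baseChange,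
    ← dualMap_comp, ← dualMap_comp, ← map_comp, ← map_comp, dualMap_dualMap_comp_bidual]

/-- The morphism `F^# ∘ A^# → (F ∘ A)^#`. -/
def dualComp (F : StrictPoly k d) : F.dual.comp A.dual ⟶ (F.comp A).dual :=
  mkHom (F := F.dual.comp A.dual) (G := (F.comp A).dual)
    (fun V => dualLin (F.lin (bidual (A.obj (dualObj V)))))
    fun S _ _ _ _ f => F.dualLin_lin_bidual_naturality (A.map S (dualMap f))

/-- The precomposition with `A` corresponds to the precomposition with `A^#` by the Kuhn
duality. -/
def kuhnPrecomp (d : ℕ) : kuhn d ⋙ precomp d A.dual ≅ (precomp d A).op ⋙ kuhn (d * s) :=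
  have (F : StrictPoly k d) : IsIso (dualComp A F) :=
    isIso_of_bijective _ fun V => dualLin_bijective (F.lin_bijective (bidual_bijective _))
  NatIso.ofComponents (fun F => @asIso _ _ _ _ (dualComp A F.unop) (this F.unop)) fun {F G} φ => hom_ext fun V => by
    change dualLin (G.unop.lin _) ∘ₗ dualLin (app φ.unop _) =
      dualLin (app φ.unop _) ∘ₗ dualLin (F.unop.lin _)
    rw [← dualLin_comp, ← dualLin_comp]
    refine congrArg dualLin (LinearMap.ext fun x => ?_)
    exact app_lin φ.unop _ x

end StrictPoly

end SPF

namespace SPF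

open Limits Opposite

universe v w v' w' v'' w'' v''' w'''

/-! ### Kuhn duality on the derived categories and the left adjoint. -/

section MapBounded

variable {C : Type w} [Category.{v} C] [Preadditive C] {D : Type w'} [Category.{v'} D]
  [Preadditive D] {E : Type w''} [Category.{v''} E] [Preadditive E]
  {C' : Type w'''} [Category.{v'''} C'] [Preadditive C']

/-- The degreewise extension to bounded complexes of an isomorphism `F ⋙ G ≅ H.op ⋙ F'`, where
`F` and `F'` are contravariant. -/
def mapBoundedOpCompIso {F : Cᵒᵖ ⥤ D} {G : D ⥤ E} {H : C ⥤ C'} {F' : C'ᵒᵖ ⥤ E} [F.Additive]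
    [G.Additive] [H.Additive] [F'.Additive] (α : F ⋙ G ≅ H.op ⋙ F') :
    mapBoundedOp F ⋙ mapBounded G ≅ (mapBounded H).op ⋙ mapBoundedOp F' :=
  NatIso.ofComponents
    (fun K => ObjectProperty.isoMk _ (HomologicalComplex.Hom.isoOfComponents
      (fun n => α.app (op (K.unop.obj.X (-n))))
      (fun i j _ => (α.hom.naturality (K.unop.obj.d (-j) (-i)).op).symm)))
    (fun f => ObjectProperty.hom_ext _ (by
      ext n
      exact α.hom.naturality (f.unop.hom.f (-n)).op))

/-- The degreewise extension to bounded complexes of a biduality isomorphism. -/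
def mapBoundedOpBidual {F : Cᵒᵖ ⥤ C} [F.Additive] (α : 𝟭 C ≅ F.rightOp ⋙ F) :
    𝟭 (BoundedComplex C) ≅ (mapBoundedOp F).rightOp ⋙ mapBoundedOp F :=
  NatIso.ofComponents
    (fun K => ObjectProperty.isoMk _ (HomologicalComplex.Hom.isoOfComponents
      -- Dualizing twice negates the degree twice, and `- -n` has to be transported to `n`.
      (fun n => K.obj.XIsoOfEq (neg_neg n).symm ≪≫ α.app (K.obj.X (- -n)))
      (fun i j _ => by
        have h := α.hom.naturality (K.obj.d (- -i) (- -j))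
        refine (Category.assoc _ _ _).trans ((congrArg (_ ≫ ·) h.symm).trans ?_)
        refine (Category.assoc _ _ _).symm.trans (Eq.trans ?_ (Category.assoc _ _ _))
        refine congrArg (· ≫ α.hom.app (K.obj.X (- -j))) ?_
        exact (K.obj.XIsoOfEq_hom_comp_d _ _).trans (K.obj.d_comp_XIsoOfEq_hom _ _).symm)))
    (fun {K L} f => ObjectProperty.hom_ext _ (by
      ext n
      have h := α.hom.naturality (f.hom.f (- -n))
      refine Eq.trans ?_ ((congrArg ((K.obj.XIsoOfEq (neg_neg n).symm).hom ≫ ·) h).trans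
        (Category.assoc _ _ _).symm)
      refine (Category.assoc _ _ _).symm.trans (Eq.trans ?_ (Category.assoc _ _ _))
      exact congrArg (· ≫ α.hom.app (L.obj.X (- -n)))
        (HomologicalComplex.XIsoOfEq_hom_naturality f.hom _)))

end MapBounded

variable {k : Type u} [Field k] (d : ℕ) {s : ℕ} (A : StrictPoly k s)

/-- The isomorphism which characterizes the Kuhn duality on the derived category. -/
def derivedKuhnIso : (DPQ k d).op ⋙ derivedKuhn d ≅
    mapBoundedOp (StrictPoly.kuhn (k := k) d) ⋙ DPQ k d :=
  Localization.fac (mapBoundedOp (StrictPoly.kuhn (k := k) d) ⋙ DPQ k d) (quasiIsos_kuhn d)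
    (DPQ k d).op

/-- The Kuhn duality on the derived category is an involution. -/
def derivedKuhnBidual : 𝟭 (DP k d) ≅ (derivedKuhn d).rightOp ⋙ derivedKuhn d :=
  letI : Localization.Lifting (DPQ k d) (quasiIsos k d)
      ((mapBoundedOp (StrictPoly.kuhn (k := k) d)).rightOp ⋙
        mapBoundedOp (StrictPoly.kuhn (k := k) d) ⋙ DPQ k d)
      ((derivedKuhn d).rightOp ⋙ derivedKuhn d) :=
    ⟨NatIso.ofComponents (fun K => (derivedKuhn d).mapIso ((derivedKuhnIso d).app (op K)).symm.op ≪≫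
        (derivedKuhnIso d).app (op ((mapBoundedOp (StrictPoly.kuhn (k := k) d)).obj (op K))))
      (fun {K L} f => by
        have h1 := ((derivedKuhn d).map_comp _ _).symm.trans ((congrArg
          (fun q => (derivedKuhn d).map q.op) ((derivedKuhnIso d).inv.naturality f.op)).symm.trans
            ((derivedKuhn d).map_comp _ _))
        have h2 := (derivedKuhnIso d).hom.naturality
          ((mapBoundedOp (StrictPoly.kuhn (k := k) d)).map f.op).op
        exact (Category.assoc _ _ _).symm.trans ((congrArg (· ≫ _) h1).trans
          ((Category.assoc _ _ _).trans ((congrArg (_ ≫ ·) h2).trans (Category.assoc _ _ _).symm))))⟩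
  Localization.liftNatIso (DPQ k d) (quasiIsos k d) (DPQ k d)
    ((mapBoundedOp (StrictPoly.kuhn (k := k) d)).rightOp ⋙
      mapBoundedOp (StrictPoly.kuhn (k := k) d) ⋙ DPQ k d) _ _
    (Functor.isoWhiskerRight (mapBoundedOpBidual (StrictPoly.kuhnBidual k d)) (DPQ k d))

/-- The precomposition with `A` corresponds to the precomposition with `A^#` by the Kuhn duality,
on the derived categories. -/
def derivedKuhnPrecomp : derivedKuhn d ⋙ derivedPrecomp d A.dual ≅
    (derivedPrecomp d A).op ⋙ derivedKuhn (d * s) :=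
  letI : Localization.Lifting (DPQ k d).op (quasiIsos k d).op
      (mapBoundedOp (StrictPoly.kuhn d) ⋙ mapBounded (StrictPoly.precomp d A.dual) ⋙
        DPQ k (d * s)) (derivedKuhn d ⋙ derivedPrecomp d A.dual) :=
    ⟨Functor.isoWhiskerRight (derivedKuhnIso d) (derivedPrecomp d A.dual) ≪≫
      Functor.isoWhiskerLeft (mapBoundedOp (StrictPoly.kuhn d)) (derivedPrecompIso d A.dual)⟩
  letI : Localization.Lifting (DPQ k d).op (quasiIsos k d).op
      ((mapBounded (StrictPoly.precomp d A)).op ⋙ mapBoundedOp (StrictPoly.kuhn (d * s)) ⋙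
        DPQ k (d * s)) ((derivedPrecomp d A).op ⋙ derivedKuhn (d * s)) :=
    ⟨Functor.isoWhiskerRight (NatIso.op (derivedPrecompIso d A)).symm (derivedKuhn (d * s)) ≪≫
      Functor.isoWhiskerLeft (mapBounded (StrictPoly.precomp d A)).op (derivedKuhnIso (d * s))⟩
  Localization.liftNatIso (DPQ k d).op (quasiIsos k d).op
    (mapBoundedOp (StrictPoly.kuhn d) ⋙ mapBounded (StrictPoly.precomp d A.dual) ⋙
      DPQ k (d * s))
    ((mapBounded (StrictPoly.precomp d A)).op ⋙ mapBoundedOp (StrictPoly.kuhn (d * s)) ⋙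
      DPQ k (d * s)) _ _
    (Functor.isoWhiskerRight (mapBoundedOpCompIso (StrictPoly.kuhnPrecomp A d)) (DPQ k (d * s)))

/-- The Kuhn duality, as an equivalence between the derived category and its opposite. -/
def derivedKuhnEquivalence : DP k d ≌ (DP k d)ᵒᵖ :=
  CategoryTheory.Equivalence.mk (derivedKuhn d).rightOp (derivedKuhn d) (derivedKuhnBidual d)
    (NatIso.ofComponents (fun X => ((derivedKuhnBidual d).app X.unop).op)
      (fun f => Quiver.Hom.unop_inj ((derivedKuhnBidual d).hom.naturality f.unop).symm))

variable [(kanComplex d A.dual).HasPointwiseRightDerivedFunctor (quasiIsos k (d * s))]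

/-- The functor `K^l_A` is left adjoint to `C_A`. -/
def derivedCoadjunction : leftKan d A ⊣ derivedPrecomp d A :=
  -- The composite of the three left adjoints is `leftKan` by definition. The composite of the right
  -- adjoints is `C_{A^#}` conjugated by Kuhn duality, and `derivedKuhnPrecomp` together with
  -- biduality identifies it with `C_A`.
  ((derivedKuhnEquivalence (d * s)).toAdjunction.comp
    ((derivedAdjunction d A.dual).op.comp
      (derivedKuhnEquivalence d).symm.toAdjunction)).ofNatIsoRight
    (NatIso.ofComponents (fun X => (derivedKuhn (d * s)).mapIso
        ((derivedKuhnPrecomp d A).app (op X)).symm.op ≪≫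
          ((derivedKuhnBidual (d * s)).app ((derivedPrecomp d A).obj X)).symm)
      (fun {X Y} f => by
        have h1 := ((derivedKuhn (d * s)).map_comp _ _).symm.trans ((congrArg
          (fun q => (derivedKuhn (d * s)).map q.op)
            ((derivedKuhnPrecomp d A).inv.naturality f.op)).symm.trans
              ((derivedKuhn (d * s)).map_comp _ _))
        have h2 := (derivedKuhnBidual (d * s)).inv.naturality ((derivedPrecomp d A).map f)
        exact (Category.assoc _ _ _).symm.trans ((congrArg (· ≫ _) h1).trans
          ((Category.assoc _ _ _).trans ((congrArg (_ ≫ ·) h2).trans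
            (Category.assoc _ _ _).symm)))))

end SPF

end

theorem theorem2p2 {k : Type u} [Field k] (d s : ℕ) (A : SPF.StrictPoly k s) :
    ∃ (_ : (SPF.kanComplex d A).HasPointwiseRightDerivedFunctor (SPF.quasiIsos k (d * s)))
      (_ : (SPF.kanComplex d A.dual).HasPointwiseRightDerivedFunctor (SPF.quasiIsos k (d * s))),
      Nonempty (SPF.derivedPrecomp d A ⊣ SPF.rightKan d A) ∧
        Nonempty (SPF.leftKan d A ⊣ SPF.derivedPrecomp d A) :=
  ⟨SPF.kanComplex_hasPointwiseRightDerivedFunctor d A,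
    SPF.kanComplex_hasPointwiseRightDerivedFunctor d A.dual,
    ⟨have := SPF.kanComplex_hasPointwiseRightDerivedFunctor d A; SPF.derivedAdjunction d A⟩,
    ⟨have := SPF.kanComplex_hasPointwiseRightDerivedFunctor d A.dual; SPF.derivedCoadjunction d A⟩⟩
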